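/- **Setting.** Let $R$ be a commutative ring, $h,t\in R$, and $A=R[X]/(X^2-hX-t)$ the Frobenius algebra with counit $\epsilon(1)=0$, $\epsilon(X)=1$. For an oriented link diagram $D$ let $CKh_{h,t}(D)$ be its Khovanov complex over $A$ and $Kh_{h,t}(D)$ its homology. An oriented normally immersed link cobordism $S\subset[0,1]\times\mathbb R^3$ is given as a movie, i.e. a finite sequence of elementary moves between oriented link diagrams: planar isotopies, Reidemeister moves, Morse moves and crossing changes. Each crossing change contributes one double point, which is positive if a negative crossing becomes positive and negative if a positive crossing becomes negative. Each double point is assigned a direction, i.e. an ordering of the two arcs of the $1$-resolution of the crossing before the change. A crossing change carries two chain maps: $f_0$ sends the $1$-resolution of the old crossing to the $0$-resolution of the new one (these are the same pair of arcs) by $\pm\Phi$, where $\Phi=X\otimes1-1\otimes X$ on the two arcs and the direction determines the sign; $f_1$ sends the $0$-resolution of the old crossing to the $1$-resolution of the new one by the identity; all other components vanish. All other elementary moves carry their standard chain maps. Composing the maps of a movie $S$, with $f_i$ at all positive and $f_j$ at all negative double points, gives a chain map $\varphi_{ij}(S)$. Put $\varphi^{\mathrm{low}}=\varphi_{00}$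 and $\varphi^{\mathrm{bal}}=\varphi_{01}$, and let $Kh^{\mathrm{low}}_{h,t}(S)$, $Kh^{\mathrm{bal}}_{h,t}(S)$ be the induced maps on homology. Let $S=N\circ M$, where $M$ is a movie from $D$ to a diagram $E$ and $N$ is a movie from $E$ to $D'$. Let $S'=N\circ T\circ M$, where $T$ is the movie from $E$ to $E$ of one of the following local moves at some place of $E$: * a *positive* (resp. *negative*) *twist*: create a kink with a negative (resp. positive) crossing on a strand, change this crossing, and remove the resulting kink; this introduces one positive (resp. negative) double point; * a *finger move*: push one of two adjacent strands over the other by a Reidemeister 2 move, change both crossings (in either order), and pull the strands apart again; this introduces one positive and one negative double point. For a twist, the arcs of the $1$-resolution of a kink with a negative crossing, or of the $0$-resolution of a kink with a positive crossing, are the strand and the loop of the kink. **Proposition 1.7.** Here $X$ at a point of $E$ denotes the corresponding chain endomorphism of $CKh_{h,t}(E)$. For a finger move, put $\Phi=X_l-X_r$ and $\Psi=X_l+X_r-h$, where $X_l,X_r$ denote $X$ at the left and at the right strand. 1. *Positive twist.* If the new double point is directed from the strand to the loop, then $Kh^{\mathrm{low}}_{h,t}(S')=Kh^{\mathrm{low}}_{h,t}(S)$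 and $Kh^{\mathrm{bal}}_{h,t}(S')=Kh^{\mathrm{bal}}_{h,t}(S)$; with the opposite direction both equalities hold with a factor $-1$ on the right-hand side. 2. *Negative twist and finger move.* In these cases $Kh^{\mathrm{low}}_{h,t}(S')=0$. 3. *Local compositions* (as chain maps $CKh_{h,t}(E)\to CKh_{h,t}(E)$). * If $T$ is a positive twist, then $\varphi_{0j}(T)=\mathrm{Id}$ for the direction from the strand to the loop and $\varphi_{0j}(T)=-\mathrm{Id}$ for the opposite one, and $\varphi_{1j}(T)=0$ ($j=0,1$). * If $T$ is a negative twist, then $\varphi_{i0}(T)=0$ and $\varphi_{i1}(T)=\pm(2X-h)$, with $X$ at the strand of the twist ($i=0,1$). * If $T$ is a finger move, then $\varphi_{ii}(T)=0$ for $i=0,1$. If the two strands are parallel, then $\varphi_{01}(T)=\pm\Phi$ and $\varphi_{10}(T)=\pm\Psi$; if they are antiparallel, then $\varphi_{01}(T)=\pm\Psi$ and $\varphi_{10}(T)=\pm\Phi$. 4. *Balanced maps.* $\varphi^{\mathrm{bal}}(S)=\varphi^{\mathrm{bal}}(N)\circ\varphi^{\mathrm{bal}}(M)$, whereas $$\varphi^{\mathrm{bal}}(S')=\pm\,\varphi^{\mathrm{bal}}(N)\circ\Theta\circ\varphi^{\mathrm{bal}}(M),$$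 where $\Theta=2X-h$ for a negative twist, $\Theta=\Phi$ for a finger move on parallel strands, and $\Theta=\Psi$ for a finger move on antiparallel strands. 5. *Degrees.* Suppose that $R$ is $\mathbb Z$-graded with $h$ in degree $-2$ and $t$ in degree $-4$. Let $s_-$ be the number of negative double points of $S$. Then $Kh^{\mathrm{bal}}_{h,t}(S)$ is homogeneous of bidegree $(0,\chi(S)-2s_-)$, and for a negative twist or a finger move $Kh^{\mathrm{bal}}_{h,t}(S')$ is homogeneous of bidegree $(0,\chi(S)-2s_--2)$; that is, the degree is shifted by $(0,-2)$. 6. *Non-vanishing.* The balanced map does not vanish in general. If $2\ne0$ or $h\neq 0$ in $R$, there are $S$ and $S'$ as above, with $S'$ obtained from $S$ by a negative twist, such that $Kh^{\mathrm{bal}}_{h,t}(S)\neq0$ and $Kh^{\mathrm{bal}}_{h,t}(S')\ne0$. If $R\neq0$, there are such $S$ and $S'$ with $S'$ obtained from $S$ by a finger move on parallel strands, and also with $S'$ obtained by a finger move on antiparallel strands. -/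

import Mathlib

open scoped TensorProduct

namespace ImmersedKhovanov

/-! ### Oriented link diagrams

A link diagram in the plane is given in Morse position: read from top to bottom it is a word of
layers, each of which contains one local maximum (`cup`, creating two strands), one local minimum
(`cap`, joining two strands) or one crossing; all other strands run vertically.  Up to planar
isotopy every link diagram has this form, and planar isotopies are among the elementary moves
below.  An orientation is carried along as the list of the directions (`true` = downwards) of the
strands between two layers. -/

/-- The nontrivial piece of a layer.  In `cup d` the left strand of the maximum has direction `d`.
In `cross ε` the `0`-smoothing is vertical `)(` if `ε = true`, and it is horizontal if `ε = false`;
so `ε = true` is a positive crossing precisely when its two strands are parallel. -/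
inductive Shape : Type
  | cup (d : Bool)
  | cap
  | cross (ε : Bool)

/-- A layer: a shape at horizontal position `pos` (the number of strands to its left). -/
structure Layer : Type where
  shape : Shape
  pos : ℕ

abbrev cup (i : ℕ) (d : Bool) : Layer := ⟨.cup d, i⟩
abbrev cap (i : ℕ) : Layer := ⟨.cap, i⟩
abbrev cross (i : ℕ) (ε : Bool) : Layer := ⟨.cross ε, i⟩

/-- The directed strands below a layer, from those above it (`none` if the layer does not fit). -/
def Layer.act (L : Layer) (s : List Bool) : Option (List Bool) :=
  match L.shape, s.drop L.pos with
  | .cup d, r => if L.pos ≤ s.length then some (s.take L.pos ++ d :: (!d) :: r) else none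
  | .cap, a :: b :: r => if b = !a then some (s.take L.pos ++ r) else none
  | .cross _, a :: b :: r => some (s.take L.pos ++ b :: a :: r)
  | _, _ => none

def run (w : List Layer) (s : List Bool) : Option (List Bool) :=
  w.foldlM (fun s L => L.act s) s

/-- An oriented link diagram in the plane, in Morse position. -/
structure Diagram : Type where
  word : List Layer
  closed : run word [] = some []

namespace Diagram

variable (D : Diagram)

/-- The directed strands at level `l`, i.e. just above the layer with index `l`. -/
def strands (l : ℕ) : List Bool := (run (D.word.take l) []).getD []

/-- The intersection points of the diagram with the levels between its layers. -/
abbrev Point : Type := Σ l : Fin (D.word.length + 1), Fin (D.strands l).length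

/-- The coordinates (level, position) of a point. -/
def coords {D : Diagram} (p : D.Point) : ℕ × ℕ := (p.1, p.2)

open Classical in
/-- The crossings, given by the indices of their layers. -/
noncomputable def crossings : Finset ℕ :=
  (Finset.range D.word.length).filter fun l => ∃ i ε, D.word[l]? = some (cross i ε)

/-- Whether the crossing in layer `l` is positive. -/
def isPositive (l : ℕ) : Bool :=
  match D.word[l]? with
  | some ⟨.cross ε, i⟩ => ε == ((D.strands l)[i]? == (D.strands l)[i + 1]?)
  | _ => false

noncomputable def numPos : ℕ := (D.crossings.filter fun l => D.isPositive l = true).card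
noncomputable def numNeg : ℕ := (D.crossings.filter fun l => D.isPositive l = false).card

/-- The vertices of the cube of resolutions: a vertex is the set of `1`-resolved crossings. -/
abbrev Vertex : Type := D.crossings.powerset

end Diagram

/-- Two points (given by coordinates) are joined by an arc within one layer of the resolution of
`D` in which exactly the crossings in `v` are `1`-resolved. -/
inductive Link (D : Diagram) (v : Finset ℕ) : ℕ × ℕ → ℕ × ℕ → Prop
  | cup_left {l i j : ℕ} {d : Bool} : D.word[l]? = some (cup i d) → j < i → Link D v (l, j) (l + 1, j)
  | cup_right {l i j : ℕ} {d : Bool} :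
      D.word[l]? = some (cup i d) → i ≤ j → Link D v (l, j) (l + 1, j + 2)
  | cup_arc {l i : ℕ} {d : Bool} : D.word[l]? = some (cup i d) → Link D v (l + 1, i) (l + 1, i + 1)
  | cap_left {l i j : ℕ} : D.word[l]? = some (cap i) → j < i → Link D v (l, j) (l + 1, j)
  | cap_right {l i j : ℕ} : D.word[l]? = some (cap i) → i ≤ j → Link D v (l, j + 2) (l + 1, j)
  | cap_arc {l i : ℕ} : D.word[l]? = some (cap i) → Link D v (l, i) (l, i + 1)
  | cross_away {l i j : ℕ} {ε : Bool} : D.word[l]? = some (cross i ε) → j ≠ i → j ≠ i + 1 →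
      Link D v (l, j) (l + 1, j)
  | vertical {l i j : ℕ} {ε : Bool} : D.word[l]? = some (cross i ε) → (l ∈ v ↔ ε = false) →
      (j = i ∨ j = i + 1) → Link D v (l, j) (l + 1, j)
  | upper_arc {l i : ℕ} {ε : Bool} : D.word[l]? = some (cross i ε) → (l ∈ v ↔ ε = true) →
      Link D v (l, i) (l, i + 1)
  | lower_arc {l i : ℕ} {ε : Bool} : D.word[l]? = some (cross i ε) → (l ∈ v ↔ ε = true) →
      Link D v (l + 1, i) (l + 1, i + 1)

/-- The circles of the resolution `v` of `D`. -/
def Circle (D : Diagram) (v : Finset ℕ) : Type :=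
  Quot fun p q : D.Point => Link D v (Diagram.coords p) (Diagram.coords q)

/-- The circle through a point. -/
def circleOf (D : Diagram) (v : Finset ℕ) (p : D.Point) : Circle D v := Quot.mk _ p

/-- Two points (given by coordinates) lie on the same circle. -/
def Connected (D : Diagram) (v : Finset ℕ) (p q : ℕ × ℕ) : Prop :=
  Relation.EqvGen (Link D v) p q

instance (D : Diagram) (v : Finset ℕ) : Finite (Circle D v) := Quot.finite _

noncomputable instance (D : Diagram) (v : Finset ℕ) : Fintype (Circle D v) := Fintype.ofFinite _

noncomputable section

open Classical

variable {R : Type*} [CommRing R] (h t : R)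

/-! ### The Frobenius algebra and the Khovanov complex

`QuadraticAlgebra R t h` is the algebra `A = R[X]/(X² - hX - t)`; its element `X` is `ω`, and the
counit is the coefficient of `X`. -/

/-- The module of a resolution: the tensor product of copies of `A`, one for each circle. -/
def State (D : Diagram) (v : Finset ℕ) : Type _ :=
  ⨂[R] _ : Circle D v, QuadraticAlgebra R t h

instance (D : Diagram) (v : Finset ℕ) : CommRing (State h t D v) :=
  inferInstanceAs (CommRing (⨂[R] _ : Circle D v, QuadraticAlgebra R t h))

instance (D : Diagram) (v : Finset ℕ) : Algebra R (State h t D v) :=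
  inferInstanceAs (Algebra R (⨂[R] _ : Circle D v, QuadraticAlgebra R t h))

/-- The pure tensor with factor `X` at the circles in `s` and `1` at the others. -/
def monomial (D : Diagram) (v : Finset ℕ) (s : Finset (Circle D v)) : State h t D v :=
  PiTensorProduct.tprod R fun c => if c ∈ s then QuadraticAlgebra.omega else 1

/-- The element `X` on the circle through the point with coordinates `p`. -/
def dot (D : Diagram) (v : Finset ℕ) (p : ℕ × ℕ) : State h t D v :=
  if hp : ∃ q : D.Point, Diagram.coords q = p then monomial h t D v {circleOf D v hp.choose} else 0

/-- Suppose that `D'` arises from `D` by replacing the `m` layers from index `k` on by `m'` layers,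
the other layers being unchanged.  A point of `D` is outer if it is not strictly inside the
replaced part. -/
def IsOuter (k m : ℕ) (p : ℕ × ℕ) : Prop := p.1 ≤ k ∨ k + m ≤ p.1

/-- The outer point of `D'` that corresponds to an outer point of `D`. -/
def transport (k m m' : ℕ) (p : ℕ × ℕ) : ℕ × ℕ := if p.1 ≤ k then p else (p.1 - m + m', p.2)

/-- The image of `X` on a circle `c` of a resolution of `D` under a map that is local to the
replaced part: `X` on the circle of `D'` through a corresponding outer point, or the new
indeterminate `ω` if `c` is contained in the replaced part. -/
def transportCircle (D D' : Diagram) (k m m' : ℕ) (v v' : Finset ℕ) (c : Circle D v) :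
    QuadraticAlgebra (State h t D' v') (algebraMap R _ t) (algebraMap R _ h) :=
  if hc : ∃ p : D.Point, IsOuter k m (Diagram.coords p) ∧ circleOf D v p = c then
    algebraMap (State h t D' v') _ (dot h t D' v' (transport k m m' (Diagram.coords hc.choose)))
  else QuadraticAlgebra.omega

/-- The local map with values `e` and `e'`: it is linear over the dots on outer points, sends `1`
to `e`, and sends `X` on a circle inside the replaced part to `e'`.  (All resolutions to which it
is applied have at most one such circle.)  For instance `e = 1` is the map of an isotopy, of a
merge of circles, and of a birth if `D'` has an inner circle; `e = 0`, `e' = 1` is the counit on an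
inner circle of `D`. -/
def localMap (D D' : Diagram) (k m m' : ℕ) (v v' : Finset ℕ) (e e' : State h t D' v') :
    State h t D v →ₗ[R] State h t D' v' :=
  let B := QuadraticAlgebra (State h t D' v') (algebraMap R _ t) (algebraMap R _ h)
  let ev : State h t D v →ₗ[R] B :=
    PiTensorProduct.lift ((MultilinearMap.mkPiAlgebra R (Circle D v) B).compLinearMap fun c =>
      (Algebra.linearMap R B).comp (QuadraticAlgebra.reₗ t h) +
        (LinearMap.toSpanSingleton R B (transportCircle h t D D' k m m' v v' c)).comp
          (QuadraticAlgebra.imₗ t h))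
  (LinearMap.mulRight R e).comp
      (((QuadraticAlgebra.reₗ (algebraMap R _ t) (algebraMap R _ h)).restrictScalars R).comp ev) +
    (LinearMap.mulRight R e').comp
      (((QuadraticAlgebra.imₗ (algebraMap R _ t) (algebraMap R _ h)).restrictScalars R).comp ev)

/-- Isotopy, or birth if `D'` has an inner circle. -/
def isoMap (D D' : Diagram) (k m m' : ℕ) (v v' : Finset ℕ) : State h t D v →ₗ[R] State h t D' v' :=
  localMap h t D D' k m m' v v' 1 0

/-- Death of the inner circle of `D`. -/
def deathMap (D D' : Diagram) (k m m' : ℕ) (v v' : Finset ℕ) :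
    State h t D v →ₗ[R] State h t D' v' :=
  localMap h t D D' k m m' v v' 0 1

/-- Consider a saddle between the vertical smoothing `)(` and the horizontal smoothing of the
strands `i`, `i + 1` in the replaced part.  The upper left and the lower right end lie on different
arcs both before and after it.  If they are on different circles before it, then it merges two
circles and `1 ↦ 1`; otherwise it splits a circle into two, and `1 ↦ X ⊗ 1 + 1 ⊗ X - h`. -/
def saddleValue (D D' : Diagram) (k m m' i : ℕ) (v v' : Finset ℕ) : State h t D' v' :=
  if Connected D v (k, i) (k + m, i + 1) then
    dot h t D' v' (k, i) + dot h t D' v' (k + m', i + 1) - algebraMap R _ h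
  else 1

/-- A saddle on the strands `i`, `i + 1` (together with a birth if `D'` has an inner circle). -/
def saddleMap (D D' : Diagram) (k m m' i : ℕ) (v v' : Finset ℕ) :
    State h t D v →ₗ[R] State h t D' v' :=
  localMap h t D D' k m m' v v' (saddleValue h t D D' k m m' i v v') 0

/-- Death of the inner circle of `D`, followed by a saddle on the strands `i`, `i + 1`. -/
def deathSaddleMap (D D' : Diagram) (k m m' i : ℕ) (v v' : Finset ℕ) :
    State h t D v →ₗ[R] State h t D' v' :=
  localMap h t D D' k m m' v v' 0 (saddleValue h t D D' k m m' i v v')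

/-- The Khovanov chain module of a diagram. -/
abbrev CKh (D : Diagram) : Type _ := (v : D.Vertex) → State h t D v

/-- The horizontal position of the layer with index `l`. -/
def posAt (D : Diagram) (l : ℕ) : ℕ := (D.word[l]?.map Layer.pos).getD 0

/-- The differential of the Khovanov complex. -/
def differential (D : Diagram) : CKh h t D →ₗ[R] CKh h t D :=
  LinearMap.pi fun w => ∑ v : D.Vertex, ∑ l ∈ D.crossings,
    if l ∉ v.1 ∧ w.1 = insert l v.1 then
      (-1 : ℤ) ^ (v.1.filter fun a => a < l).card •
        (saddleMap h t D D l 1 1 (posAt D l) v w).comp (LinearMap.proj v)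
    else 0

/-- Khovanov homology. -/
abbrev Kh (D : Diagram) : Type _ :=
  (differential h t D).ker ⧸ (differential h t D).range.submoduleOf (differential h t D).ker

/-- A chain map sends cycles to cycles and boundaries to boundaries. -/
theorem chainMap_aux {D D' : Diagram} {f : CKh h t D →ₗ[R] CKh h t D'}
    (hf : f.comp (differential h t D) = (differential h t D').comp f) :
    ∃ hk : ∀ x ∈ (differential h t D).ker, f x ∈ (differential h t D').ker,
      (differential h t D).range.submoduleOf (differential h t D).ker ≤
        ((differential h t D').range.submoduleOf (differential h t D').ker).comap
          (f.restrict hk) := by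
  have hk : ∀ x ∈ (differential h t D).ker, f x ∈ (differential h t D').ker := by
    intro x hx
    have := LinearMap.congr_fun hf x
    simp only [LinearMap.comp_apply] at this
    rw [LinearMap.mem_ker] at hx ⊢
    rw [← this, hx, map_zero]
  refine ⟨hk, ?_⟩
  rintro ⟨x, hx⟩ ⟨y, hy⟩
  refine ⟨f y, ?_⟩
  have := LinearMap.congr_fun hf y
  simp only [LinearMap.comp_apply] at this
  rw [← this, hy]
  rfl

/-- The map induced on homology by a chain map. -/
def homologyMap {D D' : Diagram} (f : CKh h t D →ₗ[R] CKh h t D') : Kh h t D →ₗ[R] Kh h t D' :=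
  if hf : f.comp (differential h t D) = (differential h t D').comp f then
    Submodule.mapQ _ _ _ (chainMap_aux h t hf).choose_spec
  else 0

/-- Multiplication by `X` at the point with coordinates `p`. -/
def dotMap (D : Diagram) (p : ℕ × ℕ) : CKh h t D →ₗ[R] CKh h t D :=
  LinearMap.pi fun v => (LinearMap.mulLeft R (dot h t D v p)).comp (LinearMap.proj v)

end

/-! ### Elementary moves -/

/-- Numbers of strands that a shape takes in from above and gives out below. -/
def Shape.inWidth : Shape → ℕ
  | .cup _ => 0
  | _ => 2

def Shape.outWidth : Shape → ℕ
  | .cap => 0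
  | _ => 2

/-- The planar isotopies (other than exchanging the heights of distant layers): straightening a
zigzag, and pulling a crossing over a maximum or minimum. -/
inductive PlanarIsotopy : List Layer → List Layer → Prop
  | zigzag_left (i : ℕ) (d : Bool) : PlanarIsotopy [cup i d, cap (i + 1)] []
  | zigzag_right (i : ℕ) (d : Bool) : PlanarIsotopy [cup (i + 1) d, cap i] []
  | turn_cup (i : ℕ) (d ε : Bool) :
      PlanarIsotopy [cup i d, cross (i + 1) ε] [cup (i + 1) d, cross i (!ε)]
  | turn_cap (i : ℕ) (ε : Bool) :
      PlanarIsotopy [cross (i + 1) ε, cap i] [cross i (!ε), cap (i + 1)]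
  | symm {u u' : List Layer} : PlanarIsotopy u u' → PlanarIsotopy u' u

/-- A kink on the vertical strand `i`, whose loop is on the right or on the left of the strand.
The crossing is positive if and only if `ε = true`. -/
def kinkWord (right : Bool) (i : ℕ) (d ε : Bool) : List Layer :=
  if right then [cup (i + 1) d, cross i ε, cap (i + 1)] else [cup i d, cross (i + 1) ε, cap i]

/-- The elementary moves.  The Reidemeister 3 moves listed here, together with planar isotopies, give
all of them: the remaining braid-like ones (with three equal crossings) are rotations of these. -/
inductive Move : Type
  /-- planar isotopy: exchange of the heights of two layers with disjoint supports -/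
  | exchange (σ τ : Shape) (i g : ℕ) (reversed : Bool)
  /-- any other planar isotopy -/
  | isotopy (u u' : List Layer) (hu : PlanarIsotopy u u')
  /-- Reidemeister 1, creating or removing a kink -/
  | kink (right : Bool) (i : ℕ) (d ε : Bool)
  | unkink (right : Bool) (i : ℕ) (d ε : Bool)
  /-- Reidemeister 2, creating or removing two crossings of the strands `i`, `i + 1` -/
  | poke (i : ℕ) (ε : Bool)
  | unpoke (i : ℕ) (ε : Bool)
  /-- Reidemeister 3 on the strands `i`, `i + 1`, `i + 2`; here `(p, q)` is `(i, i + 1)` or, if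
  `mirrored`, `(i + 1, i)`, and `p, q, p` is turned into `q, p, q` -/
  | slide (i : ℕ) (mirrored a b : Bool)
  /-- Morse moves -/
  | birth (i : ℕ) (d : Bool)
  | death (i : ℕ) (d : Bool)
  | saddle (i : ℕ) (d : Bool)
  | unsaddle (i : ℕ) (d : Bool)
  /-- crossing change; the direction orders the two arcs of the `1`-resolution: it points from the
  arc of the upper left end to the arc of the lower right end if `dir = true`, and conversely
  if `dir = false` -/
  | crossingChange (i : ℕ) (ε dir : Bool)

namespace Move

/-- The layers that the move replaces. -/
def source : Move → List Layer
  | exchange σ τ i g false => [⟨σ, i⟩, ⟨τ, i + σ.outWidth + g⟩]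
  | exchange σ τ i g true => [⟨τ, i + σ.inWidth + g⟩, ⟨σ, i⟩]
  | isotopy u _ _ => u
  | kink _ _ _ _ => []
  | unkink r i d ε => kinkWord r i d ε
  | poke _ _ => []
  | unpoke i ε => [cross i ε, cross i (!ε)]
  | slide i false a b => [cross i a, cross (i + 1) b, cross i (!a)]
  | slide i true a b => [cross (i + 1) a, cross i b, cross (i + 1) (!a)]
  | birth _ _ => []
  | death i d => [cup i d, cap i]
  | saddle _ _ => []
  | unsaddle i d => [cap i, cup i d]
  | crossingChange i ε _ => [cross i ε]

/-- The layers by which the move replaces them. -/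
def target : Move → List Layer
  | exchange σ τ i g false => [⟨τ, i + σ.inWidth + g⟩, ⟨σ, i⟩]
  | exchange σ τ i g true => [⟨σ, i⟩, ⟨τ, i + σ.outWidth + g⟩]
  | isotopy _ u' _ => u'
  | kink r i d ε => kinkWord r i d ε
  | unkink _ _ _ _ => []
  | poke i ε => [cross i ε, cross i (!ε)]
  | unpoke _ _ => []
  | slide i false a b => [cross (i + 1) (!a), cross i b, cross (i + 1) a]
  | slide i true a b => [cross i (!a), cross (i + 1) b, cross i a]
  | birth i d => [cup i d, cap i]
  | death _ _ => []
  | saddle i d => [cap i, cup i d]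
  | unsaddle _ _ => []
  | crossingChange i ε _ => [cross i (!ε)]

/-- The Euler characteristic of the elementary cobordism, relative to its incoming end. -/
def euler : Move → ℤ
  | birth _ _ | death _ _ => 1
  | saddle _ _ | unsaddle _ _ => -1
  | _ => 0

end Move

/-- An elementary cobordism: a move applied to some consecutive layers of `D`, leaving all other
layers unchanged and being compatible with the orientations. -/
structure Step (D D' : Diagram) : Type where
  move : Move
  pre : List Layer
  post : List Layer
  source_eq : D.word = pre ++ move.source ++ post
  target_eq : D'.word = pre ++ move.target ++ post
  oriented : run (pre ++ move.source) [] = run (pre ++ move.target) []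

namespace Step

/-- The double point of an elementary cobordism, if it has one: a change from a negative to a
positive crossing is a positive double point (`some true`), a change from a positive to a negative
crossing is a negative double point (`some false`). -/
def doublePoint {D D' : Diagram} (S : Step D D') : Option Bool :=
  match S.move with
  | .crossingChange _ _ _ => some (!D.isPositive S.pre.length)
  | _ => none

end Step

noncomputable section

open Classical

variable {R : Type*} [CommRing R] (h t : R)

/-- Whether the crossing in layer `l` is `1`-resolved. -/
def bit (v : Finset ℕ) (l : ℕ) : Bool := decide (l ∈ v)

/-- The resolutions in layers `k`, `k + 1`, `k + 2`, and the vertex with these changed to `x`. -/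
def bits3 (v : Finset ℕ) (k : ℕ) : Bool × Bool × Bool := (bit v k, bit v (k + 1), bit v (k + 2))

def setBits3 (v : Finset ℕ) (k : ℕ) (x : Bool × Bool × Bool) : Finset ℕ :=
  (v \ {k, k + 1, k + 2}) ∪ (if x.1 then {k} else ∅) ∪ (if x.2.1 then {k + 1} else ∅) ∪
    (if x.2.2 then {k + 2} else ∅)

def sgn (b : Bool) : ℤ := if b then -1 else 1

/-- The component from `v` to `v'` of the map of the Reidemeister 3 move that replaces
`[cross p a, cross q b, cross p (!a)]` by `[cross q (!a), cross p b, cross q a]`, where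
`{p, q} = {i, i + 1}`.

If the middle crossing is smoothed horizontally (`x₂ = b`), both sides are isotopic.  If it is
smoothed vertically, both sides are simplified to three vertical strands by a Reidemeister 2 move;
`xD` denotes the resolution in which all strands are vertical, `xC` the one with a small circle
(`yD`, `yC` on the other side).  Let `F`, `G`, `H` be the inclusion, the retraction and the
homotopy of the Reidemeister 2 move, and `ψ` the saddle at the middle crossing.  The map of the
Reidemeister 3 move is the one between mapping cones with components `F' G`, the isotopy, and
`-ψ H` (if the vertical smoothing is the `0`-smoothing) or `-H' ψ'` (otherwise). -/
def slideEntry (p q : ℕ) (a b : Bool) (D D' : Diagram) (k : ℕ) (v v' : Finset ℕ) :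
    State h t D v →ₗ[R] State h t D' v' :=
  let x := bits3 v k
  let y := bits3 v' k
  let atV := setBits3 v k
  let atV' := setBits3 v' k
  let m := !b
  let xD := (!a, m, a)
  let xC := (a, m, !a)
  let yD := (a, m, !a)
  let yC := (!a, m, a)
  if x.2.1 = b ∧ y = x then isoMap h t D D' k 3 3 v v'
  else if x = xD ∧ y = yD then isoMap h t D D' k 3 3 v v'
  else if x = xD ∧ y = yC then sgn m • saddleMap h t D D' k 3 3 q v v'
  else if x = xC ∧ y = yD then -(sgn m • deathSaddleMap h t D D' k 3 3 p v v')
  else if x = xC ∧ y = yC then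
    -((saddleMap h t D D' k 3 3 q (atV xD) v').comp
      (deathSaddleMap h t D D k 3 3 p v (atV xD)))
  else if b = true ∧ x = xC ∧ y = (false, true, false) then
    -((isoMap h t D D' k 3 3 (atV y) v').comp
      ((saddleMap h t D D (k + 1) 1 1 q (atV (false, false, false)) (atV y)).comp
        (deathMap h t D D k 3 3 v (atV (false, false, false)))))
  else if b = true ∧ x = (true, false, true) ∧ y = (a, true, !a) then
    -((isoMap h t D D' k 3 3 (atV y) v').comp
      ((saddleMap h t D D (k + 1) 1 1 q (atV xC) (atV y)).comp
        (isoMap h t D D k 3 3 v (atV xC))))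
  else if b = false ∧ x = (!a, false, a) ∧ y = (false, true, false) then
    (deathMap h t D' D' k 3 3 (atV' yC) v').comp
      ((saddleMap h t D' D' (k + 1) 1 1 p (atV' x) (atV' yC)).comp
        (isoMap h t D D' k 3 3 v (atV' x)))
  else if b = false ∧ x = (true, false, true) ∧ y = yC then
    (isoMap h t D' D' k 3 3 (atV' (true, true, true)) v').comp
      ((saddleMap h t D' D' (k + 1) 1 1 p (atV' x) (atV' (true, true, true))).comp
        (isoMap h t D D' k 3 3 v (atV' x)))
  else 0

/-- The component from the resolution `v` of `D` to the resolution `v'` of `D'` of the map of a move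
applied at layer `k`, where the resolutions outside of the move agree.  For crossing changes, `z = 0`
stands for the map `f₀` (of the generator `ζ₀` of the homology of the Hopf link), which is `± Φ`
from the `1`-resolution to the `0`-resolution, and `z = 1` for the map `f₁` (of the generator `ζ₁`),
which is the identity from the `0`-resolution to the `1`-resolution. -/
def Move.entry (μ : Move) (z : Fin 2) (D D' : Diagram) (k : ℕ) (v v' : Finset ℕ) :
    State h t D v →ₗ[R] State h t D' v' :=
  match μ with
  | .exchange _ _ _ _ _ =>
      if bit v' k = bit v (k + 1) ∧ bit v' (k + 1) = bit v k then
        sgn (bit v k && bit v (k + 1)) • isoMap h t D D' k 2 2 v v'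
      else 0
  | .isotopy u u' _ =>
      if ∀ j < min u.length u'.length, bit v (k + j) = bit v' (k + j) then
        isoMap h t D D' k u.length u'.length v v'
      else 0
  | .kink _ i _ ε =>
      if bit v' (k + 1) = !ε then
        localMap h t D D' k 0 3 v v'
          (if ε then dot h t D' v' (k + 1, i + 1) - dot h t D' v' (k, i) else 1) 0
      else 0
  | .unkink _ i _ ε =>
      if bit v (k + 1) = !ε then
        if ε then deathMap h t D D' k 3 0 v v'
        else localMap h t D D' k 3 0 v v' 1 (algebraMap R _ h - dot h t D' v' (k, i))
      else 0
  | .poke i ε =>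
      if (bit v' k, bit v' (k + 1)) = (!ε, ε) then isoMap h t D D' k 0 2 v v'
      else if (bit v' k, bit v' (k + 1)) = (ε, !ε) then saddleMap h t D D' k 0 2 i v v'
      else 0
  | .unpoke i ε =>
      if (bit v k, bit v (k + 1)) = (!ε, ε) then isoMap h t D D' k 2 0 v v'
      else if (bit v k, bit v (k + 1)) = (ε, !ε) then -deathSaddleMap h t D D' k 2 0 i v v'
      else 0
  | .slide i mirrored a b =>
      if mirrored then slideEntry h t (i + 1) i a b D D' k v v'
      else slideEntry h t i (i + 1) a b D D' k v v'
  | .birth _ _ => isoMap h t D D' k 0 2 v v'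
  | .death _ _ => deathMap h t D D' k 2 0 v v'
  | .saddle i _ => saddleMap h t D D' k 0 2 i v v'
  | .unsaddle i _ => saddleMap h t D D' k 2 0 i v v'
  | .crossingChange i _ dir =>
      if z = 1 then
        if bit v k = false ∧ bit v' k = true then isoMap h t D D' k 1 1 v v' else 0
      else
        if bit v k = true ∧ bit v' k = false then
          localMap h t D D' k 1 1 v v'
            (sgn (!dir) • (dot h t D' v' (k + 1, i + 1) - dot h t D' v' (k, i))) 0
        else 0

/-- The resolutions `v` of `D` and `v'` of `D'` agree outside of the replaced layers. -/
def AgreeOutside (k m m' : ℕ) (v v' : Finset ℕ) : Prop :=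
  (∀ l < k, (l ∈ v ↔ l ∈ v')) ∧ ∀ l, (k + m + l ∈ v ↔ k + m' + l ∈ v')

/-- The chain map of an elementary cobordism.  (The sign makes the local components commute with the
differentials of the crossings below the move.) -/
def Step.map {D D' : Diagram} (S : Step D D') (z : Fin 2) : CKh h t D →ₗ[R] CKh h t D' :=
  let k := S.pre.length
  let m := S.move.source.length
  let m' := S.move.target.length
  LinearMap.pi fun v' => ∑ v : D.Vertex,
    if AgreeOutside k m m' v.1 v'.1 then
      (-1 : ℤ) ^ ((v.1.filter fun l => k + m ≤ l).card * (v.1.card + v'.1.card)) •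
        (S.move.entry h t z D D' k v v').comp (LinearMap.proj v)
    else 0

end

/-! ### Immersed cobordisms and their maps -/

/-- An oriented normally immersed link cobordism in `[0,1] × ℝ³`, decomposed into elementary
cobordisms, with a direction assigned to each double point. -/
inductive Cobordism : Diagram → Diagram → Type
  | nil (D : Diagram) : Cobordism D D
  | cons {D D' D'' : Diagram} (S : Step D D') (M : Cobordism D' D'') : Cobordism D D''

namespace Cobordism

/-- Composition of cobordisms (first the first one). -/
def append {D D' D'' : Diagram} : Cobordism D D' → Cobordism D' D'' → Cobordism D D''
  | nil _, N => N
  | cons S M, N => cons S (M.append N)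

/-- The Euler characteristic. -/
def euler {D D' : Diagram} : Cobordism D D' → ℤ
  | nil _ => 0
  | cons S M => S.move.euler + M.euler

/-- The number of double points of the given sign (`true` = positive). -/
def numDouble (sign : Bool) {D D' : Diagram} : Cobordism D D' → ℕ
  | nil _ => 0
  | cons S M => (if S.doublePoint = some sign then 1 else 0) + M.numDouble sign

noncomputable section

variable {R : Type*} [CommRing R] (h t : R)

/-- The chain map of an immersed cobordism, with `ζ_i` used for all positive double points and `ζ_j`
for all negative ones. -/
def chainMap (i j : Fin 2) {D D' : Diagram} : Cobordism D D' → (CKh h t D →ₗ[R] CKh h t D')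
  | nil _ => LinearMap.id
  | cons S M => (M.chainMap i j).comp (S.map h t (if S.doublePoint = some true then i else j))

/-- The immersed cobordism map of lowest homological degree. -/
def khLow {D D' : Diagram} (S : Cobordism D D') : Kh h t D →ₗ[R] Kh h t D' :=
  homologyMap h t (S.chainMap h t 0 0)

/-- The immersed cobordism map of balanced homological degree. -/
def khBal {D D' : Diagram} (S : Cobordism D D') : Kh h t D →ₗ[R] Kh h t D' :=
  homologyMap h t (S.chainMap h t 0 1)

end

end Cobordism

/-! ### Twist moves and finger moves -/

/-- A local twist at a generic point of the diagram `E`: create a kink on the strand `i` at some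
level, change its crossing, and remove the resulting kink.  The new double point is positive if the
kink is created with a negative crossing, and negative otherwise. -/
structure Twist (E : Diagram) (positive : Bool) : Type where
  {E₁ E₂ : Diagram}
  create : Step E E₁
  change : Step E₁ E₂
  remove : Step E₂ E
  right : Bool
  i : ℕ
  d : Bool
  dir : Bool
  create_move : create.move = .kink right i d (!positive)
  change_move : change.move = .crossingChange (if right then i else i + 1) (!positive) dir
  remove_move : remove.move = .unkink right i d positive
  change_level : change.pre.length = create.pre.length + 1
  remove_level : remove.pre.length = create.pre.length

namespace Twist

variable {E : Diagram} {positive : Bool} (τ : Twist E positive)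

def movie : Cobordism E E := .cons τ.create (.cons τ.change (.cons τ.remove (.nil E)))

/-- The point of the diagram at which the twist takes place. -/
def point : ℕ × ℕ := (τ.create.pre.length, τ.i)

/-- The sign of the direction of the new double point: `1` if it points from the strand to the loop
of the kink, and `-1` if it points from the loop to the strand. -/
def sign : ℤ := if τ.dir = τ.right then 1 else -1

/-- The cobordism that is obtained from `M` followed by `N` by adding the twist in between. -/
def insert {D D' : Diagram} (M : Cobordism D E) (N : Cobordism E D') : Cobordism D D' :=
  M.append (τ.movie.append N)

end Twist

/-- A local finger move at the diagram `E`: push two adjacent strands `i`, `i + 1` across each other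
by a Reidemeister 2 move, change both crossings (in either order), and pull the strands apart. -/
structure Finger (E : Diagram) : Type where
  {E₁ E₂ E₃ : Diagram}
  create : Step E E₁
  change₁ : Step E₁ E₂
  change₂ : Step E₂ E₃
  remove : Step E₃ E
  i : ℕ
  ε : Bool
  upperFirst : Bool
  dir₁ : Bool
  dir₂ : Bool
  create_move : create.move = .poke i ε
  change₁_move : change₁.move = .crossingChange i (if upperFirst then ε else !ε) dir₁
  change₂_move : change₂.move = .crossingChange i (if upperFirst then !ε else ε) dir₂
  remove_move : remove.move = .unpoke i (!ε)
  change₁_level : change₁.pre.length = create.pre.length + (if upperFirst then 0 else 1)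
  change₂_level : change₂.pre.length = create.pre.length + (if upperFirst then 1 else 0)
  remove_level : remove.pre.length = create.pre.length

namespace Finger

variable {E : Diagram} (φ : Finger E)

def movie : Cobordism E E :=
  .cons φ.create (.cons φ.change₁ (.cons φ.change₂ (.cons φ.remove (.nil E))))

/-- The points on the two strands at which the finger move takes place. -/
def leftPoint : ℕ × ℕ := (φ.create.pre.length, φ.i)
def rightPoint : ℕ × ℕ := (φ.create.pre.length, φ.i + 1)

/-- The two strands have the same direction. -/
def Parallel : Prop :=
  (E.strands φ.create.pre.length)[φ.i]? = (E.strands φ.create.pre.length)[φ.i + 1]?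

/-- The cobordism that is obtained from `M` followed by `N` by a finger move in between. -/
def insert {D D' : Diagram} (M : Cobordism D E) (N : Cobordism E D') : Cobordism D D' :=
  M.append (φ.movie.append N)

end Finger

noncomputable section

variable {R : Type*} [CommRing R] (h t : R)

/-- The endomorphism `2X - h` at the place of a twist. -/
def Twist.handle {E : Diagram} {positive : Bool} (τ : Twist E positive) :
    CKh h t E →ₗ[R] CKh h t E :=
  (2 : R) • dotMap h t E τ.point - h • LinearMap.id

/-- The endomorphism `Φ = X ⊗ 1 - 1 ⊗ X` on the two strands of a finger move. -/
def Finger.phi {E : Diagram} (φ : Finger E) : CKh h t E →ₗ[R] CKh h t E :=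
  dotMap h t E φ.leftPoint - dotMap h t E φ.rightPoint

/-- The endomorphism `Ψ = X ⊗ 1 + 1 ⊗ X - h` on the two strands of a finger move. -/
def Finger.psi {E : Diagram} (φ : Finger E) : CKh h t E →ₗ[R] CKh h t E :=
  dotMap h t E φ.leftPoint + dotMap h t E φ.rightPoint - h • LinearMap.id

/-! ### The bigrading -/

/-- The chains of homological degree `i` and quantum degree `j`, where `R` is graded by `𝓡`.  Each
factor `1` has degree `1`, and each factor `X` has degree `-1`. -/
def homogeneousChains (𝓡 : ℤ → AddSubgroup R) (D : Diagram) (i j : ℤ) :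
    AddSubgroup (CKh h t D) :=
  AddSubgroup.closure
    {x | ∃ (v : D.Vertex) (s : Finset (Circle D v)) (n : ℤ) (r : R), r ∈ 𝓡 n ∧
      (v.1.card : ℤ) - D.numNeg = i ∧
      n + (Fintype.card (Circle D v) - 2 * s.card) + v.1.card + D.numPos - 2 * D.numNeg = j ∧
      x = LinearMap.single R (fun v : D.Vertex => State h t D v) v (r • monomial h t D v s)}

/-- The homology classes of homological degree `i` and quantum degree `j`. -/
def homogeneousClasses (𝓡 : ℤ → AddSubgroup R) (D : Diagram) (i j : ℤ) :
    AddSubgroup (Kh h t D) :=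
  ((homogeneousChains h t 𝓡 D i j).comap (differential h t D).ker.subtype.toAddMonoidHom).map
    (Submodule.mkQ _).toAddMonoidHom

/-- A map on Khovanov homology is homogeneous of bidegree `(a, b)`. -/
def HasBidegree (𝓡 : ℤ → AddSubgroup R) {D D' : Diagram} (f : Kh h t D →ₗ[R] Kh h t D')
    (a b : ℤ) : Prop :=
  ∀ i j : ℤ, ∀ x ∈ homogeneousClasses h t 𝓡 D i j, f x ∈ homogeneousClasses h t 𝓡 D' (i + a) (j + b)

end

end ImmersedKhovanov

open ImmersedKhovanov

/-! The module of a resolution is a commutative algebra generated by the dots, the elements `X` on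
single circles. Every map in a twist or finger move is local: it commutes with the dots at all
points outside the modified layers. Hence, resolution by resolution of `E`, the composition is
multiplication by the image of `1` (`eq_mul_of_dot`, `eq_mul_of_insertion`), and it remains to
follow the element `1`.

In a positive twist `1` becomes `1` on the kink, then `± (X_loop - X_strand)` under `f₀`, and the
counit on the loop gives `± 1`. In a negative twist `1` becomes `X_loop - X_strand`, is carried
along by `f₁`, and the last map sends `1` to `1` and `X_loop` to `h - X`, which gives `h - 2X`
(`Twist.map_eq_mul`). In a finger move with `f₀` at one crossing and `f₁` at the other, a single
pair of smoothings contributes. If both crossings are smoothed vertically, only the factor `Φ` of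
`f₀` is seen (`Finger.map_eq_vertical`). If both are smoothed horizontally, the two Reidemeister 2
maps are saddles, one of which merges and the other splits; `f₀` puts a dot on the small circle,
which is then capped off, and the neck-cutting element `Ψ` remains (`Finger.map_eq_horizontal`). The
orientation of the strands decides which case belongs to which generator. All other choices of
generators end in a smoothing on which the last Reidemeister map vanishes.

Locality of saddles uses planarity: a saddle either merges two circles or splits one, and never
turns one circle into one circle. In Morse position this is proved with two-colourings. A resolution
with `c` circles has `2 ^ c` colourings, and these are counted by transfer operators that satisfy
the Temperley–Lieb relations with circle value `2`. Reducing a closed crossingless word by these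
relations shows that `2c` agrees modulo `4` with the signed number of extrema
(`FlatValid.isClosedValue`), so a saddle changes the parity of `c` (`LocalChange.saddle`).
Colourings also detect which points lie on the same circle (`circleOf_eq_iff`), so all statements
about arcs become equations between labels.

The degree statement is checked component by component for all elementary moves
(`Step.entry_degree`): the change of the number of circles, the degree of the local value and the
change of the crossing signs add up to the Euler characteristic minus twice the number of negative
double points.

Concatenation of movies is composition of maps, so the global statements follow from the local ones.
On homology, `homologyMap` is zero for maps that do not commute with the differentials; the
equalities and the bidegrees hold in either case. Non-vanishing is tested on crossingless diagrams,
whose differentials are zero. -/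

namespace ImmersedKhovanov

/-! ### Transfer operators of two-colourings, and the number of circles modulo two. -/

/-! ### Labels of strands and transfer operators -/

/-- A labelling of the strands at one level (only finitely many of them belong to the diagram). -/
abbrev Row : Type := ℕ → Bool

/-- Insert two strands with label `c` at position `i`. -/
def Row.ins (i : ℕ) (c : Bool) (x : Row) : Row :=
  fun j => if j < i then x j else if j < i + 2 then c else x (j - 2)

/-- Delete the strands `i` and `i + 1`. -/
def Row.del (i : ℕ) (x : Row) : Row := fun j => if j < i then x j else x (j + 2)

theorem Row.del_ins (i : ℕ) (c : Bool) (x : Row) : (x.ins i c).del i = x := by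
  funext j; simp only [Row.ins, Row.del]; grind

theorem Row.del_succ_ins (i : ℕ) (x : Row) : (x.ins i (x i)).del (i + 1) = x := by
  funext j; simp only [Row.ins, Row.del]; grind

theorem Row.del_ins_succ (i : ℕ) (x : Row) : (x.ins (i + 1) (x i)).del i = x := by
  funext j; simp only [Row.ins, Row.del]; grind

theorem Row.ins_self (i : ℕ) (x : Row) (hx : x i = x (i + 1)) : (x.del i).ins i (x i) = x := by
  funext j; simp only [Row.ins, Row.del]; grind

theorem Row.ins_comm (i g : ℕ) (c d : Bool) (x : Row) :
    (x.ins i c).ins (i + 2 + g) d = (x.ins (i + g) d).ins i c := by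
  funext j; simp only [Row.ins]; grind

theorem Row.del_comm (i g : ℕ) (x : Row) : (x.del i).del (i + g) = (x.del (i + 2 + g)).del i := by
  funext j; simp only [Row.del]; grind

theorem Row.del_ins_far (i g : ℕ) (c : Bool) (x : Row) :
    (x.ins i c).del (i + 2 + g) = (x.del (i + g)).ins i c := by
  funext j; simp only [Row.ins, Row.del]; grind

theorem Row.ins_del_far (i g : ℕ) (c : Bool) (x : Row) :
    (x.del i).ins (i + g) c = (x.ins (i + 2 + g) c).del i := by
  funext j; simp only [Row.ins, Row.del]; grind

/-- Transfer operators run upwards: from a count of labellings of everything below a layer, as a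
function of the row under it, they produce the count that includes the layer, as a function of the
row above it. A maximum sums over the label of its new arc; a minimum demands equal labels at its
two ends. -/
def cupT (i : ℕ) (g : Row → ℕ) : Row → ℕ := fun x => g (x.ins i false) + g (x.ins i true)

def capT (i : ℕ) (g : Row → ℕ) : Row → ℕ := fun x => if x i = x (i + 1) then g (x.del i) else 0

theorem cupT_smul (i n : ℕ) (g : Row → ℕ) : cupT i (n • g) = n • cupT i g := by
  funext x; simp [cupT, mul_add]

theorem capT_smul (i n : ℕ) (g : Row → ℕ) : capT i (n • g) = n • capT i g := by
  funext x; simp [capT]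

/-- A closed circle has two labels. Together with the zigzag relations and the commutations of
distant extrema below, this is a full set of relations for reducing closed crossingless words to
scalars. -/
theorem cupT_capT (i : ℕ) (g : Row → ℕ) : cupT i (capT i g) = 2 • g := by
  funext x
  simp only [cupT, capT, Row.del_ins, Pi.smul_apply, smul_eq_mul]
  simp [Row.ins]; ring

theorem cupT_capT_succ (i : ℕ) (g : Row → ℕ) : cupT i (capT (i + 1) g) = g := by
  funext x
  have h1 : ∀ c, (x.ins i c) (i + 1) = c := by intro c; simp [Row.ins]
  have h2 : ∀ c, (x.ins i c) (i + 1 + 1) = x i := by intro c; simp [Row.ins]; omega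
  have h3 := Row.del_succ_ins i x
  simp only [cupT, capT, h1, h2]
  cases hx : x i <;> rw [hx] at h3 <;> simp [h3]

theorem cupT_succ_capT (i : ℕ) (g : Row → ℕ) : cupT (i + 1) (capT i g) = g := by
  funext x
  have h1 : ∀ c, (x.ins (i + 1) c) (i + 1) = c := by intro c; simp [Row.ins]
  have h2 : ∀ c, (x.ins (i + 1) c) i = x i := by intro c; simp [Row.ins]
  have h3 := Row.del_ins_succ i x
  simp only [cupT, capT, h1, h2]
  cases hx : x i <;> rw [hx] at h3 <;> simp [h3]

theorem cupT_cupT (i k : ℕ) (g : Row → ℕ) :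
    cupT i (cupT (i + 2 + k) g) = cupT (i + k) (cupT i g) := by
  funext x; simp only [cupT, Row.ins_comm]; ring

theorem capT_capT (i k : ℕ) (g : Row → ℕ) :
    capT i (capT (i + k) g) = capT (i + 2 + k) (capT i g) := by
  funext x
  have h1 : (x.del i) (i + k) = x (i + 2 + k) := by simp [Row.del]; congr 1; omega
  have h2 : (x.del i) (i + k + 1) = x (i + 2 + k + 1) := by
    simp only [Row.del]; rw [if_neg (by omega)]; congr 1; omega
  have h3 : (x.del (i + 2 + k)) i = x i := by simp [Row.del]; omega
  have h4 : (x.del (i + 2 + k)) (i + 1) = x (i + 1) := by simp [Row.del]; omega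
  simp only [capT, h1, h2, h3, h4, Row.del_comm]
  split_ifs <;> rfl

theorem cupT_capT_far (i k : ℕ) (g : Row → ℕ) :
    cupT i (capT (i + 2 + k) g) = capT (i + k) (cupT i g) := by
  funext x
  have h1 : ∀ c, (x.ins i c) (i + 2 + k) = x (i + k) := by
    intro c; simp only [Row.ins]; rw [if_neg (by omega), if_neg (by omega)]; congr 1; omega
  have h2 : ∀ c, (x.ins i c) (i + 2 + k + 1) = x (i + k + 1) := by
    intro c; simp only [Row.ins]; rw [if_neg (by omega), if_neg (by omega)]; congr 1; omega
  simp only [cupT, capT, h1, h2, Row.del_ins_far]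
  split_ifs <;> rfl

theorem capT_cupT_far (i k : ℕ) (g : Row → ℕ) :
    capT i (cupT (i + k) g) = cupT (i + 2 + k) (capT i g) := by
  funext x
  have h1 : ∀ c, (x.ins (i + 2 + k) c) i = x i := by intro c; simp [Row.ins]; omega
  have h2 : ∀ c, (x.ins (i + 2 + k) c) (i + 1) = x (i + 1) := by
    intro c; simp [Row.ins]; omega
  simp only [cupT, capT, h1, h2, Row.ins_del_far]
  split_ifs <;> rfl

/-! ### Flat words -/

/-- The operator of a crossingless word, whose letters are maxima (`true`) and minima. -/
def flatT : List (Bool × ℕ) → (Row → ℕ) → Row → ℕ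
  | [], g => g
  | (true, i) :: w, g => cupT i (flatT w g)
  | (false, i) :: w, g => capT i (flatT w g)

theorem flatT_append (u w : List (Bool × ℕ)) (g : Row → ℕ) :
    flatT (u ++ w) g = flatT u (flatT w g) := by
  induction u with
  | nil => rfl
  | cons a u ih => rcases a with ⟨_ | _, i⟩ <;> simp [flatT, ih]

theorem flatT_smul (w : List (Bool × ℕ)) (n : ℕ) (g : Row → ℕ) :
    flatT w (n • g) = n • flatT w g := by
  induction w with
  | nil => rfl
  | cons a u ih => rcases a with ⟨_ | _, i⟩ <;> simp only [flatT, ih, cupT_smul, capT_smul]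

/-- A crossingless word that fits `n` strands and leaves `m` strands. -/
inductive FlatValid : ℕ → List (Bool × ℕ) → ℕ → Prop
  | nil (n : ℕ) : FlatValid n [] n
  | cup {n i m : ℕ} {w : List (Bool × ℕ)} : i ≤ n → FlatValid (n + 2) w m →
      FlatValid n ((true, i) :: w) m
  | cap {n i m : ℕ} {w : List (Bool × ℕ)} : i ≤ n → FlatValid n w m →
      FlatValid (n + 2) ((false, i) :: w) m

theorem FlatValid.append {n m p : ℕ} {u w : List (Bool × ℕ)} (hu : FlatValid n u m)
    (hw : FlatValid m w p) : FlatValid n (u ++ w) p := by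
  induction hu with
  | nil => exact hw
  | cup h _ ih => exact .cup h (ih hw)
  | cap h _ ih => exact .cap h (ih hw)

theorem FlatValid.of_append {n p : ℕ} {u w : List (Bool × ℕ)} (h : FlatValid n (u ++ w) p) :
    ∃ m, FlatValid n u m ∧ FlatValid m w p := by
  induction u generalizing n with
  | nil => exact ⟨n, .nil n, h⟩
  | cons a u ih =>
    cases h with
    | cup hi h => obtain ⟨m, h1, h2⟩ := ih h; exact ⟨m, .cup hi h1, h2⟩
    | cap hi h => obtain ⟨m, h1, h2⟩ := ih h; exact ⟨m, .cap hi h1, h2⟩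

/-- Twice the rotation number of a closed crossingless word. -/
def rot (w : List (Bool × ℕ)) : ℤ := (w.map fun a => (-1 : ℤ) ^ a.2).sum

theorem rot_append (u w : List (Bool × ℕ)) : rot (u ++ w) = rot u + rot w := by simp [rot]

theorem rot_cons (a : Bool × ℕ) (w : List (Bool × ℕ)) : rot (a :: w) = (-1 : ℤ) ^ a.2 + rot w := by
  simp [rot]

/-- `w` acts as `2 ^ c`, and `c` is congruent to the rotation number. -/
def IsClosedValue (w : List (Bool × ℕ)) : Prop :=
  ∃ c : ℕ, (∀ g, flatT w g = 2 ^ c • g) ∧ (4 : ℤ) ∣ rot w - 2 * c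

theorem isClosedValue_of_equiv {w w' : List (Bool × ℕ)} (h : IsClosedValue w')
    (hT : ∀ g, flatT w g = flatT w' g) (hr : rot w = rot w') : IsClosedValue w := by
  obtain ⟨c, h1, h2⟩ := h
  exact ⟨c, fun g => by rw [hT, h1], by rw [hr]; exact h2⟩

/-- Here `(false, j)` is the first minimum of the word. It is compared with the maximum directly
above it. They form a circle, cancel as a zigzag, or lie apart and can be exchanged; in the last
case fewer maxima precede the minimum, so induction on `A` applies. The congruence survives: a
circle contributes `± 2` to `rot` and `2` to `2c`, the two signs in a zigzag cancel, and an exchange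
shifts positions by `2`. -/
theorem isClosedValue_cups_cap (N : ℕ)
    (IH : ∀ w : List (Bool × ℕ), w.length < N → FlatValid 0 w 0 → IsClosedValue w)
    (A : List (Bool × ℕ)) : ∀ (j : ℕ) (B : List (Bool × ℕ)), (∀ a ∈ A, a.1 = true) →
    (A ++ (false, j) :: B).length = N → FlatValid 0 (A ++ (false, j) :: B) 0 →
    IsClosedValue (A ++ (false, j) :: B) := by
  induction A using List.reverseRecOn with
  | nil => intro j B _ _ h; cases h
  | append_singleton A a ih =>
    intro j B hA hN hV
    obtain ⟨b, i⟩ := a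
    obtain rfl : b = true := hA (b, i) (by simp)
    have hA' : ∀ a ∈ A, a.1 = true := fun a ha => hA a (by simp [ha])
    simp only [List.append_assoc, List.singleton_append] at hN hV ⊢
    obtain ⟨n, hVA, hV'⟩ := hV.of_append
    cases hV' with
    | cup hi hV' =>
    cases hV' with
    | cap hj hV' =>
    have key : i = j ∨ j = i + 1 ∨ i = j + 1 ∨ (∃ k, j = i + 2 + k) ∨ ∃ k, i = j + 2 + k := by
      rcases lt_trichotomy i j with h | h | h
      · rcases Nat.lt_or_ge j (i + 2) with h' | h'
        · right; left; omega
        · right; right; right; left; exact ⟨j - (i + 2), by omega⟩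
      · exact Or.inl h
      · rcases Nat.lt_or_ge i (j + 2) with h' | h'
        · right; right; left; omega
        · right; right; right; right; exact ⟨i - (j + 2), by omega⟩
    have hlen : (A ++ B).length < N := by simp at hN ⊢; omega
    rcases key with rfl | rfl | rfl | ⟨k, rfl⟩ | ⟨k, rfl⟩
    · obtain ⟨c, h1, h2⟩ := IH _ hlen (hVA.append hV')
      refine ⟨c + 1, fun g => ?_, ?_⟩
      · have := h1 g
        rw [flatT_append] at this ⊢
        simp only [flatT, cupT_capT, flatT_smul, this, smul_smul]
        rw [pow_succ]; ring_nf
      · simp only [rot_append, rot_cons] at h2 ⊢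
        -- The removed circle contributes `2` or `-2` according to the parity of its position, and
        -- these agree modulo `4`.
        rcases neg_one_pow_eq_or ℤ i with h | h <;> rw [h] <;> push_cast <;> omega
    · refine isClosedValue_of_equiv (IH _ hlen (hVA.append hV')) (fun g => ?_) ?_
      · simp only [flatT_append, flatT, cupT_capT_succ]
      · simp only [rot_append, rot_cons, pow_succ]; ring
    · refine isClosedValue_of_equiv (IH _ hlen (hVA.append hV')) (fun g => ?_) ?_
      · simp only [flatT_append, flatT, cupT_succ_capT]
      · simp only [rot_append, rot_cons, pow_succ]; ring
    · obtain ⟨n, rfl⟩ : ∃ n', n = n' + 2 := ⟨n - 2, by omega⟩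
      refine isClosedValue_of_equiv (ih (i + k) ((true, i) :: B) hA' (by simpa using hN)
        (hVA.append (.cap (by omega) (.cup (by omega) hV')))) (fun g => ?_) ?_
      · simp only [flatT_append, flatT, cupT_capT_far]
      · simp only [rot_append, rot_cons, pow_add]; ring
    · obtain ⟨n, rfl⟩ : ∃ n', n = n' + 2 := ⟨n - 2, by omega⟩
      refine isClosedValue_of_equiv (ih j ((true, j + k) :: B) hA' (by simpa using hN)
        (hVA.append (.cap (by omega) (.cup (by omega) hV')))) (fun g => ?_) ?_
      · simp only [flatT_append, flatT, capT_cupT_far]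
      · simp only [rot_append, rot_cons, pow_add]; ring

theorem exists_cups_cap (w : List (Bool × ℕ)) : (∀ a ∈ w, a.1 = true) ∨
    ∃ A j B, (∀ a ∈ A, a.1 = true) ∧ w = A ++ (false, j) :: B := by
  induction w with
  | nil => left; simp
  | cons a w ih =>
    obtain ⟨b, i⟩ := a
    cases b with
    | false => right; exact ⟨[], i, w, by simp, rfl⟩
    | true =>
      rcases ih with h | ⟨A, j, B, hA, rfl⟩
      · left; simpa using h
      · right; exact ⟨(true, i) :: A, j, B, by simpa using hA, rfl⟩

theorem FlatValid.le_of_cups {n m : ℕ} {w : List (Bool × ℕ)} (h : FlatValid n w m)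
    (hw : ∀ a ∈ w, a.1 = true) : n + w.length ≤ m := by
  induction h with
  | nil => simp
  | cup _ _ ih => have := ih (fun a ha => hw a (by simp [ha])); simp; omega
  | cap => simp at hw

/-- Strong induction on the length. A word without minima only gains strands, so it closes up only
if it is empty; any other word contains a first minimum and can be shortened. -/
theorem FlatValid.isClosedValue {w : List (Bool × ℕ)} (h : FlatValid 0 w 0) :
    IsClosedValue w := by
  induction hN : w.length using Nat.strong_induction_on generalizing w with
  | _ N IH =>
    rcases exists_cups_cap w with hw | ⟨A, j, B, hA, rfl⟩
    · have := h.le_of_cups hw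
      obtain rfl : w = [] := List.length_eq_zero_iff.mp (by omega)
      exact ⟨0, fun g => by simp [flatT], by simp [rot]⟩
    · exact isClosedValue_cups_cap N (fun w hw hv => IH w.length hw hv rfl) A j B hA hN h

/-- Inserting a horizontal smoothing changes the parity of the number of circles. -/
theorem closed_values_of_saddle {A B : List (Bool × ℕ)} {n i : ℕ} (hA : FlatValid 0 A n)
    (hB : FlatValid n B 0) (hi : i + 2 ≤ n) :
    ∃ c c' : ℕ, (∀ g, flatT A (flatT B g) = 2 ^ c • g) ∧
      (∀ g, flatT A (capT i (cupT i (flatT B g))) = 2 ^ c' • g) ∧ ¬ (2 : ℤ) ∣ (c' : ℤ) - c := by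
  obtain ⟨c, h1, h2⟩ := (hA.append hB).isClosedValue
  obtain ⟨n, rfl⟩ : ∃ n', n = n' + 2 := ⟨n - 2, by omega⟩
  obtain ⟨c', h1', h2'⟩ := (hA.append (.cap (i := i) (by omega) (.cup (i := i) (by omega)
    hB))).isClosedValue
  refine ⟨c, c', fun g => by rw [← h1, flatT_append],
    fun g => by rw [← h1', flatT_append]; rfl, ?_⟩
  simp only [rot_append, rot_cons] at h2 h2'
  -- The inserted minimum and maximum sit at the same position, so `rot` changes by `± 2`. Modulo
  -- `4` this forces `c' - c` to be odd.
  rcases neg_one_pow_eq_or ℤ i with h | h <;> rw [h] at h2' <;> omega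

/-! ### Transfer operators of resolved layers -/

noncomputable instance : DecidableEq Row := Classical.decEq _

/-- The rows that may follow the row `x` below a layer, resolved according to `b`. -/
noncomputable def outs (L : Layer) (b : Bool) (x : Row) : Finset Row :=
  match L.shape with
  | .cup _ => {x.ins L.pos false, x.ins L.pos true}
  | .cap => if x L.pos = x (L.pos + 1) then {x.del L.pos} else ∅
  | .cross ε => if b = !ε then {x} else
      if x L.pos = x (L.pos + 1) then
        {(x.del L.pos).ins L.pos false, (x.del L.pos).ins L.pos true}
      else ∅

noncomputable def transfer (L : Layer) (b : Bool) (g : Row → ℕ) : Row → ℕ :=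
  fun x => ∑ y ∈ outs L b x, g y

theorem Row.ins_ne (i : ℕ) (x : Row) : x.ins i false ≠ x.ins i true := by
  intro h; have := congrFun h i; simp [Row.ins] at this

theorem transfer_cup (i : ℕ) (d b : Bool) (g : Row → ℕ) : transfer (cup i d) b g = cupT i g := by
  funext x
  simp only [transfer, outs, cupT]
  rw [Finset.sum_insert (by simpa using Row.ins_ne i x), Finset.sum_singleton]

theorem transfer_cap (i : ℕ) (b : Bool) (g : Row → ℕ) : transfer (cap i) b g = capT i g := by
  funext x
  simp only [transfer, outs, capT]
  split_ifs <;> simp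

theorem transfer_cross (i : ℕ) (ε b : Bool) (g : Row → ℕ) :
    transfer (cross i ε) b g = if b = !ε then g else capT i (cupT i g) := by
  funext x
  simp only [transfer, outs]
  split_ifs with h1 h2
  · simp
  · rw [Finset.sum_insert (by simpa using Row.ins_ne i _), Finset.sum_singleton]
    simp [capT, cupT, h2]
  · simp [capT, h2]

theorem transfer_smul (L : Layer) (b : Bool) (n : ℕ) (g : Row → ℕ) :
    transfer L b (n • g) = n • transfer L b g := by
  funext x; simp [transfer, Finset.mul_sum]

noncomputable def transferWord (v : Finset ℕ) : ℕ → List Layer → (Row → ℕ) → Row → ℕ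
  | _, [], g => g
  | k, L :: w, g => transfer L (bit v k) (transferWord v (k + 1) w g)

theorem transferWord_append (v : Finset ℕ) (k : ℕ) (u w : List Layer) (g : Row → ℕ) :
    transferWord v k (u ++ w) g = transferWord v k u (transferWord v (k + u.length) w g) := by
  induction u generalizing k with
  | nil => rfl
  | cons L u ih =>
    simp only [List.cons_append, transferWord, ih, List.length_cons]
    congr 3; omega

theorem transferWord_smul (v : Finset ℕ) (k : ℕ) (w : List Layer) (n : ℕ) (g : Row → ℕ) :
    transferWord v k w (n • g) = n • transferWord v k w g := by
  induction w generalizing k with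
  | nil => rfl
  | cons L u ih => simp only [transferWord, ih, transfer_smul]

theorem bit_congr {v v' : Finset ℕ} {l l' : ℕ} (h : l ∈ v ↔ l' ∈ v') : bit v l = bit v' l' := by
  simp [bit, h]

theorem transferWord_congr {v v' : Finset ℕ} {k k' : ℕ} (w : List Layer) (g : Row → ℕ)
    (h : ∀ j < w.length, (k + j ∈ v ↔ k' + j ∈ v')) :
    transferWord v k w g = transferWord v' k' w g := by
  induction w generalizing k k' with
  | nil => rfl
  | cons L u ih =>
    simp only [transferWord]
    rw [bit_congr (by simpa using h 0 (by simp)), ih]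
    intro j hj
    have := h (j + 1) (by simpa using hj)
    rwa [show k + 1 + j = k + (j + 1) by omega, show k' + 1 + j = k' + (j + 1) by omega]

/-- The crossingless word of a resolution. -/
def flatten (v : Finset ℕ) : ℕ → List Layer → List (Bool × ℕ)
  | _, [] => []
  | k, ⟨.cup _, i⟩ :: w => (true, i) :: flatten v (k + 1) w
  | k, ⟨.cap, i⟩ :: w => (false, i) :: flatten v (k + 1) w
  | k, ⟨.cross ε, i⟩ :: w =>
      if decide (k ∈ v) = !ε then flatten v (k + 1) w
      else (false, i) :: (true, i) :: flatten v (k + 1) w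

theorem bit_eq (v : Finset ℕ) (k : ℕ) : bit v k = decide (k ∈ v) := by simp [bit]

theorem transferWord_eq_flatT (v : Finset ℕ) (k : ℕ) (w : List Layer) (g : Row → ℕ) :
    transferWord v k w g = flatT (flatten v k w) g := by
  induction w generalizing k with
  | nil => rfl
  | cons L u ih =>
    obtain ⟨_ | _ | ε, i⟩ := L
    · exact (transfer_cup _ _ _ _).trans (by rw [ih]; rfl)
    · exact (transfer_cap _ _ _).trans (by rw [ih]; rfl)
    · refine (transfer_cross _ _ _ _).trans ?_
      rw [ih]
      simp only [flatten, bit_eq]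
      split_ifs <;> rfl

/-! ### The action of layers on directed strands -/

theorem act_cup {i : ℕ} {d : Bool} {s s' : List Bool} : (cup i d).act s = some s' ↔
    ∃ A B, A.length = i ∧ s = A ++ B ∧ s' = A ++ d :: (!d) :: B := by
  simp only [Layer.act]
  constructor
  · intro h
    split_ifs at h with hi
    exact ⟨s.take i, s.drop i, by simpa using hi, by simp, by simpa using h.symm⟩
  · rintro ⟨A, B, rfl, rfl, rfl⟩
    simp

theorem act_cap {i : ℕ} {s s' : List Bool} : (cap i).act s = some s' ↔
    ∃ A a B, A.length = i ∧ s = A ++ a :: (!a) :: B ∧ s' = A ++ B := by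
  constructor
  · intro h
    simp only [Layer.act] at h
    rcases hd : s.drop i with _ | ⟨a, _ | ⟨b, r⟩⟩ <;> simp only [hd] at h <;> try simp at h
    obtain ⟨rfl, rfl⟩ := h
    have hi : i ≤ s.length := by
      by_contra hc
      rw [List.drop_eq_nil_of_le (by omega)] at hd; simp at hd
    exact ⟨s.take i, a, r, by simpa using hi, by rw [← hd]; simp, rfl⟩
  · rintro ⟨A, a, B, rfl, rfl, rfl⟩
    simp [Layer.act]

theorem act_cross {i : ℕ} {ε : Bool} {s s' : List Bool} : (cross i ε).act s = some s' ↔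
    ∃ A a b B, A.length = i ∧ s = A ++ a :: b :: B ∧ s' = A ++ b :: a :: B := by
  constructor
  · intro h
    simp only [Layer.act] at h
    rcases hd : s.drop i with _ | ⟨a, _ | ⟨b, r⟩⟩ <;> simp only [hd] at h <;> try simp at h
    obtain rfl := h
    have hi : i ≤ s.length := by
      by_contra hc
      rw [List.drop_eq_nil_of_le (by omega)] at hd; simp at hd
    exact ⟨s.take i, a, b, r, by simpa using hi, by rw [← hd]; simp, rfl⟩
  · rintro ⟨A, a, b, B, rfl, rfl, rfl⟩
    simp [Layer.act]

theorem run_cons (L : Layer) (w : List Layer) (s : List Bool) :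
    run (L :: w) s = (L.act s).bind (run w) := by
  simp only [run, List.foldlM_cons]; rfl

theorem run_append (u w : List Layer) (s : List Bool) :
    run (u ++ w) s = (run u s).bind (run w) := by
  simp only [run, List.foldlM_append]; rfl

theorem run_cons_eq_some {L : Layer} {w : List Layer} {s s' : List Bool} :
    run (L :: w) s = some s' ↔ ∃ r, L.act s = some r ∧ run w r = some s' := by
  rw [run_cons, Option.bind_eq_some_iff]

theorem run_append_eq_some {u w : List Layer} {s s' : List Bool} :
    run (u ++ w) s = some s' ↔ ∃ r, run u s = some r ∧ run w r = some s' := by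
  rw [run_append, Option.bind_eq_some_iff]

theorem run_nil (s : List Bool) : run [] s = some s := rfl

/-- Only the number of strands is kept: a horizontal smoothing of parallel strands is not compatible
with their directions, but it always fits as a crossingless word. -/
theorem flatValid_flatten (v : Finset ℕ) (k : ℕ) (w : List Layer) (s s' : List Bool)
    (h : run w s = some s') : FlatValid s.length (flatten v k w) s'.length := by
  induction w generalizing k s with
  | nil => simp only [run_nil, Option.some.injEq] at h; subst h; exact .nil _
  | cons L u ih =>
    obtain ⟨r, hr, h⟩ := run_cons_eq_some.mp h
    have ih := ih (k + 1) r h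
    obtain ⟨_ | _ | ε, i⟩ := L
    · obtain ⟨A, B, rfl, rfl, rfl⟩ := act_cup.mp hr
      refine .cup (by simp) ?_
      convert ih using 1
      simp; omega
    · obtain ⟨A, a, B, rfl, rfl, rfl⟩ := act_cap.mp hr
      have e : (A ++ a :: (!a) :: B).length = (A ++ B).length + 2 := by simp; omega
      rw [e]
      exact .cap (by simp) ih
    · obtain ⟨A, a, b, B, rfl, rfl, rfl⟩ := act_cross.mp hr
      have e : (A ++ a :: b :: B).length = (A ++ B).length + 2 := by simp; omega
      have e' : (A ++ b :: a :: B).length = (A ++ B).length + 2 := by simp; omega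
      rw [e'] at ih
      rw [e]
      simp only [flatten]
      split_ifs
      · exact ih
      · exact .cap (by simp) (.cup (by simp) ih)

end ImmersedKhovanov

/-! ### Circles of a resolution, counted and separated by two-colourings. -/

namespace ImmersedKhovanov

/-! ### Labellings of words -/

def consRow (x : Row) (f : ℕ → Row) : ℕ → Row
  | 0 => x
  | l + 1 => f l

theorem consRow_injective (x : Row) : Function.Injective (consRow x) := by
  intro f g h; funext l; exact congrFun h (l + 1)

noncomputable instance : DecidableEq (ℕ → Row) := Classical.decEq _

/-- The labellings of a resolved word that start with the row `x`. -/
noncomputable def labs (v : Finset ℕ) : ℕ → List Layer → Row → Finset (ℕ → Row)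
  -- Rows beyond the end of the word are normalised to `false`, so that a labelling is determined by
  -- its rows within the word.
  | _, [], x => {consRow x fun _ _ => false}
  | k, L :: w, x => (outs L (bit v k) x).biUnion fun y => (labs v (k + 1) w y).image (consRow x)

theorem mem_labs {v : Finset ℕ} {k : ℕ} {w : List Layer} {x : Row} {f : ℕ → Row} :
    f ∈ labs v k w x ↔ f 0 = x ∧
      (∀ l L, w[l]? = some L → f (l + 1) ∈ outs L (bit v (k + l)) (f l)) ∧
      ∀ l, w.length < l → f l = fun _ => false := by
  induction w generalizing k x f with
  | nil =>
    simp only [labs, Finset.mem_singleton]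
    constructor
    · rintro rfl
      refine ⟨rfl, by simp, ?_⟩
      rintro (_ | l) hl
      · simp at hl
      · rfl
    · rintro ⟨rfl, -, h⟩
      funext l
      cases l with
      | zero => rfl
      | succ l => exact h (l + 1) (by simp)
  | cons L w ih =>
    simp only [labs, Finset.mem_biUnion, Finset.mem_image]
    constructor
    · rintro ⟨y, hy, g, hg, rfl⟩
      obtain ⟨h0, h1, h2⟩ := ih.mp hg
      refine ⟨rfl, ?_, ?_⟩
      · rintro (_ | l) L' hl
        · obtain rfl : L = L' := by simpa using hl
          simpa [consRow, h0] using hy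
        · have := h1 l L' (by simpa using hl)
          rwa [show k + 1 + l = k + (l + 1) by omega] at this
      · rintro (_ | l) hl
        · simp at hl
        · exact h2 l (by simpa using hl)
    · rintro ⟨rfl, h1, h2⟩
      refine ⟨f 1, h1 0 L (by simp), fun l => f (l + 1), ih.mpr ⟨rfl, ?_, ?_⟩, ?_⟩
      · intro l L' hl
        have := h1 (l + 1) L' (by simpa using hl)
        rwa [show k + (l + 1) = k + 1 + l by omega] at this
      · intro l hl
        exact h2 (l + 1) (by simpa using hl)
      · funext l; cases l <;> rfl

open Classical in
/-- The number of labellings with a given property. -/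
noncomputable def count (v : Finset ℕ) (k : ℕ) (w : List Layer) (x : Row)
    (P : (ℕ → Row) → Prop) : ℕ := ((labs v k w x).filter P).card

theorem count_eq_card (v : Finset ℕ) (k : ℕ) (w : List Layer) (x : Row) (P : (ℕ → Row) → Prop)
    [DecidablePred P] : count v k w x P = ((labs v k w x).filter P).card := by
  rw [count]; congr!

theorem count_cons (v : Finset ℕ) (k : ℕ) (L : Layer) (w : List Layer) (x : Row)
    (P : (ℕ → Row) → Prop) : count v k (L :: w) x P =
      transfer L (bit v k) (fun y => count v (k + 1) w y fun f => P (consRow x f)) x := by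
  classical
  simp only [count, transfer, labs]
  rw [Finset.filter_biUnion, Finset.card_biUnion]
  · refine Finset.sum_congr rfl fun y _ => ?_
    rw [Finset.filter_image, Finset.card_image_of_injective _ (consRow_injective x)]
  · intro y _ y' _ hne
    rw [Function.onFun, Finset.disjoint_left]
    intro f hf hf'
    simp only [Finset.mem_filter, Finset.mem_image] at hf hf'
    obtain ⟨⟨g, hg, rfl⟩, -⟩ := hf
    obtain ⟨⟨g', hg', h⟩, -⟩ := hf'
    obtain rfl := consRow_injective x h
    exact hne ((mem_labs.mp hg).1.symm.trans (mem_labs.mp hg').1)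

theorem count_congr (v : Finset ℕ) (k : ℕ) (w : List Layer) (x : Row)
    {P Q : (ℕ → Row) → Prop} (h : ∀ f, f 0 = x → (P f ↔ Q f)) :
    count v k w x P = count v k w x Q := by
  classical
  simp only [count]
  congr 1
  refine Finset.filter_congr fun f hf => h f (mem_labs.mp hf).1

/-- This connects operators with labellings: applied to the constant function `1`, the transfer
operator of a word counts all labellings with a given first row. -/
theorem count_const (v : Finset ℕ) (k : ℕ) (w : List Layer) (x : Row) (c : Prop) [Decidable c] :
    count v k w x (fun _ => c) = if c then transferWord v k w 1 x else 0 := by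
  by_cases hc : c
  · rw [if_pos hc]
    induction w generalizing k x with
    | nil => simp [count, labs, transferWord, hc]
    | cons L w ih =>
      rw [count_cons, transferWord]
      congr 1
      funext y
      exact ih _ _
  · simp [count, hc]

theorem count_prefix (v : Finset ℕ) (k : ℕ) (u w : List Layer) (x : Row)
    (Q : (ℕ → Row) → Prop) : count v k (u ++ w) x (fun f => Q fun l => f (u.length + l)) =
      transferWord v k u (fun y => count v (k + u.length) w y Q) x := by
  induction u generalizing k x with
  | nil => simp [transferWord]
  | cons L u ih =>
    rw [List.cons_append, count_cons, transferWord]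
    congr 1
    funext y
    rw [List.length_cons, show k + (u.length + 1) = k + 1 + u.length by omega, ← ih]
    congr 1
    funext f
    congr 1
    funext l
    rw [show u.length + 1 + l = (u.length + l) + 1 by omega]
    rfl

theorem count_eq_const (v : Finset ℕ) (k : ℕ) (u w : List Layer) (x : Row) (b : ℕ) (c : Bool) :
    count v k (u ++ w) x (fun f => c = f u.length b) =
      transferWord v k u (fun y => if c = y b then transferWord v (k + u.length) w 1 y else 0) x := by
  have := count_prefix v k u w x (fun f => c = f 0 b)
  simp only [Nat.add_zero] at this
  rw [this]
  congr 1
  funext y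
  rw [← count_const]
  exact count_congr _ _ _ _ fun f hf => by rw [hf]

/-- The number of labellings with equal labels at two points. -/
theorem count_eq (v : Finset ℕ) (k : ℕ) (u m w : List Layer) (x : Row) (a b : ℕ) :
    count v k (u ++ (m ++ w)) x (fun f => f u.length a = f (u.length + m.length) b) =
      transferWord v k u (fun y => transferWord v (k + u.length) m (fun z =>
        if y a = z b then transferWord v (k + u.length + m.length) w 1 z else 0) y) x := by
  have := count_prefix v k u (m ++ w) x (fun f => f 0 a = f m.length b)
  simp only [Nat.add_zero] at this
  rw [this]
  congr 1
  funext y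
  rw [← count_eq_const]
  exact count_congr _ _ _ _ fun f hf => by rw [hf]

/-! ### Rows of a diagram -/

namespace Diagram

/-- Since the whole word runs, so does each of its prefixes; the default value in `strands` never
occurs. -/
theorem run_take (D : Diagram) (l : ℕ) : run (D.word.take l) [] = some (D.strands l) := by
  have h := D.closed
  rw [← List.take_append_drop l D.word] at h
  obtain ⟨r, hr, -⟩ := run_append_eq_some.mp h
  simp [strands, hr]

theorem strands_zero (D : Diagram) : D.strands 0 = [] := by simp [strands, run_nil]

theorem strands_of_le (D : Diagram) {l : ℕ} (h : D.word.length ≤ l) : D.strands l = [] := by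
  simp [strands, List.take_of_length_le h, D.closed]

theorem act_strands (D : Diagram) {l : ℕ} {L : Layer} (h : D.word[l]? = some L) :
    L.act (D.strands l) = some (D.strands (l + 1)) := by
  have h1 := D.run_take (l + 1)
  obtain ⟨hl, rfl⟩ := List.getElem?_eq_some_iff.mp h
  rw [List.take_succ_eq_append_getElem hl] at h1
  obtain ⟨r, hr, h2⟩ := run_append_eq_some.mp h1
  rw [D.run_take, Option.some.injEq] at hr
  subst hr
  obtain ⟨r', h3, h4⟩ := run_cons_eq_some.mp h2
  rw [h3]; exact h4

/-- The width of the diagram at a level. -/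
abbrev width (D : Diagram) (l : ℕ) : ℕ := (D.strands l).length

theorem width_cup (D : Diagram) {l i : ℕ} {d : Bool} (h : D.word[l]? = some (cup i d)) :
    i ≤ D.width l ∧ D.width (l + 1) = D.width l + 2 := by
  obtain ⟨A, B, rfl, h1, h2⟩ := act_cup.mp (D.act_strands h)
  simp only [width, h1, h2]; simp; omega

theorem width_cap (D : Diagram) {l i : ℕ} (h : D.word[l]? = some (cap i)) :
    i ≤ D.width (l + 1) ∧ D.width l = D.width (l + 1) + 2 := by
  obtain ⟨A, a, B, rfl, h1, h2⟩ := act_cap.mp (D.act_strands h)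
  simp only [width, h1, h2]; simp; omega

theorem width_cross (D : Diagram) {l i : ℕ} {ε : Bool} (h : D.word[l]? = some (cross i ε)) :
    i + 2 ≤ D.width l ∧ D.width (l + 1) = D.width l := by
  obtain ⟨A, a, b, B, rfl, h1, h2⟩ := act_cross.mp (D.act_strands h)
  simp only [width, h1, h2]; simp

/-- Coordinates of a point of the diagram. -/
def InRange (D : Diagram) (p : ℕ × ℕ) : Prop := p.1 ≤ D.word.length ∧ p.2 < D.width p.1

theorem inRange_iff (D : Diagram) (p : ℕ × ℕ) : D.InRange p ↔ p.2 < D.width p.1 := by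
  refine ⟨fun h => h.2, fun h => ⟨?_, h⟩⟩
  by_contra hc
  rw [width, D.strands_of_le (by omega)] at h
  simp at h

theorem inRange_coords {D : Diagram} (q : D.Point) : D.InRange (coords q) :=
  ⟨Nat.lt_succ_iff.mp q.1.2, q.2.2⟩

theorem InRange.exists_point {D : Diagram} {p : ℕ × ℕ} (h : D.InRange p) :
    ∃ q : D.Point, coords q = p := by
  obtain ⟨l, j⟩ := p
  exact ⟨⟨⟨l, Nat.lt_succ_iff.mpr h.1⟩, ⟨j, h.2⟩⟩, rfl⟩

theorem coords_injective (D : Diagram) : Function.Injective (coords : D.Point → ℕ × ℕ) := by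
  rintro ⟨⟨l, hl⟩, ⟨j, hj⟩⟩ ⟨⟨l', hl'⟩, ⟨j', hj'⟩⟩ h
  simp only [coords, Prod.mk.injEq] at h
  obtain ⟨rfl, rfl⟩ := h
  rfl

end Diagram

open Diagram

/-- `Link` is a relation on raw coordinates and also joins coordinates to the right of the diagram.
This guarantees that it never leads from points of the diagram to other coordinates. -/
theorem Link.inRange_iff {D : Diagram} {v : Finset ℕ} {p q : ℕ × ℕ} (h : Link D v p q) :
    D.InRange p ↔ D.InRange q := by
  simp only [Diagram.inRange_iff]
  cases h with
  | cup_left h | cup_right h | cup_arc h => have := D.width_cup h; grind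
  | cap_left h | cap_right h | cap_arc h => have := D.width_cap h; grind
  | cross_away h | vertical h | upper_arc h | lower_arc h => have := D.width_cross h; grind

/-- The characterisations of `outs` by equations between labels contain one equation for each
constructor of `Link`. For this reason labellings are the functions that are constant along arcs. -/
theorem mem_outs_cup {i : ℕ} {d b : Bool} {x y : Row} : y ∈ outs (cup i d) b x ↔
    (∀ j < i, x j = y j) ∧ (∀ j, i ≤ j → x j = y (j + 2)) ∧ y i = y (i + 1) := by
  simp only [outs, Finset.mem_insert, Finset.mem_singleton]
  constructor
  · rintro (rfl | rfl) <;> simp only [Row.ins] <;> grind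
  · rintro ⟨h1, h2, h3⟩
    have : y = x.ins i (y i) := by
      funext j
      simp only [Row.ins]
      split_ifs with ha hb
      · exact (h1 j ha).symm
      · rcases (show j = i ∨ j = i + 1 by omega) with rfl | rfl
        · rfl
        · exact h3.symm
      · rw [h2 (j - 2) (by omega)]; congr 1; omega
    cases hy : y i <;> rw [hy] at this <;> simp [this]

theorem mem_outs_cap {i : ℕ} {b : Bool} {x y : Row} : y ∈ outs (cap i) b x ↔
    (∀ j < i, x j = y j) ∧ (∀ j, i ≤ j → x (j + 2) = y j) ∧ x i = x (i + 1) := by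
  simp only [outs]
  split_ifs with h
  · simp only [Finset.mem_singleton]
    constructor
    · rintro rfl; simp only [Row.del]; grind
    · rintro ⟨h1, h2, -⟩; funext j; simp only [Row.del]; grind
  · simp [h]

theorem mem_outs_cross {i : ℕ} {ε b : Bool} {x y : Row} : y ∈ outs (cross i ε) b x ↔
    (∀ j, j ≠ i → j ≠ i + 1 → x j = y j) ∧
    (b = (!ε) → x i = y i ∧ x (i + 1) = y (i + 1)) ∧
    (b = ε → x i = x (i + 1) ∧ y i = y (i + 1)) := by
  simp only [outs]
  split_ifs with hb h
  · have hb' : b ≠ ε := by rw [hb]; cases ε <;> simp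
    rw [Finset.mem_singleton]
    constructor
    · rintro rfl; simp [hb']
    · rintro ⟨h1, h, -⟩
      obtain ⟨h2, h3⟩ := h hb
      funext j
      by_cases e1 : j = i
      · subst e1; exact h2.symm
      by_cases e2 : j = i + 1
      · subst e2; exact h3.symm
      exact (h1 j e1 e2).symm
  · have hb' : b = ε := by revert hb; cases ε <;> cases b <;> simp
    simp only [Finset.mem_insert, Finset.mem_singleton]
    constructor
    · rintro (rfl | rfl) <;> simp only [Row.ins, Row.del] <;> grind
    · rintro ⟨h1, -, h3⟩
      obtain ⟨-, h3⟩ := h3 hb'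
      have : y = (x.del i).ins i (y i) := by
        funext j; simp only [Row.ins, Row.del]; grind
      cases hy : y i <;> rw [hy] at this <;> simp [this]
  · have hb' : b = ε := by revert hb; cases ε <;> cases b <;> simp
    simp [hb', h]

/-- The labellings of a resolution of a diagram. -/
noncomputable def Diagram.labels (D : Diagram) (v : Finset ℕ) : Finset (ℕ → Row) :=
  labs v 0 D.word fun _ => false

theorem mem_labels_iff {D : Diagram} {v : Finset ℕ} {f : ℕ → Row} :
    f ∈ D.labels v ↔ f 0 = (fun _ => false) ∧
      (∀ l L, D.word[l]? = some L → f (l + 1) ∈ outs L (bit v l) (f l)) ∧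
      ∀ l, D.word.length < l → f l = fun _ => false := by
  rw [Diagram.labels, mem_labs]; simp only [Nat.zero_add]

theorem Link.label_eq {D : Diagram} {v : Finset ℕ} {f : ℕ → Row} (hf : f ∈ D.labels v)
    {p q : ℕ × ℕ} (h : Link D v p q) : f p.1 p.2 = f q.1 q.2 := by
  have hf := (mem_labels_iff.mp hf).2.1
  cases h with
  | cup_left h | cup_right h | cup_arc h => have := mem_outs_cup.mp (hf _ _ h); grind
  | cap_left h | cap_right h | cap_arc h => have := mem_outs_cap.mp (hf _ _ h); grind
  | @cross_away l i j ε h | @vertical l i j ε h | @upper_arc l i ε h | @lower_arc l i ε h =>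
    have := mem_outs_cross.mp (hf _ _ h)
    rw [bit_eq] at this
    cases ε <;> grind

theorem mem_labels_of_links {D : Diagram} {v : Finset ℕ} {f : ℕ → Row}
    (h0 : f 0 = fun _ => false) (h1 : ∀ p q, Link D v p q → f p.1 p.2 = f q.1 q.2)
    (h2 : ∀ l, D.word.length < l → f l = fun _ => false) : f ∈ D.labels v := by
  refine mem_labels_iff.mpr ⟨h0, ?_, h2⟩
  rintro l ⟨_ | _ | ε, i⟩ hl
  · exact mem_outs_cup.mpr ⟨fun j hj => h1 _ _ (.cup_left hl hj),
      fun j hj => h1 _ _ (.cup_right hl hj), h1 _ _ (.cup_arc hl)⟩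
  · exact mem_outs_cap.mpr ⟨fun j hj => h1 _ _ (.cap_left hl hj),
      fun j hj => h1 _ _ (.cap_right hl hj), h1 _ _ (.cap_arc hl)⟩
  · refine mem_outs_cross.mpr ⟨fun j hj hj' => h1 _ _ (.cross_away hl hj hj'), ?_, ?_⟩
    · intro hb
      have hb : l ∈ v ↔ ε = false := by rw [bit_eq] at hb; cases ε <;> simpa using hb
      exact ⟨h1 _ _ (.vertical hl hb (.inl rfl)), h1 _ _ (.vertical hl hb (.inr rfl))⟩
    · intro hb
      have hb : l ∈ v ↔ ε = true := by rw [bit_eq] at hb; cases ε <;> simpa using hb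
      exact ⟨h1 _ _ (.upper_arc hl hb), h1 _ _ (.lower_arc hl hb)⟩

/-- The first row is `false` and the strands to the right of the diagram are only shifted from level
to level. So the labels outside of the diagram are forced, and a labelling carries no information
beyond its values at points. -/
theorem label_eq_false {D : Diagram} {v : Finset ℕ} {f : ℕ → Row} (hf : f ∈ D.labels v)
    {l j : ℕ} (hj : D.width l ≤ j) : f l j = false := by
  obtain ⟨h0, h1, h2⟩ := mem_labels_iff.mp hf
  induction l generalizing j with
  | zero => rw [h0]
  | succ l ih =>
    rcases lt_or_ge l D.word.length with hl | hl
    · have hL : D.word[l]? = some D.word[l] := List.getElem?_eq_getElem hl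
      generalize D.word[l] = L at hL
      have h := h1 l L hL
      obtain ⟨_ | _ | ε, i⟩ := L
      · have hw := D.width_cup hL
        have := (mem_outs_cup.mp h).2.1 (j - 2) (by omega)
        rw [show j - 2 + 2 = j by omega] at this
        rw [← this, ih (by omega)]
      · have hw := D.width_cap hL
        rw [← (mem_outs_cap.mp h).2.1 j (by omega), ih (by omega)]
      · have hw := D.width_cross hL
        rw [← (mem_outs_cross.mp h).1 j (by omega) (by omega), ih (by omega)]
    · rw [h2 _ (by omega)]

open Classical in
/-- The labelling given by labels of the circles. -/
noncomputable def toLabel {D : Diagram} {v : Finset ℕ} (F : Circle D v → Bool) : ℕ → Row :=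
  fun l j => if hp : ∃ q : D.Point, coords q = (l, j) then F (circleOf D v hp.choose) else false

theorem toLabel_coords {D : Diagram} {v : Finset ℕ} (F : Circle D v → Bool) (q : D.Point) :
    toLabel F (coords q).1 (coords q).2 = F (circleOf D v q) := by
  have hp : ∃ q' : D.Point, coords q' = coords q := ⟨q, rfl⟩
  unfold toLabel
  rw [dif_pos hp, D.coords_injective hp.choose_spec]

theorem toLabel_of_not_inRange {D : Diagram} {v : Finset ℕ} (F : Circle D v → Bool) {p : ℕ × ℕ}
    (h : ¬ D.InRange p) : toLabel F p.1 p.2 = false := by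
  unfold toLabel
  rw [dif_neg]
  rintro ⟨q, hq⟩
  exact h (by rw [show p = (p.1, p.2) from rfl, ← hq]; exact inRange_coords q)

theorem toLabel_mem {D : Diagram} {v : Finset ℕ} (F : Circle D v → Bool) :
    toLabel F ∈ D.labels v := by
  refine mem_labels_of_links ?_ ?_ ?_
  · funext j
    refine toLabel_of_not_inRange F (p := (0, j)) ?_
    simp [Diagram.inRange_iff, Diagram.width, Diagram.strands_zero]
  · intro p q h
    by_cases hp : D.InRange p
    · obtain ⟨p, rfl⟩ := hp.exists_point
      obtain ⟨q, rfl⟩ := (h.inRange_iff.mp hp).exists_point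
      rw [toLabel_coords, toLabel_coords]
      congr 1
      exact Quot.sound h
    · rw [toLabel_of_not_inRange F hp, toLabel_of_not_inRange F (h.inRange_iff.not.mp hp)]
  · intro l hl
    funext j
    exact toLabel_of_not_inRange F (p := (l, j)) fun h => by have := h.1; simp at this; omega

theorem toLabel_injective (D : Diagram) (v : Finset ℕ) :
    Function.Injective (toLabel : (Circle D v → Bool) → ℕ → Row) := by
  intro F G h
  funext c
  obtain ⟨q, rfl⟩ := Quot.exists_rep c
  have := toLabel_coords F q
  rw [h, toLabel_coords] at this
  exact this.symm

theorem exists_toLabel {D : Diagram} {v : Finset ℕ} {f : ℕ → Row} (hf : f ∈ D.labels v) :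
    ∃ F : Circle D v → Bool, toLabel F = f := by
  refine ⟨Quot.lift (fun q => f (coords q).1 (coords q).2) fun p q h => h.label_eq hf, ?_⟩
  funext l j
  by_cases hp : D.InRange (l, j)
  · obtain ⟨q, hq⟩ := hp.exists_point
    have := toLabel_coords (v := v) (Quot.lift (fun q => f (coords q).1 (coords q).2)
      fun p q h => h.label_eq hf) q
    rw [hq] at this
    rw [this]
    simp [circleOf, hq]
  · refine (toLabel_of_not_inRange (p := (l, j)) _ hp).trans (label_eq_false hf ?_).symm
    rw [Diagram.inRange_iff] at hp
    simpa using hp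

noncomputable instance (D : Diagram) (v : Finset ℕ) : DecidableEq (Circle D v) :=
  Classical.decEq _

theorem labels_eq_image (D : Diagram) (v : Finset ℕ) :
    D.labels v = Finset.univ.image (toLabel : (Circle D v → Bool) → ℕ → Row) := by
  ext f
  simp only [Finset.mem_image, Finset.mem_univ, true_and]
  exact ⟨exists_toLabel, fun ⟨F, hF⟩ => hF ▸ toLabel_mem F⟩

/-- Flipping the value at `a` is a bijection between the functions with equal and those with
different values at `a` and `b`. -/
theorem two_mul_card_filter_eq {α : Type*} [Fintype α] [DecidableEq α] {a b : α} (h : a ≠ b) :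
    2 * ((Finset.univ : Finset (α → Bool)).filter fun F => F a = F b).card =
      2 ^ Fintype.card α := by
  have h1 := Finset.card_filter_add_card_filter_not (s := (Finset.univ : Finset (α → Bool)))
    (fun F => F a = F b)
  have h2 : ((Finset.univ : Finset (α → Bool)).filter fun F => F a = F b).card =
      ((Finset.univ : Finset (α → Bool)).filter fun F => ¬ F a = F b).card := by
    refine Finset.card_nbij' (fun F => Function.update F a (!F a))
      (fun F => Function.update F a (!F a)) ?_ ?_ ?_ ?_
    · intro F hF
      simp only [Finset.coe_filter, Finset.mem_univ, true_and, Set.mem_ofPred_eq] at hF ⊢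
      simp [Function.update_of_ne h.symm, hF]
    · intro F hF
      simp only [Finset.coe_filter, Finset.mem_univ, true_and, Set.mem_ofPred_eq] at hF ⊢
      simp only [Function.update_self, Function.update_of_ne h.symm]
      cases hA : F a <;> cases hB : F b <;> simp_all
    · intro F _; simp
    · intro F _; simp
  rw [← h2] at h1
  rw [two_mul, h1, Finset.card_univ, Fintype.card_fun, Fintype.card_bool]

/-- The left side allows chains through arbitrary coordinates, the right side is about the quotient
of the points of the diagram. If the circles differ, the colouring that marks one of them is
constant along every chain of links and separates the two points. -/
theorem connected_iff {D : Diagram} {v : Finset ℕ} {p q : D.Point} :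
    Connected D v (coords p) (coords q) ↔ circleOf D v p = circleOf D v q := by
  constructor
  · intro h
    by_contra hne
    have key : ∀ x y, Connected D v x y → ∀ F : Circle D v → Bool,
        toLabel F x.1 x.2 = toLabel F y.1 y.2 := by
      intro x y h F
      induction h with
      | rel x y h => exact h.label_eq (toLabel_mem F)
      | refl => rfl
      | symm _ _ _ ih => exact ih.symm
      | trans _ _ _ _ _ ih1 ih2 => exact ih1.trans ih2
    classical
    have := key _ _ h fun c => decide (c = circleOf D v q)
    rw [toLabel_coords, toLabel_coords] at this
    simp [hne] at this
  · intro h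
    replace h := Quot.eqvGen_exact h
    induction h with
    | rel x y h => exact .rel _ _ h
    | refl => exact .refl _
    | symm _ _ _ ih => exact .symm _ _ ih
    | trans _ _ _ _ _ ih1 ih2 => exact .trans _ _ _ ih1 ih2

/-- Colourings separate circles. This is the criterion by which dots are compared below, without
following arcs. -/
theorem circleOf_eq_iff {D : Diagram} {v : Finset ℕ} {p q : D.Point} :
    circleOf D v p = circleOf D v q ↔
      ∀ f ∈ D.labels v, f (coords p).1 (coords p).2 = f (coords q).1 (coords q).2 := by
  constructor
  · intro h f hf
    obtain ⟨F, rfl⟩ := exists_toLabel hf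
    rw [toLabel_coords, toLabel_coords, h]
  · intro h
    by_contra hne
    classical
    have := h _ (toLabel_mem fun c => decide (c = circleOf D v q))
    rw [toLabel_coords, toLabel_coords] at this
    simp [hne] at this

/-- The number of circles of a resolution. -/
noncomputable abbrev numCircles (D : Diagram) (v : Finset ℕ) : ℕ := Fintype.card (Circle D v)

theorem two_pow_numCircles (D : Diagram) (v : Finset ℕ) :
    2 ^ numCircles D v = transferWord v 0 D.word 1 fun _ => false := by
  have h1 : (D.labels v).card = 2 ^ numCircles D v := by
    classical
    rw [labels_eq_image, Finset.card_image_of_injective _ (toLabel_injective D v),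
      Finset.card_univ, Fintype.card_fun, Fintype.card_bool]
  have h2 := count_const v 0 D.word (fun _ => false) True
  simp only [count, Finset.filter_true, if_true] at h2
  rw [← h1, ← h2]; rfl

/-- The condition of equal labels is void for points of one circle, and it halves the number of
colourings for points of two circles. So connectedness can be read off from transfer operators. -/
theorem count_eq_of_connected {D : Diagram} {v : Finset ℕ} {p q : ℕ × ℕ} (hp : D.InRange p)
    (hq : D.InRange q) :
    (Connected D v p q → count v 0 D.word (fun _ => false)
      (fun f => f p.1 p.2 = f q.1 q.2) = 2 ^ numCircles D v) ∧
    (¬ Connected D v p q → 2 * count v 0 D.word (fun _ => false)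
      (fun f => f p.1 p.2 = f q.1 q.2) = 2 ^ numCircles D v) := by
  classical
  obtain ⟨p, rfl⟩ := hp.exists_point
  obtain ⟨q, rfl⟩ := hq.exists_point
  have h1 : count v 0 D.word (fun _ => false)
      (fun f => f (coords p).1 (coords p).2 = f (coords q).1 (coords q).2) =
      ((Finset.univ : Finset (Circle D v → Bool)).filter
        fun F => F (circleOf D v p) = F (circleOf D v q)).card := by
    rw [count_eq_card]
    symm
    refine Finset.card_bij (fun F _ => toLabel F) ?_ (fun F _ G _ h => toLabel_injective D v h) ?_
    · intro F hF
      rw [Finset.mem_filter, toLabel_coords, toLabel_coords]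
      exact ⟨toLabel_mem F, (Finset.mem_filter.mp hF).2⟩
    · intro f hf
      rw [Finset.mem_filter] at hf
      obtain ⟨F, rfl⟩ := exists_toLabel (D := D) hf.1
      rw [toLabel_coords, toLabel_coords] at hf
      exact ⟨F, Finset.mem_filter.mpr ⟨Finset.mem_univ _, hf.2⟩, rfl⟩
  rw [connected_iff, h1]
  constructor
  · intro h
    simp [h]
  · intro h
    exact two_mul_card_filter_eq h

end ImmersedKhovanov

/-! ### The number of circles before and after a local change; saddles merge or split. -/

namespace ImmersedKhovanov

open Diagram

/-! ### Counting circles under local changes -/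

/-- Two diagrams that differ in some consecutive layers only. -/
structure LocalChange (D D' : Diagram) : Type where
  pre : List Layer
  mid : List Layer
  mid' : List Layer
  post : List Layer
  word_eq : D.word = pre ++ mid ++ post
  word_eq' : D'.word = pre ++ mid' ++ post
  oriented : run (pre ++ mid) [] = run (pre ++ mid') []

/-- In a horizontal smoothing the label of the upper arc forces `y i = y (i + 1)`, and the condition
fixes the otherwise free label of the lower arc to be the same. What remains is the row of the
vertical smoothing under the condition `y i = y (i + 1)`. Hence both smoothings have equally many
colourings in which the upper left and the lower right end agree. -/
theorem capT_cupT_cond (i : ℕ) (P : Row → ℕ) (y : Row) :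
    capT i (cupT i fun z => if y i = z (i + 1) then P z else 0) y =
      if y i = y (i + 1) then P y else 0 := by
  have t : ∀ c, ((y.del i).ins i c) (i + 1) = c := by intro c; simp [Row.ins]
  simp only [capT, cupT, t]
  by_cases hy : y i = y (i + 1)
  · have e := Row.ins_self i y hy
    rw [if_pos hy, if_pos hy]
    cases hyi : y i <;> rw [hyi] at e <;> simp [e]
  · rw [if_neg hy, if_neg hy]

namespace LocalChange

variable {D D' : Diagram} (C : LocalChange D D')

def symm : LocalChange D' D :=
  ⟨C.pre, C.mid', C.mid, C.post, C.word_eq', C.word_eq, C.oriented.symm⟩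

/-- The trivial change of a part of a diagram. -/
def refl (D : Diagram) (u m w : List Layer) (h : D.word = u ++ m ++ w) : LocalChange D D :=
  ⟨u, m, m, w, h, h, rfl⟩

theorem strands_pre_of_word {D : Diagram} {u m w : List Layer} (h : D.word = u ++ m ++ w) :
    run u [] = some (D.strands u.length) ∧
    run m (D.strands u.length) = some (D.strands (u.length + m.length)) ∧
    run w (D.strands (u.length + m.length)) = some [] := by
  have h1 := D.run_take u.length
  rw [h, List.append_assoc, List.take_left] at h1
  have h2 := D.run_take (u.length + m.length)
  rw [h, ← List.length_append, List.take_left] at h2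
  have h3 := D.closed
  rw [h] at h3
  obtain ⟨r, hr, h4⟩ := run_append_eq_some.mp h3
  rw [h2, Option.some.injEq] at hr
  obtain ⟨s, hs, h5⟩ := run_append_eq_some.mp h2
  rw [h1, Option.some.injEq] at hs
  subst hs
  rw [List.length_append] at h5 hr
  exact ⟨h1, h5, by rw [hr]; exact h4⟩

theorem run_mid : run C.mid (D.strands C.pre.length) =
    some (D.strands (C.pre.length + C.mid.length)) := (strands_pre_of_word C.word_eq).2.1

theorem strands_pre : D'.strands C.pre.length = D.strands C.pre.length := by
  have h1 := (strands_pre_of_word C.word_eq).1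
  rw [(strands_pre_of_word C.word_eq').1] at h1
  simpa using h1

theorem strands_post : D'.strands (C.pre.length + C.mid'.length) =
    D.strands (C.pre.length + C.mid.length) := by
  have h := C.oriented
  rw [run_append, run_append, (strands_pre_of_word C.word_eq).1, Option.bind_some, Option.bind_some,
    C.run_mid, ← C.strands_pre, (strands_pre_of_word C.word_eq').2.1] at h
  simpa using h.symm

theorem getElem?_pre {l : ℕ} (hl : l < C.pre.length) : D.word[l]? = C.pre[l]? := by
  rw [C.word_eq, List.append_assoc, List.getElem?_append_left hl]

theorem getElem?_mid {l : ℕ} (hl : l < C.mid.length) :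
    D.word[C.pre.length + l]? = C.mid[l]? := by
  rw [C.word_eq, List.append_assoc, List.getElem?_append_right (by omega),
    List.getElem?_append_left (by omega)]
  congr 1; omega

theorem getElem?_post (l : ℕ) :
    D.word[C.pre.length + C.mid.length + l]? = C.post[l]? := by
  rw [C.word_eq, List.getElem?_append_right (by simp)]
  congr 1; simp

/-- Agreement of resolutions outside of the change. -/
abbrev Agree (v v' : Finset ℕ) : Prop :=
  AgreeOutside C.pre.length C.mid.length C.mid'.length v v'

variable {C} {v v' : Finset ℕ}

theorem Agree.symm (h : C.Agree v v') : C.symm.Agree v' v :=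
  ⟨fun l hl => (h.1 l hl).symm, fun l => (h.2 l).symm⟩

theorem transferWord_pre (h : C.Agree v v') (g : Row → ℕ) :
    transferWord v' 0 C.pre g = transferWord v 0 C.pre g :=
  transferWord_congr _ _ fun j hj => by
    simpa using (h.1 j hj).symm

theorem transferWord_post (h : C.Agree v v') (g : Row → ℕ) :
    transferWord v' (C.pre.length + C.mid'.length) C.post g =
      transferWord v (C.pre.length + C.mid.length) C.post g :=
  transferWord_congr _ _ fun j _ => (h.2 j).symm

variable (C v)

theorem two_pow_numCircles : 2 ^ numCircles D v =
    transferWord v 0 C.pre (transferWord v C.pre.length C.mid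
      (transferWord v (C.pre.length + C.mid.length) C.post 1)) fun _ => false := by
  rw [ImmersedKhovanov.two_pow_numCircles, C.word_eq, transferWord_append, transferWord_append]
  simp

theorem count_eq (a b : ℕ) : count v 0 D.word (fun _ => false)
      (fun f => f C.pre.length a = f (C.pre.length + C.mid.length) b) =
    transferWord v 0 C.pre (fun y => transferWord v C.pre.length C.mid (fun z =>
      if y a = z b then transferWord v (C.pre.length + C.mid.length) C.post 1 z else 0) y)
      fun _ => false := by
  rw [C.word_eq, List.append_assoc, ImmersedKhovanov.count_eq]
  simp

variable {v}

/-- Local changes that do not affect how the ends are joined. -/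
theorem numCircles_eq (h : C.Agree v v') {a b : ℕ} {O : (Row → ℕ) → Row → ℕ}
    (h1 : ∀ g, transferWord v C.pre.length C.mid g = 2 ^ a • O g)
    (h2 : ∀ g, transferWord v' C.pre.length C.mid' g = 2 ^ b • O g) :
    (numCircles D' v' : ℤ) + a = numCircles D v + b := by
  have e1 := C.two_pow_numCircles v
  have e2 := C.symm.two_pow_numCircles v'
  simp only [symm] at e2
  rw [transferWord_pre h, transferWord_post h, h2, transferWord_smul] at e2
  rw [h1, transferWord_smul] at e1
  simp only [Pi.smul_apply, smul_eq_mul] at e1 e2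
  have : 2 ^ (numCircles D' v' + a) = 2 ^ (numCircles D v + b) := by
    rw [pow_add, pow_add, e1, e2]; ring
  exact_mod_cast Nat.pow_right_injective le_rfl this

/-- The effect of a saddle on the number of circles. -/
theorem saddle (h : C.Agree v v') {a b i : ℕ}
    (hw : i + 2 ≤ D.width C.pre.length)
    (hw' : D.width (C.pre.length + C.mid.length) = D.width C.pre.length)
    (h1 : ∀ g, transferWord v C.pre.length C.mid g = 2 ^ a • g)
    (h2 : ∀ g, transferWord v' C.pre.length C.mid' g = 2 ^ b • capT i (cupT i g)) :
    ((Connected D v (C.pre.length, i) (C.pre.length + C.mid.length, i + 1) ∧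
      ¬ Connected D' v' (C.pre.length, i) (C.pre.length + C.mid'.length, i + 1) ∧
      (numCircles D' v' : ℤ) + a = numCircles D v + b + 1) ∨
     (¬ Connected D v (C.pre.length, i) (C.pre.length + C.mid.length, i + 1) ∧
      Connected D' v' (C.pre.length, i) (C.pre.length + C.mid'.length, i + 1) ∧
      (numCircles D' v' : ℤ) + a = numCircles D v + b - 1)) := by
  set P := transferWord v (C.pre.length + C.mid.length) C.post 1 with hP
  obtain ⟨r1, r2, r3⟩ := strands_pre_of_word C.word_eq
  have f1 := flatValid_flatten v 0 _ _ _ r1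
  have f2 := flatValid_flatten v (C.pre.length + C.mid.length) _ _ _ r3
  change FlatValid (D.width (C.pre.length + C.mid.length)) _ _ at f2
  rw [hw'] at f2
  -- `c` and `c'` are the numbers of circles for the vertical and the horizontal smoothing after
  -- removal of the `a` and `b` small inner circles; they have different parities.
  obtain ⟨c, c', hc, hc', hpar⟩ := closed_values_of_saddle f1 f2 hw
  simp only [← transferWord_eq_flatT] at hc hc'
  replace hc := congrFun (hc 1) fun _ => false
  replace hc' := congrFun (hc' 1) fun _ => false
  rw [← hP] at hc hc'
  simp only [Pi.smul_apply, Pi.one_apply, smul_eq_mul, mul_one] at hc hc'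
  have e1 := C.two_pow_numCircles v
  have e2 := C.symm.two_pow_numCircles v'
  simp only [symm] at e2
  rw [transferWord_pre h, transferWord_post h, h2, transferWord_smul] at e2
  rw [h1, transferWord_smul] at e1
  rw [← hP] at e1 e2
  simp only [Pi.smul_apply, smul_eq_mul, hc, hc'] at e1 e2
  rw [← pow_add] at e1 e2
  replace e1 := Nat.pow_right_injective le_rfl e1
  replace e2 := Nat.pow_right_injective le_rfl e2
  -- Up to the factors `2 ^ a` and `2 ^ b` of the inner circles, `α` is on both sides the number of
  -- colourings in which the upper left and the lower right end have equal labels.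
  set α := transferWord v 0 C.pre (fun y => if y i = y (i + 1) then P y else 0) fun _ => false
    with hα
  have k1 := C.count_eq v i (i + 1)
  have k2 := C.symm.count_eq v' i (i + 1)
  simp only [symm] at k2
  rw [transferWord_pre h, transferWord_post h, ← hP] at k2
  rw [← hP] at k1
  replace k1 : count v 0 D.word (fun _ => false) (fun f => f C.pre.length i =
      f (C.pre.length + C.mid.length) (i + 1)) = 2 ^ a * α := by
    rw [k1, hα, ← smul_eq_mul, ← Pi.smul_apply, ← transferWord_smul]
    congr 1
    funext y
    rw [h1]
    rfl
  replace k2 : count v' 0 D'.word (fun _ => false) (fun f => f C.pre.length i =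
      f (C.pre.length + C.mid'.length) (i + 1)) = 2 ^ b * α := by
    rw [k2, hα, ← smul_eq_mul, ← Pi.smul_apply, ← transferWord_smul]
    congr 1
    funext y
    rw [h2]
    rw [Pi.smul_apply, capT_cupT_cond, Pi.smul_apply]
  have q1 : D.InRange (C.pre.length, i) := by
    rw [Diagram.inRange_iff]; exact lt_of_lt_of_le (by simp) hw
  have q2 : D.InRange (C.pre.length + C.mid.length, i + 1) := by
    rw [Diagram.inRange_iff, hw']; exact lt_of_lt_of_le (by simp) hw
  have q1' : D'.InRange (C.pre.length, i) := by
    rw [Diagram.inRange_iff, width, C.strands_pre]; exact lt_of_lt_of_le (by simp) hw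
  have q2' : D'.InRange (C.pre.length + C.mid'.length, i + 1) := by
    rw [Diagram.inRange_iff, width, C.strands_post]
    change _ < D.width _
    rw [hw']; exact lt_of_lt_of_le (by simp) hw
  obtain ⟨m1, m2⟩ := count_eq_of_connected (v := v) q1 q2
  obtain ⟨m1', m2'⟩ := count_eq_of_connected (v := v') q1' q2'
  rw [k1, e1] at m1 m2
  rw [k2, e2] at m1' m2'
  have n1 : ∀ a c : ℕ, 2 ^ a * α = 2 ^ (a + c) → α = 2 ^ c := by
    intro a c h; rw [pow_add] at h; exact Nat.eq_of_mul_eq_mul_left (by positivity) h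
  have n2 : ∀ a c : ℕ, 2 * (2 ^ a * α) = 2 ^ (a + c) → 2 * α = 2 ^ c := by
    intro a c h; rw [pow_add] at h
    exact Nat.eq_of_mul_eq_mul_left (n := 2 ^ a) (by positivity) (by rw [← h]; ring)
  by_cases hcon : Connected D v (C.pre.length, i) (C.pre.length + C.mid.length, i + 1) <;>
  by_cases hcon' : Connected D' v' (C.pre.length, i) (C.pre.length + C.mid'.length, i + 1)
  -- If the two ends are joined on both sides, then `α = 2 ^ c = 2 ^ c'`, against the parity; if
  -- they are joined on neither, `2 * α` leads to the same contradiction. In the mixed cases `c` and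
  -- `c'` differ by exactly one.
  · exfalso
    have := Nat.pow_right_injective le_rfl ((n1 _ _ (m1 hcon)).symm.trans (n1 _ _ (m1' hcon')))
    subst this; simp at hpar
  · left
    refine ⟨hcon, hcon', ?_⟩
    have t := n2 _ _ (m2' hcon')
    rw [n1 _ _ (m1 hcon), ← pow_succ'] at t
    replace t := Nat.pow_right_injective le_rfl t
    omega
  · right
    refine ⟨hcon, hcon', ?_⟩
    have t := n2 _ _ (m2 hcon)
    rw [n1 _ _ (m1' hcon'), ← pow_succ'] at t
    replace t := Nat.pow_right_injective le_rfl t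
    omega
  · exfalso
    have := Nat.pow_right_injective le_rfl ((n2 _ _ (m2 hcon)).symm.trans (n2 _ _ (m2' hcon')))
    subst this; simp at hpar

end LocalChange

end ImmersedKhovanov

/-! ### The algebra of a resolution: evaluation, dots, local maps and the quantum grading. -/

namespace ImmersedKhovanov

open Diagram

noncomputable section

/-! ### The algebra of a resolution -/

section State

variable {R : Type*} [CommRing R] (h t : R) {D D' : Diagram} {v v' : Finset ℕ}

/-- A pure tensor. -/
def tensor (a : Circle D v → QuadraticAlgebra R t h) : State h t D v := PiTensorProduct.tprod R a

variable {h t} in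
theorem state_induction {motive : State h t D v → Prop} (x : State h t D v)
    (smul : ∀ (r : R) a, motive (r • tensor h t a))
    (add : ∀ x y, motive x → motive y → motive (x + y)) : motive x :=
  PiTensorProduct.induction_on (motive := motive) x smul add

theorem monomial_eq (s : Finset (Circle D v)) : monomial h t D v s =
    tensor h t fun c => if c ∈ s then QuadraticAlgebra.omega else 1 := by
  unfold monomial tensor; congr!

theorem tensor_mul (a b : Circle D v → QuadraticAlgebra R t h) :
    tensor h t a * tensor h t b = tensor h t (a * b) :=
  PiTensorProduct.tprod_mul_tprod _ _

theorem tensor_one : tensor h t (1 : Circle D v → QuadraticAlgebra R t h) = 1 := rfl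

theorem tensor_update_add (a : Circle D v → QuadraticAlgebra R t h) (c : Circle D v)
    (x y : QuadraticAlgebra R t h) : tensor h t (Function.update a c (x + y)) =
      tensor h t (Function.update a c x) + tensor h t (Function.update a c y) :=
  (PiTensorProduct.tprod R : MultilinearMap R (fun _ : Circle D v => QuadraticAlgebra R t h)
    (⨂[R] _ : Circle D v, QuadraticAlgebra R t h)).map_update_add _ _ _ _

theorem tensor_update_smul (a : Circle D v → QuadraticAlgebra R t h) (c : Circle D v)
    (r : R) (x : QuadraticAlgebra R t h) : tensor h t (Function.update a c (r • x)) =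
      r • tensor h t (Function.update a c x) :=
  (PiTensorProduct.tprod R : MultilinearMap R (fun _ : Circle D v => QuadraticAlgebra R t h)
    (⨂[R] _ : Circle D v, QuadraticAlgebra R t h)).map_update_smul _ _ _ _

theorem monomial_empty : monomial h t D v ∅ = 1 := by
  rw [monomial_eq, ← tensor_one]; rfl

theorem monomial_insert {c : Circle D v} {s : Finset (Circle D v)} (hc : c ∉ s) :
    monomial h t D v (insert c s) = monomial h t D v {c} * monomial h t D v s := by
  rw [monomial_eq, monomial_eq, monomial_eq, tensor_mul]
  congr 1
  funext x
  by_cases hx : x = c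
  · subst hx; simp [hc]
  · simp [hx]

theorem monomial_singleton (c : Circle D v) : monomial h t D v {c} =
    tensor h t (Function.update 1 c QuadraticAlgebra.omega) := by
  rw [monomial_eq]
  congr 1
  funext x
  by_cases hx : x = c
  · subst hx; simp
  · simp [hx]

theorem monomial_sq (c : Circle D v) : monomial h t D v {c} * monomial h t D v {c} =
    t • (1 : State h t D v) + h • monomial h t D v {c} := by
  have e1 : (Function.update (1 : Circle D v → QuadraticAlgebra R t h) c QuadraticAlgebra.omega *
      Function.update (1 : Circle D v → QuadraticAlgebra R t h) c QuadraticAlgebra.omega) =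
      Function.update (1 : Circle D v → QuadraticAlgebra R t h) c
        (t • 1 + h • QuadraticAlgebra.omega) := by
    rw [← QuadraticAlgebra.omega_mul_omega_eq_add]
    funext x
    by_cases hx : x = c
    · subst hx; simp
    · simp [hx]
  rw [monomial_singleton, tensor_mul, e1, tensor_update_add, tensor_update_smul,
    tensor_update_smul]
  congr 2
  rw [← tensor_one]
  congr 1
  exact Function.update_eq_self _ _

theorem tensor_eq_prod (a : Circle D v → QuadraticAlgebra R t h) :
    tensor h t a = ∏ c, tensor h t (Function.update 1 c (a c)) := by
  let f : (Circle D v → QuadraticAlgebra R t h) →* State h t D v :=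
    ⟨⟨tensor h t, rfl⟩, fun a b => (tensor_mul h t a b).symm⟩
  change f a = ∏ c, f (Pi.mulSingle c (a c))
  rw [← map_prod, Finset.univ_prod_mulSingle]

/-- A pure tensor is the product of its factors placed on single circles, and each factor is a
combination of `1` and `X`. -/
theorem adjoin_monomial :
    Algebra.adjoin R (Set.range fun c : Circle D v => monomial h t D v {c}) = ⊤ := by
  rw [eq_top_iff]
  rintro x -
  refine state_induction x (fun r a => ?_) fun x y hx hy => Subalgebra.add_mem _ hx hy
  refine Subalgebra.smul_mem _ ?_ r
  rw [tensor_eq_prod]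
  refine Subalgebra.prod_mem _ fun c _ => ?_
  have e : a c = (a c).re • 1 + (a c).im • QuadraticAlgebra.omega := by
    ext <;> simp [QuadraticAlgebra.re_one, QuadraticAlgebra.im_one]
  rw [e, tensor_update_add, tensor_update_smul, tensor_update_smul, ← monomial_singleton,
    show Function.update (1 : Circle D v → QuadraticAlgebra R t h) c 1 = 1 from
      Function.update_eq_self _ _, tensor_one]
  exact Subalgebra.add_mem _ (Subalgebra.smul_mem _ (Subalgebra.one_mem _) _)
    (Subalgebra.smul_mem _ (Algebra.subset_adjoin (Set.mem_range_self c)) _)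

/-- Evaluation at roots of `X² - hX - t`, one for each circle. -/
def evalState {S : Type*} [CommRing S] [Algebra R S] (ρ : Circle D v → S) :
    State h t D v →ₗ[R] S :=
  PiTensorProduct.lift ((MultilinearMap.mkPiAlgebra R (Circle D v) S).compLinearMap fun c =>
      (Algebra.linearMap R S).comp (QuadraticAlgebra.reₗ t h) +
        (LinearMap.toSpanSingleton R S (ρ c)).comp (QuadraticAlgebra.imₗ t h))

variable {S : Type*} [CommRing S] [Algebra R S] {ρ : Circle D v → S}

variable (ρ) in
theorem evalState_tensor (a : Circle D v → QuadraticAlgebra R t h) :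
    evalState h t ρ (tensor h t a) = ∏ c, (algebraMap R S (a c).re + (a c).im • ρ c) :=
  (PiTensorProduct.lift.tprod _).trans (by simp)

variable (ρ) in
theorem evalState_monomial (s : Finset (Circle D v)) :
    evalState h t ρ (monomial h t D v s) = ∏ c ∈ s, ρ c := by
  rw [monomial_eq, evalState_tensor, ← Finset.prod_subset (Finset.subset_univ s)]
  · exact Finset.prod_congr rfl fun c hc => by simp [hc]
  · intro c _ hc; simp [hc, QuadraticAlgebra.re_one, QuadraticAlgebra.im_one]

variable (ρ) in
theorem evalState_one : evalState h t ρ (1 : State h t D v) = 1 := by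
  rw [← monomial_empty, evalState_monomial, Finset.prod_empty]

/-- Evaluation is set up as a linear map only. It becomes multiplicative because the values satisfy
the quadratic relation of `X`, and through this the local maps become linear over dots. -/
theorem evalState_mul (hρ : ∀ c, ρ c * ρ c = t • (1 : S) + h • ρ c) (x y : State h t D v) :
    evalState h t ρ (x * y) = evalState h t ρ x * evalState h t ρ y := by
  induction x using state_induction with
  | add x z hx hz => rw [add_mul, map_add, map_add, hx, hz, add_mul]
  | smul r a =>
  induction y using state_induction with
  | add y z hy hz => rw [mul_add, map_add, map_add, hy, hz, mul_add]
  | smul r' b =>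
  rw [smul_mul_smul_comm, tensor_mul, map_smul, map_smul, map_smul, evalState_tensor,
    evalState_tensor, evalState_tensor, smul_mul_smul_comm, ← Finset.prod_mul_distrib]
  congr 1
  refine Finset.prod_congr rfl fun c _ => ?_
  simp only [Pi.mul_apply, QuadraticAlgebra.re_mul, QuadraticAlgebra.im_mul,
    Algebra.smul_def, map_add, map_mul]
  have := hρ c
  simp only [Algebra.smul_def, mul_one] at this
  linear_combination (-algebraMap R S (a c).im * algebraMap R S (b c).im) * this

/-! ### Dots -/

theorem dot_coords (q : D.Point) : dot h t D v (coords q) = monomial h t D v {circleOf D v q} := by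
  have hq : ∃ q' : D.Point, coords q' = coords q := ⟨q, rfl⟩
  unfold dot
  rw [dif_pos hq, D.coords_injective hq.choose_spec]

theorem dot_of_not_inRange {p : ℕ × ℕ} (hp : ¬ D.InRange p) : dot h t D v p = 0 := by
  unfold dot
  rw [dif_neg]
  rintro ⟨q, rfl⟩
  exact hp (inRange_coords q)

theorem dot_sq {p : ℕ × ℕ} (hp : D.InRange p) : dot h t D v p * dot h t D v p =
    algebraMap R _ t + algebraMap R _ h * dot h t D v p := by
  obtain ⟨q, rfl⟩ := hp.exists_point
  rw [dot_coords, monomial_sq, Algebra.smul_def, Algebra.smul_def, mul_one]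

/-- Dots at points of the same circle agree. -/
theorem dot_eq_of_labels {p q : ℕ × ℕ} (hp : D.InRange p) (hq : D.InRange q)
    (H : ∀ f ∈ D.labels v, f p.1 p.2 = f q.1 q.2) : dot h t D v p = dot h t D v q := by
  obtain ⟨p, rfl⟩ := hp.exists_point
  obtain ⟨q, rfl⟩ := hq.exists_point
  rw [dot_coords, dot_coords, circleOf_eq_iff.mpr H]

/-- Linear maps that commute with all dots are multiplications. -/
theorem eq_mul_of_dot {F : State h t D v →ₗ[R] State h t D v}
    (hF : ∀ p, D.InRange p → ∀ x, F (dot h t D v p * x) = dot h t D v p * F x)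
    (x : State h t D v) : F x = x * F 1 := by
  suffices hs : ∀ y : State h t D v, ∀ x, F (y * x) = y * F x by simpa using hs x 1
  intro y
  have hy : y ∈ Algebra.adjoin R (Set.range fun c : Circle D v => monomial h t D v {c}) := by
    rw [adjoin_monomial]; trivial
  induction hy using Algebra.adjoin_induction with
  | mem y hy =>
    obtain ⟨c, rfl⟩ := hy
    obtain ⟨q, rfl⟩ := Quot.exists_rep c
    intro x
    have := hF (coords q) (inRange_coords q) x
    rwa [dot_coords] at this
  | algebraMap r => intro x; rw [← Algebra.smul_def, map_smul, Algebra.smul_def]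
  | add y z _ _ hy hz => intro x; rw [add_mul, map_add, hy, hz, add_mul]
  | mul y z _ _ hy hz => intro x; rw [mul_assoc, hy, hz, mul_assoc]

/-! ### Local maps -/

variable (k m m' : ℕ)

/-- Both kinds of values of `transportCircle`, a dot of the new diagram and the fresh indeterminate,
are roots of `X² - hX - t`. The hypothesis excludes the default value `0` of `dot`. -/
theorem transport_inRange_sq {c : Circle D v}
    (hT : ∀ p, D.InRange p → IsOuter k m p → D'.InRange (transport k m m' p)) :
    transportCircle h t D D' k m m' v v' c * transportCircle h t D D' k m m' v v' c =
      t • 1 + h • transportCircle h t D D' k m m' v v' c := by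
  unfold transportCircle
  split_ifs with hc
  · rw [← map_mul, dot_sq h t (hT _ (inRange_coords _) hc.choose_spec.1)]
    simp only [map_add, map_mul, Algebra.smul_def, mul_one]
    rfl
  · rw [QuadraticAlgebra.omega_mul_omega_eq_add]
    ext <;> simp [QuadraticAlgebra.re_one, QuadraticAlgebra.im_one,
      Algebra.algebraMap_eq_smul_one]

theorem localMap_apply (e e' : State h t D' v') (x : State h t D v) :
    localMap h t D D' k m m' v v' e e' x =
      (evalState h t (transportCircle h t D D' k m m' v v') x).re * e +
      (evalState h t (transportCircle h t D D' k m m' v v') x).im * e' := rfl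

theorem localMap_one (e e' : State h t D' v') : localMap h t D D' k m m' v v' e e' 1 = e := by
  rw [localMap_apply, evalState_one]
  simp [QuadraticAlgebra.re_one, QuadraticAlgebra.im_one]

/-- Local maps are linear over dots at outer points. -/
theorem localMap_dot_mul {e e' : State h t D' v'}
    (hT : ∀ p, D.InRange p → IsOuter k m p → D'.InRange (transport k m m' p))
    (hW : ∀ p q, D.InRange p → D.InRange q → IsOuter k m p → IsOuter k m q →
      (∀ f ∈ D.labels v, f p.1 p.2 = f q.1 q.2) →
      dot h t D' v' (transport k m m' p) * e = dot h t D' v' (transport k m m' q) * e ∧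
      dot h t D' v' (transport k m m' p) * e' = dot h t D' v' (transport k m m' q) * e')
    {p : ℕ × ℕ} (hp : D.InRange p) (ho : IsOuter k m p) (x : State h t D v) :
    localMap h t D D' k m m' v v' e e' (dot h t D v p * x) =
      dot h t D' v' (transport k m m' p) * localMap h t D D' k m m' v v' e e' x := by
  obtain ⟨q, rfl⟩ := hp.exists_point
  rw [localMap_apply, localMap_apply,
    evalState_mul h t (fun c => transport_inRange_sq h t k m m' hT), dot_coords,
    evalState_monomial, Finset.prod_singleton]
  have hc : ∃ p : D.Point, IsOuter k m (coords p) ∧ circleOf D v p = circleOf D v q :=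
    ⟨q, ho, rfl⟩
  -- `transportCircle` uses some chosen outer point of the circle, which need not be `q`. The
  -- hypothesis `hW` makes the choice irrelevant after multiplication with `e` and `e'`.
  obtain ⟨h1, h2⟩ := hW _ _ (inRange_coords hc.choose) (inRange_coords q) hc.choose_spec.1 ho
    (circleOf_eq_iff.mp hc.choose_spec.2)
  have e1 : transportCircle h t D D' k m m' v v' (circleOf D v q) =
      algebraMap (State h t D' v') _
        (dot h t D' v' (transport k m m' (coords hc.choose))) := by
    unfold transportCircle
    rw [dif_pos hc]
  rw [e1, QuadraticAlgebra.re_mul, QuadraticAlgebra.im_mul, QuadraticAlgebra.algebraMap_re,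
    QuadraticAlgebra.algebraMap_im]
  generalize evalState h t (transportCircle h t D D' k m m' v v') x = z
  linear_combination z.re * h1 + z.im * h2

/-- The value of a local map at an inner circle. -/
theorem localMap_dot_inner (e e' : State h t D' v') {q : ℕ × ℕ} (hq : D.InRange q)
    (hi : ∀ p, D.InRange p → IsOuter k m p → ∃ f ∈ D.labels v, f p.1 p.2 ≠ f q.1 q.2) :
    localMap h t D D' k m m' v v' e e' (dot h t D v q) = e' := by
  obtain ⟨q, rfl⟩ := hq.exists_point
  rw [localMap_apply, dot_coords, evalState_monomial, Finset.prod_singleton]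
  have hc : ¬ ∃ p : D.Point, IsOuter k m (coords p) ∧ circleOf D v p = circleOf D v q := by
    rintro ⟨p, ho, hp⟩
    obtain ⟨f, hf, hne⟩ := hi _ (inRange_coords p) ho
    exact hne (circleOf_eq_iff.mp hp f hf)
  unfold transportCircle
  rw [dif_neg hc]
  simp

/-! ### Gradings -/

variable (𝓡 : ℤ → AddSubgroup R)

/-- The elements of degree `d`, where `X` has degree `-2`. -/
def gradedState (D : Diagram) (v : Finset ℕ) (d : ℤ) : AddSubgroup (State h t D v) :=
  AddSubgroup.closure {x | ∃ (s : Finset (Circle D v)) (n : ℤ) (r : R), r ∈ 𝓡 n ∧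
    n - 2 * s.card = d ∧ x = r • monomial h t D v s}

variable {𝓡}

theorem smul_monomial_mem_gradedState {n : ℤ} {r : R} (hr : r ∈ 𝓡 n) (s : Finset (Circle D v)) :
    r • monomial h t D v s ∈ gradedState h t 𝓡 D v (n - 2 * s.card) :=
  AddSubgroup.subset_closure ⟨s, n, r, hr, rfl, rfl⟩

variable [GradedRing 𝓡]

theorem one_mem_gradedState : (1 : State h t D v) ∈ gradedState h t 𝓡 D v 0 := by
  have := smul_monomial_mem_gradedState h t (SetLike.GradedOne.one_mem (A := 𝓡))
    (∅ : Finset (Circle D v))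
  simpa [monomial_empty] using this

theorem smul_mem_gradedState {n d : ℤ} {r : R} (hr : r ∈ 𝓡 n) {x : State h t D v}
    (hx : x ∈ gradedState h t 𝓡 D v d) : r • x ∈ gradedState h t 𝓡 D v (n + d) := by
  induction hx using AddSubgroup.closure_induction with
  | mem x hx =>
    obtain ⟨s, n', r', hr', rfl, rfl⟩ := hx
    rw [smul_smul, ← add_sub_assoc]
    exact smul_monomial_mem_gradedState h t (SetLike.GradedMul.mul_mem hr hr') s
  | zero => rw [smul_zero]; exact zero_mem _
  | add x y _ _ hx hy => rw [smul_add]; exact add_mem hx hy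
  | neg x _ hx => rw [smul_neg]; exact neg_mem hx

variable {h t} (hh : h ∈ 𝓡 (-2)) (ht : t ∈ 𝓡 (-4))
include hh ht

/-- If the circle already carries `X`, the relation `X² = hX + t` replaces a product of degree `-4`
by `h` times a factor of degree `-2` and by `t`; the assumed degrees of `h` and `t` are exactly
those that make this homogeneous. -/
theorem monomial_singleton_mul_mem {d : ℤ} (c : Circle D v) {x : State h t D v}
    (hx : x ∈ gradedState h t 𝓡 D v d) :
    monomial h t D v {c} * x ∈ gradedState h t 𝓡 D v (d - 2) := by
  induction hx using AddSubgroup.closure_induction with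
  | mem x hx =>
    obtain ⟨s, n, r, hr, rfl, rfl⟩ := hx
    rw [mul_smul_comm]
    by_cases hc : c ∈ s
    · rw [← Finset.insert_erase hc, monomial_insert h t (Finset.notMem_erase c s), ← mul_assoc,
        monomial_sq, add_mul, smul_mul_assoc, smul_mul_assoc, one_mul,
        ← monomial_insert h t (Finset.notMem_erase c s), Finset.insert_erase hc, smul_add]
      have hcard := Finset.card_erase_add_one hc
      refine add_mem ?_ ?_
      · convert smul_mem_gradedState h t hr (smul_monomial_mem_gradedState h t ht (s.erase c))
          using 2
        have : (s.card : ℤ) = (s.erase c).card + 1 := by exact_mod_cast hcard.symm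
        rw [this]; ring
      · convert smul_mem_gradedState h t hr (smul_monomial_mem_gradedState h t hh s) using 2
        ring
    · rw [← monomial_insert h t hc]
      convert smul_monomial_mem_gradedState h t hr (insert c s) using 2
      rw [Finset.card_insert_of_notMem hc]; push_cast; ring
  | zero => rw [mul_zero]; exact zero_mem _
  | add x y _ _ hx hy => rw [mul_add]; exact add_mem hx hy
  | neg x _ hx => rw [mul_neg]; exact neg_mem hx

theorem monomial_mul_mem {d : ℤ} (s : Finset (Circle D v)) {x : State h t D v}
    (hx : x ∈ gradedState h t 𝓡 D v d) :
    monomial h t D v s * x ∈ gradedState h t 𝓡 D v (d - 2 * s.card) := by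
  induction s using Finset.induction_on with
  | empty => simpa [monomial_empty] using hx
  | insert c s hc ih =>
    rw [monomial_insert h t hc, mul_assoc]
    convert monomial_singleton_mul_mem hh ht c ih using 2
    rw [Finset.card_insert_of_notMem hc]; push_cast; ring

theorem mul_mem_gradedState {d d' : ℤ} {x y : State h t D v}
    (hx : x ∈ gradedState h t 𝓡 D v d) (hy : y ∈ gradedState h t 𝓡 D v d') :
    x * y ∈ gradedState h t 𝓡 D v (d + d') := by
  induction hx using AddSubgroup.closure_induction with
  | mem x hx =>
    obtain ⟨s, n, r, hr, rfl, rfl⟩ := hx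
    rw [smul_mul_assoc]
    convert smul_mem_gradedState h t hr (monomial_mul_mem hh ht s hy) using 2
    ring
  | zero => rw [zero_mul]; exact zero_mem _
  | add x y _ _ hx hy => rw [add_mul]; exact add_mem hx hy
  | neg x _ hx => rw [neg_mul]; exact neg_mem hx

omit ht in
theorem algebraMap_mem_gradedState : algebraMap R (State h t D v) h ∈ gradedState h t 𝓡 D v (-2) := by
  rw [Algebra.algebraMap_eq_smul_one]
  simpa using smul_mem_gradedState h t hh (one_mem_gradedState h t)

theorem dot_mem_gradedState (p : ℕ × ℕ) : dot h t D v p ∈ gradedState h t 𝓡 D v (-2) := by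
  by_cases hp : D.InRange p
  · obtain ⟨q, rfl⟩ := hp.exists_point
    rw [dot_coords]
    simpa using monomial_singleton_mul_mem hh ht (circleOf D v q) (one_mem_gradedState h t)
  · rw [dot_of_not_inRange h t hp]; exact zero_mem _

/-- The degree of a local map. -/
theorem localMap_mem_gradedState {a d : ℤ} {e e' : State h t D' v'}
    (he : e ∈ gradedState h t 𝓡 D' v' a) (he' : e' ∈ gradedState h t 𝓡 D' v' (a - 2))
    {x : State h t D v} (hx : x ∈ gradedState h t 𝓡 D v d) :
    localMap h t D D' k m m' v v' e e' x ∈ gradedState h t 𝓡 D' v' (d + a) := by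
  -- The indeterminate `ω` stands for `X` on an inner circle and counts with degree `-2`. Its
  -- coefficient therefore has degree `d + 2`, which is compensated by the degree `a - 2` of `e'`.
  have key : (evalState h t (transportCircle h t D D' k m m' v v') x).re ∈
      gradedState h t 𝓡 D' v' d ∧
      (evalState h t (transportCircle h t D D' k m m' v v') x).im ∈
      gradedState h t 𝓡 D' v' (d + 2) := by
    induction hx using AddSubgroup.closure_induction with
    | mem x hx =>
      obtain ⟨s, n, r, hr, rfl, rfl⟩ := hx
      rw [map_smul, evalState_monomial, QuadraticAlgebra.re_smul, QuadraticAlgebra.im_smul,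
        show n - 2 * (s.card : ℤ) + 2 = n + (-2 * s.card + 2) by ring,
        show n - 2 * (s.card : ℤ) = n + (-2 * s.card) by ring]
      suffices hs : (∏ c ∈ s, transportCircle h t D D' k m m' v v' c).re ∈
          gradedState h t 𝓡 D' v' (-2 * s.card) ∧
          (∏ c ∈ s, transportCircle h t D D' k m m' v v' c).im ∈
          gradedState h t 𝓡 D' v' (-2 * s.card + 2) from
        ⟨smul_mem_gradedState h t hr hs.1, smul_mem_gradedState h t hr hs.2⟩
      induction s using Finset.induction_on with
      | empty =>
        simp only [Finset.prod_empty, Finset.card_empty, Nat.cast_zero, mul_zero,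
          QuadraticAlgebra.re_one, QuadraticAlgebra.im_one]
        exact ⟨one_mem_gradedState h t, zero_mem _⟩
      | insert c s hc ih =>
        rw [Finset.prod_insert hc, Finset.card_insert_of_notMem hc]
        obtain ⟨i1, i2⟩ := ih
        generalize ∏ c ∈ s, transportCircle h t D D' k m m' v v' c = z at i1 i2
        unfold transportCircle
        split_ifs with hx
        · have hd := dot_mem_gradedState (D := D') (v := v') hh ht
            (transport k m m' (coords hx.choose))
          rw [QuadraticAlgebra.re_mul, QuadraticAlgebra.im_mul, QuadraticAlgebra.algebraMap_re,
            QuadraticAlgebra.algebraMap_im]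
          simp only [mul_zero, zero_mul, add_zero]
          constructor
          · convert mul_mem_gradedState hh ht hd i1 using 2
            push_cast; ring
          · convert mul_mem_gradedState hh ht hd i2 using 2
            push_cast; ring
        · rw [QuadraticAlgebra.re_mul, QuadraticAlgebra.im_mul, QuadraticAlgebra.omega_re,
            QuadraticAlgebra.omega_im]
          simp only [mul_one, zero_mul, zero_add, one_mul]
          constructor
          · rw [← Algebra.smul_def]
            convert smul_mem_gradedState h t ht i2 using 2
            push_cast; ring
          · rw [← Algebra.smul_def]
            refine add_mem ?_ ?_
            · convert i1 using 2
              push_cast; ring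
            · convert smul_mem_gradedState h t hh i2 using 2
              push_cast; ring
    | zero => simp
    | add x y _ _ hx hy =>
      rw [map_add]
      exact ⟨add_mem hx.1 hy.1, add_mem hx.2 hy.2⟩
    | neg x _ hx =>
      rw [map_neg]
      exact ⟨neg_mem hx.1, neg_mem hx.2⟩
  rw [localMap_apply]
  refine add_mem (mul_mem_gradedState hh ht key.1 he) ?_
  convert mul_mem_gradedState hh ht key.2 he' using 2
  ring

end State

end

end ImmersedKhovanov

/-! ### Bidegrees of the maps of all elementary moves. -/

namespace ImmersedKhovanov

open Diagram

/-! ### Counting crossings -/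

/-- The sign of a crossing, from the directed strands above it. -/
def Layer.sign? (L : Layer) (s : List Bool) : Option Bool :=
  match L.shape with
  | .cross ε => some (ε == (s[L.pos]? == s[L.pos + 1]?))
  | _ => none

/-- The number of crossings of a given sign in a word. -/
def crossCount (b : Bool) : List Layer → List Bool → ℕ
  | [], _ => 0
  | L :: w, s => (if L.sign? s = some b then 1 else 0) + crossCount b w ((L.act s).getD [])

theorem crossCount_append (b : Bool) (u w : List Layer) {s r : List Bool} (h : run u s = some r) :
    crossCount b (u ++ w) s = crossCount b u s + crossCount b w r := by
  induction u generalizing s with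
  | nil => simp only [run_nil, Option.some.injEq] at h; subst h; simp [crossCount]
  | cons L u ih =>
    obtain ⟨q, hq, h⟩ := run_cons_eq_some.mp h
    simp only [List.cons_append, crossCount, hq, Option.getD_some, ih h, add_assoc]

theorem mem_crossings {D : Diagram} {l : ℕ} : l ∈ D.crossings ↔ ∃ i ε, D.word[l]? = some (cross i ε) := by
  simp only [crossings, Finset.mem_filter, Finset.mem_range, and_iff_right_iff_imp]
  rintro ⟨i, ε, h⟩
  exact (List.getElem?_eq_some_iff.mp h).1

theorem Diagram.card_filter_crossings (D : Diagram) (b : Bool) :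
    (D.crossings.filter fun l => D.isPositive l = b).card = crossCount b D.word [] := by
  classical
  have h1 : (D.crossings.filter fun l => D.isPositive l = b) =
      (Finset.range D.word.length).filter fun l =>
        ∃ L, D.word[l]? = some L ∧ L.sign? (D.strands l) = some b := by
    ext l
    rw [Finset.mem_filter, Finset.mem_filter, mem_crossings, Finset.mem_range, isPositive]
    by_cases hl : l < D.word.length
    swap
    · simp [List.getElem?_eq_none (not_lt.mp hl)]
    have hL : D.word[l]? = some D.word[l] := List.getElem?_eq_getElem hl
    generalize D.word[l] = L at hL
    obtain ⟨_ | _ | ε, i⟩ := L <;> simp only [hL, hl, Option.some.injEq] <;> simp [Layer.sign?]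
  rw [h1]
  suffices h : ∀ n ≤ D.word.length, ((Finset.range n).filter fun l =>
      ∃ L, D.word[l]? = some L ∧ L.sign? (D.strands l) = some b).card =
      crossCount b (D.word.take n) [] by
    simpa using h _ le_rfl
  intro n
  induction n with
  | zero => simp [crossCount]
  | succ n ih =>
    intro hn
    have hL : D.word[n]? = some D.word[n] := List.getElem?_eq_getElem hn
    rw [List.take_succ_eq_append_getElem hn, crossCount_append b _ _ (D.run_take n),
      ← ih (by omega), Finset.range_add_one, Finset.filter_insert]
    simp only [crossCount, hL, Option.some.injEq, exists_eq_left', add_zero]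
    split_ifs
    · rw [Finset.card_insert_of_notMem (by simp)]
    · rfl

theorem Diagram.numPos_eq (D : Diagram) : D.numPos = crossCount true D.word [] := by
  rw [← card_filter_crossings]; rfl

theorem Diagram.numNeg_eq (D : Diagram) : D.numNeg = crossCount false D.word [] := by
  rw [← card_filter_crossings]; rfl

/-- The sign of a crossing depends only on the directed strands above it. Outside of the replaced
layers these are unchanged, so only the replaced layers contribute to the difference. -/
theorem LocalChange.crossCount {D D' : Diagram} (C : LocalChange D D') (b : Bool) :
    (crossCount b D'.word [] : ℤ) - crossCount b D.word [] =
      crossCount b C.mid' (D.strands C.pre.length) -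
        crossCount b C.mid (D.strands C.pre.length) := by
  have h : ∀ {D : Diagram} {u m w : List Layer}, D.word = u ++ m ++ w →
      ImmersedKhovanov.crossCount b D.word [] = ImmersedKhovanov.crossCount b u [] +
        ImmersedKhovanov.crossCount b m (D.strands u.length) +
        ImmersedKhovanov.crossCount b w (D.strands (u.length + m.length)) := by
    intro D u m w hD
    obtain ⟨h1, h2, h3⟩ := LocalChange.strands_pre_of_word hD
    rw [hD, crossCount_append b _ w (r := D.strands (u.length + m.length)),
      crossCount_append b u m h1]
    rw [run_append, h1, Option.bind_some, h2]
  rw [h C.word_eq, h C.word_eq', C.strands_pre, C.strands_post]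
  push_cast; ring

/-- The number of `1`-resolved crossings in some consecutive layers. -/
def bitSum (v : Finset ℕ) (k m : ℕ) : ℕ := ∑ j ∈ Finset.range m, (bit v (k + j)).toNat

theorem card_eq_bitSum (v : Finset ℕ) (k m : ℕ) : v.card =
    (v.filter fun l => l < k).card + bitSum v k m + (v.filter fun l => k + m ≤ l).card := by
  classical
  have h2 : (v.filter fun l => k ≤ l ∧ l < k + m).card = bitSum v k m := by
    rw [bitSum]
    have hb : ∀ j, (bit v (k + j)).toNat = if k + j ∈ v then 1 else 0 := by
      intro j; rw [bit_eq]; split_ifs with h <;> simp [h]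
    simp only [hb]
    rw [Finset.sum_ite, Finset.sum_const_zero, add_zero, Finset.sum_const, smul_eq_mul, mul_one]
    symm
    refine Finset.card_nbij' (fun j => k + j) (fun l => l - k) ?_ ?_ ?_ ?_
    · intro j hj
      simp only [Finset.coe_filter, Set.mem_ofPred_eq, Finset.mem_range] at hj ⊢
      exact ⟨hj.2, by omega, by omega⟩
    · intro j hj
      simp only [Finset.coe_filter, Set.mem_ofPred_eq, Finset.mem_range] at hj ⊢
      refine ⟨by omega, ?_⟩
      rw [show k + (j - k) = j by omega]; exact hj.1
    · intro j hj; simp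
    · intro j hj; simp at hj ⊢; omega
  rw [← h2, ← Finset.card_filter_add_card_filter_not (s := v) (fun l => l < k), add_assoc]
  congr 1
  rw [← Finset.card_filter_add_card_filter_not (s := v.filter fun l => ¬ l < k)
    (fun l => l < k + m), Finset.filter_filter, Finset.filter_filter]
  congr 2 <;> refine Finset.filter_congr fun l _ => ?_ <;> omega

variable {D D' : Diagram} {C : LocalChange D D'} {v v' : Finset ℕ}

theorem LocalChange.Agree.card_filter_lt (h : C.Agree v v') :
    (v'.filter fun l => l < C.pre.length) = v.filter fun l => l < C.pre.length := by
  ext l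
  simp only [Finset.mem_filter]
  exact ⟨fun hl => ⟨(h.1 l hl.2).mpr hl.1, hl.2⟩, fun hl => ⟨(h.1 l hl.2).mp hl.1, hl.2⟩⟩

theorem LocalChange.Agree.card_filter_ge (h : C.Agree v v') :
    (v'.filter fun l => C.pre.length + C.mid'.length ≤ l).card =
      (v.filter fun l => C.pre.length + C.mid.length ≤ l).card := by
  have h2 := h.2
  generalize C.pre.length = k at h2 ⊢
  generalize C.mid.length = m at h2 ⊢
  generalize C.mid'.length = m' at h2 ⊢
  refine Finset.card_nbij' (fun l => l - m' + m) (fun l => l - m + m') ?_ ?_ ?_ ?_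
  · intro l hl
    simp only [Finset.coe_filter, Set.mem_ofPred_eq] at hl ⊢
    obtain ⟨j, rfl⟩ := Nat.exists_eq_add_of_le hl.2
    refine ⟨?_, by omega⟩
    rw [show k + m' + j - m' + m = k + m + j by omega]
    exact (h2 j).mpr hl.1
  · intro l hl
    simp only [Finset.coe_filter, Set.mem_ofPred_eq] at hl ⊢
    obtain ⟨j, rfl⟩ := Nat.exists_eq_add_of_le hl.2
    refine ⟨?_, by omega⟩
    rw [show k + m + j - m + m' = k + m' + j by omega]
    exact (h2 j).mp hl.1
  · intro l hl; simp at hl ⊢; omega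
  · intro l hl; simp at hl ⊢; omega

theorem LocalChange.Agree.card (h : C.Agree v v') : (v'.card : ℤ) - v.card =
    bitSum v' C.pre.length C.mid'.length - bitSum v C.pre.length C.mid.length := by
  rw [card_eq_bitSum v C.pre.length C.mid.length, card_eq_bitSum v' C.pre.length C.mid'.length,
    h.card_filter_lt, h.card_filter_ge]
  push_cast; ring

theorem bit_eq_false {l : ℕ} (hv : v ⊆ D.crossings) {L : Layer} (hL : D.word[l]? = some L)
    (h : ∀ i ε, L ≠ cross i ε) : bit v l = false := by
  rw [bit_eq, decide_eq_false_iff_not]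
  intro hl
  obtain ⟨i, ε, h'⟩ := mem_crossings.mp (hv hl)
  rw [hL, Option.some.injEq] at h'
  exact h i ε h'

theorem LocalChange.bit_mid_eq_false {j : ℕ} (hv : v ⊆ D.crossings) {L : Layer}
    (hL : C.mid[j]? = some L) (h : ∀ i ε, L ≠ cross i ε) : bit v (C.pre.length + j) = false :=
  bit_eq_false hv (by rw [C.getElem?_mid (List.getElem?_eq_some_iff.mp hL).1, hL]) h

/-! ### Crossings and labels under the elementary moves -/

/-- The effect of a shape on the directions of the strands that it meets. -/
def Shape.LocalAct : Shape → List Bool → List Bool → Prop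
  | .cup d, u, u' => u = [] ∧ u' = [d, !d]
  | .cap, u, u' => ∃ a, u = [a, !a] ∧ u' = []
  | .cross _, u, u' => ∃ a b, u = [a, b] ∧ u' = [b, a]

theorem act_eq_some_iff {σ : Shape} {i : ℕ} {s s' : List Bool} :
    Layer.act ⟨σ, i⟩ s = some s' ↔ ∃ A u u' B, A.length = i ∧ σ.LocalAct u u' ∧
      s = A ++ (u ++ B) ∧ s' = A ++ (u' ++ B) := by
  rcases σ with d | _ | ε
  · refine act_cup.trans ⟨?_, ?_⟩
    · rintro ⟨A, B, h, rfl, rfl⟩; exact ⟨A, [], _, B, h, ⟨rfl, rfl⟩, rfl, rfl⟩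
    · rintro ⟨A, _, _, B, h, ⟨rfl, rfl⟩, rfl, rfl⟩; exact ⟨A, B, h, rfl, rfl⟩
  · refine act_cap.trans ⟨?_, ?_⟩
    · rintro ⟨A, a, B, h, rfl, rfl⟩; exact ⟨A, _, _, B, h, ⟨a, rfl, rfl⟩, rfl, rfl⟩
    · rintro ⟨A, _, _, B, h, ⟨a, rfl, rfl⟩, rfl, rfl⟩; exact ⟨A, a, B, h, rfl, rfl⟩
  · refine act_cross.trans ⟨?_, ?_⟩
    · rintro ⟨A, a, b, B, h, rfl, rfl⟩; exact ⟨A, _, _, B, h, ⟨a, b, rfl, rfl⟩, rfl, rfl⟩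
    · rintro ⟨A, _, _, B, h, ⟨a, b, rfl, rfl⟩, rfl, rfl⟩; exact ⟨A, a, b, B, h, rfl, rfl⟩

theorem Shape.LocalAct.length {σ : Shape} {u u' : List Bool} (h : σ.LocalAct u u') :
    u.length = σ.inWidth ∧ u'.length = σ.outWidth := by
  rcases σ with d | _ | ε
  · obtain ⟨rfl, rfl⟩ := h; simp [inWidth, outWidth]
  · obtain ⟨a, rfl, rfl⟩ := h; simp [inWidth, outWidth]
  · obtain ⟨a, b, rfl, rfl⟩ := h; simp [inWidth, outWidth]

theorem Shape.LocalAct.sign? {σ : Shape} {u u' : List Bool} (h : σ.LocalAct u u')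
    (A A' B B' : List Bool) : Layer.sign? ⟨σ, A.length⟩ (A ++ (u ++ B)) =
      Layer.sign? ⟨σ, A'.length⟩ (A' ++ (u ++ B')) := by
  rcases σ with d | _ | ε
  · rfl
  · rfl
  · obtain ⟨a, b, rfl, rfl⟩ := h; simp [Layer.sign?]

/-- The two shapes act on disjoint blocks of strands, so the directions that each of them sees do
not depend on the order. -/
theorem crossCount_exchange {σ τ : Shape} {i g : ℕ} {s r : List Bool}
    (h : run [⟨σ, i⟩, ⟨τ, i + σ.outWidth + g⟩] s = some r) (b : Bool) :
    crossCount b [⟨τ, i + σ.inWidth + g⟩, ⟨σ, i⟩] s =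
      crossCount b [⟨σ, i⟩, ⟨τ, i + σ.outWidth + g⟩] s := by
  obtain ⟨q, hq, h⟩ := run_cons_eq_some.mp h
  obtain ⟨q', hq', -⟩ := run_cons_eq_some.mp h
  obtain ⟨A, u, u', B, rfl, hu, rfl, rfl⟩ := act_eq_some_iff.mp hq
  obtain ⟨A₂, w, w', B₂, hA₂, hw, e, rfl⟩ := act_eq_some_iff.mp hq'
  obtain ⟨l1, l2⟩ := hu.length
  rw [← List.append_assoc] at e
  -- `G` is the block of `g` strands between the two supports; it exists because the second shape
  -- starts to the right of the output `u'` of the first.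
  obtain ⟨G, rfl, rfl⟩ : ∃ G, A₂ = A ++ u' ++ G ∧ B = G ++ (w ++ B₂) := by
    rcases List.append_eq_append_iff.mp e with ⟨G, h1, h2⟩ | ⟨G, h1, h2⟩
    · exact ⟨G, h1, h2⟩
    · have h3 := congrArg List.length h1
      simp only [List.length_append, hA₂] at h3
      obtain rfl : G = [] := List.length_eq_zero_iff.mp (by omega)
      exact ⟨[], by simpa using h1.symm, by simpa using h2.symm⟩
  have hg : G.length = g := by simp only [List.length_append] at hA₂; omega
  have e1 : A.length + σ.inWidth + g = (A ++ u ++ G).length := by simp; omega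
  have e2 : Layer.act ⟨τ, (A ++ u ++ G).length⟩ (A ++ u ++ G ++ (w ++ B₂)) =
      some (A ++ u ++ G ++ (w' ++ B₂)) := act_eq_some_iff.mpr ⟨_, _, _, _, rfl, hw, rfl, rfl⟩
  have e3 : A ++ (u ++ (G ++ (w ++ B₂))) = A ++ u ++ G ++ (w ++ B₂) := by simp
  have e4 : A ++ (u' ++ (G ++ (w ++ B₂))) = A ++ u' ++ G ++ (w ++ B₂) := by simp
  have e5 : A ++ u ++ G ++ (w' ++ B₂) = A ++ (u ++ (G ++ (w' ++ B₂))) := by simp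
  have e6 : A.length + σ.outWidth + g = (A ++ u' ++ G).length := by simp; omega
  simp only [crossCount, hq, Option.getD_some, add_zero]
  rw [e1, e6, e4, hw.sign? (A ++ u' ++ G) (A ++ u ++ G) B₂ B₂, e3, e2, Option.getD_some, e5, ← e3,
    hu.sign? A A (G ++ (w ++ B₂)) (G ++ (w' ++ B₂)), add_comm]

theorem transfer_exchange (σ τ : Shape) (i k : ℕ) (b b' : Bool) (g : Row → ℕ) :
    transfer ⟨σ, i⟩ b (transfer ⟨τ, i + σ.outWidth + k⟩ b' g) =
      transfer ⟨τ, i + σ.inWidth + k⟩ b' (transfer ⟨σ, i⟩ b g) := by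
  have hcup : ∀ (i : ℕ) (d b : Bool) g, transfer ⟨.cup d, i⟩ b g = cupT i g := transfer_cup
  have hcap : ∀ (i : ℕ) (b : Bool) g, transfer ⟨.cap, i⟩ b g = capT i g := transfer_cap
  have hcross : ∀ (i : ℕ) (ε b : Bool) g, transfer ⟨.cross ε, i⟩ b g =
    if b = !ε then g else capT i (cupT i g) := transfer_cross
  rcases σ with d | _ | ε <;> rcases τ with d' | _ | ε' <;>
    simp only [hcup, hcap, hcross, Shape.outWidth, Shape.inWidth, Nat.add_zero] <;>
    (try split_ifs) <;>
    simp only [cupT_cupT, capT_capT, cupT_capT_far, capT_cupT_far]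

/-- What is preserved by planar isotopies of words. -/
structure IsotopyInvariance (u u' : List Layer) : Prop where
  transferWord_eq : ∀ (v v' : Finset ℕ) (k : ℕ),
    (∀ j < min u.length u'.length, bit v (k + j) = bit v' (k + j)) →
    ∀ g, transferWord v k u g = transferWord v' k u' g
  bitSum_eq : ∀ (v v' : Finset ℕ) (k : ℕ),
    (∀ j < min u.length u'.length, bit v (k + j) = bit v' (k + j)) →
    (∀ j L, u[j]? = some L → (∀ i ε, L ≠ cross i ε) → bit v (k + j) = false) →
    (∀ j L, u'[j]? = some L → (∀ i ε, L ≠ cross i ε) → bit v' (k + j) = false) →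
    bitSum v k u.length = bitSum v' k u'.length
  crossCount_eq : ∀ (b : Bool) (s r r' : List Bool), run u s = some r → run u' s = some r' →
    crossCount b u s = crossCount b u' s

theorem IsotopyInvariance.symm {u u' : List Layer} (h : IsotopyInvariance u u') :
    IsotopyInvariance u' u where
  transferWord_eq v v' k hj g := (h.transferWord_eq v' v k
    (fun j hj' => (hj j (by rwa [min_comm])).symm) g).symm
  bitSum_eq v v' k hj h1 h2 := (h.bitSum_eq v' v k
    (fun j hj' => (hj j (by rwa [min_comm])).symm) h2 h1).symm
  crossCount_eq b s r r' h1 h2 := (h.crossCount_eq b s r' r h2 h1).symm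

theorem exists_append_three {i : ℕ} {s : List Bool} (h : i + 3 ≤ s.length) :
    ∃ A a b c B, A.length = i ∧ s = A ++ a :: b :: c :: B := by
  refine ⟨s.take i, s[i], s[i + 1], s[i + 2], s.drop (i + 3), by simp; omega, ?_⟩
  rw [List.cons_getElem_drop_succ, List.cons_getElem_drop_succ, List.cons_getElem_drop_succ,
    List.take_append_drop]

end ImmersedKhovanov

namespace ImmersedKhovanov

open Diagram

/-! ### Signs of crossings in words -/

section Words

variable (A B : List Bool) (x a b d ε : Bool)

theorem act_cup_append : (cup A.length d).act (A ++ B) = some (A ++ d :: (!d) :: B) :=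
  act_cup.mpr ⟨A, B, rfl, rfl, rfl⟩

theorem act_cup_append_succ :
    (cup (A.length + 1) d).act (A ++ x :: B) = some (A ++ x :: d :: (!d) :: B) :=
  act_cup.mpr ⟨A ++ [x], B, by simp, by simp, by simp⟩

theorem act_cross_append : (cross A.length ε).act (A ++ a :: b :: B) = some (A ++ b :: a :: B) :=
  act_cross.mpr ⟨A, a, b, B, rfl, rfl, rfl⟩

theorem act_cross_append_succ :
    (cross (A.length + 1) ε).act (A ++ x :: a :: b :: B) = some (A ++ x :: b :: a :: B) :=
  act_cross.mpr ⟨A ++ [x], a, b, B, by simp, by simp, by simp⟩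

theorem act_cap_append : (cap A.length).act (A ++ a :: b :: B) =
    if b = !a then some (A ++ B) else none := by
  simp [Layer.act]

theorem act_cap_append_succ : (cap (A.length + 1)).act (A ++ x :: a :: b :: B) =
    if b = !a then some (A ++ x :: B) else none := by
  have := act_cap_append (A ++ [x]) B a b
  simpa using this

theorem sign?_cross_append : (cross A.length ε).sign? (A ++ a :: b :: B) =
    some (ε == (a == b)) := by
  simp [Layer.sign?]

theorem sign?_cross_append_succ : (cross (A.length + 1) ε).sign? (A ++ x :: a :: b :: B) =
    some (ε == (a == b)) := by
  have := sign?_cross_append (A ++ [x]) B a b ε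
  simpa using this

theorem sign?_cup (i : ℕ) (s : List Bool) : (cup i d).sign? s = none := rfl

theorem sign?_cap (i : ℕ) (s : List Bool) : (cap i).sign? s = none := rfl

end Words

theorem run_cross_exists {i : ℕ} {ε : Bool} {w : List Layer} {s r : List Bool}
    (h : run (cross i ε :: w) s = some r) : ∃ A a b B, A.length = i ∧ s = A ++ a :: b :: B := by
  obtain ⟨q, hq, -⟩ := run_cons_eq_some.mp h
  obtain ⟨A, a, b, B, h1, h2, -⟩ := act_cross.mp hq
  exact ⟨A, a, b, B, h1, h2⟩

theorem length_of_run_cross_pair {i : ℕ} {ε ε' : Bool} {w : List Layer} {s r : List Bool}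
    (h : run (cross i ε :: cross (i + 1) ε' :: w) s = some r) : i + 3 ≤ s.length := by
  obtain ⟨q, hq, h⟩ := run_cons_eq_some.mp h
  obtain ⟨q', hq', -⟩ := run_cons_eq_some.mp h
  obtain ⟨A, a, b, B, rfl, rfl, rfl⟩ := act_cross.mp hq
  obtain ⟨A', a', b', B', h1, h2, -⟩ := act_cross.mp hq'
  have := congrArg List.length h2
  simp at this ⊢; omega

theorem length_of_run_cross_pair' {i : ℕ} {ε ε' : Bool} {w : List Layer} {s r : List Bool}
    (h : run (cross (i + 1) ε :: cross i ε' :: w) s = some r) : i + 3 ≤ s.length := by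
  obtain ⟨A, a, b, B, h1, rfl⟩ := run_cross_exists h
  simp; omega

theorem run_cup_cross {i : ℕ} {d ε : Bool} {w : List Layer} {s r : List Bool}
    (h : run (cup i d :: cross (i + 1) ε :: w) s = some r) :
    ∃ A x B, A.length = i ∧ s = A ++ x :: B := by
  obtain ⟨q, hq, h⟩ := run_cons_eq_some.mp h
  obtain ⟨q', hq', -⟩ := run_cons_eq_some.mp h
  obtain ⟨A, B, rfl, rfl, rfl⟩ := act_cup.mp hq
  obtain ⟨A', a', b', B', h1, h2, -⟩ := act_cross.mp hq'
  have := congrArg List.length h2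
  rcases B with _ | ⟨x, B⟩
  · simp at this; omega
  · exact ⟨A, x, B, rfl, rfl⟩

theorem run_cup_succ {i : ℕ} {d : Bool} {w : List Layer} {s r : List Bool}
    (h : run (cup (i + 1) d :: w) s = some r) : ∃ A x B, A.length = i ∧ s = A ++ x :: B := by
  obtain ⟨q, hq, -⟩ := run_cons_eq_some.mp h
  obtain ⟨A, B, h1, rfl, -⟩ := act_cup.mp hq
  induction A using List.reverseRecOn with
  | nil => simp at h1
  | append_singleton A x _ => exact ⟨A, x, B, by simpa using h1, by simp⟩

/-- The final minimum has to fit the directions of the strands. This forces the two strands at the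
crossing to be parallel, so that the sign is `ε` itself. -/
theorem crossCount_kink {r : Bool} {i : ℕ} {d ε : Bool} {s s' : List Bool}
    (h : run (kinkWord r i d ε) s = some s') (b : Bool) :
    crossCount b (kinkWord r i d ε) s = if ε = b then 1 else 0 := by
  cases r
  · simp only [kinkWord, Bool.false_eq_true, if_false] at h ⊢
    obtain ⟨A, x, B, rfl, rfl⟩ := run_cup_cross h
    simp only [run_cons, act_cup_append, Option.bind_some, act_cross_append_succ,
      act_cap_append] at h
    simp only [crossCount, act_cup_append, act_cross_append_succ, sign?_cup, sign?_cap,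
      sign?_cross_append_succ, Option.getD_some]
    cases x <;> cases d <;> cases ε <;> cases b <;> simp at h ⊢
  · simp only [kinkWord, if_true] at h ⊢
    obtain ⟨A, x, B, rfl, rfl⟩ := run_cup_succ h
    simp only [run_cons, act_cup_append_succ, Option.bind_some, act_cross_append,
      act_cap_append_succ] at h
    simp only [crossCount, act_cup_append_succ, act_cross_append, sign?_cup, sign?_cap,
      sign?_cross_append, Option.getD_some]
    cases x <;> cases d <;> cases ε <;> cases b <;> simp at h ⊢

theorem crossCount_poke {i : ℕ} {ε : Bool} {s s' : List Bool}
    (h : run [cross i ε, cross i (!ε)] s = some s') (b : Bool) :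
    crossCount b [cross i ε, cross i (!ε)] s = 1 := by
  obtain ⟨A, x, y, B, rfl, rfl⟩ := run_cross_exists h
  simp only [crossCount, act_cross_append, sign?_cross_append, Option.getD_some]
  cases x <;> cases y <;> cases ε <;> cases b <;> simp

/-- On both sides each pair of the three strands crosses once, with the same value of `ε`; only the
order of the three crossings differs. -/
theorem crossCount_slide {i : ℕ} {a c : Bool} {s s' : List Bool}
    (h : run [cross i a, cross (i + 1) c, cross i (!a)] s = some s') (b : Bool) :
    crossCount b [cross (i + 1) (!a), cross i c, cross (i + 1) a] s =
      crossCount b [cross i a, cross (i + 1) c, cross i (!a)] s := by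
  obtain ⟨A, x, y, z, B, rfl, rfl⟩ := exists_append_three (length_of_run_cross_pair h)
  simp only [crossCount, act_cross_append, act_cross_append_succ, sign?_cross_append,
    sign?_cross_append_succ, Option.getD_some]
  omega

/-! ### Planar isotopies -/

/-- Zigzags are removed by the zigzag relations of the operators. Pulling a crossing over an
extremum exchanges its vertical and horizontal smoothings, so `ε` is negated; at the same time it
reverses one of the two strands, so the sign of the crossing and the numbering of its resolutions
are unchanged. -/
theorem planarIsotopy_invariance {u u' : List Layer} (h : PlanarIsotopy u u') :
    IsotopyInvariance u u' := by
  induction h with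
  | zigzag_left i d =>
    refine ⟨fun v v' k _ g => ?_, fun v v' k _ h1 _ => ?_, fun b s r r' _ _ => ?_⟩
    · simp only [transferWord, transfer_cup, transfer_cap, cupT_capT_succ]
    · have e0 := h1 0 _ rfl (by simp)
      have e1 := h1 1 _ rfl (by simp)
      rw [add_zero] at e0
      simp [bitSum, Finset.sum_range_succ, e0, e1]
    · simp [crossCount, sign?_cup, sign?_cap]
  | zigzag_right i d =>
    refine ⟨fun v v' k _ g => ?_, fun v v' k _ h1 _ => ?_, fun b s r r' _ _ => ?_⟩
    · simp only [transferWord, transfer_cup, transfer_cap, cupT_succ_capT]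
    · have e0 := h1 0 _ rfl (by simp)
      have e1 := h1 1 _ rfl (by simp)
      rw [add_zero] at e0
      simp [bitSum, Finset.sum_range_succ, e0, e1]
    · simp [crossCount, sign?_cup, sign?_cap]
  | turn_cup i d ε =>
    refine ⟨fun v v' k hj g => ?_, fun v v' k hj _ _ => ?_, fun b s r r' h1 h2 => ?_⟩
    · simp only [transferWord, transfer_cup, transfer_cross, hj 1 (by simp)]
      cases ε <;> cases bit v' (k + 1) <;> simp [cupT_capT_succ, cupT_succ_capT]
    · simp only [bitSum, List.length_cons, List.length_nil]
      exact Finset.sum_congr rfl fun j hj' => by rw [hj j (by simpa using hj')]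
    · obtain ⟨A, x, B, rfl, rfl⟩ := run_cup_cross h1
      simp only [crossCount, act_cup_append, act_cup_append_succ, sign?_cross_append,
        sign?_cross_append_succ, sign?_cup, Option.getD_some]
      cases x <;> cases d <;> cases ε <;> cases b <;> simp
  | turn_cap i ε =>
    refine ⟨fun v v' k hj g => ?_, fun v v' k hj _ _ => ?_, fun b s r r' h1 h2 => ?_⟩
    · have h0 := hj 0 (by simp)
      rw [add_zero] at h0
      simp only [transferWord, transfer_cap, transfer_cross, h0]
      cases ε <;> cases bit v' k <;> simp [cupT_capT_succ, cupT_succ_capT]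
    · simp only [bitSum, List.length_cons, List.length_nil]
      exact Finset.sum_congr rfl fun j hj' => by rw [hj j (by simpa using hj')]
    · obtain ⟨A', y, z, B, hA, rfl⟩ := run_cross_exists h1
      obtain ⟨A, x, B, rfl, h⟩ : ∃ A x B', A.length = i ∧ A' ++ y :: z :: B =
          A ++ x :: y :: z :: B' := by
        induction A' using List.reverseRecOn with
        | nil => simp at hA
        | append_singleton A x _ => exact ⟨A, x, B, by simpa using hA, by simp⟩
      rw [h] at h1 h2 ⊢
      simp only [run_cons, act_cross_append_succ, Option.bind_some, act_cap_append] at h1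
      simp only [crossCount, act_cross_append_succ, act_cross_append, sign?_cross_append,
        sign?_cross_append_succ, sign?_cap, Option.getD_some]
      cases x <;> cases y <;> cases z <;> cases ε <;> cases b <;> simp at h1 ⊢
  | symm _ ih => exact ih.symm

/-! ### Degrees of local maps -/

noncomputable section

namespace LocalChange

variable {D D' : Diagram} {C : LocalChange D D'} {v v' : Finset ℕ}

/-- A saddle at the strands `i`, `i + 1`, together with `n` births. -/
def IsSaddle (C : LocalChange D D') (v v' : Finset ℕ) (i : ℕ) (n : ℤ) : Prop :=
  (Connected D v (C.pre.length, i) (C.pre.length + C.mid.length, i + 1) ∧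
    (numCircles D' v' : ℤ) = numCircles D v + n + 1) ∨
  (¬ Connected D v (C.pre.length, i) (C.pre.length + C.mid.length, i + 1) ∧
    (numCircles D' v' : ℤ) = numCircles D v + n - 1)

theorem isSaddle_of_vertical (h : C.Agree v v') {a b i : ℕ}
    (hw : i + 2 ≤ D.width C.pre.length)
    (hw' : D.width (C.pre.length + C.mid.length) = D.width C.pre.length)
    (h1 : ∀ g, transferWord v C.pre.length C.mid g = 2 ^ a • g)
    (h2 : ∀ g, transferWord v' C.pre.length C.mid' g = 2 ^ b • capT i (cupT i g)) :
    C.IsSaddle v v' i (b - a) := by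
  rcases C.saddle h hw hw' h1 h2 with ⟨p, -, q⟩ | ⟨p, -, q⟩
  · exact .inl ⟨p, by omega⟩
  · exact .inr ⟨p, by omega⟩

/-- The same saddle, read backwards: `LocalChange.saddle` is applied to `C.symm`, where merging and
splitting change roles. -/
theorem isSaddle_of_horizontal (h : C.Agree v v') {a b i : ℕ}
    (hw : i + 2 ≤ D.width C.pre.length)
    (hw' : D.width (C.pre.length + C.mid.length) = D.width C.pre.length)
    (h1 : ∀ g, transferWord v C.pre.length C.mid g = 2 ^ a • capT i (cupT i g))
    (h2 : ∀ g, transferWord v' C.pre.length C.mid' g = 2 ^ b • g) :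
    C.IsSaddle v v' i (b - a) := by
  have e1 : D'.width C.pre.length = D.width C.pre.length := by rw [width, C.strands_pre]
  have e2 : D'.width (C.pre.length + C.mid'.length) = D.width (C.pre.length + C.mid.length) := by
    rw [width, C.strands_post]
  rcases C.symm.saddle (a := b) (b := a) (i := i) h.symm (by simp only [symm]; omega)
    (by simp only [symm]; omega) h2 h1 with ⟨-, p, q⟩ | ⟨-, p, q⟩
  · exact .inr ⟨p, by omega⟩
  · exact .inl ⟨p, by omega⟩

end LocalChange

section

variable {R : Type*} [CommRing R] {h t : R} {D D' D'' : Diagram} {v v' v'' : Finset ℕ}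
variable (𝓡 : ℤ → AddSubgroup R)

/-- Maps that shift the quantum degree (without the shifts of the complex) by `δ`. -/
def HasDegree (f : State h t D v →ₗ[R] State h t D' v') (δ : ℤ) : Prop :=
  ∀ d, ∀ x ∈ gradedState h t 𝓡 D v d,
    f x ∈ gradedState h t 𝓡 D' v' (d + δ + numCircles D v - numCircles D' v')

variable {𝓡}

theorem HasDegree.comp {g : State h t D' v' →ₗ[R] State h t D'' v''}
    {f : State h t D v →ₗ[R] State h t D' v'} {δ δ' : ℤ} (hg : HasDegree 𝓡 g δ')
    (hf : HasDegree 𝓡 f δ) : HasDegree 𝓡 (g.comp f) (δ' + δ) := by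
  intro d x hx
  rw [LinearMap.comp_apply]
  convert hg _ _ (hf d x hx) using 2
  ring

theorem HasDegree.zsmul {f : State h t D v →ₗ[R] State h t D' v'} {δ : ℤ}
    (hf : HasDegree 𝓡 f δ) (n : ℤ) : HasDegree 𝓡 (n • f) δ :=
  fun d x hx => AddSubgroup.zsmul_mem _ (hf d x hx) n

theorem HasDegree.neg {f : State h t D v →ₗ[R] State h t D' v'} {δ : ℤ}
    (hf : HasDegree 𝓡 f δ) : HasDegree 𝓡 (-f) δ :=
  fun d x hx => neg_mem (hf d x hx)

theorem HasDegree.congr {f : State h t D v →ₗ[R] State h t D' v'} {δ δ' : ℤ}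
    (hf : HasDegree 𝓡 f δ) (e : δ = δ') : HasDegree 𝓡 f δ' := e ▸ hf

variable [GradedRing 𝓡] (hh : h ∈ 𝓡 (-2)) (ht : t ∈ 𝓡 (-4))
include hh ht

theorem localMap_hasDegree {k m m' : ℕ} {a : ℤ} {e e' : State h t D' v'}
    (he : e ∈ gradedState h t 𝓡 D' v' a) (he' : e' ∈ gradedState h t 𝓡 D' v' (a - 2)) :
    HasDegree 𝓡 (localMap h t D D' k m m' v v' e e')
      (a + numCircles D' v' - numCircles D v) := by
  intro d x hx
  convert localMap_mem_gradedState k m m' hh ht he he' hx using 2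
  ring

/-- A split creates a circle and has a value of degree `-2`; a merge loses a circle and has value
`1`. In both cases the saddle contributes `-1` to the degree that counts circles, and each birth
contributes `1`. -/
theorem saddleValue_mem {C : LocalChange D D'} {k m m' i : ℕ} {n : ℤ} (hk : C.pre.length = k)
    (hm : C.mid.length = m) (hs : C.IsSaddle v v' i n) :
    saddleValue h t D D' k m m' i v v' ∈
      gradedState h t 𝓡 D' v' (n - 1 - numCircles D' v' + numCircles D v) := by
  subst hk hm
  unfold saddleValue
  rcases hs with ⟨hc, hn⟩ | ⟨hc, hn⟩
  · rw [if_pos hc, show n - 1 - numCircles D' v' + numCircles D v = (-2 : ℤ) by omega]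
    exact sub_mem (add_mem (dot_mem_gradedState hh ht _) (dot_mem_gradedState hh ht _))
      (algebraMap_mem_gradedState hh)
  · rw [if_neg hc, show n - 1 - numCircles D' v' + numCircles D v = (0 : ℤ) by omega]
    exact one_mem_gradedState h t

theorem saddleMap_hasDegree {C : LocalChange D D'} {k m m' i : ℕ} {n : ℤ} (hk : C.pre.length = k)
    (hm : C.mid.length = m) (hs : C.IsSaddle v v' i n) :
    HasDegree 𝓡 (saddleMap h t D D' k m m' i v v') (n - 1) :=
  (localMap_hasDegree hh ht (saddleValue_mem hh ht hk hm hs) (zero_mem _)).congr (by ring)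

theorem deathSaddleMap_hasDegree {C : LocalChange D D'} {k m m' i : ℕ} {n : ℤ}
    (hk : C.pre.length = k) (hm : C.mid.length = m) (hs : C.IsSaddle v v' i n) :
    HasDegree 𝓡 (deathSaddleMap h t D D' k m m' i v v') (n + 1) := by
  refine (localMap_hasDegree hh ht (a := n + 1 - numCircles D' v' + numCircles D v) (zero_mem _)
    ?_).congr (by ring)
  convert saddleValue_mem hh ht hk hm hs using 2
  ring

/-- Degrees of local maps between resolutions with equally joined ends. -/
theorem localMap_hasDegree_of_eq {C : LocalChange D D'} {k m m' : ℕ} (hk : C.pre.length = k)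
    (hA : C.Agree v v') {a b : ℕ}
    {O : (Row → ℕ) → Row → ℕ} (h1 : ∀ g, transferWord v k C.mid g = 2 ^ a • O g)
    (h2 : ∀ g, transferWord v' k C.mid' g = 2 ^ b • O g) {n : ℤ} {e e' : State h t D' v'}
    (he : e ∈ gradedState h t 𝓡 D' v' n) (he' : e' ∈ gradedState h t 𝓡 D' v' (n - 2)) :
    HasDegree 𝓡 (localMap h t D D' k m m' v v' e e') (n + b - a) := by
  subst hk
  have := C.numCircles_eq hA h1 h2
  exact (localMap_hasDegree hh ht he he').congr (by omega)

theorem isoMap_hasDegree {C : LocalChange D D'} {k m m' : ℕ} (hk : C.pre.length = k)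
    (hA : C.Agree v v') {a b : ℕ}
    {O : (Row → ℕ) → Row → ℕ} (h1 : ∀ g, transferWord v k C.mid g = 2 ^ a • O g)
    (h2 : ∀ g, transferWord v' k C.mid' g = 2 ^ b • O g) :
    HasDegree 𝓡 (isoMap h t D D' k m m' v v') (b - a) :=
  (localMap_hasDegree_of_eq hh ht hk hA h1 h2 (one_mem_gradedState h t) (zero_mem _)).congr
    (by ring)

theorem deathMap_hasDegree {C : LocalChange D D'} {k m m' : ℕ} (hk : C.pre.length = k)
    (hA : C.Agree v v') {a b : ℕ}
    {O : (Row → ℕ) → Row → ℕ} (h1 : ∀ g, transferWord v k C.mid g = 2 ^ a • O g)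
    (h2 : ∀ g, transferWord v' k C.mid' g = 2 ^ b • O g) :
    HasDegree 𝓡 (deathMap h t D D' k m m' v v') (2 + b - a) :=
  localMap_hasDegree_of_eq hh ht hk hA h1 h2 (zero_mem _) (by simpa using one_mem_gradedState h t)

end

end

end ImmersedKhovanov

namespace ImmersedKhovanov

open Diagram

noncomputable section

/-! ### Degrees of the components of the maps of the elementary moves -/

variable {R : Type*} [CommRing R] {h t : R} {D D' : Diagram} {v v' : Finset ℕ}

/-- Maps `f` that vanish, or preserve the homological degree and shift the quantum degree by `n`. -/
def EntryDegree (𝓡 : ℤ → AddSubgroup R) (C : LocalChange D D')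
    (f : State h t D v →ₗ[R] State h t D' v') (n : ℤ) : Prop :=
  f = 0 ∨ ∃ δ : ℤ, HasDegree 𝓡 f δ ∧
    (bitSum v' C.pre.length C.mid'.length : ℤ) - bitSum v C.pre.length C.mid.length =
      crossCount false C.mid' (D.strands C.pre.length) -
        crossCount false C.mid (D.strands C.pre.length) ∧
    -- The quantum degree contains the shift `|v| + n₊ - 2 n₋`. Since the preceding condition keeps
    -- `|v| - n₋` fixed, this shift changes by the change of `n₊ - n₋`.
    δ + (crossCount true C.mid' (D.strands C.pre.length) -
        crossCount true C.mid (D.strands C.pre.length)) -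
      (crossCount false C.mid' (D.strands C.pre.length) -
        crossCount false C.mid (D.strands C.pre.length)) = n

theorem length_eq_of_run_crosses {w : List Layer} {s r : List Bool}
    (hw : ∀ L ∈ w, ∃ i ε, L = cross i ε) (h : run w s = some r) : r.length = s.length := by
  induction w generalizing s with
  | nil => simp only [run_nil, Option.some.injEq] at h; rw [h]
  | cons L w ih =>
    obtain ⟨q, hq, h⟩ := run_cons_eq_some.mp h
    rw [ih (fun L hL => hw L (by simp [hL])) h]
    obtain ⟨i, ε, rfl⟩ := hw L (by simp)
    obtain ⟨A, a, b, B, -, rfl, rfl⟩ := act_cross.mp hq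
    simp

namespace LocalChange

variable (C : LocalChange D D')

theorem run_mid' : run C.mid' (D.strands C.pre.length) =
    some (D'.strands (C.pre.length + C.mid'.length)) := by
  rw [← C.strands_pre]; exact C.symm.run_mid

theorem width_post_of_mid_nil (h : C.mid = []) :
    D.width (C.pre.length + C.mid.length) = D.width C.pre.length := by
  rw [h]; rfl

theorem width_post_of_mid'_nil (h : C.mid' = []) :
    D.width (C.pre.length + C.mid.length) = D.width C.pre.length := by
  rw [width, ← C.strands_post, h, List.length_nil, Nat.add_zero, C.strands_pre]

theorem width_post_of_crosses (h : ∀ L ∈ C.mid, ∃ i ε, L = cross i ε) :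
    D.width (C.pre.length + C.mid.length) = D.width C.pre.length :=
  length_eq_of_run_crosses h C.run_mid

end LocalChange

variable {𝓡 : ℤ → AddSubgroup R} [GradedRing 𝓡] (hh : h ∈ 𝓡 (-2)) (ht : t ∈ 𝓡 (-4))
variable {C : LocalChange D D'} (hA : C.Agree v v')

include hh ht hA

theorem exchange_degree {σ τ : Shape} {i g : ℕ} (z : Fin 2) (r : Bool)
    (hm : C.mid = (Move.exchange σ τ i g r).source)
    (hm' : C.mid' = (Move.exchange σ τ i g r).target) :
    EntryDegree 𝓡 C ((Move.exchange σ τ i g r).entry h t z D D' C.pre.length v v') 0 := by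
  simp only [Move.entry]
  split_ifs with hb
  swap
  · exact .inl rfl
  obtain ⟨b0, b1⟩ := hb
  have r1 := C.run_mid
  have r2 := C.run_mid'
  refine .inr ⟨0, (isoMap_hasDegree (a := 0) (b := 0) hh ht rfl hA
    (O := transferWord v C.pre.length C.mid) (fun g => by simp) fun g => ?_).zsmul _, ?_, ?_⟩
  · cases r <;> simp only [Move.source, Move.target] at hm hm' <;>
      simp only [hm, hm', transferWord, b0, b1, transfer_exchange, pow_zero, one_smul]
  · have e : (bitSum v' C.pre.length C.mid'.length : ℤ) = bitSum v C.pre.length C.mid.length := by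
      cases r <;> simp [Move.source, Move.target] at hm hm' <;>
      simp [hm, hm', bitSum, Finset.sum_range_succ, b0, b1, add_comm]
    rw [e, sub_self]
    cases r <;> simp only [Move.source, Move.target] at hm hm' <;>
      rw [hm] at r1 ⊢ <;> rw [hm'] at r2 ⊢
    · rw [crossCount_exchange r1, sub_self]
    · rw [crossCount_exchange r2, sub_self]
  · cases r <;> simp only [Move.source, Move.target] at hm hm' <;>
      rw [hm] at r1 ⊢ <;> rw [hm'] at r2 ⊢
    · rw [crossCount_exchange r1, crossCount_exchange r1]; ring
    · rw [crossCount_exchange r2, crossCount_exchange r2]; ring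

theorem isotopy_degree (hv : v ⊆ D.crossings) (hv' : v' ⊆ D'.crossings)
    {u u' : List Layer} (hu : PlanarIsotopy u u') (z : Fin 2)
    (hm : C.mid = u) (hm' : C.mid' = u') :
    EntryDegree 𝓡 C ((Move.isotopy u u' hu).entry h t z D D' C.pre.length v v') 0 := by
  subst hm hm'
  simp only [Move.entry]
  split_ifs with hb
  swap
  · exact .inl rfl
  have I := planarIsotopy_invariance hu
  refine .inr ⟨0, isoMap_hasDegree (a := 0) (b := 0) hh ht rfl hA
    (O := transferWord v C.pre.length C.mid) (fun g => by simp) fun g => ?_, ?_, ?_⟩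
  · rw [pow_zero, one_smul, I.transferWord_eq v v' _ hb]
  · rw [I.bitSum_eq v v' _ hb (fun j L hL hc => C.bit_mid_eq_false hv hL hc)
      (fun j L hL hc => C.symm.bit_mid_eq_false hv' hL hc),
      I.crossCount_eq _ _ _ _ C.run_mid C.run_mid']
    ring
  · rw [I.crossCount_eq _ _ _ _ C.run_mid C.run_mid', I.crossCount_eq _ _ _ _ C.run_mid C.run_mid']
    ring

omit hh ht hA in
theorem bitSum_kinkWord (hv : v ⊆ D.crossings) {r : Bool} {i : ℕ} {d ε : Bool}
    (hm : C.mid = kinkWord r i d ε) :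
    bit v C.pre.length = false ∧ bit v (C.pre.length + 2) = false ∧
    bitSum v C.pre.length C.mid.length = (bit v (C.pre.length + 1)).toNat := by
  have h0 : bit v (C.pre.length + 0) = false := by
    cases r <;> refine C.bit_mid_eq_false hv (j := 0) (by rw [hm]; rfl) ?_ <;> simp
  have h2 : bit v (C.pre.length + 2) = false := by
    cases r <;> refine C.bit_mid_eq_false hv (j := 2) (by rw [hm]; rfl) ?_ <;> simp
  have hl : C.mid.length = 3 := by rw [hm]; cases r <;> rfl
  rw [hl]
  refine ⟨h0, h2, ?_⟩
  rw [Nat.add_zero] at h0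
  simp [bitSum, Finset.sum_range_succ, h0, h2]

omit hh ht hA in
theorem transferWord_kinkWord {r : Bool} {i : ℕ} {d ε : Bool} {k : ℕ}
    (hb : bit v (k + 1) = !ε) (g : Row → ℕ) :
    transferWord v k (kinkWord r i d ε) g = 2 ^ 1 • g := by
  cases r <;> simp [kinkWord, transferWord, transfer_cup, transfer_cap, transfer_cross, hb, cupT_capT]

/-- The birth of the loop has degree `1`. For a positive kink the value `X_loop - X_strand` lowers
this to `-1`, which cancels against the new positive crossing. For a negative kink the value is `1`,
and the degree `1` cancels against the new negative crossing, whose `1`-resolution is used. -/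
theorem kink_degree (hv' : v' ⊆ D'.crossings) {r : Bool} {i : ℕ} {d ε : Bool} (z : Fin 2)
    (hm : C.mid = []) (hm' : C.mid' = kinkWord r i d ε) :
    EntryDegree 𝓡 C ((Move.kink r i d ε).entry h t z D D' C.pre.length v v') 0 := by
  simp only [Move.entry]
  by_cases hb : bit v' (C.pre.length + 1) = !ε
  swap
  · exact .inl (if_neg hb)
  rw [if_pos hb]
  obtain ⟨-, -, b⟩ := bitSum_kinkWord (C := C.symm) hv' hm'
  have r2 := C.run_mid'
  rw [hm'] at r2
  simp only [LocalChange.symm] at b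
  refine .inr ⟨if ε then -1 else 1, ?_, ?_, ?_⟩
  · refine (localMap_hasDegree_of_eq (a := 0) (b := 1) (O := id) (n := if ε then -2 else 0) hh ht rfl
      hA (fun g => by simp [hm, transferWord]) (fun g => by
        rw [hm', transferWord_kinkWord hb]; rfl) ?_ (zero_mem _)).congr (by cases ε <;> simp)
    cases ε
    · simpa using one_mem_gradedState h t
    · simpa using sub_mem (dot_mem_gradedState hh ht _) (dot_mem_gradedState hh ht _)
  · rw [b, hb, hm', crossCount_kink r2, hm]
    cases ε <;> simp [bitSum, crossCount]
  · rw [hm', crossCount_kink r2, crossCount_kink r2, hm]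
    cases ε <;> simp [crossCount]

theorem unkink_degree (hv : v ⊆ D.crossings) {r : Bool} {i : ℕ} {d ε : Bool} (z : Fin 2)
    (hm : C.mid = kinkWord r i d ε) (hm' : C.mid' = []) :
    EntryDegree 𝓡 C ((Move.unkink r i d ε).entry h t z D D' C.pre.length v v') 0 := by
  simp only [Move.entry]
  by_cases hb : bit v (C.pre.length + 1) = !ε
  swap
  · exact .inl (if_neg hb)
  rw [if_pos hb]
  obtain ⟨-, -, b⟩ := bitSum_kinkWord hv hm
  have r1 := C.run_mid
  rw [hm] at r1
  have h1 : ∀ g, transferWord v C.pre.length C.mid g = 2 ^ 1 • id g := fun g => by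
    rw [hm, transferWord_kinkWord hb]; rfl
  have h2 : ∀ g, transferWord v' C.pre.length C.mid' g = 2 ^ 0 • id g := fun g => by
    simp [hm', transferWord]
  refine .inr ⟨if ε then 1 else -1, ?_, ?_, ?_⟩
  · cases ε
    · refine (localMap_hasDegree_of_eq (n := 0) hh ht rfl hA h1 h2 (one_mem_gradedState h t)
        ?_).congr (by simp)
      simpa using sub_mem (algebraMap_mem_gradedState hh) (dot_mem_gradedState hh ht _)
    · exact (deathMap_hasDegree hh ht rfl hA h1 h2).congr (by simp)
  · rw [b, hb, hm, crossCount_kink r1, hm']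
    cases ε <;> simp [bitSum, crossCount]
  · rw [hm, crossCount_kink r1, crossCount_kink r1, hm']
    cases ε <;> simp [crossCount]

omit hh ht hA in
theorem transferWord_poke {i : ℕ} {ε : Bool} {k : ℕ} (h0 : bit v k = ε) (h1 : bit v (k + 1) = !ε)
    (g : Row → ℕ) : transferWord v k [cross i ε, cross i (!ε)] g = 2 ^ 1 • capT i (cupT i g) := by
  simp only [transferWord, transfer_cross, h0, h1]
  rw [if_neg (by simp), if_neg (by simp), cupT_capT, capT_smul, pow_one]

theorem poke_degree {i : ℕ} {ε : Bool} (z : Fin 2)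
    (hm : C.mid = []) (hm' : C.mid' = [cross i ε, cross i (!ε)]) :
    EntryDegree 𝓡 C ((Move.poke i ε).entry h t z D D' C.pre.length v v') 0 := by
  have r2 := C.run_mid'
  rw [hm'] at r2
  have hw : i + 2 ≤ D.width C.pre.length := by
    obtain ⟨A, a, b, B, rfl, e⟩ := run_cross_exists r2
    rw [width, e]; simp
  have h1 : ∀ g, transferWord v C.pre.length C.mid g = 2 ^ 0 • g := fun g => by
    simp [hm, transferWord]
  have hc : ∀ b, crossCount b C.mid' (D.strands C.pre.length) = 1 := fun b => by
    rw [hm', crossCount_poke r2]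
  have hc' : ∀ b, crossCount b C.mid (D.strands C.pre.length) = 0 := fun b => by rw [hm]; rfl
  simp only [Move.entry, Prod.mk.injEq]
  by_cases hb : bit v' C.pre.length = (!ε) ∧ bit v' (C.pre.length + 1) = ε
  · rw [if_pos hb]
    refine .inr ⟨0, isoMap_hasDegree (a := 0) (b := 0) (O := id) hh ht rfl hA h1 fun g => ?_, ?_, ?_⟩
    · simp [hm', transferWord, transfer_cross, hb]
    · rw [hc, hc', hm, hm']
      simp only [bitSum, List.length_cons, List.length_nil, Finset.sum_range_succ,
        Finset.sum_range_zero, Nat.add_zero, hb]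
      cases ε <;> simp
    · simp [hc, hc']
  rw [if_neg hb]
  by_cases hb' : bit v' C.pre.length = ε ∧ bit v' (C.pre.length + 1) = !ε
  · rw [if_pos hb']
    refine .inr ⟨0, (saddleMap_hasDegree hh ht rfl (by rw [hm]; rfl) (C.isSaddle_of_vertical hA
      (a := 0) (b := 1) hw (C.width_post_of_mid_nil hm) h1 fun g => ?_)).congr (by simp), ?_, ?_⟩
    · rw [hm', transferWord_poke hb'.1 hb'.2]
    · rw [hc, hc', hm, hm']
      simp only [bitSum, List.length_cons, List.length_nil, Finset.sum_range_succ,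
        Finset.sum_range_zero, Nat.add_zero, hb']
      cases ε <;> simp
    · simp [hc, hc']
  · exact .inl (if_neg hb')

theorem unpoke_degree {i : ℕ} {ε : Bool} (z : Fin 2)
    (hm : C.mid = [cross i ε, cross i (!ε)]) (hm' : C.mid' = []) :
    EntryDegree 𝓡 C ((Move.unpoke i ε).entry h t z D D' C.pre.length v v') 0 := by
  have r1 := C.run_mid
  rw [hm] at r1
  have hw : i + 2 ≤ D.width C.pre.length := by
    obtain ⟨A, a, b, B, rfl, e⟩ := run_cross_exists r1
    rw [width, e]; simp
  have h2 : ∀ g, transferWord v' C.pre.length C.mid' g = 2 ^ 0 • g := fun g => by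
    simp [hm', transferWord]
  have hc : ∀ b, crossCount b C.mid (D.strands C.pre.length) = 1 := fun b => by
    rw [hm, crossCount_poke r1]
  have hc' : ∀ b, crossCount b C.mid' (D.strands C.pre.length) = 0 := fun b => by rw [hm']; rfl
  simp only [Move.entry, Prod.mk.injEq]
  by_cases hb : bit v C.pre.length = (!ε) ∧ bit v (C.pre.length + 1) = ε
  · rw [if_pos hb]
    refine .inr ⟨0, isoMap_hasDegree (a := 0) (b := 0) (O := id) hh ht rfl hA (fun g => ?_) h2,
      ?_, ?_⟩
    · simp [hm, transferWord, transfer_cross, hb]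
    · rw [hc, hc', hm, hm']
      simp only [bitSum, List.length_cons, List.length_nil, Finset.sum_range_succ,
        Finset.sum_range_zero, Nat.add_zero, hb]
      cases ε <;> simp
    · simp [hc, hc']
  rw [if_neg hb]
  by_cases hb' : bit v C.pre.length = ε ∧ bit v (C.pre.length + 1) = !ε
  · rw [if_pos hb']
    refine .inr ⟨0, (deathSaddleMap_hasDegree hh ht rfl (by rw [hm]; rfl)
      (C.isSaddle_of_horizontal hA (a := 1) (b := 0) hw (C.width_post_of_mid'_nil hm')
      (fun g => ?_) h2)).neg.congr (by simp), ?_, ?_⟩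
    · rw [hm, transferWord_poke hb'.1 hb'.2]
    · rw [hc, hc', hm, hm']
      simp only [bitSum, List.length_cons, List.length_nil, Finset.sum_range_succ,
        Finset.sum_range_zero, Nat.add_zero, hb']
      cases ε <;> simp
    · simp [hc, hc']
  · exact .inl (if_neg hb')

omit hh ht hA in
theorem bitSum_eq_zero (hv : v ⊆ D.crossings) (C : LocalChange D D')
    (hc : ∀ L ∈ C.mid, ∀ i ε, L ≠ cross i ε) : bitSum v C.pre.length C.mid.length = 0 := by
  refine Finset.sum_eq_zero fun j hj => ?_
  have hj := Finset.mem_range.mp hj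
  rw [C.bit_mid_eq_false hv (List.getElem?_eq_getElem hj) (hc _ (List.getElem_mem hj))]
  rfl

omit hh ht hA in
theorem crossCount_eq_zero {w : List Layer} (hc : ∀ L ∈ w, ∀ i ε, L ≠ cross i ε) (b : Bool)
    (s : List Bool) : crossCount b w s = 0 := by
  induction w generalizing s with
  | nil => rfl
  | cons L w ih =>
    rw [crossCount, ih fun L hL => hc L (by simp [hL])]
    obtain ⟨_ | _ | ε, i⟩ := L
    · rfl
    · rfl
    · exact absurd rfl (hc _ List.mem_cons_self i ε)

omit [GradedRing 𝓡] hh ht hA in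
theorem EntryDegree.of_flat (hv : v ⊆ D.crossings) (hv' : v' ⊆ D'.crossings)
    (hc : ∀ L ∈ C.mid, ∀ i ε, L ≠ cross i ε) (hc' : ∀ L ∈ C.mid', ∀ i ε, L ≠ cross i ε)
    {f : State h t D v →ₗ[R] State h t D' v'} {n : ℤ} (hf : HasDegree 𝓡 f n) :
    EntryDegree 𝓡 C f n := by
  have b' := bitSum_eq_zero hv' C.symm hc'
  simp only [LocalChange.symm] at b'
  refine .inr ⟨n, hf, ?_, ?_⟩ <;>
  simp [bitSum_eq_zero hv C hc, b', crossCount_eq_zero hc, crossCount_eq_zero hc']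

theorem birth_degree (hv : v ⊆ D.crossings) (hv' : v' ⊆ D'.crossings) {i : ℕ} {d : Bool} (z : Fin 2)
    (hm : C.mid = []) (hm' : C.mid' = [cup i d, cap i]) :
    EntryDegree 𝓡 C ((Move.birth i d).entry h t z D D' C.pre.length v v') 1 := by
  refine .of_flat hv hv' (by simp [hm]) (by simp [hm']) ?_
  refine (isoMap_hasDegree (a := 0) (b := 1) (O := id) hh ht rfl hA (fun g => ?_)
    fun g => ?_).congr (by simp)
  · simp [hm, transferWord]
  · simp [hm', transferWord, transfer_cup, transfer_cap, cupT_capT]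

theorem death_degree (hv : v ⊆ D.crossings) (hv' : v' ⊆ D'.crossings) {i : ℕ} {d : Bool} (z : Fin 2)
    (hm : C.mid = [cup i d, cap i]) (hm' : C.mid' = []) :
    EntryDegree 𝓡 C ((Move.death i d).entry h t z D D' C.pre.length v v') 1 := by
  refine .of_flat hv hv' (by simp [hm]) (by simp [hm']) ?_
  refine (deathMap_hasDegree (a := 1) (b := 0) (O := id) hh ht rfl hA (fun g => ?_)
    fun g => ?_).congr (by simp)
  · simp [hm, transferWord, transfer_cup, transfer_cap, cupT_capT]
  · simp [hm', transferWord]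

omit hh ht hA in
theorem length_of_run_cap {i : ℕ} {w : List Layer} {s r : List Bool}
    (h : run (cap i :: w) s = some r) : i + 2 ≤ s.length := by
  obtain ⟨q, hq, -⟩ := run_cons_eq_some.mp h
  obtain ⟨A, a, B, rfl, rfl, -⟩ := act_cap.mp hq
  simp

theorem saddle_degree (hv : v ⊆ D.crossings) (hv' : v' ⊆ D'.crossings) {i : ℕ} {d : Bool}
    (z : Fin 2) (hm : C.mid = []) (hm' : C.mid' = [cap i, cup i d]) :
    EntryDegree 𝓡 C ((Move.saddle i d).entry h t z D D' C.pre.length v v') (-1) := by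
  have r2 := C.run_mid'
  rw [hm'] at r2
  refine .of_flat hv hv' (by simp [hm]) (by simp [hm']) ?_
  refine (saddleMap_hasDegree (n := 0) hh ht rfl (by rw [hm]; rfl) (C.isSaddle_of_vertical hA
    (a := 0) (b := 0) (length_of_run_cap r2) (C.width_post_of_mid_nil hm) (fun g => ?_) fun g => ?_)).congr
    (by simp)
  · simp [hm, transferWord]
  · simp [hm', transferWord, transfer_cup, transfer_cap]

theorem unsaddle_degree (hv : v ⊆ D.crossings) (hv' : v' ⊆ D'.crossings) {i : ℕ} {d : Bool}
    (z : Fin 2) (hm : C.mid = [cap i, cup i d]) (hm' : C.mid' = []) :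
    EntryDegree 𝓡 C ((Move.unsaddle i d).entry h t z D D' C.pre.length v v') (-1) := by
  have r1 := C.run_mid
  rw [hm] at r1
  refine .of_flat hv hv' (by simp [hm]) (by simp [hm']) ?_
  refine (saddleMap_hasDegree (n := 0) hh ht rfl (by rw [hm]; rfl) (C.isSaddle_of_horizontal hA
    (a := 0) (b := 0) (length_of_run_cap r1) (C.width_post_of_mid'_nil hm') (fun g => ?_) fun g => ?_)).congr
    (by simp)
  · simp [hm, transferWord, transfer_cup, transfer_cap]
  · simp [hm', transferWord]

/-- `s` is the sign of the double point. At a positive one, `Φ` has degree `-2` and the change of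
`n₊ - n₋` by `2` cancels it. At a negative one, the identity has degree `0` and the change of `n₊ -
n₋` by `-2` remains; this is the only source of the degree shift. -/
theorem crossingChange_degree {i : ℕ} {ε dir s : Bool}
    (hm : C.mid = [cross i ε]) (hm' : C.mid' = [cross i (!ε)])
    (hs : D.isPositive C.pre.length = !s) :
    EntryDegree 𝓡 C ((Move.crossingChange i ε dir).entry h t (if s then 0 else 1) D D' C.pre.length v v')
      (if s then 0 else -2) := by
  have r1 := C.run_mid
  rw [hm] at r1
  obtain ⟨A, a, b, B, rfl, e⟩ := run_cross_exists r1
  have hp : (ε == (a == b)) = !s := by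
    rw [← hs, isPositive, ← Nat.add_zero C.pre.length, C.getElem?_mid (by simp [hm]), hm, Nat.add_zero, e]
    simp
  have hc : ∀ c, crossCount c C.mid (D.strands C.pre.length) = if c = !s then 1 else 0 := by
    intro c
    rw [hm, e]
    simp only [crossCount, sign?_cross_append, hp]
    cases c <;> cases s <;> simp
  have hc' : ∀ c, crossCount c C.mid' (D.strands C.pre.length) = if c = s then 1 else 0 := by
    intro c
    have hp' : ((!ε) == (a == b)) = s := by
      cases ε <;> cases a <;> cases b <;> cases s <;> simp_all
    rw [hm', e]
    simp only [crossCount, sign?_cross_append, hp']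
    cases c <;> cases s <;> simp
  simp only [Move.entry]
  cases s
  · simp only [Bool.false_eq_true, if_false, if_true]
    by_cases hb : bit v C.pre.length = false ∧ bit v' C.pre.length = true
    swap
    · exact .inl (if_neg hb)
    rw [if_pos hb]
    refine .inr ⟨0, isoMap_hasDegree (a := 0) (b := 0) (O := transferWord v C.pre.length C.mid) hh ht
      rfl hA (fun g => by simp) fun g => ?_, ?_, ?_⟩
    · simp [hm, hm', transferWord, transfer_cross, hb]
    · rw [hc, hc', hm, hm']; simp [bitSum, hb]
    · simp [hc, hc']
  · simp only [if_true]
    rw [if_neg (by simp)]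
    by_cases hb : bit v C.pre.length = true ∧ bit v' C.pre.length = false
    swap
    · exact .inl (if_neg hb)
    rw [if_pos hb]
    refine .inr ⟨-2, (localMap_hasDegree_of_eq (n := -2) (a := 0) (b := 0)
      (O := transferWord v C.pre.length C.mid) hh ht
      rfl hA (fun g => by simp) (fun g => ?_) (zsmul_mem (sub_mem (dot_mem_gradedState hh ht _)
        (dot_mem_gradedState hh ht _)) _) (zero_mem _)).congr (by simp), ?_, ?_⟩
    · simp [hm, hm', transferWord, transfer_cross, hb]
    · rw [hc, hc', hm, hm']; simp [bitSum, hb]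
    · simp [hc, hc']

end

end ImmersedKhovanov

namespace ImmersedKhovanov

open Diagram

noncomputable section

/-! ### Degrees of the components of Reidemeister 3 moves -/

/-- The operator of a horizontal smoothing. -/
def turnT (i : ℕ) (g : Row → ℕ) : Row → ℕ := capT i (cupT i g)

theorem turnT_turnT (i : ℕ) (g : Row → ℕ) : turnT i (turnT i g) = 2 • turnT i g := by
  rw [turnT, turnT, cupT_capT, capT_smul]

/-- The Temperley–Lieb relation. It makes the two sides of a Reidemeister 3 move isotopic when the
middle crossing is smoothed horizontally. -/
theorem turnT_braid {p q : ℕ} (hpq : q = p + 1 ∨ p = q + 1) (g : Row → ℕ) :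
    turnT p (turnT q (turnT p g)) = turnT p g := by
  rcases hpq with rfl | rfl
  · simp only [turnT, cupT_capT_succ, cupT_succ_capT]
  · simp only [turnT, cupT_capT_succ, cupT_succ_capT]

/-- The operator of a crossing. -/
def smoothT (i : ℕ) (ε x : Bool) (g : Row → ℕ) : Row → ℕ := if x = !ε then g else turnT i g

theorem transferWord_cross_cons (v : Finset ℕ) (k i : ℕ) (ε : Bool) (w : List Layer) (g : Row → ℕ) :
    transferWord v k (cross i ε :: w) g =
      smoothT i ε (bit v k) (transferWord v (k + 1) w g) := by
  rw [transferWord, transfer_cross]; rfl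

theorem transferWord_three {v : Finset ℕ} {k p q : ℕ} {a b c : Bool} {x : Bool × Bool × Bool}
    (hx : bits3 v k = x) (g : Row → ℕ) :
    transferWord v k [cross p a, cross q b, cross p c] g =
      smoothT p a x.1 (smoothT q b x.2.1 (smoothT p c x.2.2 g)) := by
  subst hx
  rw [transferWord_cross_cons, transferWord_cross_cons, transferWord_cross_cons]
  rfl

theorem AgreeOutside.trans {k m m' m'' : ℕ} {u v w : Finset ℕ} (h1 : AgreeOutside k m m' u v)
    (h2 : AgreeOutside k m' m'' v w) : AgreeOutside k m m'' u w :=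
  ⟨fun l hl => (h1.1 l hl).trans (h2.1 l hl), fun l => (h1.2 l).trans (h2.2 l)⟩

theorem AgreeOutside.symm {k m m' : ℕ} {v w : Finset ℕ} (h : AgreeOutside k m m' v w) :
    AgreeOutside k m' m w v :=
  ⟨fun l hl => (h.1 l hl).symm, fun l => (h.2 l).symm⟩

theorem mem_setBits3 {v : Finset ℕ} {k l : ℕ} {x : Bool × Bool × Bool} : l ∈ setBits3 v k x ↔
    (l ∈ v ∧ l ≠ k ∧ l ≠ k + 1 ∧ l ≠ k + 2) ∨ (l = k ∧ x.1 = true) ∨ (l = k + 1 ∧ x.2.1 = true) ∨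
      (l = k + 2 ∧ x.2.2 = true) := by
  obtain ⟨a, b, c⟩ := x
  cases a <;> cases b <;> cases c <;> simp [setBits3] <;> tauto

theorem agreeOutside_setBits3 (v : Finset ℕ) (k : ℕ) (x : Bool × Bool × Bool) :
    AgreeOutside k 3 3 v (setBits3 v k x) := by
  refine ⟨fun l hl => ?_, fun l => ?_⟩ <;> rw [mem_setBits3]
  · constructor
    · exact fun h => .inl ⟨h, by omega, by omega, by omega⟩
    · rintro (h | h | h | h)
      · exact h.1
      all_goals omega
  · constructor
    · exact fun h => .inl ⟨h, by omega, by omega, by omega⟩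
    · rintro (h | h | h | h)
      · exact h.1
      all_goals omega

theorem bits3_setBits3 (v : Finset ℕ) (k : ℕ) (x : Bool × Bool × Bool) :
    bits3 (setBits3 v k x) k = x := by
  obtain ⟨a, b, c⟩ := x
  simp only [bits3, bit_eq, mem_setBits3]
  simp

theorem agreeOutside_setBits3_mid (v : Finset ℕ) (k : ℕ) (x y z z' : Bool) :
    AgreeOutside (k + 1) 1 1 (setBits3 v k (x, z, y)) (setBits3 v k (x, z', y)) := by
  refine ⟨fun l hl => ?_, fun l => ?_⟩ <;> simp only [mem_setBits3] <;> constructor <;>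
    rintro (h | h | h | h) <;> first | omega | tauto

theorem bit_setBits3_mid (v : Finset ℕ) (k : ℕ) (x : Bool × Bool × Bool) :
    bit (setBits3 v k x) (k + 1) = x.2.1 :=
  congrArg (fun x => x.2.1) (bits3_setBits3 v k x)

variable {R : Type*} [CommRing R] {h t : R} {D D' : Diagram} {v v' w w' : Finset ℕ}
variable {𝓡 : ℤ → AddSubgroup R} [GradedRing 𝓡] (hh : h ∈ 𝓡 (-2)) (ht : t ∈ 𝓡 (-4))

include hh ht

/-- Depending on the crossing, the saddle leads from the vertical to the horizontal smoothing or
back; both directions are treated. -/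
theorem saddleMap_cross_hasDegree {l j : ℕ} {ε : Bool} (hl : D.word[l]? = some (cross j ε))
    (hA : AgreeOutside l 1 1 w w') (hb : bit w' l = !bit w l) :
    HasDegree 𝓡 (saddleMap h t D D l 1 1 j w w') (-1) := by
  obtain ⟨hl', hL⟩ := List.getElem?_eq_some_iff.mp hl
  have hD : D.word = D.word.take l ++ [cross j ε] ++ D.word.drop (l + 1) := by
    rw [← hL, List.append_assoc, List.singleton_append, List.cons_getElem_drop_succ,
      List.take_append_drop]
  let C := LocalChange.refl D _ _ _ hD
  have hk : C.pre.length = l := by simp [C, LocalChange.refl]; omega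
  have hw : j + 2 ≤ D.width C.pre.length := by rw [hk]; exact (D.width_cross hl).1
  have hw' : D.width (C.pre.length + C.mid.length) = D.width C.pre.length := by
    rw [hk]; exact (D.width_cross hl).2
  have hA' : C.Agree w w' := by rw [LocalChange.Agree, hk]; exact hA
  have h1 : ∀ u : Finset ℕ, ∀ g, transferWord u C.pre.length [cross j ε] g =
      smoothT j ε (bit u l) g := fun u g => by rw [transferWord_cross_cons, hk]; rfl
  by_cases hv : bit w l = !ε
  · have hv' : bit w' l = ε := by rw [hb, hv, Bool.not_not]
    refine (saddleMap_hasDegree hh ht hk rfl (n := 0) (C.isSaddle_of_vertical hA' (a := 0) (b := 0)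
      hw hw' (fun g => ?_) (fun g => ?_))).congr (by simp)
    · exact (h1 w g).trans (by simp [smoothT, hv])
    · exact (h1 w' g).trans (by simp [smoothT, hv', turnT])
  · have hv0 : bit w l = ε := by simpa using hv
    have hv' : bit w' l = !ε := by rw [hb, hv0]
    refine (saddleMap_hasDegree hh ht hk rfl (n := 0) (C.isSaddle_of_horizontal hA' (a := 0) (b := 0)
      hw hw' (fun g => ?_) (fun g => ?_))).congr (by simp)
    · exact (h1 w g).trans (by simp [smoothT, hv0, turnT])
    · exact (h1 w' g).trans (by simp [smoothT, hv'])

set_option maxHeartbeats 400000 in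
-- Crossing signs are unchanged by the move, so each nonzero component has to preserve the number of
-- `1`-resolutions and to have degree `0`. It is a composition of isotopies, saddles of degree `-1`,
-- and births or deaths of degree `1`, and in each case these cancel.
theorem slideEntry_degree {C : LocalChange D D'} (hA : C.Agree v v') {p q : ℕ} {a b : Bool}
    (hpq : q = p + 1 ∨ p = q + 1)
    (hm : C.mid = [cross p a, cross q b, cross p (!a)])
    (hm' : C.mid' = [cross q (!a), cross p b, cross q a])
    (hcc : ∀ b, crossCount b C.mid' (D.strands C.pre.length) =
      crossCount b C.mid (D.strands C.pre.length)) :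
    EntryDegree 𝓡 C (slideEntry h t p q a b D D' C.pre.length v v') 0 := by
  set k := C.pre.length with hk
  let C₁ := LocalChange.refl D _ _ _ C.word_eq
  let C₂ := LocalChange.refl D' _ _ _ C.word_eq'
  have hA : AgreeOutside k 3 3 v v' := by
    have := hA; rwa [LocalChange.Agree, hm, hm'] at this
  have agree : ∀ {u u'}, AgreeOutside k 3 3 u u' → C.Agree u u' := fun hu => by
    rw [LocalChange.Agree, hm, hm']; exact hu
  have agree₁ : ∀ {u u'}, AgreeOutside k 3 3 u u' → C₁.Agree u u' := fun hu => by
    change AgreeOutside k C.mid.length C.mid.length _ _; rw [hm]; exact hu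
  have agree₂ : ∀ {u u'}, AgreeOutside k 3 3 u u' → C₂.Agree u u' := fun hu => by
    change AgreeOutside k C.mid'.length C.mid'.length _ _; rw [hm']; exact hu
  have T : ∀ {u : Finset ℕ} {x}, bits3 u k = x → ∀ g, transferWord u k C.mid g =
      smoothT p a x.1 (smoothT q b x.2.1 (smoothT p (!a) x.2.2 g)) := fun hx g => by
    rw [hm, transferWord_three hx]
  have T' : ∀ {u : Finset ℕ} {x}, bits3 u k = x → ∀ g, transferWord u k C.mid' g =
      smoothT q (!a) x.1 (smoothT p b x.2.1 (smoothT q a x.2.2 g)) := fun hx g => by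
    rw [hm', transferWord_three hx]
  have hw : p + 2 ≤ D.width k ∧ q + 2 ≤ D.width k := by
    have r := C.run_mid
    rw [hm] at r
    rcases hpq with rfl | rfl
    · have := length_of_run_cross_pair r
      rw [width, hk]; omega
    · have := length_of_run_cross_pair' r
      rw [width, hk]; omega
  have hwp : D.width (k + C.mid.length) = D.width k := by
    refine C.width_post_of_crosses ?_
    rw [hm]
    exact List.forall_mem_cons.mpr ⟨⟨_, _, rfl⟩, List.forall_mem_cons.mpr ⟨⟨_, _, rfl⟩,
      List.forall_mem_cons.mpr ⟨⟨_, _, rfl⟩, by simp⟩⟩⟩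
  have hD : D.word[k + 1]? = some (cross q b) := by
    rw [C.getElem?_mid (by simp [hm]), hm]; rfl
  have hD' : D'.word[k + 1]? = some (cross p b) := by
    have : D'.word[k + 1]? = C.mid'[1]? := C.symm.getElem?_mid (by simp [LocalChange.symm, hm'])
    rw [this, hm']; rfl
  have hl : C.mid.length = 3 := by rw [hm]; rfl
  have iso : ∀ {u u'} x, AgreeOutside k 3 3 u u' → bits3 u k = x → bits3 u' k = x → x.2.1 = b →
      HasDegree 𝓡 (isoMap h t D D' k 3 3 u u') 0 := by
    intro u u' x hu hx hx' hb
    refine isoMap_hasDegree hh ht rfl (agree hu) (a := 0) (b := 0)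
      (O := transferWord u k C.mid) (fun g => by simp [hk]) fun g => ?_
    obtain ⟨x1, x2, x3⟩ := x
    subst hb
    rw [← hk, T' hx', T hx, pow_zero, one_smul]
    cases a <;> cases x1 <;> cases x2 <;> cases x3 <;>
      simp [smoothT, turnT_braid hpq, turnT_braid hpq.symm]
  -- The homological condition reduces to counting resolutions in the three layers, since `hcc`
  -- removes all crossing signs.
  have bits : ∀ {x y}, bits3 v k = x → bits3 v' k = y →
      (x.1.toNat + x.2.1.toNat + x.2.2.toNat : ℕ) = y.1.toNat + y.2.1.toNat + y.2.2.toNat →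
      ∀ {f : State h t D v →ₗ[R] State h t D' v'}, HasDegree 𝓡 f 0 → EntryDegree 𝓡 C f 0 := by
    rintro x y rfl rfl e f hf
    refine .inr ⟨0, hf, ?_, ?_⟩
    · rw [hcc, sub_self, hm, hm']
      simp only [bits3] at e
      simp only [bitSum, List.length_cons, List.length_nil, Finset.sum_range_succ,
        Finset.sum_range_zero, Nat.add_zero, ← hk]
      omega
    · rw [hcc, hcc]; ring
  have dS : ∀ {u u'}, AgreeOutside k 3 3 u u' → bits3 u k = (a, !b, !a) → bits3 u' k = (!a, !b, a) →
      HasDegree 𝓡 (deathSaddleMap h t D D k 3 3 p u u') 0 := by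
    intro u u' hu hx hx'
    refine (deathSaddleMap_hasDegree hh ht (C := C₁) (k := k) (m := 3) (m' := 3) rfl hl
      (C₁.isSaddle_of_horizontal (agree₁ hu) (a := 1) (b := 0) hw.1 hwp
        (fun g => (T hx g).trans ?_) fun g => (T hx' g).trans ?_)).congr (by simp)
    · cases a <;> simp only [smoothT] <;> simp [turnT_turnT] <;> rfl
    · cases a <;> simp [smoothT]
  have sd : ∀ {u u'}, AgreeOutside k 3 3 u u' → bits3 u k = (!a, !b, a) → bits3 u' k = (!a, !b, a) →
      HasDegree 𝓡 (saddleMap h t D D' k 3 3 q u u') 0 := by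
    intro u u' hu hx hx'
    refine (saddleMap_hasDegree hh ht rfl hl (C.isSaddle_of_vertical (agree hu) (a := 0) (b := 1)
      hw.2 hwp (fun g => (T hx g).trans ?_) fun g => (T' hx' g).trans ?_)).congr (by simp)
    · simp [smoothT]
    · cases a <;> simp only [smoothT] <;> simp [turnT_turnT] <;> rfl
  have hS := agreeOutside_setBits3 v k
  have hS' := fun x => hA.trans (agreeOutside_setBits3 v' k x)
  unfold slideEntry
  dsimp only
  split_ifs with h1 h2 h3 h4 h5 h6 h7 h8 h9
  · exact bits rfl h1.2 rfl (iso _ hA rfl h1.2 h1.1)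
  · refine bits h2.1 h2.2 (by dsimp only; omega) ?_
    refine isoMap_hasDegree hh ht rfl (agree hA) (a := 0) (b := 0) (O := id)
      (fun g => (T h2.1 g).trans ?_) (fun g => (T' h2.2 g).trans ?_) <;> simp [smoothT]
  · exact bits h3.1 h3.2 rfl (.zsmul (sd hA h3.1 h3.2) _)
  · refine bits h4.1 h4.2 rfl (.neg (.zsmul ?_ _))
    refine (deathSaddleMap_hasDegree hh ht (C := C) rfl hl
      (C.isSaddle_of_horizontal (agree hA) (a := 1) (b := 0) hw.1 hwp
        (fun g => (T h4.1 g).trans ?_) fun g => (T' h4.2 g).trans ?_)).congr (by simp)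
    · cases a <;> simp only [smoothT] <;> simp [turnT_turnT] <;> rfl
    · cases a <;> simp [smoothT]
  · refine bits h5.1 h5.2 (by dsimp only; omega) (.neg ?_)
    exact ((sd ((hS _).symm.trans hA) (bits3_setBits3 _ _ _) h5.2).comp
      (dS (hS _) h5.1 (bits3_setBits3 _ _ _))).congr (add_zero 0)
  -- Degrees `1` for the death, `-1` for the saddle at the middle crossing and `0` for the isotopy.
  -- In the three cases after this one a birth may take the place of the death, and the factors may
  -- lie on the other side of the move.
  · obtain ⟨rfl, hx, hy⟩ := h6
    refine bits hx hy (by cases a <;> rfl) (.neg ?_)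
    have f1 := deathMap_hasDegree hh ht (C := C₁) (k := k) (m := 3) (m' := 3) rfl (agree₁ (hS (false, false, false)))
      (a := 1) (b := 0) (O := turnT p) (fun g => (T hx g).trans (by
        cases a <;> simp only [smoothT] <;> simp [turnT_turnT]))
      fun g => (T (bits3_setBits3 _ _ _) g).trans (by cases a <;> simp [smoothT])
    have f2 := saddleMap_cross_hasDegree hh ht (h := h) (t := t) hD
      (agreeOutside_setBits3_mid v k false false false true) (by simp only [bit_setBits3_mid]; rfl)
    rw [← hy] at f2
    have f3 := iso (false, true, false) ((hS (bits3 v' k)).symm.trans hA)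
      ((bits3_setBits3 _ _ _).trans hy) hy rfl
    exact (f3.comp (f2.comp f1)).congr (by norm_num)
  · obtain ⟨rfl, hx, hy⟩ := h7
    refine bits hx hy (by cases a <;> rfl) (.neg ?_)
    have f1 := isoMap_hasDegree hh ht (C := C₁) (k := k) (m := 3) (m' := 3) rfl (agree₁ (hS (a, !true, !a))) (a := 0) (b := 1)
      (O := turnT p) (fun g => (T hx g).trans (by cases a <;> simp [smoothT]))
      fun g => (T (bits3_setBits3 _ _ _) g).trans (by
        cases a <;> simp only [smoothT] <;> simp [turnT_turnT])
    have f2 := saddleMap_cross_hasDegree hh ht (h := h) (t := t) hD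
      (agreeOutside_setBits3_mid v k a (!a) (!true) true) (by simp only [bit_setBits3_mid]; rfl)
    rw [← hy] at f2
    have f3 := iso _ ((hS (bits3 v' k)).symm.trans hA) ((bits3_setBits3 _ _ _).trans hy) hy rfl
    exact (f3.comp (f2.comp f1)).congr (by norm_num)
  · obtain ⟨rfl, hx, hy⟩ := h8
    refine bits hx hy (by cases a <;> rfl) ?_
    have f1 := iso _ (hS' (bits3 v k)) hx ((bits3_setBits3 _ _ _).trans hx) rfl
    have f2 := saddleMap_cross_hasDegree hh ht (h := h) (t := t) hD'
      (agreeOutside_setBits3_mid v' k (!a) a false (!false)) (by simp only [bit_setBits3_mid])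
    rw [← hx] at f2
    have f3 := deathMap_hasDegree hh ht (C := C₂) (k := k) (m := 3) (m' := 3) rfl
      (agree₂ ((hS' (!a, !false, a)).symm.trans hA)) (a := 1) (b := 0) (O := turnT q)
      (fun g => (T' (bits3_setBits3 _ _ _) g).trans (by
        cases a <;> simp only [smoothT] <;> simp [turnT_turnT]))
      fun g => (T' hy g).trans (by cases a <;> simp [smoothT])
    exact (f3.comp (f2.comp f1)).congr (by norm_num)
  · obtain ⟨rfl, hx, hy⟩ := h9
    refine bits hx hy (by cases a <;> rfl) ?_
    have f1 := iso _ (hS' (bits3 v k)) hx ((bits3_setBits3 _ _ _).trans hx) rfl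
    have f2 := saddleMap_cross_hasDegree hh ht (h := h) (t := t) hD'
      (agreeOutside_setBits3_mid v' k true true false true) (by simp only [bit_setBits3_mid]; rfl)
    rw [← hx] at f2
    have f3 := isoMap_hasDegree hh ht (C := C₂) (k := k) (m := 3) (m' := 3) rfl
      (agree₂ ((hS' (true, true, true)).symm.trans hA)) (a := 0) (b := 1) (O := turnT q)
      (fun g => (T' (bits3_setBits3 _ _ _) g).trans (by cases a <;> simp [smoothT]))
      fun g => (T' hy g).trans (by cases a <;> simp only [smoothT] <;> simp [turnT_turnT])
    exact (f3.comp (f2.comp f1)).congr (by norm_num)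
  · exact .inl rfl

end

end ImmersedKhovanov

namespace ImmersedKhovanov

open Diagram

noncomputable section

/-! ### The bidegree of the map of a cobordism -/

/-- The change of the diagram in an elementary cobordism. -/
def Step.change {D D' : Diagram} (S : Step D D') : LocalChange D D' :=
  ⟨S.pre, S.move.source, S.move.target, S.post, S.source_eq, S.target_eq, S.oriented⟩

variable {R : Type*} [CommRing R] {h t : R} {D D' : Diagram} {v v' : Finset ℕ}

theorem Vertex.subset (v : D.Vertex) : v.1 ⊆ D.crossings := Finset.mem_powerset.mp v.2

/-- The degree of the map of an elementary cobordism in the balanced theory. -/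
def Step.degree (S : Step D D') : ℤ :=
  S.move.euler - 2 * (if S.doublePoint = some false then 1 else 0)

open Classical in
theorem Step.map_apply (S : Step D D') (z : Fin 2) (x : CKh h t D) (v' : D'.Vertex) :
    S.map h t z x v' = ∑ v : D.Vertex,
      if S.change.Agree v.1 v'.1 then
        (-1 : ℤ) ^ ((v.1.filter fun l => S.change.pre.length + S.change.mid.length ≤ l).card *
          (v.1.card + v'.1.card)) •
          S.move.entry h t z D D' S.change.pre.length v.1 v'.1 (x v)
      else 0 := by
  simp only [Step.map, LinearMap.pi_apply, LinearMap.coe_sum, Finset.sum_apply]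
  refine Finset.sum_congr rfl fun v _ => ?_
  split_ifs with h1 h2 h2
  · rfl
  · exact absurd h1 h2
  · exact absurd h2 h1
  · rfl

section Graded

variable {𝓡 : ℤ → AddSubgroup R}

theorem single_mem_homogeneousChains {v : D.Vertex} {d i j : ℤ} {y : State h t D v}
    (hy : y ∈ gradedState h t 𝓡 D v d) (hi : (v.1.card : ℤ) - D.numNeg = i)
    (hj : d + numCircles D v + v.1.card + D.numPos - 2 * D.numNeg = j) :
    LinearMap.single R (fun v : D.Vertex => State h t D v) v y ∈ homogeneousChains h t 𝓡 D i j := by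
  induction hy using AddSubgroup.closure_induction with
  | mem x hx =>
    obtain ⟨s, n, r, hr, rfl, rfl⟩ := hx
    refine AddSubgroup.subset_closure ⟨v, s, n, r, hr, hi, ?_, ?_⟩
    · rw [← hj]; ring
    · congr!
  | zero => rw [map_zero]; exact zero_mem _
  | add x y _ _ hx hy => rw [map_add]; exact add_mem hx hy
  | neg x _ hx => rw [map_neg]; exact neg_mem hx

variable [GradedRing 𝓡] (hh : h ∈ 𝓡 (-2)) (ht : t ∈ 𝓡 (-4))

include hh ht

theorem Step.entry_degree (S : Step D D') (hA : S.change.Agree v v') (hv : v ⊆ D.crossings)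
    (hv' : v' ⊆ D'.crossings) :
    EntryDegree 𝓡 S.change (S.move.entry h t (if S.doublePoint = some true then 0 else 1) D D'
      S.change.pre.length v v') S.degree := by
  have flat : ∀ {n : ℤ}, S.move.euler = n → S.doublePoint = none → S.degree = n := by
    intro n h1 h2; rw [Step.degree, h1, h2]; simp
  rcases hS : S.move with ⟨σ, τ, i, g, r⟩ | ⟨u, u', hu⟩ | ⟨r, i, d, ε⟩ | ⟨r, i, d, ε⟩ | ⟨i, ε⟩ |
    ⟨i, ε⟩ | ⟨i, r, a, b⟩ | ⟨i, d⟩ | ⟨i, d⟩ | ⟨i, d⟩ | ⟨i, d⟩ | ⟨i, ε, dir⟩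
  all_goals
    have hm : S.change.mid = S.move.source := rfl
    have hm' : S.change.mid' = S.move.target := rfl
    rw [hS] at hm hm'
  on_goal 12 =>
    have hs : S.doublePoint = some (!D.isPositive S.pre.length) := by
      rw [Step.doublePoint, hS]
    have := crossingChange_degree hh ht hA (dir := dir) (s := !D.isPositive S.pre.length) hm hm'
      (by simp only [Bool.not_not]; rfl)
    convert this using 1
    · rw [hs]; simp
    · rw [Step.degree, hS, hs]; cases D.isPositive S.pre.length <;> simp [Move.euler]
  all_goals
    have hn : S.doublePoint = none := by rw [Step.doublePoint, hS]
    have hf := fun n e => flat (n := n) e hn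
    rw [hS] at hf
    rw [hf _ rfl]
  · exact exchange_degree hh ht hA _ r hm hm'
  · exact isotopy_degree hh ht hA hv hv' hu _ hm hm'
  · exact kink_degree hh ht hA hv' _ hm hm'
  · exact unkink_degree hh ht hA hv _ hm hm'
  · exact poke_degree hh ht hA _ hm hm'
  · exact unpoke_degree hh ht hA _ hm hm'
  · have r1 := S.change.run_mid
    have r2 := S.change.run_mid'
    cases r
    · refine slideEntry_degree hh ht hA (.inl rfl) hm hm' fun c => ?_
      rw [hm] at r1 ⊢
      rw [hm']
      exact crossCount_slide r1 c
    · refine slideEntry_degree hh ht hA (.inr rfl) hm hm' fun c => ?_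
      rw [hm'] at r2 ⊢
      rw [hm]
      -- The mirrored move is the inverse of the unmirrored one with `a` negated.
      have := crossCount_slide (a := !a) (c := b) (i := i) (by rw [Bool.not_not]; exact r2) c
      simp only [Bool.not_not] at this
      exact this.symm
  · exact birth_degree hh ht hA hv hv' _ hm hm'
  · exact death_degree hh ht hA hv hv' _ hm hm'
  · exact saddle_degree hh ht hA hv hv' _ hm hm'
  · exact unsaddle_degree hh ht hA hv hv' _ hm hm'

/-- It suffices to treat a generator at one vertex and one component of the map. The global numbers
`|v|`, `n₊` and `n₋` change only by their local contributions, which are controlled by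
`Step.entry_degree`. -/
theorem Step.map_mem_homogeneousChains (S : Step D D') {i j : ℤ} {x : CKh h t D}
    (hx : x ∈ homogeneousChains h t 𝓡 D i j) :
    S.map h t (if S.doublePoint = some true then 0 else 1) x ∈
      homogeneousChains h t 𝓡 D' i (j + S.degree) := by
  classical
  induction hx using AddSubgroup.closure_induction with
  | zero => rw [map_zero]; exact zero_mem _
  | add x y _ _ hx hy => rw [map_add]; exact add_mem hx hy
  | neg x _ hx => rw [map_neg]; exact neg_mem hx
  | mem x hx =>
    obtain ⟨v, s, n, r, hr, hi, hj, rfl⟩ := hx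
    have hy := smul_monomial_mem_gradedState (h := h) (t := t) hr s
    set y := r • monomial h t D v s
    set Y := LinearMap.single R (fun v : D.Vertex => State h t D v) v y with hY
    set z : Fin 2 := if S.doublePoint = some true then 0 else 1 with hz
    have hsum : S.map h t z Y = ∑ v' : D'.Vertex,
        LinearMap.single R (fun v : D'.Vertex => State h t D' v) v' (S.map h t z Y v') := by
      funext v'
      simp [Finset.sum_apply]
    rw [hsum]
    refine sum_mem fun v' _ => ?_
    rw [Step.map_apply, map_sum]
    refine sum_mem fun v₀ _ => ?_
    split_ifs with hA
    swap
    · rw [map_zero]; exact zero_mem _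
    rw [map_zsmul]
    refine zsmul_mem ?_ _
    by_cases hv : v₀ = v
    swap
    · have : Y v₀ = 0 := by simp [hY, hv]
      rw [this, map_zero, map_zero]; exact zero_mem _
    subst hv
    have hYv : Y v₀ = y := by simp [hY]
    rw [hYv]
    rcases S.entry_degree hh ht hA (Vertex.subset v₀) (Vertex.subset v') with h0 | ⟨δ, hδ, e1, e2⟩
    · rw [← hz] at h0
      rw [h0, LinearMap.zero_apply, map_zero]; exact zero_mem _
    · have c := hA.card
      have p := S.change.crossCount true
      have q := S.change.crossCount false
      rw [← numPos_eq, ← numPos_eq] at p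
      rw [← numNeg_eq, ← numNeg_eq] at q
      refine single_mem_homogeneousChains (hδ _ _ hy) ?_ ?_
      · omega
      · simp only [numCircles]
        omega

end Graded

end

end ImmersedKhovanov

/-! ### Linearity of local maps over dots at outer points. -/

namespace ImmersedKhovanov

open Diagram

noncomputable section

/-! ### Extending labels over local changes -/

/-- The values are natural numbers, so nothing cancels: a nonzero value is witnessed by a single
labelling, and conversely any labelling makes the value nonzero. Identities of operators therefore
imply existence of labellings. -/
theorem exists_path_of_transferWord {v : Finset ℕ} {k : ℕ} {w : List Layer} {g : Row → ℕ} {y : Row}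
    (h : transferWord v k w g y ≠ 0) : ∃ f : ℕ → Row, f 0 = y ∧
      (∀ j L, w[j]? = some L → f (j + 1) ∈ outs L (bit v (k + j)) (f j)) ∧ g (f w.length) ≠ 0 := by
  induction w generalizing k y with
  | nil => exact ⟨fun _ => y, rfl, by simp, h⟩
  | cons L w ih =>
    obtain ⟨z, hz, h⟩ := Finset.exists_ne_zero_of_sum_ne_zero h
    obtain ⟨f, rfl, h1, h2⟩ := ih h
    refine ⟨consRow y f, rfl, ?_, h2⟩
    rintro (_ | j) L' hL
    · simp only [List.getElem?_cons_zero, Option.some.injEq] at hL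
      subst hL; exact hz
    · have := h1 j L' (by simpa using hL)
      rwa [show k + 1 + j = k + (j + 1) by omega] at this

theorem transferWord_ne_zero_of_path {v : Finset ℕ} {k : ℕ} {w : List Layer} {g : Row → ℕ}
    {f : ℕ → Row} (h : ∀ j L, w[j]? = some L → f (j + 1) ∈ outs L (bit v (k + j)) (f j))
    (hg : g (f w.length) ≠ 0) : transferWord v k w g (f 0) ≠ 0 := by
  induction w generalizing k f with
  | nil => exact hg
  | cons L w ih =>
    have h0 := h 0 L rfl
    refine fun hz => ih (k := k + 1) (f := fun j => f (j + 1)) (fun j L' hL => ?_) hg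
      (Finset.sum_eq_zero_iff.mp hz _ h0)
    have := h (j + 1) L' (by simpa using hL)
    rwa [show k + (j + 1) = k + 1 + j by omega] at this

namespace LocalChange

variable {D D' : Diagram} {v v' : Finset ℕ} (C : LocalChange D D')

theorem length_word : D.word.length = C.pre.length + C.mid.length + C.post.length := by
  rw [C.word_eq]; simp [add_assoc]

/-- Two labellings agree at corresponding outer points. -/
def OuterEq (f f' : ℕ → Row) : Prop :=
  (∀ l ≤ C.pre.length, f l = f' l) ∧
    ∀ l, f (C.pre.length + C.mid.length + l) = f' (C.pre.length + C.mid'.length + l)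

variable {C} in
theorem OuterEq.apply {f f' : ℕ → Row} (h : C.OuterEq f f') {p : ℕ × ℕ}
    (hp : IsOuter C.pre.length C.mid.length p) {q : ℕ × ℕ}
    (hq : q = transport C.pre.length C.mid.length C.mid'.length p) : f p.1 p.2 = f' q.1 q.2 := by
  subst hq
  unfold transport
  split_ifs with hl
  · rw [h.1 _ hl]
  · obtain ⟨l, hl'⟩ := Nat.exists_eq_add_of_le (hp.resolve_left hl)
    have := h.2 l
    simp only
    rw [hl', this, show C.pre.length + C.mid.length + l - C.mid.length + C.mid'.length =
      C.pre.length + C.mid'.length + l by omega]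

/-- Extension of a labelling of the outer part by a labelling of the inner part. -/
theorem exists_label_of_path (hA : C.Agree v v') {f' : ℕ → Row} (hf' : f' ∈ D'.labels v')
    {g : ℕ → Row} (h0 : g 0 = f' C.pre.length)
    (hg : ∀ j L, C.mid[j]? = some L → g (j + 1) ∈ outs L (bit v (C.pre.length + j)) (g j))
    (hm : g C.mid.length = f' (C.pre.length + C.mid'.length)) :
    ∃ f ∈ D.labels v, C.OuterEq f f' ∧ ∀ j ≤ C.mid.length, f (C.pre.length + j) = g j := by
  obtain ⟨a0, a1, a2⟩ := mem_labels_iff.mp hf'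
  have len := C.length_word
  have len' := C.symm.length_word
  simp only [symm] at len'
  have e1 := fun l => C.getElem?_pre (l := l)
  have e2 := fun l => C.getElem?_mid (l := l)
  have e3 := C.getElem?_post
  have e1' : ∀ l, l < C.pre.length → D'.word[l]? = C.pre[l]? := fun l => C.symm.getElem?_pre
  have e3' : ∀ l, D'.word[C.pre.length + C.mid'.length + l]? = C.post[l]? := C.symm.getElem?_post
  obtain ⟨A1, A2⟩ := hA
  unfold OuterEq
  generalize C.pre.length = k at *
  generalize hM : C.mid.length = m at *
  generalize C.mid'.length = m' at *
  set f : ℕ → Row := fun l => if l ≤ k then f' l else if l < k + m then g (l - k)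
    else f' (l - m + m') with hf
  have f1 : ∀ l ≤ k, f l = f' l := fun l hl => if_pos hl
  have f2 : ∀ j ≤ m, f (k + j) = g j := by
    intro j hj
    rcases Nat.eq_zero_or_pos j with rfl | hj0
    · rw [h0]; exact f1 _ le_rfl
    · simp only [hf]
      rw [if_neg (by omega)]
      split_ifs with hjm
      · congr 1; omega
      · obtain rfl : j = m := by omega
        rw [hm]; congr 1; omega
  have f3 : ∀ l, f (k + m + l) = f' (k + m' + l) := by
    intro l
    rcases Nat.eq_zero_or_pos l with rfl | hl
    · rw [add_zero, f2 m le_rfl, hm, add_zero]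
    · simp only [hf]
      rw [if_neg (by omega), if_neg (by omega)]
      congr 1; omega
  refine ⟨f, mem_labels_iff.mpr ⟨?_, ?_, ?_⟩, ⟨?_, ?_⟩, ?_⟩
  · rw [f1 0 (by omega), a0]
  · intro l L hL
    rcases Nat.lt_or_ge l k with hl | hl
    · rw [f1 _ (by omega), f1 _ (by omega), bit_congr (A1 l hl)]
      exact a1 l L (by rw [e1' l hl, ← e1 l hl, hL])
    obtain ⟨j, rfl⟩ := Nat.exists_eq_add_of_le hl
    rcases Nat.lt_or_ge j m with hj | hj
    · rw [f2 j (by omega), show k + j + 1 = k + (j + 1) by omega, f2 (j + 1) (by omega)]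
      exact hg j L (by rw [← e2 j hj, hL])
    obtain ⟨j, rfl⟩ := Nat.exists_eq_add_of_le hj
    rw [← add_assoc] at hL ⊢
    rw [f3 j, show k + m + j + 1 = k + m + (j + 1) by omega, f3 (j + 1), bit_congr (A2 j)]
    exact a1 (k + m' + j) L (by rw [e3', ← e3, hL])
  · intro l hl
    obtain ⟨j, rfl⟩ := Nat.exists_eq_add_of_le (show k + m ≤ l by omega)
    rw [f3, a2 _ (by omega)]
  · exact f1
  · exact f3
  · exact f2

/-- Labellings extend over a local change if the inner part of the new diagram admits some
labelling with the same ends. -/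
theorem exists_label (hA : C.Agree v v') {f' : ℕ → Row} (hf' : f' ∈ D'.labels v')
    {g : Row → ℕ} (hg : ∀ y, g y ≠ 0 → y = f' (C.pre.length + C.mid'.length))
    (h : transferWord v C.pre.length C.mid g (f' C.pre.length) ≠ 0) :
    ∃ f ∈ D.labels v, C.OuterEq f f' := by
  obtain ⟨p, h0, h1, h2⟩ := exists_path_of_transferWord h
  obtain ⟨f, hf, ho, -⟩ := C.exists_label_of_path hA hf' h0 h1 (hg _ h2)
  exact ⟨f, hf, ho⟩

theorem transferWord_mid'_ne_zero {f' : ℕ → Row} (hf' : f' ∈ D'.labels v') {g : Row → ℕ}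
    (hg : g (f' (C.pre.length + C.mid'.length)) ≠ 0) :
    transferWord v' C.pre.length C.mid' g (f' C.pre.length) ≠ 0 := by
  refine transferWord_ne_zero_of_path (f := fun j => f' (C.pre.length + j)) (fun j L hL => ?_) hg
  refine (mem_labels_iff.mp hf').2.1 _ L ?_
  rw [← hL]
  exact C.symm.getElem?_mid (List.getElem?_eq_some_iff.mp hL).1

/-- The two inner parts have the same operator up to powers of two. So if one of them has a
labelling with given rows at both ends, then so has the other, and it can be glued to the outer
part. -/
theorem exists_label_of_eq (hA : C.Agree v v') {a b : ℕ} {O : (Row → ℕ) → Row → ℕ}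
    (h1 : ∀ g, transferWord v C.pre.length C.mid g = 2 ^ a • O g)
    (h2 : ∀ g, transferWord v' C.pre.length C.mid' g = 2 ^ b • O g) :
    ∀ f' ∈ D'.labels v', ∃ f ∈ D.labels v, C.OuterEq f f' := by
  intro f' hf'
  -- The test function is the indicator of the prescribed lower row.
  have := C.transferWord_mid'_ne_zero hf'
    (g := fun y => if y = f' (C.pre.length + C.mid'.length) then 1 else 0) (by simp)
  refine C.exists_label hA hf'
    (g := fun y => if y = f' (C.pre.length + C.mid'.length) then 1 else 0) (by simp) ?_
  rw [h2] at this
  rw [h1]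
  simp only [Pi.smul_apply, smul_eq_mul, ne_eq, mul_eq_zero, not_or] at this ⊢
  exact ⟨by positivity, this.2⟩

/-- In a change between the vertical and the horizontal smoothing of the strands `i`, `i + 1`,
labellings extend if their values at the ends on both arcs coincide. -/
theorem exists_label_of_vertical (hA : C.Agree v v') {a b i : ℕ}
    (h1 : ∀ g, transferWord v C.pre.length C.mid g = 2 ^ a • g)
    (h2 : ∀ g, transferWord v' C.pre.length C.mid' g = 2 ^ b • capT i (cupT i g)) :
    ∀ f' ∈ D'.labels v', f' C.pre.length i = f' (C.pre.length + C.mid'.length) (i + 1) →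
      ∃ f ∈ D.labels v, C.OuterEq f f' := by
  intro f' hf' he
  have := C.transferWord_mid'_ne_zero hf'
    (g := fun z => if f' C.pre.length i = z (i + 1) then
      (if z = f' (C.pre.length + C.mid'.length) then 1 else 0) else 0) (by simp [he])
  refine C.exists_label hA hf'
    (g := fun y => if y = f' (C.pre.length + C.mid'.length) then 1 else 0) (by simp) ?_
  rw [h2, Pi.smul_apply, capT_cupT_cond] at this
  rw [h1]
  simp only [Pi.smul_apply, smul_eq_mul, ne_eq, mul_eq_zero, not_or] at this ⊢
  exact ⟨by positivity, fun h0 => this.2 (by rw [h0, ite_self])⟩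

/-- In the new vertical smoothing the upper and the lower row coincide. The assumed equality
therefore says that the labels at `i` and `i + 1` agree, which is what both arcs of the horizontal
smoothing need. -/
theorem exists_label_of_horizontal (hA : C.Agree v v') {a b i : ℕ}
    (h1 : ∀ g, transferWord v C.pre.length C.mid g = 2 ^ a • capT i (cupT i g))
    (h2 : ∀ g, transferWord v' C.pre.length C.mid' g = 2 ^ b • g) :
    ∀ f' ∈ D'.labels v', f' C.pre.length i = f' (C.pre.length + C.mid'.length) (i + 1) →
      ∃ f ∈ D.labels v, C.OuterEq f f' := by
  intro f' hf' he
  have := C.transferWord_mid'_ne_zero hf'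
    (g := fun z => if z = f' (C.pre.length + C.mid'.length) then 1 else 0) (by simp)
  rw [h2] at this
  simp only [Pi.smul_apply, smul_eq_mul, ne_eq, mul_eq_zero, not_or] at this
  have hyz : f' C.pre.length = f' (C.pre.length + C.mid'.length) := by
    by_contra hne; exact this.2 (if_neg hne)
  refine C.exists_label hA hf'
    (g := fun z => if f' C.pre.length i = z (i + 1) then
      (if z = f' (C.pre.length + C.mid'.length) then 1 else 0) else 0) (by simp) ?_
  rw [h1, Pi.smul_apply, capT_cupT_cond, if_pos (by rw [hyz] at he ⊢; exact he), if_pos hyz]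
  simp

/-! ### Outer points -/

theorem strands_of_le_pre {l : ℕ} (hl : l ≤ C.pre.length) : D'.strands l = D.strands l := by
  simp only [strands, C.word_eq, C.word_eq', List.append_assoc]
  rw [List.take_append_of_le_length hl, List.take_append_of_le_length hl]

theorem strands_post_add (l : ℕ) : D'.strands (C.pre.length + C.mid'.length + l) =
    D.strands (C.pre.length + C.mid.length + l) := by
  have h : ∀ {D : Diagram} {u m w : List Layer}, D.word = u ++ m ++ w →
      run (w.take l) (D.strands (u.length + m.length)) =
        some (D.strands (u.length + m.length + l)) := by
    intro D u m w hD
    have h1 := D.run_take (u.length + m.length + l)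
    rw [hD, ← List.length_append, List.take_length_add_append] at h1
    obtain ⟨r, hr, h1⟩ := run_append_eq_some.mp h1
    have h2 := D.run_take (u.length + m.length)
    rw [hD, ← List.length_append, List.take_left, hr, Option.some.injEq] at h2
    subst h2
    rw [List.length_append] at h1
    exact h1
  have a := h C.word_eq
  have b := h C.word_eq'
  rw [C.strands_post, a] at b
  simpa using b.symm

theorem inRange_transport {p : ℕ × ℕ} (hp : D.InRange p)
    (ho : IsOuter C.pre.length C.mid.length p) :
    D'.InRange (transport C.pre.length C.mid.length C.mid'.length p) := by
  rw [Diagram.inRange_iff] at hp ⊢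
  unfold transport
  split_ifs with hl
  · rwa [width, C.strands_of_le_pre hl]
  · obtain ⟨l, hl'⟩ := Nat.exists_eq_add_of_le (ho.resolve_left hl)
    have := C.strands_post_add l
    simp only [width] at hp ⊢
    rw [hl'] at hp ⊢
    rwa [show C.pre.length + C.mid.length + l - C.mid.length + C.mid'.length =
      C.pre.length + C.mid'.length + l by omega, this]

/-! ### Local maps are linear over outer dots -/

variable {R : Type*} [CommRing R] (h t : R)

/-- Linear maps that commute with dots at outer points. -/
def DotLinear (v v' : Finset ℕ) (F : State h t D v →ₗ[R] State h t D' v') : Prop :=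
  ∀ p, D.InRange p → IsOuter C.pre.length C.mid.length p → ∀ x,
    F (dot h t D v p * x) =
      dot h t D' v' (transport C.pre.length C.mid.length C.mid'.length p) * F x

variable {h t C}

/-- If all colourings of the new resolution extend to the old one, then outer points on one old
circle cannot be separated by a new colouring. They lie on one new circle, and their transported
dots agree. -/
theorem dotLinear_of_extension {k m m' : ℕ} (hk : C.pre.length = k) (hm : C.mid.length = m)
    (hm' : C.mid'.length = m') (H : ∀ f' ∈ D'.labels v', ∃ f ∈ D.labels v, C.OuterEq f f')
    (e e' : State h t D' v') : C.DotLinear h t v v' (localMap h t D D' k m m' v v' e e') := by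
  subst hk hm hm'
  intro p hp ho x
  refine localMap_dot_mul h t _ _ _ (fun p hp ho => C.inRange_transport hp ho) ?_ hp ho x
  intro p q hp hq hpo hqo hpq
  have : dot h t D' v' (transport C.pre.length C.mid.length C.mid'.length p) =
      dot h t D' v' (transport C.pre.length C.mid.length C.mid'.length q) := by
    refine dot_eq_of_labels h t (C.inRange_transport hp hpo) (C.inRange_transport hq hqo) ?_
    intro f' hf'
    obtain ⟨f, hf, ho⟩ := H f' hf'
    rw [← ho.apply hpo rfl, ← ho.apply hqo rfl, hpq f hf]
  rw [this]
  exact ⟨rfl, rfl⟩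

/-- The difference of the dots on two circles is annihilated by the neck-cutting element. -/
theorem dot_mul_neck {a b p q : ℕ × ℕ} (ha : D.InRange a) (hb : D.InRange b) (hp : D.InRange p)
    (hq : D.InRange q)
    (H : ∀ f ∈ D.labels v, f a.1 a.2 = f b.1 b.2 → f p.1 p.2 = f q.1 q.2) :
    dot h t D v p * (dot h t D v a + dot h t D v b - algebraMap R _ h) =
      dot h t D v q * (dot h t D v a + dot h t D v b - algebraMap R _ h) := by
  obtain ⟨a, rfl⟩ := ha.exists_point
  obtain ⟨b, rfl⟩ := hb.exists_point
  obtain ⟨p, rfl⟩ := hp.exists_point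
  obtain ⟨q, rfl⟩ := hq.exists_point
  have key : ∀ F : Circle D v → Bool, F (circleOf D v a) = F (circleOf D v b) →
      F (circleOf D v p) = F (circleOf D v q) := fun F hF => by
    have := H _ (toLabel_mem F)
    simp only [toLabel_coords] at this
    exact this hF
  have sa := dot_sq h t (v := v) ha
  have sb := dot_sq h t (v := v) hb
  simp only [dot_coords] at sa sb ⊢
  generalize circleOf D v a = ca at *
  generalize circleOf D v b = cb at *
  generalize circleOf D v p = cp at *
  generalize circleOf D v q = cq at *
  by_cases hpq : cp = cq
  · rw [hpq]
  have k1 := key fun c => decide (c = cp)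
  have k2 := key fun c => decide (c = cq)
  have hqp : cq ≠ cp := fun h => hpq h.symm
  simp only [decide_true, hqp, hpq, decide_false, Bool.true_eq_false, Bool.false_eq_true, imp_false,
    decide_eq_decide] at k1 k2
  -- Testing the hypothesis on the colourings that mark only the circle of `p` or only that of `q`
  -- shows that these two circles are those of `a` and `b`, in some order.
  have : (ca = cp ∧ cb = cq) ∨ (ca = cq ∧ cb = cp) := by
    by_cases h1 : ca = cp <;> by_cases h2 : cb = cp <;> by_cases h3 : ca = cq <;>
      by_cases h4 : cb = cq <;> simp_all
  rcases this with ⟨rfl, rfl⟩ | ⟨rfl, rfl⟩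
  -- `(X_a - X_b)(X_a + X_b - h)` equals `(X_a² - h X_a) - (X_b² - h X_b) = t - t = 0`.
  · linear_combination sa - sb
  · linear_combination sb - sa

/-- If the saddle splits a circle, two outer points of that circle may be separated, but the
difference of their dots is annihilated by the neck-cutting value. If the ends are not joined
before, `hS` says that they are joined afterwards; then every new colouring satisfies the condition
in `H` and extends. That one of these alternatives holds is planarity, from `LocalChange.saddle`. -/
theorem dotLinear_saddle {k m m' i : ℕ} (hk : C.pre.length = k) (hm : C.mid.length = m)
    (hm' : C.mid'.length = m') (hi : D'.InRange (k, i)) (hi' : D'.InRange (k + m', i + 1))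
    (H : ∀ f' ∈ D'.labels v', f' k i = f' (k + m') (i + 1) → ∃ f ∈ D.labels v, C.OuterEq f f')
    (hS : Connected D v (k, i) (k + m, i + 1) ∨ Connected D' v' (k, i) (k + m', i + 1)) :
    C.DotLinear h t v v' (saddleMap h t D D' k m m' i v v') ∧
    C.DotLinear h t v v' (deathSaddleMap h t D D' k m m' i v v') := by
  subst hk hm hm'
  have key : ∀ p q, D.InRange p → D.InRange q → IsOuter C.pre.length C.mid.length p →
      IsOuter C.pre.length C.mid.length q →
      (∀ f ∈ D.labels v, f p.1 p.2 = f q.1 q.2) →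
      dot h t D' v' (transport C.pre.length C.mid.length C.mid'.length p) *
          saddleValue h t D D' C.pre.length C.mid.length C.mid'.length i v v' =
        dot h t D' v' (transport C.pre.length C.mid.length C.mid'.length q) *
          saddleValue h t D D' C.pre.length C.mid.length C.mid'.length i v v' := by
    intro p q hp hq hpo hqo hpq
    have H' : ∀ f' ∈ D'.labels v',
        f' C.pre.length i = f' (C.pre.length + C.mid'.length) (i + 1) →
        f' (transport C.pre.length C.mid.length C.mid'.length p).1
            (transport C.pre.length C.mid.length C.mid'.length p).2 =
          f' (transport C.pre.length C.mid.length C.mid'.length q).1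
            (transport C.pre.length C.mid.length C.mid'.length q).2 := by
      intro f' hf' he
      obtain ⟨f, hf, ho⟩ := H f' hf' he
      rw [← ho.apply hpo rfl, ← ho.apply hqo rfl, hpq f hf]
    unfold saddleValue
    split_ifs with hc
    · exact dot_mul_neck hi hi' (C.inRange_transport hp hpo) (C.inRange_transport hq hqo) H'
    · have hc' := hS.resolve_left hc
      rw [mul_one, mul_one]
      refine dot_eq_of_labels h t (C.inRange_transport hp hpo) (C.inRange_transport hq hqo)
        fun f' hf' => H' f' hf' ?_
      obtain ⟨a, ha⟩ := hi.exists_point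
      obtain ⟨b, hb⟩ := hi'.exists_point
      rw [← ha, ← hb, connected_iff, circleOf_eq_iff, ha, hb] at hc'
      exact hc' f' hf'
  constructor <;> intro p hp ho x <;>
    refine localMap_dot_mul h t _ _ _ (fun p hp ho => C.inRange_transport hp ho) ?_ hp ho x
  · exact fun p q hp hq hpo hqo hpq => ⟨key p q hp hq hpo hqo hpq, by simp⟩
  · exact fun p q hp hq hpo hqo hpq => ⟨by simp, key p q hp hq hpo hqo hpq⟩

end LocalChange

end

end ImmersedKhovanov

/-! ### Vertices over a given vertex, single components of chain maps, and insertions as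
multiplications. -/

namespace ImmersedKhovanov

open Diagram

noncomputable section

/-! ### Vertices of the cube after an insertion of layers -/

open Classical in
/-- The vertex that arises from `v` by an insertion of `m` layers at index `k` with resolutions `β`. -/
def insBits (k m : ℕ) (v : Finset ℕ) (β : ℕ → Bool) : Finset ℕ :=
  v.filter (fun l => l < k) ∪ (((Finset.range m).filter fun j => β j = true).image (fun j => k + j) ∪
    (v.filter fun l => k ≤ l).image (fun l => l + m))

theorem mem_insBits {k m : ℕ} {v : Finset ℕ} {β : ℕ → Bool} {l : ℕ} : l ∈ insBits k m v β ↔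
    (l < k ∧ l ∈ v) ∨ (∃ j < m, l = k + j ∧ β j = true) ∨ ∃ j, l = k + m + j ∧ k + j ∈ v := by
  simp only [insBits, Finset.mem_union, Finset.mem_filter, Finset.mem_image, Finset.mem_range]
  constructor
  · rintro (⟨h1, h2⟩ | ⟨j, ⟨h1, h2⟩, rfl⟩ | ⟨j, ⟨h1, h2⟩, rfl⟩)
    · exact .inl ⟨h2, h1⟩
    · exact .inr (.inl ⟨j, h1, rfl, h2⟩)
    · obtain ⟨j, rfl⟩ := Nat.exists_eq_add_of_le h2
      exact .inr (.inr ⟨j, by omega, h1⟩)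
  · rintro (⟨h1, h2⟩ | ⟨j, h1, rfl, h2⟩ | ⟨j, rfl, h1⟩)
    · exact .inl ⟨h2, h1⟩
    · exact .inr (.inl ⟨j, ⟨h1, h2⟩, rfl⟩)
    · exact .inr (.inr ⟨k + j, ⟨h1, by omega⟩, by omega⟩)

theorem agreeOutside_insBits (k m : ℕ) (v : Finset ℕ) (β : ℕ → Bool) :
    AgreeOutside k 0 m v (insBits k m v β) := by
  refine ⟨fun l hl => ?_, fun l => ?_⟩ <;> rw [mem_insBits] <;> constructor
  · exact fun h => .inl ⟨hl, h⟩
  · rintro (h | ⟨j, _, h, _⟩ | ⟨j, h, _⟩)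
    · exact h.2
    all_goals omega
  · exact fun h => .inr (.inr ⟨l, rfl, by simpa using h⟩)
  · rintro (h | ⟨j, _, h, _⟩ | ⟨j, h, h'⟩)
    · omega
    · omega
    · obtain rfl : l = j := by omega
      simpa using h'

theorem bit_insBits {k m j : ℕ} (v : Finset ℕ) (β : ℕ → Bool) (hj : j < m) :
    bit (insBits k m v β) (k + j) = β j := by
  rw [bit_eq]
  cases h : β j
  · rw [decide_eq_false_iff_not, mem_insBits]
    rintro (h' | ⟨j', _, h', h''⟩ | ⟨j', h', _⟩)
    · omega
    · obtain rfl : j = j' := by omega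
      rw [h] at h''; simp at h''
    · omega
  · rw [decide_eq_true_iff, mem_insBits]
    exact .inr (.inl ⟨j, hj, rfl, h⟩)

theorem eq_of_agreeOutside {k m : ℕ} {u w : Finset ℕ} (h : AgreeOutside k m m u w)
    (hb : ∀ j < m, bit u (k + j) = bit w (k + j)) : u = w := by
  ext l
  rcases Nat.lt_or_ge l k with hl | hl
  · exact h.1 l hl
  obtain ⟨j, rfl⟩ := Nat.exists_eq_add_of_le hl
  rcases Nat.lt_or_ge j m with hj | hj
  · have := hb j hj
    simp only [bit_eq, decide_eq_decide] at this
    exact this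
  · obtain ⟨j, rfl⟩ := Nat.exists_eq_add_of_le hj
    rw [← add_assoc]
    exact h.2 j

theorem card_filter_insBits (k m a : ℕ) (v : Finset ℕ) (β : ℕ → Bool) (ha : a ≤ m) :
    ((insBits k m v β).filter fun l => k + a ≤ l).card =
      (v.filter fun l => k ≤ l).card +
        ((Finset.range m).filter fun j => β j = true ∧ a ≤ j).card := by
  classical
  have h : (insBits k m v β).filter (fun l => k + a ≤ l) =
      (v.filter fun l => k ≤ l).image (fun l => l + m) ∪
        ((Finset.range m).filter fun j => β j = true ∧ a ≤ j).image (fun j => k + j) := by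
    ext l
    simp only [insBits, Finset.mem_union, Finset.mem_filter, Finset.mem_image, Finset.mem_range]
    grind
  rw [h, Finset.card_union_of_disjoint, Finset.card_image_of_injective _ (add_left_injective m),
    Finset.card_image_of_injective _ (add_right_injective k)]
  rw [Finset.disjoint_left]
  simp only [Finset.mem_image, Finset.mem_filter, Finset.mem_range]
  rintro l ⟨a, ⟨-, h1⟩, rfl⟩ ⟨b, ⟨h2, -⟩, h3⟩
  omega

theorem card_insBits (k m : ℕ) (v : Finset ℕ) (β : ℕ → Bool) : (insBits k m v β).card =
    v.card + ((Finset.range m).filter fun j => β j = true).card := by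
  classical
  have h : insBits k m v β = v.filter (fun l => l < k) ∪
      (insBits k m v β).filter fun l => k + 0 ≤ l := by
    ext l
    simp only [insBits, Finset.mem_union, Finset.mem_filter, Finset.mem_image, Finset.mem_range]
    grind
  rw [h, Finset.card_union_of_disjoint, card_filter_insBits _ _ _ _ _ (Nat.zero_le m), ← add_assoc]
  · congr 1
    · rw [← Finset.card_filter_add_card_filter_not (s := v) (fun l => l < k)]
      congr 2
      exact Finset.filter_congr fun l _ => by omega
    · congr 1
      exact Finset.filter_congr fun l _ => by simp
  · rw [Finset.disjoint_left]
    intro l h1 h2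
    have := (Finset.mem_filter.mp h1).2
    have := (Finset.mem_filter.mp h2).2
    omega

variable {D D' D'' : Diagram} {v v' : Finset ℕ}

theorem LocalChange.insBits_subset (C : LocalChange D D') (hm : C.mid = []) (hv : v ⊆ D.crossings)
    {β : ℕ → Bool} (hβ : ∀ j, β j = true → ∃ i ε, C.mid'[j]? = some (cross i ε)) :
    insBits C.pre.length C.mid'.length v β ⊆ D'.crossings := by
  intro l hl
  rw [mem_crossings]
  rcases mem_insBits.mp hl with ⟨h1, h2⟩ | ⟨j, h1, rfl, h2⟩ | ⟨j, rfl, h1⟩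
  · obtain ⟨i, ε, h⟩ := mem_crossings.mp (hv h2)
    have e : D'.word[l]? = C.pre[l]? := C.symm.getElem?_pre h1
    exact ⟨i, ε, by rw [e, ← C.getElem?_pre h1, h]⟩
  · obtain ⟨i, ε, h⟩ := hβ j h2
    have e : D'.word[C.pre.length + j]? = C.mid'[j]? := C.symm.getElem?_mid h1
    exact ⟨i, ε, by rw [e, h]⟩
  · obtain ⟨i, ε, h⟩ := mem_crossings.mp (hv h1)
    have e : D'.word[C.pre.length + C.mid'.length + j]? = C.post[j]? := C.symm.getElem?_post j
    have e' := C.getElem?_post j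
    rw [hm, List.length_nil, Nat.add_zero] at e'
    exact ⟨i, ε, by rw [e, ← e', h]⟩

theorem LocalChange.crossings_eq {C : LocalChange D D'} {i i' : ℕ} {ε ε' : Bool}
    (hm : C.mid = [cross i ε]) (hm' : C.mid' = [cross i' ε']) : D'.crossings = D.crossings := by
  have key : ∀ {D D' : Diagram} {C : LocalChange D D'} {i i' : ℕ} {ε ε' : Bool},
      C.mid = [cross i ε] → C.mid' = [cross i' ε'] → D.crossings ⊆ D'.crossings := by
    intro D D' C i i' ε ε' hm hm' l hl
    obtain ⟨j, η, h⟩ := mem_crossings.mp hl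
    rw [mem_crossings]
    rcases lt_trichotomy l C.pre.length with h1 | rfl | h1
    · have e : D'.word[l]? = C.pre[l]? := C.symm.getElem?_pre h1
      exact ⟨j, η, by rw [e, ← C.getElem?_pre h1, h]⟩
    · have e : D'.word[C.pre.length + 0]? = C.mid'[0]? :=
        C.symm.getElem?_mid (by simp [LocalChange.symm, hm'])
      exact ⟨i', ε', by rw [← Nat.add_zero C.pre.length, e, hm']; rfl⟩
    · obtain ⟨n, rfl⟩ := Nat.exists_eq_add_of_le h1
      have e : D'.word[C.pre.length + C.mid'.length + n]? = C.post[n]? := C.symm.getElem?_post n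
      have e' := C.getElem?_post n
      rw [hm] at e'
      rw [hm'] at e
      exact ⟨j, η, by rw [← h]; exact e.trans e'.symm⟩
  exact (key (C := C.symm) hm' hm).antisymm (key hm hm')

/-! ### Components of the maps of elementary cobordisms -/

variable {R : Type*} [CommRing R] {h t : R}

theorem Step.map_apply_of_unique (S : Step D D') (z : Fin 2)
    (x : CKh h t D) {v : D.Vertex} {v' : D'.Vertex} (hA : S.change.Agree v.1 v'.1)
    (hu : ∀ w : D.Vertex, S.change.Agree w.1 v'.1 → w ≠ v →
      S.move.entry h t z D D' S.change.pre.length w.1 v'.1 (x w) = 0) :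
    S.map h t z x v' =
      (-1 : ℤ) ^ ((v.1.filter fun l => S.change.pre.length + S.change.mid.length ≤ l).card *
        (v.1.card + v'.1.card)) •
        S.move.entry h t z D D' S.change.pre.length v.1 v'.1 (x v) := by
  rw [S.map_apply, Finset.sum_eq_single v]
  · rw [if_pos hA]
  · intro w _ hw
    split_ifs with hA'
    · rw [hu w hA' hw, smul_zero]
    · rfl
  · simp

theorem Step.map_apply_eq (S : Step D D') (z : Fin 2) (x : CKh h t D) {v : D.Vertex}
    {v' : D'.Vertex} (hA : S.change.Agree v.1 v'.1)
    (hu : ∀ w : D.Vertex, S.change.Agree w.1 v'.1 → w ≠ v →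
      S.move.entry h t z D D' S.change.pre.length w.1 v'.1 = 0) :
    S.map h t z x v' =
      (-1 : ℤ) ^ ((v.1.filter fun l => S.change.pre.length + S.change.mid.length ≤ l).card *
        (v.1.card + v'.1.card)) •
        S.move.entry h t z D D' S.change.pre.length v.1 v'.1 (x v) :=
  S.map_apply_of_unique z x hA fun w h1 h2 => by rw [hu w h1 h2, LinearMap.zero_apply]

theorem Step.map_apply_eq_zero (S : Step D D') (z : Fin 2) (x : CKh h t D) {v' : D'.Vertex}
    (hu : ∀ w : D.Vertex, S.change.Agree w.1 v'.1 →
      S.move.entry h t z D D' S.change.pre.length w.1 v'.1 (x w) = 0) :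
    S.map h t z x v' = 0 := by
  rw [S.map_apply]
  refine Finset.sum_eq_zero fun w _ => ?_
  split_ifs with hA
  · rw [hu w hA, smul_zero]
  · rfl

/-- Maps that commute with all dots. -/
def DotCommutes (G : State h t D v →ₗ[R] State h t D' v') : Prop :=
  ∀ p, D.InRange p → D'.InRange p ∧ ∀ x, G (dot h t D v p * x) = dot h t D' v' p * G x

theorem DotCommutes.comp {v'' : Finset ℕ} {G : State h t D v →ₗ[R] State h t D' v'}
    {G' : State h t D' v' →ₗ[R] State h t D'' v''} (hG' : DotCommutes G') (hG : DotCommutes G) :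
    DotCommutes (G'.comp G) := by
  intro p hp
  obtain ⟨h1, h2⟩ := hG p hp
  obtain ⟨h3, h4⟩ := hG' p h1
  refine ⟨h3, fun x => ?_⟩
  rw [LinearMap.comp_apply, h2, h4, LinearMap.comp_apply]

theorem LocalChange.DotLinear.dotCommutes {C : LocalChange D D'} (hm : C.mid.length = 1)
    (hm' : C.mid'.length = 1) {G : State h t D v →ₗ[R] State h t D' v'}
    (hG : C.DotLinear h t v v' G) : DotCommutes G := by
  intro p hp
  have ho : IsOuter C.pre.length C.mid.length p := by
    rw [hm]; unfold IsOuter; omega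
  have ht : transport C.pre.length C.mid.length C.mid'.length p = p := by
    rw [hm, hm']; unfold transport
    split_ifs with h1
    · rfl
    · obtain ⟨a, b⟩ := p
      simp only at h1 ⊢
      rw [Nat.sub_add_cancel (by omega)]
  have h1 := C.inRange_transport hp ho
  have h2 := hG p hp ho
  rw [ht] at h1 h2
  exact ⟨h1, h2⟩

/-- The `b`-smoothing of the new crossing is the `!b`-smoothing of the old one as a plane figure, so
dots are carried to dots at the same coordinates. The case `b = true` is `f₁`, the case `b = false`
is `f₀`. -/
theorem crossingChange_entry {C : LocalChange D D'} (hA : C.Agree v v') {i : ℕ} {ε dir : Bool}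
    (hm : C.mid = [cross i ε]) (hm' : C.mid' = [cross i (!ε)]) {k : ℕ} (hk : C.pre.length = k)
    {b : Bool} (hb : bit v k = !b) (hb' : bit v' k = b) {z : Fin 2} (hz : z = if b then 1 else 0) :
    DotCommutes ((Move.crossingChange i ε dir).entry h t z D D' k v v') ∧
    (Move.crossingChange i ε dir).entry h t z D D' k v v' 1 =
      if b then 1 else sgn (!dir) • (dot h t D' v' (k + 1, i + 1) - dot h t D' v' (k, i)) := by
  have hl : C.mid.length = 1 := by rw [hm]; rfl
  have hl' : C.mid'.length = 1 := by rw [hm']; rfl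
  have ext := C.exists_label_of_eq hA (a := 0) (b := 0) (O := transferWord v C.pre.length C.mid)
    (fun g => by simp) (fun g => by
      simp only [hm, hm', hk, transferWord, transfer_cross, hb, hb']
      cases b <;> cases ε <;> simp)
  subst hk
  simp only [Move.entry]
  cases b
  · simp only [Bool.false_eq_true, if_false] at hz ⊢
    rw [hz, if_neg (by simp), if_pos ⟨hb, hb'⟩]
    exact ⟨(LocalChange.dotLinear_of_extension rfl hl hl' ext _ _).dotCommutes hl hl',
      localMap_one _ _ _ _ _ _ _⟩
  · simp only [if_true] at hz ⊢
    rw [hz, if_pos rfl, if_pos ⟨hb, hb'⟩]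
    exact ⟨(LocalChange.dotLinear_of_extension rfl hl hl' ext _ _).dotCommutes hl hl',
      localMap_one _ _ _ _ _ _ _⟩

/-- `f₀` takes values in `0`-resolutions only, and `f₁` in `1`-resolutions only. -/
theorem crossingChange_entry_eq_zero {i k : ℕ} {ε dir : Bool} {z : Fin 2}
    (hz : bit v' k = true ↔ z = 0) :
    (Move.crossingChange i ε dir).entry h t z D D' k v v' = 0 := by
  simp only [Move.entry]
  split_ifs with h1 h2 h2
  · rw [h1] at hz; simp [h2.2] at hz
  · rfl
  · have : z = 0 := by omega
    rw [this] at hz; simp [h2.2] at hz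
  · rfl

/-- An insertion of layers followed by a local modification and the removal of the layers is the
multiplication with a state. -/
theorem eq_mul_of_insertion {E E₁ E₂ : Diagram} {C : LocalChange E E₁} {C' : LocalChange E₂ E}
    (hm : C.mid = []) (hm' : C'.mid' = []) (hk : C'.pre.length = C.pre.length)
    (hl : C'.mid.length = C.mid'.length) {v v₁ v₂ : Finset ℕ}
    {e : State h t E v →ₗ[R] State h t E₁ v₁} {G : State h t E₁ v₁ →ₗ[R] State h t E₂ v₂}
    {e' : State h t E₂ v₂ →ₗ[R] State h t E v} (he : C.DotLinear h t v v₁ e) (hG : DotCommutes G)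
    (he' : C'.DotLinear h t v₂ v e') (x : State h t E v) : e' (G (e x)) = x * e' (G (e 1)) := by
  refine eq_mul_of_dot h t (F := e'.comp (G.comp e)) (fun p hp x => ?_) x
  have ho : IsOuter C.pre.length C.mid.length p := by
    rw [hm]; unfold IsOuter; simp; omega
  have h1 := C.inRange_transport hp ho
  obtain ⟨h2, h3⟩ := hG _ h1
  have ho' : IsOuter C'.pre.length C'.mid.length
      (transport C.pre.length C.mid.length C.mid'.length p) := by
    rw [hk, hl, hm]; unfold IsOuter transport
    split_ifs with h
    · exact .inl h
    · right; simp; omega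
  have ht : transport C'.pre.length C'.mid.length C'.mid'.length
      (transport C.pre.length C.mid.length C.mid'.length p) = p := by
    rw [hk, hl, hm, hm']; unfold transport
    obtain ⟨a, b⟩ := p
    simp only [List.length_nil]
    split_ifs with h h'
    · rfl
    · simp at h'; omega
    · simp
  rw [LinearMap.comp_apply, LinearMap.comp_apply, he p hp ho, h3, he' _ h2 ho', ht]
  rfl

end

end ImmersedKhovanov

/-! ### Evaluation of twists. -/

namespace ImmersedKhovanov

open Diagram

noncomputable section

/-! ### Kinks -/

section Kink

variable {D D' : Diagram} {v v' : Finset ℕ} {right : Bool} {i : ℕ} {d ε : Bool}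

theorem zero_mem_labels (D : Diagram) (v : Finset ℕ) : (fun _ _ => false) ∈ D.labels v :=
  mem_labels_of_links rfl (by simp) (by simp)

theorem LocalChange.isPositive_kink (C : LocalChange D D')
    (hm' : C.mid' = kinkWord right i d ε) : D'.isPositive (C.pre.length + 1) = ε := by
  have g0 : ∀ {j}, j < C.mid'.length → D'.word[C.pre.length + j]? = C.mid'[j]? :=
    fun hj => C.symm.getElem?_mid hj
  have r := C.run_mid'
  rw [← C.strands_pre] at r
  cases right
  · simp only [kinkWord, Bool.false_eq_true, if_false] at hm'
    have h0 := g0 (j := 0) (by simp [hm'])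
    have h1 := g0 (j := 1) (by simp [hm'])
    rw [hm'] at r h0 h1
    obtain ⟨A, x, B, rfl, e⟩ := run_cup_cross r
    have a0 := D'.act_strands (l := C.pre.length) h0
    rw [e, act_cup_append, Option.some.injEq] at a0
    rw [e] at r
    simp only [run_cons, act_cup_append, Option.bind_some, act_cross_append_succ,
      act_cap_append] at r
    simp only [isPositive, h1, List.getElem?_cons_succ, List.getElem?_cons_zero]
    rw [← a0, List.getElem?_append_right (by omega), List.getElem?_append_right (by omega),
      show A.length + 1 + 1 - A.length = 2 by omega]
    cases x <;> cases d <;> cases ε <;> simp at r ⊢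
  · simp only [kinkWord, if_true] at hm'
    have h0 := g0 (j := 0) (by simp [hm'])
    have h1 := g0 (j := 1) (by simp [hm'])
    rw [hm'] at r h0 h1
    obtain ⟨A, x, B, rfl, e⟩ := run_cup_succ r
    have a0 := D'.act_strands (l := C.pre.length) h0
    rw [e, act_cup_append_succ, Option.some.injEq] at a0
    rw [e] at r
    simp only [run_cons, act_cup_append_succ, Option.bind_some, act_cross_append,
      act_cap_append_succ] at r
    simp only [isPositive, h1, List.getElem?_cons_succ, List.getElem?_cons_zero]
    rw [← a0]
    cases x <;> cases d <;> cases ε <;> simp at r ⊢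

/-- The labels around a kink with a vertically smoothed crossing. -/
theorem LocalChange.kink_label (C : LocalChange D D') (hm : C.mid = kinkWord right i d ε)
    (hb : bit v (C.pre.length + 1) = !ε) {f : ℕ → Row} (hf : f ∈ D.labels v) :
    (right = true → f (C.pre.length + 1) i = f C.pre.length i ∧
      f (C.pre.length + 2) (i + 1) = f (C.pre.length + 1) (i + 1)) ∧
    (right = false → f (C.pre.length + 2) (i + 2) = f C.pre.length i) := by
  have g0 : ∀ {j}, j < C.mid.length → D.word[C.pre.length + j]? = C.mid[j]? :=
    fun hj => C.getElem?_mid hj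
  have hf := (mem_labels_iff.mp hf).2.1
  cases right
  · simp only [kinkWord, Bool.false_eq_true, if_false] at hm
    have h0 := mem_outs_cup.mp (hf C.pre.length _ ((g0 (j := 0) (by simp [hm])).trans (by rw [hm]; rfl)))
    have h1 := mem_outs_cross.mp (hf (C.pre.length + 1) _ ((g0 (j := 1) (by simp [hm])).trans (by rw [hm]; rfl)))
    refine ⟨by simp, fun _ => ?_⟩
    rw [h0.2.1 i le_rfl, (h1.2.1 hb).2]
  · simp only [kinkWord, if_true] at hm
    have h0 := mem_outs_cup.mp (hf C.pre.length _ ((g0 (j := 0) (by simp [hm])).trans (by rw [hm]; rfl)))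
    have h1 := mem_outs_cross.mp (hf (C.pre.length + 1) _ ((g0 (j := 1) (by simp [hm])).trans (by rw [hm]; rfl)))
    exact ⟨fun _ => ⟨(h0.1 i (by omega)).symm, (h1.2.1 hb).2.symm⟩, by simp⟩

/-- A labelling that separates the loop of a kink from the outer points. -/
theorem LocalChange.exists_kink_label (C : LocalChange D D') (hA : C.Agree v v')
    (hm : C.mid = kinkWord right i d ε)
    (hb : bit v (C.pre.length + 1) = !ε) : ∃ f ∈ D.labels v,
      (∀ p, IsOuter C.pre.length C.mid.length p → f p.1 p.2 = false) ∧
      f (C.pre.length + 1) (i + 1) = true := by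
  set z : Row := fun _ => false
  set j := if right then i + 1 else i with hj
  -- The labelling is `true` exactly on the loop, which occupies the strands `j` and `j + 1` at the
  -- two levels between the three layers of the kink.
  have hg : ∀ n L, C.mid[n]? = some L → (if n + 1 = 1 ∨ n + 1 = 2 then z.ins j true else z) ∈
      outs L (bit v (C.pre.length + n)) (if n = 1 ∨ n = 2 then z.ins j true else z) := by
    intro n L hL
    have hn := (List.getElem?_eq_some_iff.mp hL).1
    have h3 : n < 3 := by rw [hm] at hn; cases right <;> simpa [kinkWord] using hn
    rw [hm] at hL
    interval_cases n
    · cases right <;> simp only [kinkWord, Bool.false_eq_true, if_false, if_true,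
        List.getElem?_cons_zero, Option.some.injEq] at hL <;> subst hL <;> simp [outs, hj]
    · cases right <;> simp only [kinkWord, Bool.false_eq_true, if_false, if_true,
        List.getElem?_cons_zero, List.getElem?_cons_succ, Option.some.injEq] at hL <;>
        subst hL <;> simp [outs, hb]
    · cases right <;> simp only [kinkWord, Bool.false_eq_true, if_false, if_true,
        List.getElem?_cons_zero, List.getElem?_cons_succ, Option.some.injEq] at hL <;>
        subst hL <;> simp [outs, hj, Row.ins, z] <;> exact (Row.del_ins _ _ _).symm
  obtain ⟨f, hf, ho, hi⟩ := C.exists_label_of_path hA (zero_mem_labels D' v')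
    (g := fun n => if n = 1 ∨ n = 2 then z.ins j true else z) (by simp [z]) hg
    (by rw [hm]; cases right <;> simp [kinkWord, z])
  refine ⟨f, hf, fun p hp => ho.apply hp rfl, ?_⟩
  rw [hi 1 (by rw [hm]; cases right <;> simp [kinkWord])]
  simp only [true_or, if_true, Row.ins, hj]
  cases right <;> simp

end Kink

/-! ### Crossing changes -/

section CrossingChange

variable {R : Type*} [CommRing R] {h t : R} {D D' : Diagram}

theorem agreeOutside_insBits_insBits {k m a : ℕ} (v : Finset ℕ) {β β' : ℕ → Bool}
    (hβ : ∀ j < m, j ≠ a → β j = β' j) :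
    AgreeOutside (k + a) 1 1 (insBits k m v β) (insBits k m v β') := by
  refine ⟨fun l hl => ?_, fun l => ?_⟩ <;> rw [mem_insBits, mem_insBits] <;>
    refine or_congr Iff.rfl (or_congr (exists_congr fun j => and_congr_right fun hj =>
      and_congr_right fun hl' => ?_) Iff.rfl) <;> rw [hβ j hj (by omega)]

/-- For a given target vertex a single source vertex contributes: it agrees with the target
elsewhere, and its resolution at the crossing is forced by the chosen generator. -/
theorem Step.map_crossingChange (S : Step D D') {i k : ℕ} {ε dir : Bool}
    (hS : S.move = .crossingChange i ε dir) (hk : S.pre.length = k) (x : CKh h t D)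
    {v : D.Vertex} {v' : D'.Vertex} (hA : AgreeOutside k 1 1 v.1 v'.1) {b : Bool}
    (hb : bit v.1 k = !b) {z : Fin 2} (hz : z = if b then 1 else 0) :
    S.map h t z x v' = (-1 : ℤ) ^ ((v.1.filter fun l => k + 1 ≤ l).card *
      (v.1.card + v'.1.card)) •
        (Move.crossingChange i ε dir).entry h t z D D' k v.1 v'.1 (x v) := by
  have hm : S.change.mid.length = 1 := by change S.move.source.length = 1; rw [hS]; rfl
  have hm' : S.change.mid'.length = 1 := by change S.move.target.length = 1; rw [hS]; rfl
  have hk' : S.change.pre.length = k := hk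
  rw [S.map_apply_eq z x (v := v), hS, hk', hm]
  · rw [LocalChange.Agree, hm, hm', hk']; exact hA
  · intro w hw hne
    rw [LocalChange.Agree, hm, hm', hk'] at hw
    have hbw : bit w.1 k = b := by
      by_contra hc
      refine hne (Subtype.ext (eq_of_agreeOutside (hw.trans hA.symm) fun j hj => ?_))
      obtain rfl : j = 0 := by omega
      rw [Nat.add_zero, hb]
      cases b <;> simpa using hc
    rw [hS, hk']
    simp only [Move.entry, hbw, hz]
    cases b <;> simp

end CrossingChange

/-! ### Twists -/

namespace Twist

variable {E : Diagram} {positive : Bool} (τ : Twist E positive)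

theorem create_mid : τ.create.change.mid = [] := by
  change τ.create.move.source = _; rw [τ.create_move]; rfl

theorem create_mid' : τ.create.change.mid' = kinkWord τ.right τ.i τ.d (!positive) := by
  change τ.create.move.target = _; rw [τ.create_move]; rfl

theorem remove_mid : τ.remove.change.mid = kinkWord τ.right τ.i τ.d positive := by
  change τ.remove.move.source = _; rw [τ.remove_move]; rfl

theorem remove_mid' : τ.remove.change.mid' = [] := by
  change τ.remove.move.target = _; rw [τ.remove_move]; rfl

theorem create_doublePoint : τ.create.doublePoint = none := by
  rw [Step.doublePoint, τ.create_move]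

theorem remove_doublePoint : τ.remove.doublePoint = none := by
  rw [Step.doublePoint, τ.remove_move]

theorem change_doublePoint : τ.change.doublePoint = some positive := by
  have := τ.create.change.isPositive_kink τ.create_mid'
  rw [Step.doublePoint, τ.change_move, τ.change_level]
  simp only [Option.some.injEq]
  rw [show τ.create.pre.length = τ.create.change.pre.length from rfl, this, Bool.not_not]

/-- The resolutions of the inserted layers. -/
def bits (b : Bool) (j : ℕ) : Bool := decide (j = 1) && b

theorem length_kinkWord (r : Bool) (i : ℕ) (d ε : Bool) : (kinkWord r i d ε).length = 3 := by
  cases r <;> rfl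

theorem exists_cross_kinkWord {r : Bool} {i : ℕ} {d ε b : Bool} {j : ℕ} (hj : bits b j = true) :
    ∃ i' ε', (kinkWord r i d ε)[j]? = some (cross i' ε') := by
  obtain rfl : j = 1 := by simp only [bits, Bool.and_eq_true, decide_eq_true_eq] at hj; exact hj.1
  cases r
  · exact ⟨i + 1, ε, rfl⟩
  · exact ⟨i, ε, rfl⟩

/-- The vertices over `v` after the creation of the kink. -/
def vertex₁ (v : E.Vertex) (b : Bool) : τ.E₁.Vertex :=
  ⟨insBits τ.create.pre.length 3 v.1 (bits b), by
    rw [Finset.mem_powerset]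
    have := τ.create.change.insBits_subset (β := bits b) τ.create_mid (Vertex.subset v)
      fun j hj => by rw [τ.create_mid']; exact exists_cross_kinkWord hj
    rwa [τ.create_mid', length_kinkWord] at this⟩

def vertex₂ (v : E.Vertex) (b : Bool) : τ.E₂.Vertex :=
  ⟨insBits τ.create.pre.length 3 v.1 (bits b), by
    rw [Finset.mem_powerset]
    have := τ.remove.change.symm.insBits_subset (β := bits b) τ.remove_mid' (Vertex.subset v)
      fun j hj => by
        change ∃ i ε, τ.remove.change.mid[j]? = _
        rw [τ.remove_mid]; exact exists_cross_kinkWord hj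
    change insBits τ.remove.pre.length τ.remove.change.mid.length _ _ ⊆ _ at this
    rwa [τ.remove_mid, length_kinkWord, τ.remove_level] at this⟩

theorem create_agree (v : E.Vertex) (b : Bool) :
    τ.create.change.Agree v.1 (τ.vertex₁ v b).1 := by
  rw [LocalChange.Agree, τ.create_mid, τ.create_mid', length_kinkWord]
  exact agreeOutside_insBits _ _ _ _

theorem remove_agree (v : E.Vertex) (b : Bool) :
    τ.remove.change.Agree (τ.vertex₂ v b).1 v.1 := by
  rw [LocalChange.Agree, τ.remove_mid, τ.remove_mid', length_kinkWord]
  change AgreeOutside τ.remove.pre.length 3 0 _ _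
  rw [τ.remove_level]
  exact (agreeOutside_insBits _ _ _ _).symm

theorem change_agree (v : E.Vertex) (b b' : Bool) :
    AgreeOutside (τ.create.pre.length + 1) 1 1 (τ.vertex₁ v b).1 (τ.vertex₂ v b').1 :=
  agreeOutside_insBits_insBits _ fun j _ hj => by simp [bits, hj]

theorem bit_vertex₁ (v : E.Vertex) (b : Bool) :
    bit (τ.vertex₁ v b).1 (τ.create.pre.length + 1) = b :=
  (bit_insBits _ _ (by omega)).trans (by simp [bits])

theorem bit_vertex₂ (v : E.Vertex) (b : Bool) :
    bit (τ.vertex₂ v b).1 (τ.create.pre.length + 1) = b :=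
  (bit_insBits _ _ (by omega)).trans (by simp [bits])

theorem card_filter_vertex (v : E.Vertex) (b : Bool) {a : ℕ} (ha : a = 2 ∨ a = 3) :
    ((insBits τ.create.pre.length 3 v.1 (bits b)).filter
        fun l => τ.create.pre.length + a ≤ l).card =
      (v.1.filter fun l => τ.create.pre.length ≤ l).card := by
  have : ((Finset.range 3).filter fun j => bits b j = true ∧ a ≤ j) = ∅ := by
    refine Finset.filter_eq_empty_iff.mpr fun j _ => ?_
    simp only [bits, Bool.and_eq_true, decide_eq_true_eq]
    omega
  rw [card_filter_insBits _ _ _ _ _ (by omega), this, Finset.card_empty, add_zero]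

variable {R : Type*} [CommRing R] {h t : R}

/-- The component of the map of a twist at a vertex. -/
theorem map_apply (x : CKh h t E) (v : E.Vertex) (z₁ z₃ : Fin 2) {z₂ : Fin 2}
    (hz : z₂ = if positive then 0 else 1) :
    τ.remove.map h t z₃ (τ.change.map h t z₂ (τ.create.map h t z₁ x)) v =
      (Move.unkink τ.right τ.i τ.d positive).entry h t z₃ τ.E₂ E τ.create.pre.length
        (τ.vertex₂ v (!positive)).1 v.1
      ((Move.crossingChange (if τ.right then τ.i else τ.i + 1) (!positive) τ.dir).entry h t z₂ τ.E₁
          τ.E₂ (τ.create.pre.length + 1) (τ.vertex₁ v positive).1 (τ.vertex₂ v (!positive)).1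
        ((Move.kink τ.right τ.i τ.d (!positive)).entry h t z₁ E τ.E₁ τ.create.pre.length v.1
          (τ.vertex₁ v positive).1 (x v))) := by
  rw [τ.remove.map_apply_eq z₃ _ (τ.remove_agree v (!positive)),
    τ.change.map_crossingChange τ.change_move τ.change_level _ (τ.change_agree v positive (!positive))
      (b := !positive) (by rw [τ.bit_vertex₁, Bool.not_not])
      (by rw [hz]; cases positive <;> rfl),
    τ.create.map_apply_eq z₁ _ (τ.create_agree v positive)]
  · rw [τ.create_move, τ.remove_move]
    change (-1 : ℤ) ^ (((insBits _ _ _ _).filter fun l => τ.remove.pre.length +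
      τ.remove.change.mid.length ≤ l).card * _) • (Move.entry h t _ z₃ _ _ τ.remove.pre.length _ _)
      (_ ^ (((insBits _ _ _ _).filter fun l => τ.create.pre.length + 1 + 1 ≤ l).card * _) • _) = _
    rw [τ.remove_level, τ.remove_mid, length_kinkWord, τ.card_filter_vertex v _ (.inr rfl),
      add_assoc _ 1 1, τ.card_filter_vertex v _ (.inl rfl), τ.create_mid, List.length_nil,
      map_zsmul, map_zsmul, map_zsmul, smul_smul, smul_smul, ← pow_add, ← pow_add]
    change _ ^ (_ + _ + ((v.1.filter fun l => τ.create.pre.length + 0 ≤ l).card * _)) • _ = _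
    -- All three signs involve the same number `N` of `1`-resolved crossings below the kink. The
    -- exponents add up to `N` times a sum in which each of the three cardinalities `|v|`, `|v₁|`,
    -- `|v₂|` occurs twice.
    rw [Nat.add_zero, Even.neg_one_pow, one_smul]
    · rfl
    · refine ⟨(v.1.filter fun l => τ.create.pre.length ≤ l).card * (v.1.card +
        (τ.vertex₁ v positive).1.card + (τ.vertex₂ v (!positive)).1.card), ?_⟩
      ring
  · intro w hw hne
    refine absurd (Subtype.ext ?_) hne
    rw [LocalChange.Agree, τ.create_mid, τ.create_mid', length_kinkWord] at hw
    exact eq_of_agreeOutside (hw.trans (agreeOutside_insBits _ _ _ _).symm) (by simp)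
  · intro w hw hne
    rw [τ.remove_move]
    simp only [Move.entry]
    refine if_neg fun hb => hne (Subtype.ext ?_)
    obtain ⟨h0, h2, -⟩ := bitSum_kinkWord (Vertex.subset w) τ.remove_mid
    have e : τ.remove.change.pre.length = τ.create.pre.length := τ.remove_level
    rw [LocalChange.Agree, τ.remove_mid, τ.remove_mid', length_kinkWord, e] at hw
    rw [e] at h0 h2 hb
    refine eq_of_agreeOutside (hw.trans (agreeOutside_insBits _ _ _ (bits (!positive)))) fun j hj => ?_
    refine Eq.trans ?_ (bit_insBits v.1 (bits (!positive)) hj).symm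
    interval_cases j
    · exact h0
    · rw [hb]; rfl
    · exact h2

/-- With the other generator of the Hopf link, the map of a twist vanishes. -/
theorem map_apply_eq_zero (x : CKh h t τ.E₁) (z₃ : Fin 2) {z₂ : Fin 2}
    (hz : z₂ = if positive then 1 else 0) :
    τ.remove.map h t z₃ (τ.change.map h t z₂ x) = 0 := by
  funext v
  refine Step.map_apply_eq_zero _ _ _ fun w hw => ?_
  rw [τ.remove_move]
  have e : τ.remove.change.pre.length = τ.create.pre.length := τ.remove_level
  by_cases hb : bit w.1 (τ.remove.change.pre.length + 1) = !positive
  · have : τ.change.map h t z₂ x w = 0 := by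
      refine Step.map_apply_eq_zero _ _ _ fun u hu => ?_
      have e' : τ.change.change.pre.length = τ.create.pre.length + 1 := τ.change_level
      rw [τ.change_move, crossingChange_entry_eq_zero, LinearMap.zero_apply]
      rw [e', ← e, hb, hz]
      cases positive <;> simp
    rw [this, map_zero]
  · simp only [Move.entry]
    rw [if_neg hb, LinearMap.zero_apply]

end Twist

end

end ImmersedKhovanov

namespace ImmersedKhovanov

open Diagram

noncomputable section

theorem transport_of_le {k m m' : ℕ} {p : ℕ × ℕ} (hp : p.1 ≤ k) : transport k m m' p = p :=
  if_pos hp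

namespace Twist

variable {E : Diagram} {positive : Bool} (τ : Twist E positive)
variable {R : Type*} [CommRing R] {h t : R}

theorem create_dotLinear (v : E.Vertex) (e e' : State h t τ.E₁ (τ.vertex₁ v positive).1) :
    τ.create.change.DotLinear h t v.1 (τ.vertex₁ v positive).1
      (localMap h t E τ.E₁ τ.create.pre.length 0 3 v.1 (τ.vertex₁ v positive).1 e e') := by
  refine LocalChange.dotLinear_of_extension rfl (by rw [τ.create_mid]; rfl)
    (by rw [τ.create_mid', length_kinkWord]) (LocalChange.exists_label_of_eq _ (τ.create_agree v _)
    (O := id) (a := 0) (b := 1) (fun g => ?_) fun g => ?_) _ _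
  · rw [τ.create_mid]; simp [transferWord]
  · rw [τ.create_mid', transferWord_kinkWord]
    · rfl
    · exact (τ.bit_vertex₁ v positive).trans (by simp)

theorem remove_level' : τ.remove.change.pre.length = τ.create.pre.length := τ.remove_level

theorem remove_dotLinear (v : E.Vertex) (e e' : State h t E v.1) :
    τ.remove.change.DotLinear h t (τ.vertex₂ v (!positive)).1 v.1
      (localMap h t τ.E₂ E τ.create.pre.length 3 0 (τ.vertex₂ v (!positive)).1 v.1 e e') := by
  refine LocalChange.dotLinear_of_extension τ.remove_level
    (by rw [τ.remove_mid, length_kinkWord]) (by rw [τ.remove_mid']; rfl)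
    (LocalChange.exists_label_of_eq _ (τ.remove_agree v _)
    (O := id) (a := 1) (b := 0) (fun g => ?_) fun g => ?_) _ _
  · rw [τ.remove_mid, τ.remove_level', transferWord_kinkWord]
    · rfl
    · exact τ.bit_vertex₂ v (!positive)
  · rw [τ.remove_mid']; simp [transferWord]

/-- The value of the last step of a twist at the loop of the kink. -/
theorem remove_loop (v : E.Vertex) (e e' : State h t E v.1) :
    localMap h t τ.E₂ E τ.create.pre.length 3 0 (τ.vertex₂ v (!positive)).1 v.1 e e'
      (dot h t τ.E₂ (τ.vertex₂ v (!positive)).1 (τ.create.pre.length + 1, τ.i + 1)) = e' := by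
  obtain ⟨f, hf, h1, h2⟩ := τ.remove.change.exists_kink_label (τ.remove_agree v (!positive))
    τ.remove_mid (by rw [τ.remove_level']; exact τ.bit_vertex₂ v (!positive))
  rw [τ.remove_level', τ.remove_mid, length_kinkWord] at h1
  rw [τ.remove_level'] at h2
  refine localMap_dot_inner h t _ _ _ _ _ ?_ fun p _ ho => ⟨f, hf, ?_⟩
  · by_contra hc
    rw [Diagram.inRange_iff, not_lt] at hc
    rw [label_eq_false hf hc] at h2
    simp at h2
  · rw [h1 p ho, h2]; simp

theorem inRange_point : E.InRange (τ.create.pre.length, τ.i) := by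
  have r := τ.create.change.run_mid'
  rw [τ.create_mid'] at r
  rw [Diagram.inRange_iff, width]
  change _ < (E.strands τ.create.change.pre.length).length
  cases hr : τ.right <;> rw [hr] at r
  · simp only [kinkWord, Bool.false_eq_true, if_false] at r
    obtain ⟨A, x, B, hA, e⟩ := run_cup_cross r
    rw [e]; simp; omega
  · simp only [kinkWord, if_true] at r
    obtain ⟨A, x, B, hA, e⟩ := run_cup_succ r
    rw [e]; simp; omega

theorem inRange_point₂ : τ.E₂.InRange (τ.create.pre.length, τ.i) := by
  have hp := τ.remove.change.symm.inRange_transport (p := τ.point) τ.inRange_point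
    (.inl (le_of_eq τ.remove_level.symm))
  rwa [transport_of_le (le_of_eq τ.remove_level.symm)] at hp

theorem inRange₁ : τ.E₁.InRange (τ.create.pre.length + 1, τ.i + 1) ∧
    τ.E₁.InRange (τ.create.pre.length, τ.i) := by
  have hp := τ.create.change.inRange_transport τ.inRange_point (.inl le_rfl)
  rw [transport_of_le (le_refl τ.create.pre.length)] at hp
  refine ⟨?_, hp⟩
  have h0 : τ.E₁.word[τ.create.pre.length + 0]? = (kinkWord τ.right τ.i τ.d (!positive))[0]? := by
    have : τ.E₁.word[τ.create.pre.length + 0]? = τ.create.change.mid'[0]? :=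
      τ.create.change.symm.getElem?_mid (by
        change 0 < τ.create.change.mid'.length; rw [τ.create_mid', length_kinkWord]; omega)
    rw [this, τ.create_mid']
  rw [Diagram.inRange_iff] at hp ⊢
  simp only at hp ⊢
  cases hr : τ.right <;> rw [hr] at h0 <;>
  · have w0 := τ.E₁.width_cup (l := τ.create.pre.length) h0
    omega

/-- The value of the last step of a twist at the strand. -/
theorem remove_strand (v : E.Vertex) (e e' : State h t E v.1) :
    localMap h t τ.E₂ E τ.create.pre.length 3 0 (τ.vertex₂ v (!positive)).1 v.1 e e'
      (dot h t τ.E₂ (τ.vertex₂ v (!positive)).1 (τ.create.pre.length, τ.i)) =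
      dot h t E v.1 τ.point * e := by
  have hl := τ.remove_dotLinear v e e' (τ.create.pre.length, τ.i) τ.inRange_point₂
    (.inl (le_of_eq τ.remove_level.symm)) 1
  rw [mul_one, localMap_one, transport_of_le (le_of_eq τ.remove_level.symm)] at hl
  exact hl

/-- Dots near the kink after the crossing change. -/
theorem dot_eq (v : E.Vertex) :
    (τ.right = true →
      dot h t τ.E₂ (τ.vertex₂ v (!positive)).1 (τ.create.pre.length + 2, τ.i + 1) =
        dot h t τ.E₂ (τ.vertex₂ v (!positive)).1 (τ.create.pre.length + 1, τ.i + 1) ∧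
      dot h t τ.E₂ (τ.vertex₂ v (!positive)).1 (τ.create.pre.length + 1, τ.i) =
        dot h t τ.E₂ (τ.vertex₂ v (!positive)).1 (τ.create.pre.length, τ.i)) ∧
    (τ.right = false →
      dot h t τ.E₂ (τ.vertex₂ v (!positive)).1 (τ.create.pre.length + 2, τ.i + 2) =
        dot h t τ.E₂ (τ.vertex₂ v (!positive)).1 (τ.create.pre.length, τ.i)) := by
  have key := fun f hf => τ.remove.change.kink_label (f := f) τ.remove_mid
    (by rw [τ.remove_level']; exact τ.bit_vertex₂ v (!positive)) hf
  rw [τ.remove_level'] at key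
  have hp := τ.inRange_point₂
  have g0 : ∀ {j}, j < 3 → τ.E₂.word[τ.create.pre.length + j]? =
      (kinkWord τ.right τ.i τ.d positive)[j]? := fun {j} hj => by
    rw [← τ.remove_level', τ.remove.change.getElem?_mid (by rwa [τ.remove_mid, length_kinkWord]),
      τ.remove_mid]
  have h0 := g0 (j := 0) (by omega)
  have h1 := g0 (j := 1) (by omega)
  rw [Diagram.inRange_iff] at hp
  constructor <;> intro hr <;> rw [hr] at h0 h1
  · have w0 := τ.E₂.width_cup (l := τ.create.pre.length) h0
    have w1 := τ.E₂.width_cross h1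
    rw [show τ.create.pre.length + 1 + 1 = τ.create.pre.length + 2 from rfl] at w1
    refine ⟨dot_eq_of_labels h t ?_ ?_ fun f hf => ((key f hf).1 hr).2,
      dot_eq_of_labels h t ?_ ?_ fun f hf => ((key f hf).1 hr).1⟩ <;>
    rw [Diagram.inRange_iff] <;> simp only at * <;> omega
  · have w0 := τ.E₂.width_cup (l := τ.create.pre.length) h0
    have w1 := τ.E₂.width_cross h1
    rw [show τ.create.pre.length + 1 + 1 = τ.create.pre.length + 2 from rfl] at w1
    refine dot_eq_of_labels h t ?_ ?_ fun f hf => (key f hf).2 hr <;>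
    rw [Diagram.inRange_iff] <;> simp only at * <;> omega

/-- By `eq_mul_of_insertion` only the image of `1` is needed. For a positive twist the counit on the
loop sends the loop term of `Φ` to `1` and kills the strand term. For a negative twist the terms of
`X_loop - X_strand` are sent to `h - X` and `X`. -/
theorem map_eq_mul (x : CKh h t E) (v : E.Vertex) (z₁ z₃ : Fin 2) {z₂ : Fin 2}
    (hz : z₂ = if positive then 0 else 1) :
    τ.remove.map h t z₃ (τ.change.map h t z₂ (τ.create.map h t z₁ x)) v =
      x v * if positive then (τ.sign : State h t E v.1) else
        algebraMap R _ h - 2 * dot h t E v.1 τ.point := by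
  have e2 := crossingChange_entry (C := τ.change.change) (h := h) (t := t) (dir := τ.dir)
    (i := if τ.right then τ.i else τ.i + 1) (ε := !positive) (v := (τ.vertex₁ v positive).1)
    (v' := (τ.vertex₂ v (!positive)).1) (k := τ.create.pre.length + 1) (b := !positive) (z := z₂)
    (by
      have hm : τ.change.change.mid.length = 1 := by
        change τ.change.move.source.length = 1; rw [τ.change_move]; rfl
      have hm' : τ.change.change.mid'.length = 1 := by
        change τ.change.move.target.length = 1; rw [τ.change_move]; rfl
      rw [LocalChange.Agree, hm, hm', show τ.change.change.pre.length = _ from τ.change_level]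
      exact τ.change_agree v _ _)
    (by change τ.change.move.source = _; rw [τ.change_move]; rfl)
    (by change τ.change.move.target = _; rw [τ.change_move]; rfl) τ.change_level
    (by rw [τ.bit_vertex₁, Bool.not_not]) (τ.bit_vertex₂ v _) (by rw [hz]; cases positive <;> rfl)
  have b1 : bit (τ.vertex₁ v positive).1 (τ.create.pre.length + 1) = !!positive := by
    rw [τ.bit_vertex₁, Bool.not_not]
  have b2 := τ.bit_vertex₂ v (!positive)
  have L : τ.remove.change.mid.length = τ.create.change.mid'.length := by
    rw [τ.remove_mid, τ.create_mid', length_kinkWord, length_kinkWord]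
  rw [τ.map_apply x v z₁ z₃ hz]
  obtain ⟨hG, hG1⟩ := e2
  have E1 : (Move.kink τ.right τ.i τ.d (!positive)).entry h t z₁ E τ.E₁ τ.create.pre.length v.1
      (τ.vertex₁ v positive).1 = localMap h t E τ.E₁ τ.create.pre.length 0 3 v.1
        (τ.vertex₁ v positive).1 (if !positive then dot h t τ.E₁ _
          (τ.create.pre.length + 1, τ.i + 1) - dot h t τ.E₁ _ (τ.create.pre.length, τ.i) else 1) 0 := by
    simp only [Move.entry]; rw [if_pos b1]
  have E3 : (Move.unkink τ.right τ.i τ.d positive).entry h t z₃ τ.E₂ E τ.create.pre.length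
        (τ.vertex₂ v (!positive)).1 v.1 = localMap h t τ.E₂ E τ.create.pre.length 3 0 _ v.1
        (if positive then 0 else 1) (if positive then 1 else
          algebraMap R _ h - dot h t E v.1 τ.point) := by
    simp only [Move.entry]
    rw [if_pos b2]
    cases positive <;> simp [deathMap, point]
  rw [E1, E3]
  rw [eq_mul_of_insertion τ.create_mid τ.remove_mid' τ.remove_level' L (τ.create_dotLinear v _ _) hG
    (τ.remove_dotLinear v _ _), localMap_one]
  congr 1
  obtain ⟨d1, d2⟩ := τ.dot_eq (h := h) (t := t) v
  cases positive
  · have g1 := (hG _ τ.inRange₁.1).2 1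
    have g2 := (hG _ τ.inRange₁.2).2 1
    rw [mul_one, hG1, if_pos (Bool.not_false), mul_one] at g1 g2
    rw [if_pos (Bool.not_false), if_neg Bool.false_ne_true, if_neg Bool.false_ne_true,
      if_neg Bool.false_ne_true]
    have l1 := τ.remove_loop (h := h) (t := t) v 1 (algebraMap R _ h - dot h t E v.1 τ.point)
    have l2 := τ.remove_strand (h := h) (t := t) v 1 (algebraMap R _ h - dot h t E v.1 τ.point)
    rw [map_sub, g1, g2, map_sub, l1, l2]
    ring
  · simp only [Bool.not_true, if_true, Bool.false_eq_true, if_false] at hG1 ⊢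
    rw [hG1, map_zsmul, map_sub]
    -- With the loop on the right, the upper left end of the crossing lies on the strand and the
    -- lower right end on the loop; with the loop on the left it is the other way round. Therefore
    -- the sign compares `τ.dir` with `τ.right`.
    cases hr : τ.right
    · have d2 := d2 hr
      simp only [Bool.false_eq_true, if_false]
      rw [show τ.create.pre.length + 1 + 1 = τ.create.pre.length + 2 from rfl, add_assoc τ.i 1 1, d2]
      have l1 := τ.remove_loop (h := h) (t := t) v 0 1
      have l2 := τ.remove_strand (h := h) (t := t) v 0 1
      rw [l1, l2, sign, hr]
      cases τ.dir <;> simp [sgn]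
    · have d1 := d1 hr
      simp only [if_true]
      rw [show τ.create.pre.length + 1 + 1 = τ.create.pre.length + 2 from rfl, d1.1, d1.2]
      have l1 := τ.remove_loop (h := h) (t := t) v 0 1
      have l2 := τ.remove_strand (h := h) (t := t) v 0 1
      rw [l1, l2, sign, hr]
      cases τ.dir <;> simp [sgn]

end Twist

end

end ImmersedKhovanov

/-! ### Evaluation of finger moves. -/

namespace ImmersedKhovanov

open Diagram

noncomputable section

namespace Finger

variable {E : Diagram} (φ : Finger E)

/-- The shape `cross φ.first` is the crossing that is changed first. -/
def first : Bool := if φ.upperFirst then φ.ε else !φ.ε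

/-- The indices of the changed crossings within the Reidemeister 2 move. -/
def level₁ : ℕ := if φ.upperFirst then 0 else 1

def level₂ : ℕ := if φ.upperFirst then 1 else 0

theorem create_mid : φ.create.change.mid = [] := by
  change φ.create.move.source = _; rw [φ.create_move]; rfl

theorem create_mid' : φ.create.change.mid' = [cross φ.i φ.ε, cross φ.i (!φ.ε)] := by
  change φ.create.move.target = _; rw [φ.create_move]; rfl

theorem change₁_mid : φ.change₁.change.mid = [cross φ.i φ.first] := by
  change φ.change₁.move.source = _; rw [φ.change₁_move]; rfl

theorem change₁_mid' : φ.change₁.change.mid' = [cross φ.i (!φ.first)] := by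
  change φ.change₁.move.target = _; rw [φ.change₁_move]; rfl

theorem change₂_move' : φ.change₂.move = .crossingChange φ.i (!φ.first) φ.dir₂ := by
  rw [φ.change₂_move, first]; cases φ.upperFirst <;> simp

theorem change₂_mid : φ.change₂.change.mid = [cross φ.i (!φ.first)] := by
  change φ.change₂.move.source = _; rw [φ.change₂_move']; rfl

theorem change₂_mid' : φ.change₂.change.mid' = [cross φ.i φ.first] := by
  change φ.change₂.move.target = _; rw [φ.change₂_move']; simp [Move.target]

theorem remove_mid : φ.remove.change.mid = [cross φ.i (!φ.ε), cross φ.i φ.ε] := by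
  change φ.remove.move.source = _; rw [φ.remove_move]; simp [Move.source]

theorem remove_mid' : φ.remove.change.mid' = [] := by
  change φ.remove.move.target = _; rw [φ.remove_move]; rfl

theorem create_doublePoint : φ.create.doublePoint = none := by
  rw [Step.doublePoint, φ.create_move]

theorem remove_doublePoint : φ.remove.doublePoint = none := by
  rw [Step.doublePoint, φ.remove_move]

theorem change₁_level' : φ.change₁.change.pre.length = φ.create.pre.length + φ.level₁ :=
  φ.change₁_level

theorem change₂_level' : φ.change₂.change.pre.length = φ.create.pre.length + φ.level₂ :=
  φ.change₂_level

theorem remove_level' : φ.remove.change.pre.length = φ.create.pre.length := φ.remove_level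

theorem level_cases : (φ.level₁ = 0 ∧ φ.level₂ = 1) ∨ (φ.level₁ = 1 ∧ φ.level₂ = 0) := by
  unfold level₁ level₂; cases φ.upperFirst <;> simp

/-- Resolutions of two crossings. -/
def bits (b b' : Bool) : ℕ → Bool
  | 0 => b
  | 1 => b'
  | _ => false

theorem exists_cross_pair {i : ℕ} {ε ε' b b' : Bool} {j : ℕ} (hj : bits b b' j = true) :
    ∃ i' η, [cross i ε, cross i ε'][j]? = some (cross i' η) := by
  rcases j with _ | _ | j
  · exact ⟨i, ε, rfl⟩
  · exact ⟨i, ε', rfl⟩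
  · exact absurd hj (by simp [bits])

theorem insBits_subset₁ (v : E.Vertex) (b b' : Bool) :
    insBits φ.create.pre.length 2 v.1 (bits b b') ⊆ φ.E₁.crossings := by
  have := φ.create.change.insBits_subset (β := bits b b') φ.create_mid (Vertex.subset v)
    fun j hj => by rw [φ.create_mid']; exact exists_cross_pair hj
  rwa [φ.create_mid'] at this

/-- The vertices over `v` in the cubes of the intermediate diagrams. -/
def vertex₁ (v : E.Vertex) (b b' : Bool) : φ.E₁.Vertex :=
  ⟨_, Finset.mem_powerset.mpr (φ.insBits_subset₁ v b b')⟩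

def vertex₂ (v : E.Vertex) (b b' : Bool) : φ.E₂.Vertex :=
  ⟨_, Finset.mem_powerset.mpr
    ((LocalChange.crossings_eq φ.change₁_mid φ.change₁_mid').symm ▸ φ.insBits_subset₁ v b b')⟩

def vertex₃ (v : E.Vertex) (b b' : Bool) : φ.E₃.Vertex :=
  ⟨_, Finset.mem_powerset.mpr ((LocalChange.crossings_eq φ.change₂_mid φ.change₂_mid').symm ▸
    (LocalChange.crossings_eq φ.change₁_mid φ.change₁_mid').symm ▸ φ.insBits_subset₁ v b b')⟩

theorem create_agree (v : E.Vertex) (b b' : Bool) :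
    φ.create.change.Agree v.1 (φ.vertex₁ v b b').1 := by
  rw [LocalChange.Agree, φ.create_mid, φ.create_mid']
  exact agreeOutside_insBits _ _ _ _

theorem remove_agree (v : E.Vertex) (b b' : Bool) :
    φ.remove.change.Agree (φ.vertex₃ v b b').1 v.1 := by
  rw [LocalChange.Agree, φ.remove_mid, φ.remove_mid', φ.remove_level']
  exact (agreeOutside_insBits _ _ _ _).symm

/-- The resolution of the upper crossing, where `b` is the resolution of the crossing that is changed
first and `b'` the one of the other crossing. -/
def order₁ (b b' : Bool) : Bool := if φ.upperFirst then b else b'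

/-- The resolution of the lower crossing. -/
def order₂ (b b' : Bool) : Bool := if φ.upperFirst then b' else b

theorem bits_level (b b' : Bool) :
    bits (φ.order₁ b b') (φ.order₂ b b') φ.level₁ = b ∧
    bits (φ.order₁ b b') (φ.order₂ b b') φ.level₂ = b' := by
  unfold order₁ order₂ level₁ level₂
  cases φ.upperFirst <;> exact ⟨rfl, rfl⟩

theorem level_lt : φ.level₁ < 2 ∧ φ.level₂ < 2 := by
  rcases φ.level_cases with ⟨h, h'⟩ | ⟨h, h'⟩ <;> rw [h, h'] <;> omega

theorem bits_congr₁ {b b' c c' : Bool} {j : ℕ} (hj : j < 2) (hne : j ≠ φ.level₁) (h : b' = c') :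
    bits (φ.order₁ b b') (φ.order₂ b b') j = bits (φ.order₁ c c') (φ.order₂ c c') j := by
  subst h
  unfold level₁ at hne
  unfold order₁ order₂
  interval_cases j <;> cases hu : φ.upperFirst <;> simp_all [bits]

theorem bits_congr₂ {b b' c c' : Bool} {j : ℕ} (hj : j < 2) (hne : j ≠ φ.level₂) (h : b = c) :
    bits (φ.order₁ b b') (φ.order₂ b b') j = bits (φ.order₁ c c') (φ.order₂ c c') j := by
  subst h
  unfold level₂ at hne
  unfold order₁ order₂
  interval_cases j <;> cases hu : φ.upperFirst <;> simp_all [bits]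

theorem card_filter_bits {k : ℕ} (v : Finset ℕ) {β : ℕ → Bool} {a : ℕ} (ha : a ≤ 2) :
    ((insBits k 2 v β).filter fun l => k + a ≤ l).card = (v.filter fun l => k ≤ l).card +
      ((Finset.range 2).filter fun j => β j = true ∧ a ≤ j).card :=
  card_filter_insBits k 2 a v β ha

variable {R : Type*} [CommRing R] {h t : R}

/-- The component of the map of a finger move at a vertex; here `b` is the resolution of the first
crossing after its change, and `!b` the one of the second crossing. -/
theorem map_apply (b : Bool) {z₁ z₂ : Fin 2} (hz₁ : z₁ = if b then 1 else 0)
    (hz₂ : z₂ = if !b then 1 else 0) (z z' : Fin 2) (x : CKh h t E) (v : E.Vertex) :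
    φ.remove.map h t z' (φ.change₂.map h t z₂ (φ.change₁.map h t z₁ (φ.create.map h t z x))) v =
      sgn b • (Move.unpoke φ.i (!φ.ε)).entry h t z' φ.E₃ E φ.create.pre.length
        (φ.vertex₃ v (φ.order₁ b !b) (φ.order₂ b !b)).1 v.1
      ((Move.crossingChange φ.i (!φ.first) φ.dir₂).entry h t z₂ φ.E₂ φ.E₃
          (φ.create.pre.length + φ.level₂) (φ.vertex₂ v (φ.order₁ b b) (φ.order₂ b b)).1
          (φ.vertex₃ v (φ.order₁ b !b) (φ.order₂ b !b)).1
        ((Move.crossingChange φ.i φ.first φ.dir₁).entry h t z₁ φ.E₁ φ.E₂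
            (φ.create.pre.length + φ.level₁) (φ.vertex₁ v (φ.order₁ (!b) b) (φ.order₂ (!b) b)).1
            (φ.vertex₂ v (φ.order₁ b b) (φ.order₂ b b)).1
          ((Move.poke φ.i φ.ε).entry h t z E φ.E₁ φ.create.pre.length v.1
            (φ.vertex₁ v (φ.order₁ (!b) b) (φ.order₂ (!b) b)).1 (x v)))) := by
  have l1 := φ.level_lt.1
  have l2 := φ.level_lt.2
  rw [φ.remove.map_apply_of_unique z' _ (φ.remove_agree v (φ.order₁ b !b) (φ.order₂ b !b)),
    φ.change₂.map_crossingChange φ.change₂_move' φ.change₂_level' _ (b := !b)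
      (v := φ.vertex₂ v (φ.order₁ b b) (φ.order₂ b b))
      (agreeOutside_insBits_insBits _ fun j hj hne => φ.bits_congr₂ hj hne rfl)
      ((bit_insBits _ _ l2).trans (by rw [(φ.bits_level _ _).2, Bool.not_not])) hz₂,
    φ.change₁.map_crossingChange (φ.change₁_move.trans rfl) φ.change₁_level' _ (b := b)
      (v := φ.vertex₁ v (φ.order₁ (!b) b) (φ.order₂ (!b) b))
      (agreeOutside_insBits_insBits _ fun j hj hne => φ.bits_congr₁ hj hne rfl)
      ((bit_insBits _ _ l1).trans (by rw [(φ.bits_level _ _).1])) hz₁,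
    φ.create.map_apply_eq z _ (φ.create_agree v (φ.order₁ (!b) b) (φ.order₂ (!b) b))]
  · rw [φ.create_move, φ.remove_move, φ.remove_level', φ.remove_mid, φ.create_mid]
    simp only [map_zsmul, smul_smul, ← pow_add]
    congr 1
    simp only [vertex₁, vertex₂, vertex₃, add_assoc φ.create.pre.length]
    rw [card_filter_bits v.1 (a := φ.level₁ + 1) (by omega),
      card_filter_bits v.1 (a := φ.level₂ + 1) (by omega)]
    rw [show [cross φ.i !φ.ε, cross φ.i φ.ε].length = 2 from rfl, card_filter_bits v.1 le_rfl]
    simp only [card_insBits, List.length_nil, Nat.add_zero]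
    change (-1 : ℤ) ^ (_ + (_ + (_ + (v.1.filter fun l => φ.create.pre.length ≤ l).card * _))) = _
    generalize (v.1.filter fun l => φ.create.pre.length ≤ l).card = N
    generalize v.1.card = n
    -- The contributions of the crossings below the move cancel in pairs. What is left comes from
    -- changing the upper crossing past the lower one, whose resolution at that moment is `b` in
    -- either order of the changes; hence `sgn b`.
    unfold order₁ order₂ level₁ level₂
    simp only [Finset.card_filter, Finset.sum_range_succ, Finset.sum_range_zero]
    cases φ.upperFirst <;> cases b <;> simp [bits, sgn] <;> ring_nf <;>
      simp [mul_comm _ 2, pow_mul, mul_comm _ 8]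
    all_goals rcases neg_one_pow_eq_or ℤ N with e | e <;> simp [e]
  · intro w hw hne
    refine absurd (Subtype.ext ?_) hne
    rw [LocalChange.Agree, φ.create_mid, φ.create_mid'] at hw
    exact eq_of_agreeOutside (hw.trans (agreeOutside_insBits _ _ _ _).symm) (by simp)
  · intro w hw hne
    rw [φ.remove_move]
    -- A vertex whose second crossing has the wrong resolution is not in the image of the second
    -- change. If that resolution is right but the first one is wrong, both crossings have equal
    -- resolutions, and the final Reidemeister 2 map vanishes.
    by_cases hb : bit w.1 (φ.create.pre.length + φ.level₂) = b
    · have : φ.change₂.map h t z₂ (φ.change₁.map h t z₁ (φ.create.map h t z x)) w = 0 := by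
        refine Step.map_apply_eq_zero _ _ _ fun u hu => ?_
        rw [φ.change₂_move', crossingChange_entry_eq_zero, LinearMap.zero_apply]
        rw [φ.change₂_level', hb, hz₂]
        cases b <;> simp
      rw [this, map_zero]
    · rw [φ.remove_level']
      have hb : bit w.1 (φ.create.pre.length + φ.level₂) = !b := by
        cases b <;> simpa using hb
      have hc : ¬ bit w.1 (φ.create.pre.length + φ.level₁) = b := by
        intro hc
        refine hne (Subtype.ext ?_)
        rw [LocalChange.Agree, φ.remove_mid, φ.remove_mid', φ.remove_level'] at hw
        refine eq_of_agreeOutside (hw.trans (agreeOutside_insBits _ _ _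
          (bits (φ.order₁ b !b) (φ.order₂ b !b)))) fun j hj => ?_
        refine Eq.trans ?_ (bit_insBits v.1 _ hj).symm
        have hj' : j = φ.level₁ ∨ j = φ.level₂ := by
          have := φ.level_cases; simp at hj; omega
        rcases hj' with rfl | rfl
        · rw [hc, (φ.bits_level _ _).1]
        · rw [hb, (φ.bits_level _ _).2]
      have hc : bit w.1 (φ.create.pre.length + φ.level₁) = !b := by
        cases b <;> simpa using hc
      have : bit w.1 φ.create.pre.length = !b ∧ bit w.1 (φ.create.pre.length + 1) = !b := by
        rcases φ.level_cases with ⟨h1, h2⟩ | ⟨h1, h2⟩ <;> rw [h1] at hc <;> rw [h2] at hb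
        · exact ⟨hc, hb⟩
        · exact ⟨hb, hc⟩
      simp only [Move.entry, this, Prod.mk.injEq]
      rw [if_neg, if_neg, LinearMap.zero_apply] <;> cases b <;> cases φ.ε <;> simp

/-- If the same generator of the Hopf link is used twice, the map of a finger move vanishes. -/
theorem map_apply_eq_zero (z z' : Fin 2) (x : CKh h t φ.E₁) :
    φ.remove.map h t z' (φ.change₂.map h t z (φ.change₁.map h t z x)) = 0 := by
  funext v
  refine Step.map_apply_eq_zero _ _ _ fun w hw => ?_
  rw [φ.remove_move, φ.remove_level']
  by_cases h2 : bit w.1 (φ.create.pre.length + φ.level₂) = true ↔ z = 0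
  · have : φ.change₂.map h t z (φ.change₁.map h t z x) w = 0 := by
      refine Step.map_apply_eq_zero _ _ _ fun u hu => ?_
      rw [φ.change₂_move', φ.change₂_level', crossingChange_entry_eq_zero h2, LinearMap.zero_apply]
    rw [this, map_zero]
  by_cases h1 : bit w.1 (φ.create.pre.length + φ.level₁) = true ↔ z = 0
  · have : φ.change₂.map h t z (φ.change₁.map h t z x) w = 0 := by
      refine Step.map_apply_eq_zero _ _ _ fun u hu => ?_
      have : φ.change₁.map h t z x u = 0 := by
        refine Step.map_apply_eq_zero _ _ _ fun u' hu' => ?_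
        rw [φ.change₁_move, φ.change₁_level', crossingChange_entry_eq_zero, LinearMap.zero_apply]
        rw [← h1]
        rw [LocalChange.Agree, φ.change₂_mid, φ.change₂_mid', φ.change₂_level'] at hu
        have e : bit u.1 (φ.create.pre.length + φ.level₁) =
            bit w.1 (φ.create.pre.length + φ.level₁) := by
          refine bit_congr ?_
          rcases φ.level_cases with ⟨e1, e2⟩ | ⟨e1, e2⟩ <;> rw [e1] <;> rw [e2] at hu
          · exact hu.1 _ (by omega)
          · exact hu.2 0
        rw [e]
      rw [this, map_zero]
    rw [this, map_zero]
  -- Two changes by the same generator leave both crossings with equal resolutions, whereas the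
  -- Reidemeister 2 map needs different ones.
  have e : bit w.1 φ.create.pre.length = bit w.1 (φ.create.pre.length + 1) := by
    rcases φ.level_cases with ⟨e1, e2⟩ | ⟨e1, e2⟩ <;> rw [e1] at h1 <;> rw [e2] at h2 <;>
      simp only [Nat.add_zero] at h1 h2 <;>
      cases hA : bit w.1 φ.create.pre.length <;>
      cases hB : bit w.1 (φ.create.pre.length + 1) <;> simp [hA, hB] at h1 h2 ⊢ <;> omega
  simp only [Move.entry, e, Prod.mk.injEq]
  rw [if_neg, if_neg, LinearMap.zero_apply] <;>
    cases bit w.1 (φ.create.pre.length + 1) <;> cases φ.ε <;> simp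

end Finger

end

end ImmersedKhovanov

namespace ImmersedKhovanov

open Diagram

noncomputable section

theorem exists_unit_sgn (b : Bool) : ∃ s : ℤˣ, (s : ℤ) = sgn b := by
  cases b
  · exact ⟨1, rfl⟩
  · exact ⟨-1, rfl⟩

/-- A labelling that separates the circle between two horizontally smoothed crossings from the outer
points. -/
theorem LocalChange.exists_pair_label {D D' : Diagram} {v v' : Finset ℕ} (C : LocalChange D D')
    (hA : C.Agree v v') {i : ℕ} {ε : Bool} (hm : C.mid = [cross i ε, cross i (!ε)])
    (h0 : bit v C.pre.length = ε) (h1 : bit v (C.pre.length + 1) = !ε) : ∃ f ∈ D.labels v,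
      (∀ p, IsOuter C.pre.length C.mid.length p → f p.1 p.2 = false) ∧
      f (C.pre.length + 1) i = true ∧ f (C.pre.length + 1) (i + 1) = true := by
  set z : Row := fun _ => false
  have hg : ∀ n L, C.mid[n]? = some L → (if n + 1 = 1 then z.ins i true else z) ∈
      outs L (bit v (C.pre.length + n)) (if n = 1 then z.ins i true else z) := by
    intro n L hL
    have hn := (List.getElem?_eq_some_iff.mp hL).1
    rw [hm] at hL hn
    simp only [List.length_cons, List.length_nil] at hn
    interval_cases n <;> simp only [List.getElem?_cons_zero, List.getElem?_cons_succ,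
      Option.some.injEq] at hL <;> subst hL <;> rw [mem_outs_cross]
    · simp [Row.ins, z, h0]
      grind
    · simp [Row.ins, z, h1]
      grind
  obtain ⟨f, hf, ho, hi⟩ := C.exists_label_of_path hA (zero_mem_labels D' v')
    (g := fun n => if n = 1 then z.ins i true else z) (by simp [z]) hg
    (by rw [hm]; simp [z])
  refine ⟨f, hf, fun p hp => ho.apply hp rfl, ?_⟩
  rw [hi 1 (by rw [hm]; simp)]
  simp [Row.ins]

namespace Finger

variable {E : Diagram} (φ : Finger E) {R : Type*} [CommRing R] {h t : R}

/-- The composition of both crossing changes. -/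
theorem change_entry (b : Bool) {z₁ z₂ : Fin 2} (hz₁ : z₁ = if b then 1 else 0)
    (hz₂ : z₂ = if !b then 1 else 0) (v : E.Vertex) :
    ∃ G : State h t φ.E₁ (φ.vertex₁ v (φ.order₁ (!b) b) (φ.order₂ (!b) b)).1 →ₗ[R]
        State h t φ.E₃ (φ.vertex₃ v (φ.order₁ b !b) (φ.order₂ b !b)).1,
      (∀ x, G x = (Move.crossingChange φ.i (!φ.first) φ.dir₂).entry h t z₂ φ.E₂ φ.E₃
          (φ.create.pre.length + φ.level₂) (φ.vertex₂ v (φ.order₁ b b) (φ.order₂ b b)).1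
          (φ.vertex₃ v (φ.order₁ b !b) (φ.order₂ b !b)).1
        ((Move.crossingChange φ.i φ.first φ.dir₁).entry h t z₁ φ.E₁ φ.E₂
            (φ.create.pre.length + φ.level₁) (φ.vertex₁ v (φ.order₁ (!b) b) (φ.order₂ (!b) b)).1
            (φ.vertex₂ v (φ.order₁ b b) (φ.order₂ b b)).1 x)) ∧ DotCommutes G ∧
      G 1 = sgn (!if b then φ.dir₂ else φ.dir₁) •
        (dot h t φ.E₃ _ (φ.create.pre.length + (if φ.order₁ b !b then 1 else 0) + 1, φ.i + 1) -
          dot h t φ.E₃ _ (φ.create.pre.length + (if φ.order₁ b !b then 1 else 0), φ.i)) := by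
  obtain ⟨l1, l2⟩ := φ.level_lt
  obtain ⟨c1, d1⟩ := crossingChange_entry (C := φ.change₁.change) (h := h) (t := t) (dir := φ.dir₁)
    (v := (φ.vertex₁ v (φ.order₁ (!b) b) (φ.order₂ (!b) b)).1)
    (v' := (φ.vertex₂ v (φ.order₁ b b) (φ.order₂ b b)).1)
    (by
      rw [LocalChange.Agree, φ.change₁_mid, φ.change₁_mid', φ.change₁_level']
      exact agreeOutside_insBits_insBits _ fun j hj hne => φ.bits_congr₁ hj hne rfl)
    φ.change₁_mid φ.change₁_mid' φ.change₁_level'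
    ((bit_insBits _ _ l1).trans (by rw [(φ.bits_level _ _).1]))
    ((bit_insBits _ _ l1).trans (by rw [(φ.bits_level _ _).1])) hz₁
  obtain ⟨c2, d2⟩ := crossingChange_entry (C := φ.change₂.change) (h := h) (t := t) (dir := φ.dir₂)
    (v := (φ.vertex₂ v (φ.order₁ b b) (φ.order₂ b b)).1)
    (v' := (φ.vertex₃ v (φ.order₁ b !b) (φ.order₂ b !b)).1)
    (by
      rw [LocalChange.Agree, φ.change₂_mid, φ.change₂_mid', φ.change₂_level']
      exact agreeOutside_insBits_insBits _ fun j hj hne => φ.bits_congr₂ hj hne rfl)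
    φ.change₂_mid (by rw [φ.change₂_mid', Bool.not_not]) φ.change₂_level'
    ((bit_insBits _ _ l2).trans (by rw [(φ.bits_level _ _).2, Bool.not_not]))
    ((bit_insBits _ _ l2).trans (by rw [(φ.bits_level _ _).2])) hz₂
  refine ⟨_, fun x => rfl, c2.comp c1, ?_⟩
  rw [LinearMap.comp_apply, d1]
  -- The factor `Φ` comes from the crossing changed by `f₀`. For `b = false` this is the first one,
  -- and `Φ` has to be carried through the second change, which commutes with dots; for `b = true`
  -- it is the second one. That crossing ends up `0`-resolved, so it is the lower one exactly when
  -- `order₁ b !b` is `true`.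
  cases b
  · rw [if_neg Bool.false_ne_true, map_zsmul, map_sub]
    have w := φ.E₂.width_cross (l := φ.create.pre.length + φ.level₁) (i := φ.i) (ε := !φ.first) (by
      have : φ.E₂.word[φ.change₁.change.pre.length + 0]? = φ.change₁.change.mid'[0]? :=
        φ.change₁.change.symm.getElem?_mid (by simp [LocalChange.symm, φ.change₁_mid'])
      rw [← φ.change₁_level', ← Nat.add_zero φ.change₁.change.pre.length, this, φ.change₁_mid']
      rfl)
    have g1 := (c2 (φ.create.pre.length + φ.level₁ + 1, φ.i + 1)
      (by rw [Diagram.inRange_iff]; simp only; omega)).2 1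
    have g2 := (c2 (φ.create.pre.length + φ.level₁, φ.i)
      (by rw [Diagram.inRange_iff]; simp only; omega)).2 1
    rw [d2, if_pos Bool.not_false, mul_one, mul_one] at g1 g2
    rw [g1, g2]
    unfold order₁ level₁
    cases φ.upperFirst <;> rfl
  · rw [if_pos rfl, d2]
    unfold order₁ level₂
    cases φ.upperFirst <;> rfl

theorem width_create : φ.i + 2 ≤ E.width φ.create.pre.length := by
  have r := φ.create.change.run_mid'
  rw [φ.create_mid'] at r
  obtain ⟨A, a, b, B, hA, e⟩ := run_cross_exists r
  change _ ≤ (E.strands φ.create.change.pre.length).length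
  rw [e]
  simp
  omega

theorem inRange_create : φ.E₁.InRange (φ.create.pre.length, φ.i) ∧
    φ.E₁.InRange (φ.create.pre.length + 2, φ.i + 1) := by
  have hw := φ.width_create
  have r1 := φ.create.change.inRange_transport (p := (φ.create.pre.length, φ.i))
    (by rw [Diagram.inRange_iff]; simp only; omega) (.inl le_rfl)
  rw [transport_of_le (le_refl φ.create.pre.length)] at r1
  refine ⟨r1, ?_⟩
  have := φ.create.change.strands_post
  rw [φ.create_mid, φ.create_mid'] at this
  rw [Diagram.inRange_iff, width]
  change _ < (φ.E₁.strands (φ.create.change.pre.length + 2)).length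
  rw [show φ.create.change.pre.length + 2 = φ.create.change.pre.length +
    [cross φ.i φ.ε, cross φ.i (!φ.ε)].length from rfl, this]
  change _ < E.width φ.create.pre.length
  simp only
  omega

theorem word_remove : φ.E₃.word[φ.create.pre.length]? = some (cross φ.i (!φ.ε)) ∧
    φ.E₃.word[φ.create.pre.length + 1]? = some (cross φ.i φ.ε) := by
  have g : ∀ {j}, j < 2 → φ.E₃.word[φ.create.pre.length + j]? =
      [cross φ.i (!φ.ε), cross φ.i φ.ε][j]? := fun {j} hj => by
    rw [← φ.remove_level', φ.remove.change.getElem?_mid (by rwa [φ.remove_mid]), φ.remove_mid]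
  exact ⟨g (j := 0) (by omega), g (j := 1) (by omega)⟩

theorem inRange_remove {l j : ℕ} (hl : l ≤ 2) (hj : j < 2) :
    φ.E₃.InRange (φ.create.pre.length + l, φ.i + j) := by
  have w0 := φ.E₃.width_cross φ.word_remove.1
  have w1 := φ.E₃.width_cross φ.word_remove.2
  rw [Diagram.inRange_iff]
  simp only
  rw [show φ.create.pre.length + 1 + 1 = φ.create.pre.length + 2 from rfl] at w1
  interval_cases l
  · rw [Nat.add_zero]; omega
  · omega
  · omega

theorem transferWord_create {v : Finset ℕ} (g : Row → ℕ) :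
    transferWord v φ.create.change.pre.length φ.create.change.mid g = 2 ^ 0 • g := by
  rw [φ.create_mid]; simp [transferWord]

theorem transferWord_remove {v : Finset ℕ} (g : Row → ℕ) :
    transferWord v φ.remove.change.pre.length φ.remove.change.mid' g = 2 ^ 0 • g := by
  rw [φ.remove_mid']; simp [transferWord]

theorem bit_vertex₁ (v : E.Vertex) (b b' : Bool) :
    bit (φ.vertex₁ v b b').1 φ.create.pre.length = b ∧
    bit (φ.vertex₁ v b b').1 (φ.create.pre.length + 1) = b' :=
  ⟨bit_insBits v.1 (bits b b') (j := 0) (by omega), bit_insBits v.1 (bits b b') (by omega)⟩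

theorem bit_vertex₃ (v : E.Vertex) (b b' : Bool) :
    bit (φ.vertex₃ v b b').1 φ.create.pre.length = b ∧
    bit (φ.vertex₃ v b b').1 (φ.create.pre.length + 1) = b' :=
  ⟨bit_insBits v.1 (bits b b') (j := 0) (by omega), bit_insBits v.1 (bits b b') (by omega)⟩

section Vertical

/-! The crossings are smoothed vertically. -/

theorem poke_dotLinear_vertical (v : E.Vertex) (z : Fin 2) :
    φ.create.change.DotLinear h t v.1 (φ.vertex₁ v (!φ.ε) φ.ε).1
      ((Move.poke φ.i φ.ε).entry h t z E φ.E₁ φ.create.pre.length v.1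
        (φ.vertex₁ v (!φ.ε) φ.ε).1) ∧
    (Move.poke φ.i φ.ε).entry h t z E φ.E₁ φ.create.pre.length v.1
        (φ.vertex₁ v (!φ.ε) φ.ε).1 1 = 1 := by
  obtain ⟨b0, b1⟩ := φ.bit_vertex₁ v (!φ.ε) φ.ε
  simp only [Move.entry, b0, b1, if_true]
  refine ⟨LocalChange.dotLinear_of_extension rfl (by rw [φ.create_mid]; rfl)
    (by rw [φ.create_mid']; rfl) (LocalChange.exists_label_of_eq _ (φ.create_agree v _ _)
    (O := id) (a := 0) (b := 0) φ.transferWord_create fun g => ?_) _ _, localMap_one _ _ _ _ _ _ _⟩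
  rw [φ.create_mid']
  change transferWord _ φ.create.pre.length _ _ = _
  simp [transferWord, transfer_cross, b0, b1]

theorem unpoke_dotLinear_vertical (v : E.Vertex) (z : Fin 2) :
    φ.remove.change.DotLinear h t (φ.vertex₃ v φ.ε !φ.ε).1 v.1
      ((Move.unpoke φ.i (!φ.ε)).entry h t z φ.E₃ E φ.create.pre.length
        (φ.vertex₃ v φ.ε !φ.ε).1 v.1) ∧
    (Move.unpoke φ.i (!φ.ε)).entry h t z φ.E₃ E φ.create.pre.length
        (φ.vertex₃ v φ.ε !φ.ε).1 v.1 1 = 1 := by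
  obtain ⟨b0, b1⟩ := φ.bit_vertex₃ v φ.ε !φ.ε
  simp only [Move.entry, b0, b1, Bool.not_not, if_true]
  refine ⟨LocalChange.dotLinear_of_extension φ.remove_level (by rw [φ.remove_mid]; rfl)
    (by rw [φ.remove_mid']; rfl) (LocalChange.exists_label_of_eq _ (φ.remove_agree v _ _)
    (O := id) (a := 0) (b := 0) (fun g => ?_) φ.transferWord_remove) _ _,
    localMap_one _ _ _ _ _ _ _⟩
  rw [φ.remove_mid, φ.remove_level']
  simp [transferWord, transfer_cross, b0, b1]

theorem dot_vertical (v : E.Vertex) {l j : ℕ} (hl : l ≤ 2) (hj : j < 2) :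
    dot h t φ.E₃ (φ.vertex₃ v φ.ε !φ.ε).1 (φ.create.pre.length + l, φ.i + j) =
      dot h t φ.E₃ (φ.vertex₃ v φ.ε !φ.ε).1 (φ.create.pre.length, φ.i + j) := by
  obtain ⟨b0, b1⟩ := φ.bit_vertex₃ v φ.ε !φ.ε
  refine dot_eq_of_labels h t (φ.inRange_remove hl hj) (φ.inRange_remove (l := 0) (by omega) hj)
    fun f hf => ?_
  have hf := (mem_labels_iff.mp hf).2.1
  have h0 := (mem_outs_cross.mp (hf _ _ φ.word_remove.1)).2.1 (by rw [b0, Bool.not_not])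
  have h1 := (mem_outs_cross.mp (hf _ _ φ.word_remove.2)).2.1 b1
  interval_cases l <;> interval_cases j <;> simp_all [add_assoc]

end Vertical

section Horizontal

/-! The crossings are smoothed horizontally. -/

theorem transferWord_create_horizontal (v : E.Vertex) (g : Row → ℕ) :
    transferWord (φ.vertex₁ v φ.ε !φ.ε).1 φ.create.change.pre.length φ.create.change.mid' g =
      2 ^ 1 • capT φ.i (cupT φ.i g) := by
  obtain ⟨b0, b1⟩ := φ.bit_vertex₁ v φ.ε !φ.ε
  rw [φ.create_mid']
  exact transferWord_poke b0 b1 g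

theorem transferWord_remove_horizontal (v : E.Vertex) (g : Row → ℕ) :
    transferWord (φ.vertex₃ v (!φ.ε) φ.ε).1 φ.remove.change.pre.length φ.remove.change.mid g =
      2 ^ 1 • capT φ.i (cupT φ.i g) := by
  obtain ⟨b0, b1⟩ := φ.bit_vertex₃ v (!φ.ε) φ.ε
  rw [φ.remove_mid, φ.remove_level']
  have := transferWord_poke (i := φ.i) b0 (by rw [b1, Bool.not_not]) g
  rwa [Bool.not_not] at this

/-- Planarity in the form that linearity of the first saddle requires: the two ends are joined
before or after it. -/
theorem connected_create (v : E.Vertex) :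
    Connected E v.1 (φ.create.pre.length, φ.i) (φ.create.pre.length + 0, φ.i + 1) ∨
    Connected φ.E₁ (φ.vertex₁ v φ.ε !φ.ε).1 (φ.create.pre.length, φ.i)
      (φ.create.pre.length + 2, φ.i + 1) := by
  have := φ.create.change.saddle (φ.create_agree v _ _) φ.width_create
    (LocalChange.width_post_of_mid_nil _ φ.create_mid) φ.transferWord_create
    (φ.transferWord_create_horizontal v)
  rw [φ.create_mid, φ.create_mid'] at this
  exact this.imp (fun h => h.1) fun h => h.2.1

/-- The ends are joined on exactly one side of the last saddle. So it merges precisely when the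
strands of `E` lie on one circle, that is, precisely when the first saddle splits. -/
theorem connected_remove (v : E.Vertex) :
    Connected E v.1 (φ.create.pre.length, φ.i) (φ.create.pre.length + 0, φ.i + 1) ↔
    ¬ Connected φ.E₃ (φ.vertex₃ v (!φ.ε) φ.ε).1 (φ.create.pre.length, φ.i)
      (φ.create.pre.length + 2, φ.i + 1) := by
  have hk : φ.remove.change.symm.pre.length = φ.create.pre.length := φ.remove_level'
  have := φ.remove.change.symm.saddle (a := 0) (b := 1) (i := φ.i)
    (φ.remove_agree v (!φ.ε) φ.ε).symm (by rw [hk]; exact φ.width_create)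
    (LocalChange.width_post_of_mid_nil _ φ.remove_mid') φ.transferWord_remove
    (φ.transferWord_remove_horizontal v)
  rw [hk, show φ.remove.change.symm.mid = [] from φ.remove_mid',
    show φ.remove.change.symm.mid' = _ from φ.remove_mid] at this
  rcases this with ⟨h1, h2, -⟩ | ⟨h1, h2, -⟩
  · exact ⟨fun _ => h2, fun _ => h1⟩
  · exact ⟨fun h => absurd h h1, fun h => absurd h2 h⟩

theorem poke_dotLinear_horizontal (v : E.Vertex) (z : Fin 2) :
    φ.create.change.DotLinear h t v.1 (φ.vertex₁ v φ.ε !φ.ε).1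
      ((Move.poke φ.i φ.ε).entry h t z E φ.E₁ φ.create.pre.length v.1
        (φ.vertex₁ v φ.ε !φ.ε).1) ∧
    (Move.poke φ.i φ.ε).entry h t z E φ.E₁ φ.create.pre.length v.1
        (φ.vertex₁ v φ.ε !φ.ε).1 1 =
      saddleValue h t E φ.E₁ φ.create.pre.length 0 2 φ.i v.1 (φ.vertex₁ v φ.ε !φ.ε).1 := by
  obtain ⟨b0, b1⟩ := φ.bit_vertex₁ v φ.ε !φ.ε
  have hm : φ.create.change.mid.length = 0 := by rw [φ.create_mid]; rfl
  have hm' : φ.create.change.mid'.length = 2 := by rw [φ.create_mid']; rfl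
  obtain ⟨r1, r2⟩ := φ.inRange_create
  simp only [Move.entry, b0, b1, Prod.mk.injEq]
  rw [if_neg (by cases φ.ε <;> simp), if_pos trivial]
  refine ⟨(LocalChange.dotLinear_saddle (C := φ.create.change) rfl hm hm' r1 r2 ?_
    (φ.connected_create v)).1, localMap_one _ _ _ _ _ _ _⟩
  have := φ.create.change.exists_label_of_vertical (φ.create_agree v φ.ε !φ.ε)
    φ.transferWord_create (φ.transferWord_create_horizontal v)
  rwa [hm'] at this

theorem unpoke_horizontal (v : E.Vertex) (z : Fin 2) :
    (Move.unpoke φ.i (!φ.ε)).entry h t z φ.E₃ E φ.create.pre.length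
        (φ.vertex₃ v (!φ.ε) φ.ε).1 v.1 =
      -deathSaddleMap h t φ.E₃ E φ.create.pre.length 2 0 φ.i (φ.vertex₃ v (!φ.ε) φ.ε).1 v.1 := by
  obtain ⟨b0, b1⟩ := φ.bit_vertex₃ v (!φ.ε) φ.ε
  simp only [Move.entry, b0, b1, Prod.mk.injEq, Bool.not_not]
  rw [if_neg (by cases φ.ε <;> simp), if_pos trivial]

theorem unpoke_dotLinear_horizontal (v : E.Vertex) :
    φ.remove.change.DotLinear h t (φ.vertex₃ v (!φ.ε) φ.ε).1 v.1
      (deathSaddleMap h t φ.E₃ E φ.create.pre.length 2 0 φ.i (φ.vertex₃ v (!φ.ε) φ.ε).1 v.1) := by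
  have hm : φ.remove.change.mid.length = 2 := by rw [φ.remove_mid]; rfl
  have hm' : φ.remove.change.mid'.length = 0 := by rw [φ.remove_mid']; rfl
  have hw := φ.width_create
  refine (LocalChange.dotLinear_saddle (C := φ.remove.change) φ.remove_level hm hm'
    (by rw [Diagram.inRange_iff]; simp only; omega)
    (by rw [Diagram.inRange_iff]; simp only [Nat.add_zero]; omega) ?_ ?_).2
  · have := φ.remove.change.exists_label_of_horizontal (φ.remove_agree v (!φ.ε) φ.ε)
      (φ.transferWord_remove_horizontal v) φ.transferWord_remove
    rwa [hm', φ.remove_level'] at this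
  · have := φ.connected_remove v
    tauto

/-- The value of the last step of a finger move at the small circle. -/
theorem unpoke_inner (v : E.Vertex) {j : ℕ} (hj : j < 2) :
    deathSaddleMap h t φ.E₃ E φ.create.pre.length 2 0 φ.i (φ.vertex₃ v (!φ.ε) φ.ε).1 v.1
      (dot h t φ.E₃ (φ.vertex₃ v (!φ.ε) φ.ε).1 (φ.create.pre.length + 1, φ.i + j)) =
      saddleValue h t φ.E₃ E φ.create.pre.length 2 0 φ.i (φ.vertex₃ v (!φ.ε) φ.ε).1 v.1 := by
  obtain ⟨b0, b1⟩ := φ.bit_vertex₃ v (!φ.ε) φ.ε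
  obtain ⟨f, hf, h1, h2⟩ := φ.remove.change.exists_pair_label (φ.remove_agree v (!φ.ε) φ.ε)
    (i := φ.i) (ε := !φ.ε) (by rw [φ.remove_mid, Bool.not_not]) (by rw [φ.remove_level', b0])
    (by rw [φ.remove_level', b1, Bool.not_not])
  rw [φ.remove_level', φ.remove_mid] at h1
  rw [φ.remove_level'] at h2
  refine localMap_dot_inner h t _ _ _ _ _ (φ.inRange_remove (by omega) hj)
    fun p _ ho => ⟨f, hf, ?_⟩
  rw [h1 p ho]
  interval_cases j
  · simp [h2.1]
  · simp [h2.2]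

theorem unpoke_upper (v : E.Vertex) {j : ℕ} (hj : j < 2) (y : State h t φ.E₃ _) :
    deathSaddleMap h t φ.E₃ E φ.create.pre.length 2 0 φ.i (φ.vertex₃ v (!φ.ε) φ.ε).1 v.1
      (dot h t φ.E₃ (φ.vertex₃ v (!φ.ε) φ.ε).1 (φ.create.pre.length, φ.i + j) * y) =
      dot h t E v.1 (φ.create.pre.length, φ.i + j) *
        deathSaddleMap h t φ.E₃ E φ.create.pre.length 2 0 φ.i (φ.vertex₃ v (!φ.ε) φ.ε).1 v.1 y := by
  have := φ.unpoke_dotLinear_horizontal (h := h) (t := t) v _ (φ.inRange_remove (l := 0) (by omega) hj)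
    (.inl (le_of_eq φ.remove_level.symm)) y
  rwa [transport_of_le (le_of_eq φ.remove_level.symm)] at this

theorem unpoke_lower (v : E.Vertex) (y : State h t φ.E₃ _) :
    deathSaddleMap h t φ.E₃ E φ.create.pre.length 2 0 φ.i (φ.vertex₃ v (!φ.ε) φ.ε).1 v.1
      (dot h t φ.E₃ (φ.vertex₃ v (!φ.ε) φ.ε).1 (φ.create.pre.length + 2, φ.i + 1) * y) =
      dot h t E v.1 φ.rightPoint *
        deathSaddleMap h t φ.E₃ E φ.create.pre.length 2 0 φ.i (φ.vertex₃ v (!φ.ε) φ.ε).1 v.1 y := by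
  have := φ.unpoke_dotLinear_horizontal (h := h) (t := t) v _
    (φ.inRange_remove (l := 2) (j := 1) le_rfl (by omega))
    (.inr (by rw [φ.remove_level', φ.remove_mid]; rfl)) y
  rw [φ.remove_level', φ.remove_mid, φ.remove_mid'] at this
  simpa [transport, rightPoint] using this

/-- Exactly one of the two ends lies on the small circle between the crossings; its dot makes the
death nonzero and leaves the value of the saddle. The dot at the other end is an outer one and
factors out of the image of `1`, which is zero. Which end is the inner one depends on which crossing
carries `Φ`, and this gives the sign. -/
theorem unpoke_sub (v : E.Vertex) {c : Bool} (hc : c = !φ.ε) :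
    deathSaddleMap h t φ.E₃ E φ.create.pre.length 2 0 φ.i (φ.vertex₃ v (!φ.ε) φ.ε).1 v.1
      (dot h t φ.E₃ (φ.vertex₃ v (!φ.ε) φ.ε).1
          (φ.create.pre.length + (if c then 1 else 0) + 1, φ.i + 1) -
        dot h t φ.E₃ (φ.vertex₃ v (!φ.ε) φ.ε).1
          (φ.create.pre.length + (if c then 1 else 0), φ.i)) =
      sgn φ.ε •
      -saddleValue h t φ.E₃ E φ.create.pre.length 2 0 φ.i (φ.vertex₃ v (!φ.ε) φ.ε).1 v.1 := by
  have l0 := φ.unpoke_inner (h := h) (t := t) v (j := 0) (by omega)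
  have l1 := φ.unpoke_inner (h := h) (t := t) v (j := 1) (by omega)
  have r0 := φ.unpoke_upper (h := h) (t := t) v (j := 0) (by omega) 1
  have r1 := φ.unpoke_lower (h := h) (t := t) v 1
  have F1 : deathSaddleMap h t φ.E₃ E φ.create.pre.length 2 0 φ.i (φ.vertex₃ v (!φ.ε) φ.ε).1 v.1 1
    = 0 := localMap_one _ _ _ _ _ _ _
  rw [F1, mul_zero, mul_one] at r0 r1
  rw [Nat.add_zero φ.i] at l0 r0
  rw [map_sub]
  cases c
  · have hs : sgn φ.ε = -1 := by rw [show φ.ε = true by simpa using hc.symm]; rfl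
    rw [if_neg Bool.false_ne_true, Nat.add_zero φ.create.pre.length, l1, r0, hs]
    simp
  · have hs : sgn φ.ε = 1 := by rw [show φ.ε = false by simpa using hc.symm]; rfl
    rw [if_pos rfl, show φ.create.pre.length + 1 + 1 = φ.create.pre.length + 2 from rfl, r1, l0, hs]
    simp

/-- Multiplication with the neck-cutting element before the last step of a finger move. -/
theorem unpoke_neck (v : E.Vertex) (y : State h t φ.E₃ _) :
    deathSaddleMap h t φ.E₃ E φ.create.pre.length 2 0 φ.i (φ.vertex₃ v (!φ.ε) φ.ε).1 v.1
      ((dot h t φ.E₃ (φ.vertex₃ v (!φ.ε) φ.ε).1 (φ.create.pre.length, φ.i) +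
        dot h t φ.E₃ (φ.vertex₃ v (!φ.ε) φ.ε).1 (φ.create.pre.length + 2, φ.i + 1) -
        algebraMap R _ h) * y) =
      (dot h t E v.1 φ.leftPoint + dot h t E v.1 φ.rightPoint - algebraMap R _ h) *
        deathSaddleMap h t φ.E₃ E φ.create.pre.length 2 0 φ.i (φ.vertex₃ v (!φ.ε) φ.ε).1 v.1 y := by
  have r0 := φ.unpoke_upper (h := h) (t := t) v (j := 0) (by omega) y
  rw [Nat.add_zero] at r0
  rw [sub_mul, add_mul, map_sub, map_add, r0, φ.unpoke_lower, ← Algebra.smul_def, map_smul,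
    Algebra.smul_def, leftPoint]
  ring

end Horizontal

theorem change_neck {v₁ v₃ : Finset ℕ} {G : State h t φ.E₁ v₁ →ₗ[R] State h t φ.E₃ v₃}
    (hG : DotCommutes G) :
    G (dot h t φ.E₁ v₁ (φ.create.pre.length, φ.i) +
          dot h t φ.E₁ v₁ (φ.create.pre.length + 2, φ.i + 1) - algebraMap R _ h) =
      (dot h t φ.E₃ v₃ (φ.create.pre.length, φ.i) +
          dot h t φ.E₃ v₃ (φ.create.pre.length + 2, φ.i + 1) - algebraMap R _ h) * G 1 := by
  obtain ⟨r1, r2⟩ := φ.inRange_create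
  have g1 := (hG _ r1).2 1
  have g2 := (hG _ r2).2 1
  rw [mul_one] at g1 g2
  rw [map_sub, map_add, g1, g2, Algebra.algebraMap_eq_smul_one, map_smul,
    Algebra.algebraMap_eq_smul_one, sub_mul, add_mul, smul_mul_assoc, one_mul]

theorem order_not (b : Bool) : φ.order₂ b (!b) = (!φ.order₁ b (!b)) ∧
    φ.order₁ (!b) b = (!φ.order₁ b (!b)) ∧ φ.order₂ (!b) b = φ.order₁ b (!b) := by
  unfold order₁ order₂
  cases φ.upperFirst <;> simp

/-- Both crossings are smoothed vertically throughout, so the strands run straight through and the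
two Reidemeister maps send `1` to `1`. The only contribution is the difference of dots from `f₀`. -/
theorem map_eq_vertical {b : Bool} (hb : φ.order₁ b (!b) = φ.ε) {z₁ z₂ : Fin 2}
    (hz₁ : z₁ = if b then 1 else 0) (hz₂ : z₂ = if !b then 1 else 0) (z z' : Fin 2) :
    ∃ s : ℤˣ, ∀ (x : CKh h t E) v,
      φ.remove.map h t z' (φ.change₂.map h t z₂ (φ.change₁.map h t z₁ (φ.create.map h t z x))) v =
        s • (x v * (dot h t E v.1 φ.leftPoint - dot h t E v.1 φ.rightPoint)) := by
  obtain ⟨s₁, h₁⟩ := exists_unit_sgn b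
  obtain ⟨s₂, h₂⟩ := exists_unit_sgn (!if b then φ.dir₂ else φ.dir₁)
  refine ⟨-(s₁ * s₂), fun x v => ?_⟩
  obtain ⟨G, hG, hG', hG1⟩ := φ.change_entry (h := h) (t := t) b hz₁ hz₂ v
  obtain ⟨o1, o2, o3⟩ := φ.order_not b
  rw [φ.map_apply b hz₁ hz₂, ← hG]
  revert G
  rw [o1, o2, o3, hb]
  intro G _ hG' hG1
  obtain ⟨p1, p2⟩ := φ.poke_dotLinear_vertical (h := h) (t := t) v z
  obtain ⟨u1, u2⟩ := φ.unpoke_dotLinear_vertical (h := h) (t := t) v z'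
  rw [eq_mul_of_insertion φ.create_mid φ.remove_mid' φ.remove_level'
    (by rw [φ.remove_mid, φ.create_mid']; rfl) p1 hG' u1, p2, hG1, map_zsmul, map_sub]
  have d1 : ∀ j < 2, dot h t φ.E₃ (φ.vertex₃ v φ.ε !φ.ε).1
      (φ.create.pre.length + (if φ.ε then 1 else 0) + 1, φ.i + j) =
        dot h t φ.E₃ (φ.vertex₃ v φ.ε !φ.ε).1 (φ.create.pre.length, φ.i + j) := fun j hj => by
    rw [add_assoc, φ.dot_vertical v (by split_ifs <;> omega) hj]
  have d2 : dot h t φ.E₃ (φ.vertex₃ v φ.ε !φ.ε).1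
      (φ.create.pre.length + (if φ.ε then 1 else 0), φ.i) =
        dot h t φ.E₃ (φ.vertex₃ v φ.ε !φ.ε).1 (φ.create.pre.length, φ.i) :=
    φ.dot_vertical v (j := 0) (by split_ifs <;> omega) (by omega)
  have key : ∀ j < 2, (Move.unpoke φ.i (!φ.ε)).entry h t z' φ.E₃ E φ.create.pre.length
      (φ.vertex₃ v φ.ε !φ.ε).1 v.1
      (dot h t φ.E₃ (φ.vertex₃ v φ.ε !φ.ε).1 (φ.create.pre.length, φ.i + j)) =
        dot h t E v.1 (φ.create.pre.length, φ.i + j) := fun j hj => by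
    have := u1 _ (φ.inRange_remove (l := 0) (by omega) hj) (.inl (le_of_eq φ.remove_level.symm)) 1
    rwa [mul_one, u2, mul_one, transport_of_le (le_of_eq φ.remove_level.symm)] at this
  rw [d1 1 (by omega), d2, key 1 (by omega)]
  have k0 := key 0 (by omega)
  rw [Nat.add_zero] at k0
  rw [k0, ← h₁, ← h₂, Units.smul_def, leftPoint, rightPoint]
  push_cast
  simp only [zsmul_eq_mul]
  push_cast
  ring

/-- The two Reidemeister maps are saddles of opposite types, one with value `1` and the other with
value `Ψ`, in an order that depends on the resolution. The dot of `f₀` on the small circle is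
consumed by the death in between, so the total is `± Ψ` in either order. -/
theorem map_eq_horizontal {b : Bool} (hb : φ.order₁ b (!b) = !φ.ε) {z₁ z₂ : Fin 2}
    (hz₁ : z₁ = if b then 1 else 0) (hz₂ : z₂ = if !b then 1 else 0) (z z' : Fin 2) :
    ∃ s : ℤˣ, ∀ (x : CKh h t E) v,
      φ.remove.map h t z' (φ.change₂.map h t z₂ (φ.change₁.map h t z₁ (φ.create.map h t z x))) v =
        s • (x v * (dot h t E v.1 φ.leftPoint + dot h t E v.1 φ.rightPoint - algebraMap R _ h)) := by
  obtain ⟨s₁, h₁⟩ := exists_unit_sgn b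
  obtain ⟨s₂, h₂⟩ := exists_unit_sgn (!if b then φ.dir₂ else φ.dir₁)
  obtain ⟨s₃, h₃⟩ := exists_unit_sgn φ.ε
  refine ⟨s₁ * s₂ * s₃, fun x v => ?_⟩
  obtain ⟨G, hG, hG', hG1⟩ := φ.change_entry (h := h) (t := t) b hz₁ hz₂ v
  obtain ⟨o1, o2, o3⟩ := φ.order_not b
  rw [φ.map_apply b hz₁ hz₂, ← hG]
  revert G
  rw [o1, o2, o3, hb, Bool.not_not]
  intro G _ hG' hG1
  obtain ⟨p1, p2⟩ := φ.poke_dotLinear_horizontal (h := h) (t := t) v z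
  have u1 := φ.unpoke_dotLinear_horizontal (h := h) (t := t) v
  rw [φ.unpoke_horizontal, LinearMap.neg_apply, eq_mul_of_insertion φ.create_mid φ.remove_mid'
    φ.remove_level' (by rw [φ.remove_mid, φ.create_mid']; rfl) p1 hG' u1, p2]
  have G1 := congrArg (deathSaddleMap h t φ.E₃ E φ.create.pre.length 2 0 φ.i
    (φ.vertex₃ v (!φ.ε) φ.ε).1 v.1) hG1
  rw [map_zsmul, φ.unpoke_sub v rfl] at G1
  have fin : deathSaddleMap h t φ.E₃ E φ.create.pre.length 2 0 φ.i (φ.vertex₃ v (!φ.ε) φ.ε).1 v.1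
      (G (saddleValue h t E φ.E₁ φ.create.pre.length 0 2 φ.i v.1 (φ.vertex₁ v φ.ε !φ.ε).1)) =
        sgn (!if b then φ.dir₂ else φ.dir₁) • sgn φ.ε •
        -(dot h t E v.1 φ.leftPoint + dot h t E v.1 φ.rightPoint - algebraMap R _ h) := by
    have hc := φ.connected_remove v
    -- If the strands lie on one circle of `E`, the first saddle splits it and the neck-cutting
    -- element has to be carried through the crossing changes and the last map; otherwise it appears
    -- only in the last map.
    by_cases hE : Connected E v.1 (φ.create.pre.length, φ.i) (φ.create.pre.length + 0, φ.i + 1)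
    · rw [show saddleValue h t E φ.E₁ φ.create.pre.length 0 2 φ.i v.1 _ = _ from if_pos hE,
        φ.change_neck hG', φ.unpoke_neck, G1,
        show saddleValue h t φ.E₃ E φ.create.pre.length 2 0 φ.i _ v.1 = _ from if_neg (hc.mp hE),
        mul_smul_comm, mul_smul_comm, mul_neg_one]
    · rw [show saddleValue h t E φ.E₁ φ.create.pre.length 0 2 φ.i v.1 _ = _ from if_neg hE, G1,
        show saddleValue h t φ.E₃ E φ.create.pre.length 2 0 φ.i _ v.1 = _ from if_pos (by tauto)]
      rfl
  rw [fin, ← h₁, ← h₂, ← h₃, Units.smul_def]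
  push_cast
  simp only [zsmul_eq_mul]
  push_cast
  ring

end Finger

end

end ImmersedKhovanov

/-! ### Induced maps on homology, composition of movies, and the local formulas. -/

namespace ImmersedKhovanov

open Diagram

noncomputable section

/-! ### Maps on homology -/

section Homology

variable {R : Type*} [CommRing R] {h t : R} {D D' : Diagram}

theorem homologyMap_zero : homologyMap h t (0 : CKh h t D →ₗ[R] CKh h t D') = 0 := by
  unfold homologyMap
  split_ifs with hf
  · refine Submodule.linearMap_qext _ (LinearMap.ext fun x => ?_)
    rw [LinearMap.comp_apply, Submodule.mkQ_apply, Submodule.mapQ_apply]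
    rw [LinearMap.zero_comp, LinearMap.zero_apply, Submodule.Quotient.mk_eq_zero]
    exact zero_mem _
  · rfl

/-- `f` and `-f` commute with the differentials simultaneously, so the default value `0` is taken
for both or for neither. -/
theorem homologyMap_neg (f : CKh h t D →ₗ[R] CKh h t D') :
    homologyMap h t (-f) = -homologyMap h t f := by
  have e : (-f).comp (differential h t D) = (differential h t D').comp (-f) ↔
      f.comp (differential h t D) = (differential h t D').comp f := by
    rw [LinearMap.neg_comp, LinearMap.comp_neg, neg_inj]
  unfold homologyMap
  by_cases hf : f.comp (differential h t D) = (differential h t D').comp f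
  · rw [dif_pos hf, dif_pos (e.mpr hf)]
    refine Submodule.linearMap_qext _ (LinearMap.ext fun x => ?_)
    rw [LinearMap.comp_apply, Submodule.mkQ_apply, Submodule.mapQ_apply]
    exact (Submodule.Quotient.mk_neg ((differential h t D').range.submoduleOf
      (differential h t D').ker) (x := ⟨f x, _⟩))
  · rw [dif_neg hf, dif_neg (e.not.mpr hf), neg_zero]

theorem hasBidegree_homologyMap {𝓡 : ℤ → AddSubgroup R} {f : CKh h t D →ₗ[R] CKh h t D'} {n : ℤ}
    (hf : ∀ i j, ∀ x ∈ homogeneousChains h t 𝓡 D i j, f x ∈ homogeneousChains h t 𝓡 D' i (j + n)) :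
    HasBidegree h t 𝓡 (homologyMap h t f) 0 n := by
  rintro i j _ ⟨x, hx, rfl⟩
  unfold homologyMap
  split_ifs with hc
  · rw [add_zero]
    exact ⟨_, hf i j _ hx, rfl⟩
  · exact zero_mem _

end Homology

/-! ### Compositions -/

namespace Cobordism

variable {R : Type*} [CommRing R] {h t : R} {D D' D'' : Diagram}

theorem chainMap_append (i j : Fin 2) (M : Cobordism D D') (N : Cobordism D' D'') :
    (M.append N).chainMap h t i j = (N.chainMap h t i j).comp (M.chainMap h t i j) := by
  induction M with
  | nil => rfl
  | cons S M ih => simp only [append, chainMap, ih, LinearMap.comp_assoc]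

theorem euler_append (M : Cobordism D D') (N : Cobordism D' D'') :
    (M.append N).euler = M.euler + N.euler := by
  induction M with
  | nil => simp [append, euler]
  | cons S M ih => simp only [append, euler, ih, add_assoc]

theorem numDouble_append (b : Bool) (M : Cobordism D D') (N : Cobordism D' D'') :
    (M.append N).numDouble b = M.numDouble b + N.numDouble b := by
  induction M with
  | nil => simp [append, numDouble]
  | cons S M ih => simp only [append, numDouble, ih, add_assoc]

theorem chainMap_mem_homogeneousChains {𝓡 : ℤ → AddSubgroup R} [GradedRing 𝓡] (hh : h ∈ 𝓡 (-2))
    (ht : t ∈ 𝓡 (-4)) (M : Cobordism D D') {i j : ℤ} {x : CKh h t D}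
    (hx : x ∈ homogeneousChains h t 𝓡 D i j) :
    M.chainMap h t 0 1 x ∈ homogeneousChains h t 𝓡 D' i (j + (M.euler - 2 * M.numDouble false)) := by
  induction M generalizing j with
  | nil => simpa [chainMap, euler, numDouble] using hx
  | cons S M ih =>
    have := ih (S.map_mem_homogeneousChains hh ht hx)
    simp only [chainMap, LinearMap.comp_apply]
    convert this using 2
    rw [Step.degree, euler, numDouble]
    split_ifs <;> push_cast <;> ring

theorem khBal_hasBidegree {𝓡 : ℤ → AddSubgroup R} [GradedRing 𝓡] (hh : h ∈ 𝓡 (-2))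
    (ht : t ∈ 𝓡 (-4)) (M : Cobordism D D') :
    HasBidegree h t 𝓡 (M.khBal h t) 0 (M.euler - 2 * M.numDouble false) :=
  hasBidegree_homologyMap fun _ _ _ hx => M.chainMap_mem_homogeneousChains hh ht hx

end Cobordism

/-! ### The maps of twists -/

namespace Twist

variable {E : Diagram} {R : Type*} [CommRing R] {h t : R}

theorem movie_chainMap {positive : Bool} (τ : Twist E positive) (i j : Fin 2) :
    τ.movie.chainMap h t i j = (τ.remove.map h t j).comp
      ((τ.change.map h t (if positive then i else j)).comp (τ.create.map h t j)) := by
  simp only [movie, Cobordism.chainMap, LinearMap.id_comp, τ.create_doublePoint,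
    τ.remove_doublePoint, τ.change_doublePoint, Option.some.injEq, reduceCtorEq, if_false]
  rfl

theorem positive_chainMap (τ : Twist E true) (j : Fin 2) :
    τ.movie.chainMap h t 0 j = τ.sign • LinearMap.id ∧ τ.movie.chainMap h t 1 j = 0 := by
  refine ⟨LinearMap.ext fun x => funext fun v => ?_, LinearMap.ext fun x => ?_⟩
  · rw [movie_chainMap, LinearMap.comp_apply, LinearMap.comp_apply, if_pos rfl,
      τ.map_eq_mul x v _ _ (if_pos rfl).symm, if_pos rfl, LinearMap.smul_apply, Pi.smul_apply, LinearMap.id_apply, mul_comm, zsmul_eq_mul]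
  · rw [movie_chainMap, LinearMap.comp_apply, LinearMap.comp_apply, if_pos rfl,
      τ.map_apply_eq_zero _ _ (if_pos rfl).symm]
    rfl

theorem negative_chainMap_zero (τ : Twist E false) (i : Fin 2) :
    τ.movie.chainMap h t i 0 = 0 := by
  refine LinearMap.ext fun x => ?_
  rw [movie_chainMap, LinearMap.comp_apply, LinearMap.comp_apply, if_neg Bool.false_ne_true,
    τ.map_apply_eq_zero _ _ (if_neg Bool.false_ne_true).symm]
  rfl

theorem handle_apply {positive : Bool} (τ : Twist E positive) (x : CKh h t E) (v : E.Vertex) :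
    τ.handle h t x v = x v * (2 * dot h t E v.1 τ.point - algebraMap R _ h) := by
  change (2 : R) • (dot h t E v.1 τ.point * x v) - h • x v = _
  rw [Algebra.smul_def, Algebra.smul_def, map_ofNat]
  ring

theorem negative_chainMap_one (τ : Twist E false) (i : Fin 2) :
    τ.movie.chainMap h t i 1 = (-1 : ℤˣ) • τ.handle h t := by
  refine LinearMap.ext fun x => funext fun v => ?_
  rw [movie_chainMap, LinearMap.comp_apply, LinearMap.comp_apply, if_neg Bool.false_ne_true,
    τ.map_eq_mul x v _ _ (if_neg Bool.false_ne_true).symm, if_neg Bool.false_ne_true, LinearMap.smul_apply, Pi.smul_apply, handle_apply, Units.smul_def]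
  simp only [Units.val_neg, Units.val_one, neg_smul, one_smul]
  ring

theorem movie_euler {positive : Bool} (τ : Twist E positive) : τ.movie.euler = 0 := by
  simp [movie, Cobordism.euler, τ.create_move, τ.change_move, τ.remove_move, Move.euler]

theorem movie_numDouble (τ : Twist E false) : τ.movie.numDouble false = 1 := by
  simp [movie, Cobordism.numDouble, τ.create_doublePoint, τ.remove_doublePoint,
    τ.change_doublePoint]

end Twist

/-! ### The maps of finger moves -/

namespace Finger

variable {E : Diagram} (φ : Finger E) {R : Type*} [CommRing R] {h t : R}

/-- Whether the two strands are parallel. -/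
def parallel : Bool :=
  (E.strands φ.create.pre.length)[φ.i]? == (E.strands φ.create.pre.length)[φ.i + 1]?

theorem parallel_iff : φ.Parallel ↔ φ.parallel = true := by
  rw [parallel, beq_iff_eq]; rfl

theorem word_create : φ.E₁.word[φ.create.pre.length]? = some (cross φ.i φ.ε) ∧
    φ.E₁.word[φ.create.pre.length + 1]? = some (cross φ.i !φ.ε) := by
  have g : ∀ {j}, j < 2 → φ.E₁.word[φ.create.pre.length + j]? =
      [cross φ.i φ.ε, cross φ.i !φ.ε][j]? := fun {j} hj => by
    have : φ.E₁.word[φ.create.change.pre.length + j]? = φ.create.change.mid'[j]? :=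
      φ.create.change.symm.getElem?_mid (by
        change j < φ.create.change.mid'.length; rwa [φ.create_mid'])
    rw [φ.create_mid'] at this
    exact this
  exact ⟨g (j := 0) (by omega), g (j := 1) (by omega)⟩

theorem parallel_eq {l : ℕ} (hl : l < 2) :
    ((φ.E₁.strands (φ.create.pre.length + l))[φ.i]? ==
      (φ.E₁.strands (φ.create.pre.length + l))[φ.i + 1]?) = φ.parallel := by
  have h0 : φ.E₁.strands φ.create.pre.length = E.strands φ.create.pre.length :=
    φ.create.change.strands_pre
  interval_cases l
  · rw [Nat.add_zero, h0, parallel]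
  · obtain ⟨A, a, b, B, hA, e1, e2⟩ := act_cross.mp (φ.E₁.act_strands φ.word_create.1)
    rw [parallel, ← h0, e1, e2, ← hA]
    simp only [List.getElem?_append_right (le_refl A.length),
      List.getElem?_append_right (Nat.le_add_right A.length 1), Nat.sub_self, Nat.add_sub_cancel_left,
      List.getElem?_cons_zero, List.getElem?_cons_succ]
    cases a <;> cases b <;> rfl

/-- A crossing is positive when its `ε` says whether its strands are parallel. Both crossings of a
Reidemeister 2 move involve the same two strands and have opposite `ε`, so they have opposite signs.
Passing the first crossing exchanges the strands but not whether they are parallel. -/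
theorem doublePoints : φ.change₁.doublePoint = some (!(φ.first == φ.parallel)) ∧
    φ.change₂.doublePoint = some (φ.first == φ.parallel) := by
  have w1 : φ.E₁.word[φ.create.pre.length + φ.level₁]? = some (cross φ.i φ.first) := by
    have := φ.change₁.change.getElem?_mid (l := 0) (by rw [φ.change₁_mid]; simp)
    rw [φ.change₁_mid, φ.change₁_level'] at this
    exact this
  have w2 : φ.E₂.word[φ.create.pre.length + φ.level₂]? = some (cross φ.i !φ.first) := by
    have := φ.change₂.change.getElem?_mid (l := 0) (by rw [φ.change₂_mid]; simp)
    rw [φ.change₂_mid, φ.change₂_level'] at this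
    exact this
  have e : φ.E₂.strands (φ.create.pre.length + φ.level₂) =
      φ.E₁.strands (φ.create.pre.length + φ.level₂) := by
    rcases φ.level_cases with ⟨l1, l2⟩ | ⟨l1, l2⟩
    · have := φ.change₁.change.strands_post
      rw [φ.change₁_mid, φ.change₁_mid', φ.change₁_level', l1] at this
      rw [l2]
      exact this
    · refine φ.change₁.change.strands_of_le_pre ?_
      rw [φ.change₁_level']
      omega
  constructor
  · rw [Step.doublePoint, φ.change₁_move]
    simp only [Option.some.injEq]
    rw [show φ.change₁.pre.length = _ from φ.change₁_level', isPositive, w1]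
    simp only [φ.parallel_eq φ.level_lt.1]
  · rw [Step.doublePoint, φ.change₂_move]
    simp only [Option.some.injEq]
    rw [show φ.change₂.pre.length = _ from φ.change₂_level', isPositive, w2]
    simp only [e, φ.parallel_eq φ.level_lt.2]
    cases φ.first <;> cases φ.parallel <;> rfl

theorem movie_chainMap (i j : Fin 2) : φ.movie.chainMap h t i j =
    (φ.remove.map h t j).comp ((φ.change₂.map h t (if φ.first == φ.parallel then i else j)).comp
      ((φ.change₁.map h t (if φ.first == φ.parallel then j else i)).comp (φ.create.map h t j))) := by
  simp only [movie, Cobordism.chainMap, LinearMap.id_comp, φ.create_doublePoint,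
    φ.remove_doublePoint, φ.doublePoints, Option.some.injEq, reduceCtorEq, if_false]
  cases φ.first == φ.parallel <;> rfl

theorem chainMap_diag (i : Fin 2) : φ.movie.chainMap h t i i = 0 := by
  refine LinearMap.ext fun x => ?_
  rw [movie_chainMap, ite_self]
  exact φ.map_apply_eq_zero _ _ _

theorem phi_apply (x : CKh h t E) (v : E.Vertex) : φ.phi h t x v =
    x v * (dot h t E v.1 φ.leftPoint - dot h t E v.1 φ.rightPoint) := by
  change dot h t E v.1 φ.leftPoint * x v - dot h t E v.1 φ.rightPoint * x v = _
  ring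

theorem psi_apply (x : CKh h t E) (v : E.Vertex) : φ.psi h t x v =
    x v * (dot h t E v.1 φ.leftPoint + dot h t E v.1 φ.rightPoint - algebraMap R _ h) := by
  change dot h t E v.1 φ.leftPoint * x v + dot h t E v.1 φ.rightPoint * x v - h • x v = _
  rw [Algebra.smul_def]
  ring

theorem order₁_not (b : Bool) : φ.order₁ b (!b) = (b == (φ.first == φ.ε)) := by
  unfold order₁ first
  cases φ.upperFirst <;> cases b <;> cases φ.ε <;> rfl

/-- After its change the first crossing has `ε = !φ.first`, so its resolution `b` is vertical
exactly if `b = φ.first`. The other value of `b` belongs to the horizontal smoothings and to `Ψ`. -/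
theorem exists_chainMap_eq_phi {i j : Fin 2} {b : Bool} (hb : b = φ.first)
    (h₁ : (if φ.first == φ.parallel then j else i) = if b then 1 else 0)
    (h₂ : (if φ.first == φ.parallel then i else j) = if !b then 1 else 0) :
    ∃ s : ℤˣ, φ.movie.chainMap h t i j = s • φ.phi h t := by
  obtain ⟨s, hs⟩ := φ.map_eq_vertical (h := h) (t := t) (b := b)
    (by rw [order₁_not, hb]; cases φ.first <;> cases φ.ε <;> rfl) h₁ h₂ j j
  refine ⟨s, LinearMap.ext fun x => funext fun v => ?_⟩
  rw [LinearMap.smul_apply, Pi.smul_apply, phi_apply, ← hs, movie_chainMap]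
  rfl

theorem exists_chainMap_eq_psi {i j : Fin 2} {b : Bool} (hb : b = !φ.first)
    (h₁ : (if φ.first == φ.parallel then j else i) = if b then 1 else 0)
    (h₂ : (if φ.first == φ.parallel then i else j) = if !b then 1 else 0) :
    ∃ s : ℤˣ, φ.movie.chainMap h t i j = s • φ.psi h t := by
  obtain ⟨s, hs⟩ := φ.map_eq_horizontal (h := h) (t := t) (b := b)
    (by rw [order₁_not, hb]; cases φ.first <;> cases φ.ε <;> rfl) h₁ h₂ j j
  refine ⟨s, LinearMap.ext fun x => funext fun v => ?_⟩
  rw [LinearMap.smul_apply, Pi.smul_apply, psi_apply, ← hs, movie_chainMap]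
  rfl

/-- For the pair of generators `(0, 1)` the first change uses `f₁`, that is `b = true`, exactly if
the first crossing is positive. On parallel strands this means `φ.first = true`, so `b = φ.first`
and the smoothings are vertical. The pair `(1, 0)` and antiparallel strands each negate `b`. -/
theorem chainMap_of_parallel (hp : φ.Parallel) :
    (∃ s : ℤˣ, φ.movie.chainMap h t 0 1 = s • φ.phi h t) ∧
    (∃ s : ℤˣ, φ.movie.chainMap h t 1 0 = s • φ.psi h t) := by
  have hp := φ.parallel_iff.mp hp
  constructor
  · refine φ.exists_chainMap_eq_phi rfl ?_ ?_ <;> rw [hp] <;> cases φ.first <;> rfl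
  · refine φ.exists_chainMap_eq_psi rfl ?_ ?_ <;> rw [hp] <;> cases φ.first <;> rfl

theorem chainMap_of_antiparallel (hp : ¬ φ.Parallel) :
    (∃ s : ℤˣ, φ.movie.chainMap h t 0 1 = s • φ.psi h t) ∧
    (∃ s : ℤˣ, φ.movie.chainMap h t 1 0 = s • φ.phi h t) := by
  have hp : φ.parallel = false := by
    rw [← Bool.not_eq_true]; exact fun h => hp (φ.parallel_iff.mpr h)
  constructor
  · refine φ.exists_chainMap_eq_psi rfl ?_ ?_ <;> rw [hp] <;> cases φ.first <;> rfl
  · refine φ.exists_chainMap_eq_phi rfl ?_ ?_ <;> rw [hp] <;> cases φ.first <;> rfl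

theorem movie_euler : φ.movie.euler = 0 := by
  simp [movie, Cobordism.euler, φ.create_move, φ.change₁_move, φ.change₂_move, φ.remove_move,
    Move.euler]

theorem movie_numDouble : φ.movie.numDouble false = 1 := by
  simp only [movie, Cobordism.numDouble, φ.create_doublePoint, φ.remove_doublePoint,
    φ.doublePoints, Option.some.injEq, reduceCtorEq, if_false]
  cases φ.first == φ.parallel <;> rfl

end Finger

end

end ImmersedKhovanov

/-! ### Non-vanishing on crossingless diagrams, and assembly of the theorem. -/

namespace ImmersedKhovanov

open Diagram

noncomputable section

/-! ### Coefficients -/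

section Coefficient

variable {R : Type*} [CommRing R] (h t : R) {D : Diagram} {v : Finset ℕ}

open Classical in
/-- The coefficient of a monomial. -/
def coefficient (s : Finset (Circle D v)) : State h t D v →ₗ[R] R :=
  PiTensorProduct.lift ((MultilinearMap.mkPiAlgebra R (Circle D v) R).compLinearMap fun c =>
    if c ∈ s then QuadraticAlgebra.imₗ t h else QuadraticAlgebra.reₗ t h)

open Classical in
theorem coefficient_monomial (s s' : Finset (Circle D v)) :
    coefficient h t s (monomial h t D v s') = if s = s' then 1 else 0 := by
  have : coefficient h t s (monomial h t D v s') =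
      ∏ c, if c ∈ s ↔ c ∈ s' then (1 : R) else 0 := by
    rw [monomial_eq]
    refine (PiTensorProduct.lift.tprod _).trans ?_
    simp only [MultilinearMap.compLinearMap_apply, MultilinearMap.mkPiAlgebra_apply]
    refine Finset.prod_congr rfl fun c _ => ?_
    by_cases h1 : c ∈ s <;> by_cases h2 : c ∈ s' <;>
      simp [h1, h2, QuadraticAlgebra.re_one, QuadraticAlgebra.im_one]
  rw [this]
  split_ifs with hs
  · exact Finset.prod_eq_one fun c _ => by rw [hs, if_pos Iff.rfl]
  · obtain ⟨c, hc⟩ := not_forall.mp fun H => hs (Finset.ext H)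
    exact Finset.prod_eq_zero (Finset.mem_univ c) (if_neg hc)

theorem coefficient_algebraMap (s : Finset (Circle D v)) (r : R) (hs : s.Nonempty) :
    coefficient h t s (algebraMap R _ r) = 0 := by
  rw [Algebra.algebraMap_eq_smul_one, map_smul, ← monomial_empty, coefficient_monomial,
    if_neg hs.ne_empty, smul_zero]

theorem coefficient_empty_algebraMap (r : R) :
    coefficient h t (∅ : Finset (Circle D v)) (algebraMap R _ r) = r := by
  rw [Algebra.algebraMap_eq_smul_one, map_smul, ← monomial_empty, coefficient_monomial,
    if_pos rfl, smul_eq_mul, mul_one]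

theorem state_one_ne_zero [Nontrivial R] : (1 : State h t D v) ≠ 0 := fun hz => by
  have := coefficient_empty_algebraMap h t (D := D) (v := v) 1
  rw [map_one, hz, map_zero] at this
  exact zero_ne_one this

/-- The coefficients at `X` and at `1` are `2` and `-h`, which accounts for the two alternatives in
the hypothesis. -/
theorem two_mul_dot_sub_ne_zero (hR : (2 : R) ≠ 0 ∨ h ≠ 0) {p : ℕ × ℕ} (hp : D.InRange p) :
    2 * dot h t D v p - algebraMap R _ h ≠ 0 := fun hz => by
  obtain ⟨q, rfl⟩ := hp.exists_point
  have e : (2 : State h t D v) * dot h t D v (coords q) = (2 : R) • monomial h t D v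
      {circleOf D v q} := by rw [dot_coords, Algebra.smul_def, map_ofNat]
  rw [e] at hz
  rcases hR with hR | hR
  · have := congrArg (coefficient h t {circleOf D v q}) hz
    rw [map_sub, map_smul, coefficient_monomial, if_pos rfl,
      coefficient_algebraMap h t _ _ (Finset.singleton_nonempty _)] at this
    simp [hR] at this
  · have := congrArg (coefficient h t ∅) hz
    rw [map_sub, map_smul, coefficient_monomial, if_neg (Finset.singleton_ne_empty _).symm,
      coefficient_empty_algebraMap] at this
    simp [hR] at this

/-- The colouring `f` shows that the points lie on different circles, so the coefficient at `X` on
the circle of `p` is `1`. With `n = -1`, `r = 0` this serves for `Φ`, with `n = 1`, `r = h` for `Ψ`.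
-/
theorem dot_add_smul_dot_ne_zero [Nontrivial R] {p q : ℕ × ℕ} (hp : D.InRange p)
    (hq : D.InRange q) {f : ℕ → Row} (hf : f ∈ D.labels v) (hpq : f p.1 p.2 ≠ f q.1 q.2) (n r : R) :
    dot h t D v p + n • dot h t D v q - algebraMap R _ r ≠ 0 := fun hz => by
  obtain ⟨p, rfl⟩ := hp.exists_point
  obtain ⟨q, rfl⟩ := hq.exists_point
  have hne : circleOf D v p ≠ circleOf D v q := fun e => hpq (circleOf_eq_iff.mp e f hf)
  have := congrArg (coefficient h t {circleOf D v p}) hz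
  rw [dot_coords, dot_coords, map_sub, map_add, map_smul, coefficient_monomial, if_pos rfl,
    coefficient_monomial, if_neg (by simpa using hne),
    coefficient_algebraMap h t _ _ (Finset.singleton_nonempty _)] at this
  simp at this

end Coefficient

/-! ### Crossingless diagrams -/

section Flat

variable {R : Type*} [CommRing R] {h t : R} {D D' : Diagram}

theorem differential_eq_zero (hD : D.crossings = ∅) : differential h t D = 0 := by
  refine LinearMap.ext fun x => funext fun w => ?_
  simp [differential, hD]

/-- Without crossings both differentials vanish. So every linear map is a chain map and homology is
the chain module itself, where a single value decides. -/
theorem homologyMap_ne_zero (hD : D.crossings = ∅) (hD' : D'.crossings = ∅)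
    {f : CKh h t D →ₗ[R] CKh h t D'} {x : CKh h t D} (hx : f x ≠ 0) : homologyMap h t f ≠ 0 := by
  have e := differential_eq_zero (h := h) (t := t) hD
  have e' := differential_eq_zero (h := h) (t := t) hD'
  intro hz
  unfold homologyMap at hz
  rw [dif_pos (by rw [e, e', LinearMap.comp_zero, LinearMap.zero_comp])] at hz
  have hk : x ∈ (differential h t D).ker := by rw [e]; trivial
  have := LinearMap.congr_fun hz (Submodule.Quotient.mk ⟨x, hk⟩)
  rw [Submodule.mapQ_apply, LinearMap.zero_apply, Submodule.Quotient.mk_eq_zero] at this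
  obtain ⟨y, hy⟩ := this
  exact hx (hy.symm.trans (LinearMap.congr_fun e' y))

theorem crossings_eq_empty (hD : ∀ L ∈ D.word, ∀ i ε, L ≠ cross i ε) : D.crossings = ∅ := by
  refine Finset.eq_empty_of_forall_notMem fun l hl => ?_
  obtain ⟨i, ε, he⟩ := mem_crossings.mp hl
  exact hD _ (List.mem_of_getElem? he) i ε rfl

/-- The empty vertex. -/
def emptyVertex (D : Diagram) : D.Vertex := ⟨∅, Finset.empty_mem_powerset _⟩

theorem khBal_nil_ne_zero [Nontrivial R] (hD : D.crossings = ∅) :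
    ((Cobordism.nil D).append (.nil D)).khBal h t ≠ 0 :=
  homologyMap_ne_zero hD hD (x := 1) fun hz =>
    state_one_ne_zero h t (congrFun hz (emptyVertex D))

end Flat

/-! ### A twist of the unknot -/

/-- The unknot. -/
def unknot : Diagram := ⟨[cup 0 true, cap 0], rfl⟩

/-- The unknot with a kink. -/
def kinkedUnknot (ε : Bool) : Diagram :=
  ⟨[cup 0 true, cup 1 true, cross 0 ε, cap 1, cap 0], by cases ε <;> rfl⟩

/-- The negative twist of the unknot. -/
def unknotTwist : Twist unknot false where
  E₁ := kinkedUnknot true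
  E₂ := kinkedUnknot false
  create := ⟨.kink true 0 true true, [cup 0 true], [cap 0], rfl, rfl, rfl⟩
  change := ⟨.crossingChange 0 true true, [cup 0 true, cup 1 true], [cap 1, cap 0], rfl, rfl, rfl⟩
  remove := ⟨.unkink true 0 true false, [cup 0 true], [cap 0], rfl, rfl, rfl⟩
  right := true
  i := 0
  d := true
  dir := true
  create_move := rfl
  change_move := rfl
  remove_move := rfl
  change_level := rfl
  remove_level := rfl

theorem crossings_unknot : unknot.crossings = ∅ := crossings_eq_empty (by simp [unknot])

theorem khBal_unknotTwist_ne_zero {R : Type*} [CommRing R] {h t : R} (hR : (2 : R) ≠ 0 ∨ h ≠ 0) :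
    (unknotTwist.insert (.nil _) (.nil _)).khBal h t ≠ 0 := by
  refine homologyMap_ne_zero crossings_unknot crossings_unknot (x := 1) fun hz => ?_
  rw [Twist.insert, Cobordism.chainMap_append, Cobordism.chainMap_append,
    unknotTwist.negative_chainMap_one] at hz
  have := congrFun hz (emptyVertex unknot)
  simp only [Cobordism.chainMap, LinearMap.id_comp, LinearMap.comp_id, LinearMap.smul_apply,
    Pi.smul_apply, Twist.handle_apply, Pi.one_apply, one_mul, Pi.zero_apply,
    smul_eq_zero_iff_eq] at this
  refine two_mul_dot_sub_ne_zero h t hR ?_ this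
  rw [Diagram.inRange_iff]
  change 0 < (unknot.strands 1).length
  decide

/-! ### Finger moves on two unknots -/

/-- Two circles side by side. -/
def twoCircles (d : Bool) : Diagram := ⟨[cup 0 true, cup 2 d, cap 2, cap 0], by cases d <;> rfl⟩

/-- Two circles with two crossings. -/
def twoCrossings (d ε ε' : Bool) : Diagram :=
  ⟨[cup 0 true, cup 2 d, cross 1 ε, cross 1 ε', cap 2, cap 0], by
    cases d <;> cases ε <;> cases ε' <;> rfl⟩

/-- The finger move on two circles. -/
def circlesFinger (d : Bool) : Finger (twoCircles d) where
  E₁ := twoCrossings d true false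
  E₂ := twoCrossings d false false
  E₃ := twoCrossings d false true
  create := ⟨.poke 1 true, [cup 0 true, cup 2 d], [cap 2, cap 0], rfl, rfl, by cases d <;> rfl⟩
  change₁ := ⟨.crossingChange 1 true true, [cup 0 true, cup 2 d], [cross 1 false, cap 2, cap 0],
    rfl, rfl, by cases d <;> rfl⟩
  change₂ := ⟨.crossingChange 1 false true, [cup 0 true, cup 2 d, cross 1 false], [cap 2, cap 0],
    rfl, rfl, by cases d <;> rfl⟩
  remove := ⟨.unpoke 1 false, [cup 0 true, cup 2 d], [cap 2, cap 0], rfl, rfl, by cases d <;> rfl⟩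
  i := 1
  ε := true
  upperFirst := true
  dir₁ := true
  dir₂ := true
  create_move := rfl
  change₁_move := rfl
  change₂_move := rfl
  remove_move := rfl
  change₁_level := rfl
  change₂_level := rfl
  remove_level := rfl

theorem crossings_twoCircles (d : Bool) : (twoCircles d).crossings = ∅ :=
  crossings_eq_empty (by simp [twoCircles])

/-- The second strand of the first circle points upwards, and the first strand of the second circle
has direction `d`; they are parallel for `d = false`. -/
theorem circlesFinger_parallel : (circlesFinger false).Parallel ∧ ¬ (circlesFinger true).Parallel := by
  unfold Finger.Parallel
  decide

/-- A labelling of the two circles that distinguishes them. -/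
theorem twoCircles_label (d : Bool) (v : Finset ℕ) :
    (fun l j => decide (1 ≤ l ∧ l ≤ 3 ∧ j < 2)) ∈ (twoCircles d).labels v := by
  refine mem_labels_iff.mpr ⟨by simp, fun l L hL => ?_, fun l hl => ?_⟩
  · have hl := (List.getElem?_eq_some_iff.mp hL).1
    simp only [twoCircles, List.length_cons, List.length_nil] at hl hL
    interval_cases l <;> simp only [List.getElem?_cons_zero, List.getElem?_cons_succ,
      Option.some.injEq] at hL <;> subst hL <;> simp only [mem_outs_cup, mem_outs_cap] <;>
      simp <;> omega
  · simp only [twoCircles, List.length_cons, List.length_nil] at hl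
    funext j
    simp
    omega

theorem khBal_circlesFinger_ne_zero {R : Type*} [CommRing R] [Nontrivial R] {h t : R} (d : Bool) :
    ((circlesFinger d).insert (.nil _) (.nil _)).khBal h t ≠ 0 := by
  refine homologyMap_ne_zero (crossings_twoCircles d) (crossings_twoCircles d) (x := 1) fun hz => ?_
  rw [Finger.insert, Cobordism.chainMap_append, Cobordism.chainMap_append] at hz
  have hp : (twoCircles d).InRange (circlesFinger d).leftPoint ∧
      (twoCircles d).InRange (circlesFinger d).rightPoint := by
    simp only [Diagram.inRange_iff, width]
    cases d <;> decide
  have hf := twoCircles_label d (emptyVertex (twoCircles d)).1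
  have hne : decide (1 ≤ (circlesFinger d).leftPoint.1 ∧ (circlesFinger d).leftPoint.1 ≤ 3 ∧
      (circlesFinger d).leftPoint.2 < 2) ≠ decide (1 ≤ (circlesFinger d).rightPoint.1 ∧
      (circlesFinger d).rightPoint.1 ≤ 3 ∧ (circlesFinger d).rightPoint.2 < 2) := by
    cases d <;> decide
  by_cases hd : (circlesFinger d).Parallel
  · obtain ⟨s, hs⟩ := ((circlesFinger d).chainMap_of_parallel (h := h) (t := t) hd).1
    rw [hs] at hz
    have := congrFun hz (emptyVertex _)
    simp only [Cobordism.chainMap, LinearMap.id_comp, LinearMap.comp_id, LinearMap.smul_apply,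
      Pi.smul_apply, Finger.phi_apply, Pi.one_apply, one_mul, Pi.zero_apply,
      smul_eq_zero_iff_eq] at this
    refine dot_add_smul_dot_ne_zero h t hp.1 hp.2 hf hne (-1) 0 ?_
    rw [map_zero, sub_zero, neg_smul, one_smul, ← sub_eq_add_neg, this]
  · obtain ⟨s, hs⟩ := ((circlesFinger d).chainMap_of_antiparallel (h := h) (t := t) hd).1
    rw [hs] at hz
    have := congrFun hz (emptyVertex _)
    simp only [Cobordism.chainMap, LinearMap.id_comp, LinearMap.comp_id, LinearMap.smul_apply,
      Pi.smul_apply, Finger.psi_apply, Pi.one_apply, one_mul, Pi.zero_apply,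
      smul_eq_zero_iff_eq] at this
    refine dot_add_smul_dot_ne_zero h t hp.1 hp.2 hf hne 1 h ?_
    rw [one_smul, this]

end

end ImmersedKhovanov

theorem proposition1p7 {R : Type*} [CommRing R] (h t : R) :
    -- Adding a positive twist: both maps are unchanged.  (The sign is the one of the direction
    -- assigned to the new double point.)
    (∀ {D E D' : Diagram} (M : Cobordism D E) (N : Cobordism E D') (τ : Twist E true),
      (τ.insert M N).khLow h t = τ.sign • (M.append N).khLow h t ∧
      (τ.insert M N).khBal h t = τ.sign • (M.append N).khBal h t) ∧
    -- Adding a negative twist or a finger move: the map of lowest homological degree vanishes.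
    (∀ {D E D' : Diagram} (M : Cobordism D E) (N : Cobordism E D') (τ : Twist E false),
      (τ.insert M N).khLow h t = 0) ∧
    (∀ {D E D' : Diagram} (M : Cobordism D E) (N : Cobordism E D') (φ : Finger E),
      (φ.insert M N).khLow h t = 0) ∧
    -- The local compositions.
    (∀ {E : Diagram} (τ : Twist E true) (j : Fin 2),
      τ.movie.chainMap h t 0 j = τ.sign • LinearMap.id ∧ τ.movie.chainMap h t 1 j = 0) ∧
    (∀ {E : Diagram} (τ : Twist E false) (i : Fin 2),
      τ.movie.chainMap h t i 0 = 0 ∧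
      ∃ s : ℤˣ, τ.movie.chainMap h t i 1 = s • τ.handle h t) ∧
    (∀ {E : Diagram} (φ : Finger E),
      (∀ i : Fin 2, φ.movie.chainMap h t i i = 0) ∧
      (φ.Parallel →
        (∃ s : ℤˣ, φ.movie.chainMap h t 0 1 = s • φ.phi h t) ∧
        (∃ s : ℤˣ, φ.movie.chainMap h t 1 0 = s • φ.psi h t)) ∧
      (¬ φ.Parallel →
        (∃ s : ℤˣ, φ.movie.chainMap h t 0 1 = s • φ.psi h t) ∧
        (∃ s : ℤˣ, φ.movie.chainMap h t 1 0 = s • φ.phi h t))) ∧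
    -- The resulting formulas for the maps of balanced homological degree.
    (∀ {D E D' : Diagram} (M : Cobordism D E) (N : Cobordism E D'),
      (M.append N).chainMap h t 0 1 = (N.chainMap h t 0 1).comp (M.chainMap h t 0 1) ∧
      (∀ τ : Twist E false, ∃ s : ℤˣ, (τ.insert M N).chainMap h t 0 1 =
        s • (N.chainMap h t 0 1).comp ((τ.handle h t).comp (M.chainMap h t 0 1))) ∧
      (∀ φ : Finger E, φ.Parallel → ∃ s : ℤˣ, (φ.insert M N).chainMap h t 0 1 =
        s • (N.chainMap h t 0 1).comp ((φ.phi h t).comp (M.chainMap h t 0 1))) ∧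
      (∀ φ : Finger E, ¬ φ.Parallel → ∃ s : ℤˣ, (φ.insert M N).chainMap h t 0 1 =
        s • (N.chainMap h t 0 1).comp ((φ.psi h t).comp (M.chainMap h t 0 1)))) ∧
    -- The degrees: a negative twist or a finger move shifts the degree by `(0, -2)`.
    (∀ (𝓡 : ℤ → AddSubgroup R) [GradedRing 𝓡], h ∈ 𝓡 (-2) → t ∈ 𝓡 (-4) →
      ∀ {D E D' : Diagram} (M : Cobordism D E) (N : Cobordism E D') (n : ℤ),
        n = (M.append N).euler - 2 * (M.append N).numDouble false →
        HasBidegree h t 𝓡 ((M.append N).khBal h t) 0 n ∧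
        (∀ τ : Twist E false, HasBidegree h t 𝓡 ((τ.insert M N).khBal h t) 0 (n - 2)) ∧
        (∀ φ : Finger E, HasBidegree h t 𝓡 ((φ.insert M N).khBal h t) 0 (n - 2))) ∧
    -- The maps of balanced homological degree do not vanish in general.
    (((2 : R) ≠ 0 ∨ h ≠ 0) →
      ∃ (D E D' : Diagram) (M : Cobordism D E) (N : Cobordism E D') (τ : Twist E false),
        (M.append N).khBal h t ≠ 0 ∧ (τ.insert M N).khBal h t ≠ 0) ∧
    (Nontrivial R →
      (∃ (D E D' : Diagram) (M : Cobordism D E) (N : Cobordism E D') (φ : Finger E),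
        φ.Parallel ∧ (M.append N).khBal h t ≠ 0 ∧ (φ.insert M N).khBal h t ≠ 0) ∧
      (∃ (D E D' : Diagram) (M : Cobordism D E) (N : Cobordism E D') (φ : Finger E),
        ¬ φ.Parallel ∧ (M.append N).khBal h t ≠ 0 ∧ (φ.insert M N).khBal h t ≠ 0)) := by
  refine ⟨?_, ?_, ?_, fun τ j => τ.positive_chainMap j, fun τ i =>
    ⟨τ.negative_chainMap_zero i, -1, τ.negative_chainMap_one i⟩, fun φ => ⟨φ.chainMap_diag,
    φ.chainMap_of_parallel, φ.chainMap_of_antiparallel⟩, ?_, ?_, fun hR => ?_, fun hR => ⟨?_, ?_⟩⟩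
  · intro D E D' M N τ
    have key : ∀ j, (τ.insert M N).chainMap h t 0 j = τ.sign • (M.append N).chainMap h t 0 j :=
      fun j => by
        rw [Twist.insert, Cobordism.chainMap_append, Cobordism.chainMap_append,
          Cobordism.chainMap_append, (τ.positive_chainMap j).1]
        refine LinearMap.ext fun x => ?_
        simp only [LinearMap.comp_apply, LinearMap.smul_apply, LinearMap.id_apply, map_zsmul]
    rw [Cobordism.khLow, Cobordism.khBal, key, key, Cobordism.khLow, Cobordism.khBal, Twist.sign]
    split_ifs
    · simp only [one_smul, and_self]
    · simp only [neg_smul, one_smul, homologyMap_neg, and_self]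
  · intro D E D' M N τ
    rw [Cobordism.khLow, Twist.insert, Cobordism.chainMap_append, Cobordism.chainMap_append,
      τ.negative_chainMap_zero, LinearMap.comp_zero, LinearMap.zero_comp, homologyMap_zero]
  · intro D E D' M N φ
    rw [Cobordism.khLow, Finger.insert, Cobordism.chainMap_append, Cobordism.chainMap_append,
      φ.chainMap_diag, LinearMap.comp_zero, LinearMap.zero_comp, homologyMap_zero]
  · intro D E D' M N
    refine ⟨Cobordism.chainMap_append _ _ _ _, fun τ => ⟨-1, ?_⟩, fun φ hφ => ?_, fun φ hφ => ?_⟩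
    · rw [Twist.insert, Cobordism.chainMap_append, Cobordism.chainMap_append,
        τ.negative_chainMap_one, LinearMap.comp_assoc, LinearMap.smul_comp, LinearMap.comp_smul]
    · obtain ⟨s, hs⟩ := (φ.chainMap_of_parallel (h := h) (t := t) hφ).1
      refine ⟨s, ?_⟩
      rw [Finger.insert, Cobordism.chainMap_append, Cobordism.chainMap_append, hs,
        LinearMap.comp_assoc, LinearMap.smul_comp, LinearMap.comp_smul]
    · obtain ⟨s, hs⟩ := (φ.chainMap_of_antiparallel (h := h) (t := t) hφ).1
      refine ⟨s, ?_⟩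
      rw [Finger.insert, Cobordism.chainMap_append, Cobordism.chainMap_append, hs,
        LinearMap.comp_assoc, LinearMap.smul_comp, LinearMap.comp_smul]
  -- The inserted movies have Euler characteristic `0` and exactly one negative double point, so the
  -- general degree formula drops by `2`.
  · rintro 𝓡 _ hh ht D E D' M N n rfl
    refine ⟨Cobordism.khBal_hasBidegree hh ht _, fun τ => ?_, fun φ => ?_⟩
    · convert Cobordism.khBal_hasBidegree hh ht (τ.insert M N) using 1
      simp only [Twist.insert, Cobordism.euler_append, Cobordism.numDouble_append, τ.movie_euler,
        τ.movie_numDouble]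
      push_cast
      ring
    · convert Cobordism.khBal_hasBidegree hh ht (φ.insert M N) using 1
      simp only [Finger.insert, Cobordism.euler_append, Cobordism.numDouble_append, φ.movie_euler,
        φ.movie_numDouble]
      push_cast
      ring
  · have : Nontrivial R := by
      by_contra hc
      rw [not_nontrivial_iff_subsingleton] at hc
      exact hR.elim (fun h2 => h2 (Subsingleton.elim _ _)) fun h2 => h2 (Subsingleton.elim _ _)
    exact ⟨_, _, _, .nil _, .nil _, unknotTwist, khBal_nil_ne_zero crossings_unknot,
      khBal_unknotTwist_ne_zero hR⟩
  · exact ⟨_, _, _, .nil _, .nil _, circlesFinger false, circlesFinger_parallel.1,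
      khBal_nil_ne_zero (crossings_twoCircles _), khBal_circlesFinger_ne_zero _⟩
  · exact ⟨_, _, _, .nil _, .nil _, circlesFinger true, circlesFinger_parallel.2,
      khBal_nil_ne_zero (crossings_twoCircles _), khBal_circlesFinger_ne_zero _⟩
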